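/- Let $n\ge 3$ and let $f\colon M^n\to\mathbb{R}^{n+1}$ be an oriented smooth hypersurface with unit normal field $N$, induced metric $\langle\,,\rangle$, Levi-Civita connection $\nabla$ and shape operator $A$, such that no restriction of $f$ to a nonempty open subset of $M$ is conformally surface-like, i.e. has image contained in the image under a Möbius transformation of $\mathbb{R}^{n+1}$ of a cylinder $\Sigma\times\mathbb{R}^{n-2}$ over a surface $\Sigma\subset\mathbb{R}^3$, of $C\Sigma\times\mathbb{R}^{n-3}$ with $C\Sigma\subset\mathbb{R}^4$ the cone over a surface $\Sigma\subset\mathbb{S}^3$, or of a rotation hypersurface over a surface $\Sigma\subset\mathbb{R}^3_+$. Let $\lambda$ be a smooth principal curvature of $f$ of constant multiplicity $n-2$, $\Delta=\ker(A-\lambda I)$, and suppose that $f$ envelops a two-parameter congruence of hyperspheres $s\colon L^2\to\mathbb{S}^{n+2}_{1,1}=\{p\in\mathbb{L}^{n+3}:\langle p,p\rangle=1\}$ with curvature $\lambda$: $L^2$ is a smooth surface which is the quotient space of leaves of $\Delta$, with quotient map $\pi\colon M\to L$ (a submersion with connected fibres and $\ker\pi_*=\Delta$), $s$ is smooth, and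 $s\circ\pi=\Psi_*N+\lambda\,\Psi\circ f$, where $\Psi(x)=p_0+Cx-\tfrac12\|x\|^2w$ is the isometric embedding of $\mathbb{R}^{n+1}$ into the light cone of $\mathbb{L}^{n+3}$ given by light-like vectors $p_0,w$ with $\langle p_0,w\rangle=1$ and a linear isometry $C\colon\mathbb{R}^{n+1}\to\operatorname{span}\{p_0,w\}^\perp$. Let $\langle\,,\rangle'$ be the metric induced by $s$, $\nabla'$ its Levi-Civita connection and $\alpha'$ the second fundamental form of $s$ in $\mathbb{S}^{n+2}_{1,1}$. For $T\in\Gamma(\Delta)$ and $X\in\Gamma(\Delta^\perp)$ put $C_TX=-(\nabla_XT)^h$, where $h$ denotes the $\Delta^\perp$-component; for $D\in\Gamma(\mathrm{End}(\Delta^\perp))$ put $(\nabla^h_TD)X=(\nabla_TDX)^h-D(\nabla_TX)^h$, and extend $D$ to $TM$ by $0$ on $\Delta$ where needed. The hypersurface $f$ is hyperbolic (respectively, elliptic) with respect to $J\in\Gamma(\mathrm{End}(\Delta^\perp))$ if $J^2=I$ and $J\neq\pm I$ at every point (respectively, $J^2=-I$), $\nabla_T^hJ=0$ and $C_T\in\operatorname{span}\{I,J\}$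 for all $T\in\Gamma(\Delta)$. The surface $s$ is hyperbolic (respectively, elliptic) with respect to a tensor $\bar J$ on $L$ if $\bar J^2=\bar I$ and $\bar J\ne\pm\bar I$ at every point (respectively, $\bar J^2=-\bar I$) and $\alpha'(\bar X,\bar J\bar Y)=\alpha'(\bar J\bar X,\bar Y)$ for all $\bar X,\bar Y\in\mathfrak{X}(L)$. A tensor $D$ on $\Delta^\perp$ is the horizontal lift of a tensor $\bar D$ on $L$ if $\pi_*\circ D=\bar D\circ\pi_*$ on $\Delta^\perp$, and a one-form $\psi$ on $M$ is the lift of $\bar\psi$ if $\psi=\bar\psi\circ\pi_*$. For $D_1,D_2\in\Gamma(\mathrm{End}(\Delta^\perp))$ and a one-form $\psi$ on $M$ consider the following conditions, where $\{i,j\}=\{1,2\}$, $X,Y\in\Gamma(\Delta^\perp)$, $(X\wedge Y)Z=\langle Y,Z\rangle X-\langle X,Z\rangle Y$, and inequalities and ranks are meant at every point: (i) $\Delta\le\ker\psi$; (ii) $\det D_i=\frac12$; (iii) $\nabla^h_TD_i=0=[D_i,C_T]$ for all $T\in\Gamma(\Delta)$; (iv) $(\nabla_X(A-\lambda I)D_i)Y-(\nabla_Y(A-\lambda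 I)D_i)X=(X\wedge Y)D_i^t\operatorname{grad}\lambda+(-1)^j(A-\lambda I)(\psi(X)D_jY-\psi(Y)D_jX)$; (v) $\langle(\nabla_YD_i)X-(\nabla_XD_i)Y,\operatorname{grad}\lambda\rangle+\operatorname{Hess}\lambda(D_iX,Y)-\operatorname{Hess}\lambda(X,D_iY)+(-1)^j\psi(X)\langle D_jY,\operatorname{grad}\lambda\rangle-(-1)^j\psi(Y)\langle D_jX,\operatorname{grad}\lambda\rangle=\lambda(\langle AX,(A-\lambda I)D_iY\rangle-\langle(A-\lambda I)D_iX,AY\rangle)$; (vi) $d\psi(Z,T)=0$ for all $Z\in\mathfrak{X}(M)$, $T\in\Gamma(\Delta)$; (vii) $d\psi(X,Y)=\langle[(A-\lambda I)D_1,(A-\lambda I)D_2]X,Y\rangle$; (viii) $D_2^2\neq\pm D_1^2$; (ix) $\operatorname{rank}(D_1^2+D_2^2-I)=2$. Then the following hold. (1) If $f$ is hyperbolic (respectively, elliptic) with respect to $J$ and $(D_1,D_2,\psi)$ is a smooth triple with $D_1,D_2\in\operatorname{span}\{I,J\}$ that satisfies (i)–(ix), then $J$, $D_1$, $D_2$ are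 the horizontal lifts of smooth tensors $\bar J$, $\bar D_1,\bar D_2\in\operatorname{span}\{\bar I,\bar J\}$ on $L^2$ and $\psi$ is the lift of a smooth one-form $\bar\psi$ on $L^2$, such that $s$ is hyperbolic (respectively, elliptic) with respect to $\bar J$ and, for all $X,Y\in\mathfrak{X}(L)$ and $\{i,j\}=\{1,2\}$, (a) $\det\bar D_i=\frac12$; (b) $(\nabla'_X\bar D_i)Y-(\nabla'_Y\bar D_i)X=(-1)^j(\bar\psi(X)\bar D_jY-\bar\psi(Y)\bar D_jX)$; (c) $d\bar\psi(X,Y)=\langle\bar D_2X,\bar D_1Y\rangle'-\langle\bar D_1X,\bar D_2Y\rangle'$; (d) $\bar D_2^2\neq\pm\bar D_1^2$; (e) $\operatorname{rank}(\bar D_1^2+\bar D_2^2-\bar I)=2$ (again with (d) and (e) at every point). (2) Conversely, if $s$ is hyperbolic (respectively, elliptic) with respect to a smooth tensor $\bar J$ on $L^2$, then $f$ is hyperbolic (respectively, elliptic) with respect to the horizontal lift $J$ of $\bar J$, and for all smooth tensors $\bar D_1,\bar D_2\in\operatorname{span}\{\bar I,\bar J\}$ and every smooth one-form $\bar\psi$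 on $L^2$ satisfying (a)–(e), the horizontal lifts $D_1,D_2\in\operatorname{span}\{I,J\}$ and $\psi$ satisfy (i)–(ix). -/

import Mathlib

open scoped Manifold ContDiff

noncomputable section

/-! ### Vector fields, tensors and one-forms on a smooth manifold -/

section Intrinsic

variable {m : ℕ} {M : Type*} [TopologicalSpace M] [ChartedSpace (EuclideanSpace ℝ (Fin m)) M]
  [IsManifold (𝓡 m) ∞ M]

/-- `X` is a smooth vector field on `M`. -/
def SmoothField (X : Π x : M, TangentSpace (𝓡 m) x) : Prop :=
  ContMDiff (𝓡 m) (𝓡 m).tangent ∞ (fun x => (⟨x, X x⟩ : TangentBundle (𝓡 m) M))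

/-- A field of endomorphisms of the tangent spaces is smooth if it maps smooth vector fields to
smooth vector fields. -/
def SmoothEnd (D : Π x : M, TangentSpace (𝓡 m) x →ₗ[ℝ] TangentSpace (𝓡 m) x) : Prop :=
  ∀ X : Π x : M, TangentSpace (𝓡 m) x, SmoothField X → SmoothField (fun x => D x (X x))

/-- A one-form is smooth if it maps smooth vector fields to smooth functions. -/
def SmoothForm (η : Π x : M, TangentSpace (𝓡 m) x →ₗ[ℝ] ℝ) : Prop :=
  ∀ X : Π x : M, TangentSpace (𝓡 m) x, SmoothField X →
    ContMDiff (𝓡 m) 𝓘(ℝ, ℝ) ∞ (fun x => η x (X x))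

/-- The derivative `X(h)` of a vector valued function `h` in the direction of the field `X`. -/
def dirDeriv {F : Type*} [NormedAddCommGroup F] [NormedSpace ℝ F]
    (X : Π x : M, TangentSpace (𝓡 m) x) (h : M → F) (x : M) : F :=
  mvfderiv (𝓡 m) h x (X x)

/-- The exterior derivative `dη(X,Y) = X(η(Y)) - Y(η(X)) - η([X,Y])` of a one-form. -/
def extDerivForm (η : Π x : M, TangentSpace (𝓡 m) x →ₗ[ℝ] ℝ)
    (X Y : Π x : M, TangentSpace (𝓡 m) x) (x : M) : ℝ :=
  dirDeriv X (fun y => η y (Y y)) x - dirDeriv Y (fun y => η y (X y)) x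
    - η x (VectorField.mlieBracket (𝓡 m) X Y x)

/-- The right-hand side of the Koszul formula for `2 ⟨∇_X Y, Z⟩`. -/
def koszul (g : Π x : M, TangentSpace (𝓡 m) x → TangentSpace (𝓡 m) x → ℝ)
    (X Y Z : Π x : M, TangentSpace (𝓡 m) x) (x : M) : ℝ :=
  dirDeriv X (fun y => g y (Y y) (Z y)) x
    + dirDeriv Y (fun y => g y (Z y) (X y)) x
    - dirDeriv Z (fun y => g y (X y) (Y y)) x
    + g x (VectorField.mlieBracket (𝓡 m) X Y x) (Z x)
    - g x (VectorField.mlieBracket (𝓡 m) Y Z x) (X x)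
    + g x (VectorField.mlieBracket (𝓡 m) Z X x) (Y x)

open Classical in
/-- The Levi-Civita connection of the metric `g`: `leviCivita g Y x v` is `∇_v Y` at `x`. It is the
linear map of `v` determined by the Koszul formula. -/
def leviCivita (g : Π x : M, TangentSpace (𝓡 m) x → TangentSpace (𝓡 m) x → ℝ)
    (Y : Π x : M, TangentSpace (𝓡 m) x) (x : M) :
    TangentSpace (𝓡 m) x →ₗ[ℝ] TangentSpace (𝓡 m) x :=
  if h : ∃ B : TangentSpace (𝓡 m) x →ₗ[ℝ] TangentSpace (𝓡 m) x,
      ∀ X Z : Π x : M, TangentSpace (𝓡 m) x, SmoothField X → SmoothField Z →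
        2 * g x (B (X x)) (Z x) = koszul g X Y Z x
  then h.choose else 0

/-- The covariant derivative `(∇_X P) Y = ∇_X (P Y) - P (∇_X Y)` of a field of endomorphisms. -/
def covEnd (g : Π x : M, TangentSpace (𝓡 m) x → TangentSpace (𝓡 m) x → ℝ)
    (P : Π x : M, TangentSpace (𝓡 m) x →ₗ[ℝ] TangentSpace (𝓡 m) x)
    (X Y : Π x : M, TangentSpace (𝓡 m) x) (x : M) : TangentSpace (𝓡 m) x :=
  leviCivita g (fun y => P y (Y y)) x (X x) - P x (leviCivita g Y x (X x))

/-- The Hessian `Hess h (X,Y) = X(Y(h)) - (∇_X Y)(h)` of a function. -/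
def hess (g : Π x : M, TangentSpace (𝓡 m) x → TangentSpace (𝓡 m) x → ℝ) (h : M → ℝ)
    (X Y : Π x : M, TangentSpace (𝓡 m) x) (x : M) : ℝ :=
  dirDeriv X (dirDeriv Y h) x - mvfderiv (𝓡 m) h x (leviCivita g Y x (X x))

end Intrinsic

/-! ### The hyperbolic and the elliptic type -/

/-- The two types of tensors `J` (hyperbolic, `J² = I`, and elliptic, `J² = -I`). -/
inductive JType
  | hyperbolic
  | elliptic

/-- `J² = I` with `J ≠ ± I` in the hyperbolic case, `J² = -I` in the elliptic case. -/
def JType.Holds {V : Type*} [AddCommGroup V] [Module ℝ V] : JType → (V →ₗ[ℝ] V) → Prop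
  | .hyperbolic, J => J ∘ₗ J = LinearMap.id ∧ J ≠ LinearMap.id ∧ J ≠ -LinearMap.id
  | .elliptic, J => J ∘ₗ J = -LinearMap.id

/-! ### Minkowski space and the light-cone model of Euclidean space -/

/-- The vector space underlying the Minkowski space of dimension `k + 1`. -/
abbrev Minkowski (k : ℕ) := EuclideanSpace ℝ (Fin (k + 1))

/-- The Lorentz product of signature `(-,+,…,+)`. -/
def lorentz {k : ℕ} (x y : Minkowski k) : ℝ :=
  -(x 0 * y 0) + ∑ i : Fin k, x i.succ * y i.succ

/-- The unit Lorentzian (de Sitter) sphere. -/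
def deSitter (k : ℕ) : Set (Minkowski k) := {p | lorentz p p = 1}

/-- A triple `(p₀, w, C)`: `w` is a light-like vector, `p₀` is a point of the light cone with
`⟨p₀, w⟩ = 1`, and `C` is a linear isometry of `ℝ^k` onto the orthogonal complement of
`span {p₀, w}` in the Minkowski space of dimension `k + 2`. -/
structure LightConeModel (k : ℕ) where
  p₀ : Minkowski (k + 1)
  w : Minkowski (k + 1)
  C : EuclideanSpace ℝ (Fin k) →ₗ[ℝ] Minkowski (k + 1)
  w_ne_zero : w ≠ 0
  w_null : lorentz w w = 0
  p₀_null : lorentz p₀ p₀ = 0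
  p₀_w : lorentz p₀ w = 1
  C_isometry : ∀ x y, lorentz (C x) (C y) = inner ℝ x y
  C_p₀ : ∀ x, lorentz (C x) p₀ = 0
  C_w : ∀ x, lorentz (C x) w = 0

/-- The embedding `Ψ(x) = p₀ + C x - ½ ‖x‖² w` of Euclidean space into the light cone. -/
def LightConeModel.Psi {k : ℕ} (P : LightConeModel k) (x : EuclideanSpace ℝ (Fin k)) :
    Minkowski (k + 1) :=
  P.p₀ + P.C x - ((1 / 2 : ℝ) * ‖x‖ ^ 2) • P.w

/-! ### Oriented hypersurfaces -/

/-- An oriented hypersurface: a smooth immersion `f : Mⁿ → ℝ^{n+1}` with a smooth unit normal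
vector field `N`. -/
structure OrientedHypersurface (n : ℕ) (M : Type*) [TopologicalSpace M]
    [ChartedSpace (EuclideanSpace ℝ (Fin n)) M] where
  f : M → EuclideanSpace ℝ (Fin (n + 1))
  N : M → EuclideanSpace ℝ (Fin (n + 1))
  smooth_f : ContMDiff (𝓡 n) (𝓡 (n + 1)) ∞ f
  smooth_N : ContMDiff (𝓡 n) (𝓡 (n + 1)) ∞ N
  immersion : ∀ x, Function.Injective (mvfderiv (𝓡 n) f x)
  unit : ∀ x, ‖N x‖ = 1
  normal : ∀ x (v : TangentSpace (𝓡 n) x), inner ℝ (mvfderiv (𝓡 n) f x v) (N x) = 0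

namespace OrientedHypersurface

variable {n : ℕ} {M : Type*} [TopologicalSpace M] [ChartedSpace (EuclideanSpace ℝ (Fin n)) M]
  [IsManifold (𝓡 n) ∞ M]
  (H : OrientedHypersurface n M) (lam : M → ℝ)

/-- The metric induced by `f`. -/
def metric (x : M) (v u : TangentSpace (𝓡 n) x) : ℝ :=
  inner ℝ (mvfderiv (𝓡 n) H.f x v) (mvfderiv (𝓡 n) H.f x u)

/-- The shape operator `A` with respect to `N`, that is `f_* A v = - N_* v` (the right-hand side is
tangent to `f`, and `f_*` is injective). -/
def shape (x : M) : TangentSpace (𝓡 n) x →ₗ[ℝ] TangentSpace (𝓡 n) x :=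
  -((mvfderiv (𝓡 n) H.f x).toLinearMap.leftInverse ∘ₗ (mvfderiv (𝓡 n) H.N x).toLinearMap)

/-- The operator `A - λ I`. -/
def shapeSub (x : M) : TangentSpace (𝓡 n) x →ₗ[ℝ] TangentSpace (𝓡 n) x :=
  H.shape x - lam x • LinearMap.id

/-- The eigenspace `Δ = ker (A - λ I)`. -/
def Δ (x : M) : Submodule ℝ (TangentSpace (𝓡 n) x) := LinearMap.ker (H.shapeSub lam x)

/-- The orthogonal complement `Δ^⊥` of `Δ` in the tangent space, for the induced metric. -/
def hor (x : M) : Submodule ℝ (TangentSpace (𝓡 n) x) where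
  carrier := {v | ∀ t ∈ H.Δ lam x, H.metric x v t = 0}
  add_mem' := by
    intro a b ha hb t ht
    have h1 := ha t ht
    have h2 := hb t ht
    simp only [metric] at h1 h2 ⊢
    rw [map_add, inner_add_left, h1, h2, add_zero]
  zero_mem' := by
    intro t _
    simp only [metric, map_zero, inner_zero_left]
  smul_mem' := by
    intro c a ha t ht
    have h1 := ha t ht
    simp only [metric] at h1 ⊢
    rw [map_smul, real_inner_smul_left, h1, mul_zero]

open Classical in
/-- The component in `Δ^⊥` with respect to `TM = Δ^⊥ ⊕ Δ` (the two subspaces are always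
complementary, since the induced metric is positive definite). -/
def horProj (x : M) : TangentSpace (𝓡 n) x →ₗ[ℝ] H.hor lam x :=
  if h : IsCompl (H.hor lam x) (H.Δ lam x) then
    Submodule.projectionOnto (H.hor lam x) (H.Δ lam x) h
  else 0

/-- `T` is a smooth section of `Δ`. -/
def SectionΔ (T : Π x : M, TangentSpace (𝓡 n) x) : Prop :=
  SmoothField T ∧ ∀ x, T x ∈ H.Δ lam x

/-- `X` is a smooth section of `Δ^⊥`. -/
def SectionHor (X : Π x : M, TangentSpace (𝓡 n) x) : Prop :=
  SmoothField X ∧ ∀ x, X x ∈ H.hor lam x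

/-- The splitting tensor `C_T X = - (∇_X T)^h`, as an endomorphism of `Δ^⊥`. -/
def splitting (T : Π x : M, TangentSpace (𝓡 n) x) (x : M) :
    H.hor lam x →ₗ[ℝ] H.hor lam x :=
  -(H.horProj lam x ∘ₗ leviCivita H.metric T x ∘ₗ (H.hor lam x).subtype)

/-- The extension of an endomorphism field of `Δ^⊥` to `TM` that vanishes on `Δ`. -/
def extend (D : Π x : M, H.hor lam x →ₗ[ℝ] H.hor lam x) (x : M) :
    TangentSpace (𝓡 n) x →ₗ[ℝ] TangentSpace (𝓡 n) x :=
  (H.hor lam x).subtype ∘ₗ D x ∘ₗ H.horProj lam x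

/-- `D` is a smooth section of `End(Δ^⊥)`. -/
def SmoothHorEnd (D : Π x : M, H.hor lam x →ₗ[ℝ] H.hor lam x) : Prop :=
  SmoothEnd (H.extend lam D)

/-- `∇_T^h D = 0` for all sections `T` of `Δ`, where
`(∇_T^h D) X = (∇_T (D X))^h - D (∇_T X)^h` for sections `X` of `Δ^⊥`. -/
def HorParallel (D : Π x : M, H.hor lam x →ₗ[ℝ] H.hor lam x) : Prop :=
  ∀ T X : Π x : M, TangentSpace (𝓡 n) x, H.SectionΔ lam T → H.SectionHor lam X → ∀ x,
    H.horProj lam x (leviCivita H.metric (fun y => H.extend lam D y (X y)) x (T x))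
      - D x (H.horProj lam x (leviCivita H.metric X x (T x))) = 0

/-- The hypersurface is hyperbolic (respectively elliptic) with respect to `J`. -/
structure IsOfType (κ : JType) (J : Π x : M, H.hor lam x →ₗ[ℝ] H.hor lam x) : Prop where
  smooth : H.SmoothHorEnd lam J
  square : ∀ x, κ.Holds (J x)
  parallel : H.HorParallel lam J
  splitting_mem : ∀ T, H.SectionΔ lam T → ∀ x,
    H.splitting lam T x ∈ Submodule.span ℝ {LinearMap.id, J x}

/-- `(A - λ I) D`, extended to `TM` by zero on `Δ`. -/
def shapeD (D : Π x : M, H.hor lam x →ₗ[ℝ] H.hor lam x) (x : M) :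
    TangentSpace (𝓡 n) x →ₗ[ℝ] TangentSpace (𝓡 n) x :=
  H.shapeSub lam x ∘ₗ H.extend lam D x

/-- The Codazzi-type condition
`(∇_X (A-λI)D) Y - (∇_Y (A-λI)D) X`
`  = (X ∧ Y) Dᵗ grad λ + ε (A-λI) (ψ(X) D' Y - ψ(Y) D' X)` for `X, Y ∈ Γ(Δ^⊥)`.
Here `(X ∧ Y) Z = ⟨Y,Z⟩ X - ⟨X,Z⟩ Y`, so that
`(X ∧ Y) Dᵗ grad λ = dλ(D Y) X - dλ(D X) Y`. -/
def CodazziCond (D D' : Π x : M, H.hor lam x →ₗ[ℝ] H.hor lam x)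
    (ψ : Π x : M, TangentSpace (𝓡 n) x →ₗ[ℝ] ℝ) (ε : ℝ) : Prop :=
  ∀ X Y : Π x : M, TangentSpace (𝓡 n) x, H.SectionHor lam X → H.SectionHor lam Y → ∀ x,
    covEnd H.metric (H.shapeD lam D) X Y x - covEnd H.metric (H.shapeD lam D) Y X x
      = (mvfderiv (𝓡 n) lam x (H.extend lam D x (Y x)) • X x
          - mvfderiv (𝓡 n) lam x (H.extend lam D x (X x)) • Y x)
        + ε • (ψ x (X x) • H.shapeD lam D' x (Y x) - ψ x (Y x) • H.shapeD lam D' x (X x))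

/-- The Ricci-type condition, for `X, Y ∈ Γ(Δ^⊥)`,
`⟨(∇_Y D) X - (∇_X D) Y, grad λ⟩ + Hess λ (D X, Y) - Hess λ (X, D Y)`
`  + ε ψ(X) ⟨D' Y, grad λ⟩ - ε ψ(Y) ⟨D' X, grad λ⟩`
`  = λ (⟨A X, (A-λI) D Y⟩ - ⟨(A-λI) D X, A Y⟩)`, where `⟨Z, grad λ⟩ = dλ(Z)`. -/
def RicciCond (D D' : Π x : M, H.hor lam x →ₗ[ℝ] H.hor lam x)
    (ψ : Π x : M, TangentSpace (𝓡 n) x →ₗ[ℝ] ℝ) (ε : ℝ) : Prop :=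
  ∀ X Y : Π x : M, TangentSpace (𝓡 n) x, H.SectionHor lam X → H.SectionHor lam Y → ∀ x,
    mvfderiv (𝓡 n) lam x
        (covEnd H.metric (H.extend lam D) Y X x - covEnd H.metric (H.extend lam D) X Y x)
      + hess H.metric lam (fun y => H.extend lam D y (X y)) Y x
      - hess H.metric lam X (fun y => H.extend lam D y (Y y)) x
      + ε * ψ x (X x) * mvfderiv (𝓡 n) lam x (H.extend lam D' x (Y x))
      - ε * ψ x (Y x) * mvfderiv (𝓡 n) lam x (H.extend lam D' x (X x))
    = lam x * (H.metric x (H.shape x (X x)) (H.shapeD lam D x (Y x))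
        - H.metric x (H.shapeD lam D x (X x)) (H.shape x (Y x)))

/-- The conditions (i)-(ix) on a triple `(D₁, D₂, ψ)` with `D₁, D₂ ∈ Γ(End(Δ^⊥))` and a one-form
`ψ` on `M`. The sign `(-1)^j` is `1` for `(i,j) = (1,2)` and `-1` for `(i,j) = (2,1)`. -/
structure TripleConditions (D₁ D₂ : Π x : M, H.hor lam x →ₗ[ℝ] H.hor lam x)
    (ψ : Π x : M, TangentSpace (𝓡 n) x →ₗ[ℝ] ℝ) : Prop where
  i : ∀ x, H.Δ lam x ≤ LinearMap.ker (ψ x)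
  ii : ∀ x, LinearMap.det (D₁ x) = 1 / 2 ∧ LinearMap.det (D₂ x) = 1 / 2
  iii_parallel : H.HorParallel lam D₁ ∧ H.HorParallel lam D₂
  iii_commute : ∀ T, H.SectionΔ lam T → ∀ x,
    D₁ x ∘ₗ H.splitting lam T x = H.splitting lam T x ∘ₗ D₁ x ∧
    D₂ x ∘ₗ H.splitting lam T x = H.splitting lam T x ∘ₗ D₂ x
  iv : H.CodazziCond lam D₁ D₂ ψ 1 ∧ H.CodazziCond lam D₂ D₁ ψ (-1)
  v : H.RicciCond lam D₁ D₂ ψ 1 ∧ H.RicciCond lam D₂ D₁ ψ (-1)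
  vi : ∀ Z T, SmoothField Z → H.SectionΔ lam T → ∀ x, extDerivForm ψ Z T x = 0
  vii : ∀ X Y, H.SectionHor lam X → H.SectionHor lam Y → ∀ x,
    extDerivForm ψ X Y x = H.metric x
      (H.shapeD lam D₁ x (H.shapeD lam D₂ x (X x)) - H.shapeD lam D₂ x (H.shapeD lam D₁ x (X x)))
      (Y x)
  viii : ∀ x, D₂ x ∘ₗ D₂ x ≠ D₁ x ∘ₗ D₁ x ∧ D₂ x ∘ₗ D₂ x ≠ -(D₁ x ∘ₗ D₁ x)
  ix : ∀ x, Module.finrank ℝ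
    (LinearMap.range (D₁ x ∘ₗ D₁ x + D₂ x ∘ₗ D₂ x - LinearMap.id)) = 2

/-- `(D₁, D₂, ψ)` is a smooth triple with `D₁, D₂ ∈ span {I, J}` that satisfies (i)-(ix). -/
structure IsTriple (J D₁ D₂ : Π x : M, H.hor lam x →ₗ[ℝ] H.hor lam x)
    (ψ : Π x : M, TangentSpace (𝓡 n) x →ₗ[ℝ] ℝ) : Prop where
  smooth_D₁ : H.SmoothHorEnd lam D₁
  smooth_D₂ : H.SmoothHorEnd lam D₂
  smooth_ψ : SmoothForm ψ
  mem_D₁ : ∀ x, D₁ x ∈ Submodule.span ℝ {LinearMap.id, J x}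
  mem_D₂ : ∀ x, D₂ x ∈ Submodule.span ℝ {LinearMap.id, J x}
  conditions : H.TripleConditions lam D₁ D₂ ψ

/-! ### Sphere congruences -/

variable {L : Type*} [TopologicalSpace L] [ChartedSpace (EuclideanSpace ℝ (Fin 2)) L]
  [IsManifold (𝓡 2) ∞ L]

/-- The hypersurface envelops the two-parameter congruence of hyperspheres `s : L² → S_{1,1}^{n+2}`,
and `λ` is its principal curvature of multiplicity `n - 2` given by the congruence: `L` is the
space of leaves of `Δ`, with quotient map `π` (a submersion whose fibres are connected and tangent
to `Δ`), and `s (π x)` is the point of de Sitter space that represents the oriented hypersphere of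
curvature `λ(x)` tangent to `f` at `x`. -/
structure Envelops (P : LightConeModel (n + 1)) (π : M → L) (s : L → Minkowski (n + 2)) : Prop where
  smooth_lam : ContMDiff (𝓡 n) 𝓘(ℝ, ℝ) ∞ lam
  multiplicity : ∀ x, Module.finrank ℝ (H.Δ lam x) + 2 = n
  smooth_π : ContMDiff (𝓡 n) (𝓡 2) ∞ π
  surjective_dπ : ∀ x, Function.Surjective (mfderiv (𝓡 n) (𝓡 2) π x)
  ker_dπ : ∀ x, LinearMap.ker (mfderiv (𝓡 n) (𝓡 2) π x).toLinearMap = H.Δ lam x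
  connected_fibre : ∀ y, IsConnected (π ⁻¹' {y})
  smooth_s : ContMDiff (𝓡 2) (𝓡 (n + 2 + 1)) ∞ s
  mem_deSitter : ∀ y, s y ∈ deSitter (n + 2)
  envelope : ∀ x, s (π x) = fderiv ℝ P.Psi (H.f x) (H.N x) + lam x • P.Psi (H.f x)

/-- The horizontal lift of a field of endomorphisms of `TL`: the field `D` of endomorphisms of
`Δ^⊥` with `π_* ∘ D = D' ∘ π_*`, where `π_*` restricts to an isomorphism of `Δ^⊥` onto the tangent
space of `L`. -/
def lift (π : M → L) (D' : Π y : L, TangentSpace (𝓡 2) y →ₗ[ℝ] TangentSpace (𝓡 2) y) (x : M) :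
    H.hor lam x →ₗ[ℝ] H.hor lam x :=
  ((mfderiv (𝓡 n) (𝓡 2) π x).toLinearMap ∘ₗ (H.hor lam x).subtype).leftInverse
    ∘ₗ D' (π x) ∘ₗ ((mfderiv (𝓡 n) (𝓡 2) π x).toLinearMap ∘ₗ (H.hor lam x).subtype)

end OrientedHypersurface

/-- The lift `ψ = ψ' ∘ π_*` of a one-form. -/
def liftForm {n : ℕ} {M : Type*} [TopologicalSpace M] [ChartedSpace (EuclideanSpace ℝ (Fin n)) M]
    {L : Type*} [TopologicalSpace L] [ChartedSpace (EuclideanSpace ℝ (Fin 2)) L]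
    (π : M → L) (ψ' : Π y : L, TangentSpace (𝓡 2) y →ₗ[ℝ] ℝ) (x : M) :
    TangentSpace (𝓡 n) x →ₗ[ℝ] ℝ :=
  ψ' (π x) ∘ₗ (mfderiv (𝓡 n) (𝓡 2) π x).toLinearMap

/-! ### Surfaces in de Sitter space -/

section Surface

variable {k : ℕ} {L : Type*} [TopologicalSpace L] [ChartedSpace (EuclideanSpace ℝ (Fin 2)) L]
  [IsManifold (𝓡 2) ∞ L]
  (s : L → Minkowski k)

/-- The metric `⟨ , ⟩'` induced by `s`. -/
def surfMetric (y : L) (v u : TangentSpace (𝓡 2) y) : ℝ :=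
  lorentz (mvfderiv (𝓡 2) s y v) (mvfderiv (𝓡 2) s y u)

/-- The second fundamental form of `s` as a surface in de Sitter space:
`α'(X,Y) = D_X (s_* Y) - s_* (∇'_X Y) + ⟨X,Y⟩' s`, with `D` the flat derivative. -/
def surfSff (X Y : Π y : L, TangentSpace (𝓡 2) y) (y : L) : Minkowski k :=
  dirDeriv X (fun z => mvfderiv (𝓡 2) s z (Y z)) y
    - mvfderiv (𝓡 2) s y (leviCivita (surfMetric s) Y y (X y))
    + surfMetric s y (X y) (Y y) • s y

/-- The surface `s` is hyperbolic (respectively elliptic) with respect to `J`. -/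
structure SurfIsOfType (κ : JType)
    (J : Π y : L, TangentSpace (𝓡 2) y →ₗ[ℝ] TangentSpace (𝓡 2) y) : Prop where
  smooth : SmoothEnd J
  square : ∀ y, κ.Holds (J y)
  sff_symm : ∀ X Y, SmoothField X → SmoothField Y → ∀ y,
    surfSff s X (fun z => J z (Y z)) y = surfSff s (fun z => J z (X z)) Y y

/-- The equation `(∇'_X D) Y - (∇'_Y D) X = ε (ψ(X) D' Y - ψ(Y) D' X)`. -/
def SurfCodazziCond (D D' : Π y : L, TangentSpace (𝓡 2) y →ₗ[ℝ] TangentSpace (𝓡 2) y)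
    (ψ : Π y : L, TangentSpace (𝓡 2) y →ₗ[ℝ] ℝ) (ε : ℝ) : Prop :=
  ∀ X Y, SmoothField X → SmoothField Y → ∀ y,
    covEnd (surfMetric s) D X Y y - covEnd (surfMetric s) D Y X y
      = ε • (ψ y (X y) • D' y (Y y) - ψ y (Y y) • D' y (X y))

/-- `(D₁, D₂, ψ)` is a smooth triple on the surface with `D₁, D₂ ∈ span {I, J}` that satisfies
(a)-(e). -/
structure SurfIsTriple
    (J D₁ D₂ : Π y : L, TangentSpace (𝓡 2) y →ₗ[ℝ] TangentSpace (𝓡 2) y)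
    (ψ : Π y : L, TangentSpace (𝓡 2) y →ₗ[ℝ] ℝ) : Prop where
  smooth_D₁ : SmoothEnd D₁
  smooth_D₂ : SmoothEnd D₂
  smooth_ψ : SmoothForm ψ
  mem_D₁ : ∀ y, D₁ y ∈ Submodule.span ℝ {LinearMap.id, J y}
  mem_D₂ : ∀ y, D₂ y ∈ Submodule.span ℝ {LinearMap.id, J y}
  a : ∀ y, LinearMap.det (D₁ y) = 1 / 2 ∧ LinearMap.det (D₂ y) = 1 / 2
  b : SurfCodazziCond s D₁ D₂ ψ 1 ∧ SurfCodazziCond s D₂ D₁ ψ (-1)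
  c : ∀ X Y, SmoothField X → SmoothField Y → ∀ y,
    extDerivForm ψ X Y y
      = surfMetric s y (D₂ y (X y)) (D₁ y (Y y)) - surfMetric s y (D₁ y (X y)) (D₂ y (Y y))
  d : ∀ y, D₂ y ∘ₗ D₂ y ≠ D₁ y ∘ₗ D₁ y ∧ D₂ y ∘ₗ D₂ y ≠ -(D₁ y ∘ₗ D₁ y)
  e : ∀ y, Module.finrank ℝ
    (LinearMap.range (D₁ y ∘ₗ D₁ y + D₂ y ∘ₗ D₂ y - LinearMap.id)) = 2

end Surface

/-! ### Conformally surface-like hypersurfaces -/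

/-- A smooth (embedded) surface in `ℝ^k`. -/
def IsRegularSurface {k : ℕ} (S : Set (EuclideanSpace ℝ (Fin k))) : Prop :=
  ∀ p ∈ S, ∃ V : Set (EuclideanSpace ℝ (Fin k)), IsOpen V ∧ p ∈ V ∧
    ∃ (W : Set (EuclideanSpace ℝ (Fin 2))) (σ : EuclideanSpace ℝ (Fin 2) → EuclideanSpace ℝ (Fin k)),
      IsOpen W ∧ ContDiffOn ℝ ∞ σ W ∧ (∀ u ∈ W, Function.Injective (fderiv ℝ σ u)) ∧
      Topology.IsEmbedding (W.domRestrict σ) ∧ σ '' W = S ∩ V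

/-- The cylinder `S × ℝ^{n-2}` over a subset `S` of `ℝ³`. -/
def cylinderOver (n : ℕ) (S : Set (EuclideanSpace ℝ (Fin 3))) :
    Set (EuclideanSpace ℝ (Fin (n + 1))) :=
  {p | !₂[p 0, p 1, p 2] ∈ S}

/-- The product `CS × ℝ^{n-3}`, where `CS` is the cone over a subset `S` of the unit sphere of
`ℝ⁴`. -/
def coneCylinderOver (n : ℕ) (S : Set (EuclideanSpace ℝ (Fin 4))) :
    Set (EuclideanSpace ℝ (Fin (n + 1))) :=
  {p | ∃ t : ℝ, 0 < t ∧ ∃ q ∈ S, !₂[p 0, p 1, p 2, p 3] = t • q}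

/-- The set obtained by rotating a subset `S` of the half-space `ℝ³₊` around the plane of the first
two coordinates. -/
def rotationOver (n : ℕ) (S : Set (EuclideanSpace ℝ (Fin 3))) :
    Set (EuclideanSpace ℝ (Fin (n + 1))) :=
  {p | !₂[p 0, p 1, √(∑ i : Fin (n + 1), if 2 ≤ i.val then p i ^ 2 else 0)] ∈ S}

/-- The three kinds of model hypersurfaces of `ℝ^{n+1}`. -/
def IsSurfaceLikeModel (n : ℕ) (Q : Set (EuclideanSpace ℝ (Fin (n + 1)))) : Prop :=
  (∃ S : Set (EuclideanSpace ℝ (Fin 3)), IsRegularSurface S ∧ Q = cylinderOver n S) ∨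
  (∃ S : Set (EuclideanSpace ℝ (Fin 4)), IsRegularSurface S ∧ (∀ q ∈ S, ‖q‖ = 1) ∧
    Q = coneCylinderOver n S) ∨
  (∃ S : Set (EuclideanSpace ℝ (Fin 3)), IsRegularSurface S ∧ (∀ q ∈ S, 0 < q 2) ∧
    Q = rotationOver n S)

/-- `Φ` is a Möbius transformation of `ℝ^k`, with domain `P` (the complement of its pole, if it has
one): a similarity, or an inversion followed by a similarity. -/
def IsMobius {k : ℕ} (Φ : EuclideanSpace ℝ (Fin k) → EuclideanSpace ℝ (Fin k))
    (P : Set (EuclideanSpace ℝ (Fin k))) : Prop :=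
  ∃ (c : ℝ) (B : EuclideanSpace ℝ (Fin k) ≃ₗᵢ[ℝ] EuclideanSpace ℝ (Fin k))
    (b : EuclideanSpace ℝ (Fin k)), c ≠ 0 ∧
    ((P = Set.univ ∧ ∀ x, Φ x = c • B x + b) ∨
      ∃ a : EuclideanSpace ℝ (Fin k), P = {a}ᶜ ∧
        ∀ x, Φ x = c • B (EuclideanGeometry.inversion a 1 x) + b)

/-- The restriction of the hypersurface to `U` is conformally surface-like: `f(U)` lies in the image
of a model hypersurface under a Möbius transformation. (As `f` is an immersion of the dimension of
the model hypersurface, `f(U)` is then automatically the image of an open subset of it.) -/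
def OrientedHypersurface.ConformallySurfaceLikeOn {n : ℕ} {M : Type*} [TopologicalSpace M]
    [ChartedSpace (EuclideanSpace ℝ (Fin n)) M] (H : OrientedHypersurface n M) (U : Set M) : Prop :=
  ∃ (Φ : EuclideanSpace ℝ (Fin (n + 1)) → EuclideanSpace ℝ (Fin (n + 1)))
    (P Q : Set (EuclideanSpace ℝ (Fin (n + 1)))),
    IsMobius Φ P ∧ IsSurfaceLikeModel n Q ∧ H.f '' U ⊆ Φ '' (Q ∩ P)

end

/-! Everything is computed in Minkowski space with the light-cone representative F = Ψ ∘ f (`lc`)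
and with ξ = Ψ_* N (`xi`). From s ∘ π = ξ + λF one gets s_* π_* X = -F_*(A - λI)X + dλ(X)F. Since F
is light-like and orthogonal to F_*TM, the metric of s pulls back to ⟨(A - λI)X, (A - λI)Y⟩. One
more derivative gives ⟨α'(X,Y), F⟩ = ⟨(A - λI)Y, X⟩ and ⟨α'(X,Y), F_*T⟩ = -⟨(A - λI)Y, C_T X⟩ for T
in Δ (`lorentz_surfSff_lc`, `lorentz_surfSff_dlc`). Statements about α' thus become statements about
A - λI and the splitting tensor.

If (A - λI)D is symmetric, (iv) and (v) are the tangential part and the F-component of a single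
equation for the exterior derivative of the vector valued form s_* π_* D (`codazzi_ricci_iff`). If
α' is symmetric with respect to a tensor on L, (b) is the same equation downstairs
(`surfCodazzi_iff`), and the exterior derivative commutes with the pull-back by π. Differentiating
s_* D̄ π_* X along a leaf in two ways shows that ∇^h_T of a lifted tensor is a commutator with C_T
(`horDeriv_lift`).

Part (2): pairing the symmetry of α' with F and with F_*T makes (A - λI)J symmetric and makes J
commute with C_T. Hence J is parallel along Δ, and in dimension two C_T is a combination of I and J.
Part (1): tensors that are parallel along Δ and commute with C_T descend (`exists_eq_lift`), and so
does ψ. If (A - λI)J is symmetric, the same pairings and one further derivative along a leaf show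
that α' is symmetric with respect to the descended tensor (`surfSff_symm_of_metric`).

There remains the symmetry of (A - λI)J in part (1), where surface-like hypersurfaces have to be
excluded (`metric_symm_of_not_surfaceLike`). The operator (A - λI)C_T is always symmetric and C_T =
aI + bJ. So if (A - λI)J is not symmetric at a point, then C_T is scalar near it. Then α' takes
values in a line (`surfSff_proportional`), and the Codazzi equation forces s to stay in a fixed
four-dimensional subspace W (`exists_constant_span`). The leaves are the directions in which the
W-part of F changes only by a factor (`mem_Δ_iff_exists_mul`), so this part, up to scale, describes
a surface. According to the signature of W, a light-cone model adapted to W exhibits f as a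
cylinder, as a cone times a Euclidean factor, or as a rotation hypersurface, up to a Möbius
transformation (`exists_isMobius`). -/

open Filter Topology

set_option linter.unusedSectionVars false

/-! ### Smoothness and derivatives on manifolds -/

section Calculus

variable {m : ℕ} {M : Type*} [TopologicalSpace M] [ChartedSpace (EuclideanSpace ℝ (Fin m)) M]
  [IsManifold (𝓡 m) ∞ M]
  {F : Type*} [NormedAddCommGroup F] [NormedSpace ℝ F]
  {G : Type*} [NormedAddCommGroup G] [NormedSpace ℝ G]
  {K : Type*} [NormedAddCommGroup K] [NormedSpace ℝ K]

/-- Smoothness at a point of a vector field. -/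
def SmoothFieldAt (X : Π x : M, TangentSpace (𝓡 m) x) (x : M) : Prop :=
  ContMDiffAt (𝓡 m) (𝓡 m).tangent ∞ (fun x => (⟨x, X x⟩ : TangentBundle (𝓡 m) M)) x

theorem SmoothField.at {X : Π x : M, TangentSpace (𝓡 m) x} (hX : SmoothField X) (x : M) :
    SmoothFieldAt X x := hX x

theorem SmoothFieldAt.mdiff {X : Π x : M, TangentSpace (𝓡 m) x} {x : M} (hX : SmoothFieldAt X x) :
    MDifferentiableAt (𝓡 m) (𝓡 m).tangent
      (fun x => (⟨x, X x⟩ : TangentBundle (𝓡 m) M)) x :=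
  ContMDiffAt.mdifferentiableAt hX (by simp)

/-- The coordinate expression at `x` of tangent vectors, in the chart at `x₀`. -/
noncomputable def coordAt (x₀ x : M) : TangentSpace (𝓡 m) x →L[ℝ] EuclideanSpace ℝ (Fin m) :=
  (trivializationAt (EuclideanSpace ℝ (Fin m)) (TangentSpace (𝓡 m)) x₀).continuousLinearMapAt ℝ x

/-- The inverse of `coordAt`. -/
noncomputable def coordInv (x₀ x : M) : EuclideanSpace ℝ (Fin m) →L[ℝ] TangentSpace (𝓡 m) x :=
  (trivializationAt (EuclideanSpace ℝ (Fin m)) (TangentSpace (𝓡 m)) x₀).symmL ℝ x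

theorem coordInv_coordAt {x₀ x : M} (hx : x ∈ (chartAt (EuclideanSpace ℝ (Fin m)) x₀).source)
    (v : TangentSpace (𝓡 m) x) : coordInv x₀ x (coordAt x₀ x v) = v := by
  apply (trivializationAt (EuclideanSpace ℝ (Fin m)) (TangentSpace (𝓡 m)) x₀).symmL_continuousLinearMapAt
  simpa using hx

theorem coordAt_coordInv {x₀ x : M} (hx : x ∈ (chartAt (EuclideanSpace ℝ (Fin m)) x₀).source)
    (v : EuclideanSpace ℝ (Fin m)) : coordAt x₀ x (coordInv x₀ x v) = v := by
  apply (trivializationAt (EuclideanSpace ℝ (Fin m)) (TangentSpace (𝓡 m)) x₀).continuousLinearMapAt_symmL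
  simpa using hx

theorem chart_source_eventually (x₀ : M) :
    ∀ᶠ x in 𝓝 x₀, x ∈ (chartAt (EuclideanSpace ℝ (Fin m)) x₀).source :=
  (chartAt (EuclideanSpace ℝ (Fin m)) x₀).open_source.mem_nhds (mem_chart_source _ x₀)

theorem smoothFieldAt_iff_of_mem {X : Π x : M, TangentSpace (𝓡 m) x} {x₀ x₁ : M}
    (h₁ : x₁ ∈ (chartAt (EuclideanSpace ℝ (Fin m)) x₀).source) :
    SmoothFieldAt X x₁ ↔
      ContMDiffAt (𝓡 m) 𝓘(ℝ, EuclideanSpace ℝ (Fin m)) ∞ (fun x => coordAt x₀ x (X x)) x₁ := by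
  have h1 := Bundle.Trivialization.contMDiffAt_section_iff (n := ∞) (IB := 𝓡 m)
    (F := EuclideanSpace ℝ (Fin m)) (E := TangentSpace (𝓡 m)) (s := X) (x₀ := x₁)
    (trivializationAt (EuclideanSpace ℝ (Fin m)) (TangentSpace (𝓡 m)) x₀) (by simpa using h₁)
  rw [SmoothFieldAt]
  refine h1.trans ?_
  apply Filter.EventuallyEq.contMDiffAt_iff
  filter_upwards [(chartAt (EuclideanSpace ℝ (Fin m)) x₀).open_source.mem_nhds h₁] with x hx
  rw [coordAt, Bundle.Trivialization.continuousLinearMapAt_apply,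
    Bundle.Trivialization.linearMapAt_apply, if_pos (by simpa using hx)]

theorem smoothFieldAt_iff {X : Π x : M, TangentSpace (𝓡 m) x} {x₀ : M} :
    SmoothFieldAt X x₀ ↔
      ContMDiffAt (𝓡 m) 𝓘(ℝ, EuclideanSpace ℝ (Fin m)) ∞ (fun x => coordAt x₀ x (X x)) x₀ :=
  smoothFieldAt_iff_of_mem (mem_chart_source _ x₀)

theorem smoothFieldAt_coordInv {x₀ x₁ : M} {c : M → EuclideanSpace ℝ (Fin m)}
    (h₁ : x₁ ∈ (chartAt (EuclideanSpace ℝ (Fin m)) x₀).source)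
    (hc : ContMDiffAt (𝓡 m) 𝓘(ℝ, EuclideanSpace ℝ (Fin m)) ∞ c x₁) :
    SmoothFieldAt (fun x => coordInv x₀ x (c x)) x₁ := by
  rw [smoothFieldAt_iff_of_mem h₁]
  refine hc.congr_of_eventuallyEq ?_
  filter_upwards [(chartAt (EuclideanSpace ℝ (Fin m)) x₀).open_source.mem_nhds h₁] with x hx
  exact coordAt_coordInv hx _

theorem contMDiffAt_mvfderiv {h : M → F} {x₀ : M} (hh : ContMDiffAt (𝓡 m) 𝓘(ℝ, F) ∞ h x₀) :
    ContMDiffAt (𝓡 m) 𝓘(ℝ, EuclideanSpace ℝ (Fin m) →L[ℝ] F) ∞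
      (fun x => (mvfderiv (𝓡 m) h x ∘L coordInv x₀ x : EuclideanSpace ℝ (Fin m) →L[ℝ] F)) x₀ := by
  have := ContMDiffAt.mfderiv_const (m := ∞) hh (by simp)
  refine this.congr_of_eventuallyEq ?_
  filter_upwards [chart_source_eventually (m := m) x₀] with x hx
  ext v
  simp [inTangentCoordinates, ContinuousLinearMap.inCoordinates, mvfderiv, coordInv]
  rfl

theorem contMDiffAt_mvfderiv_apply {h : M → F} {X : Π x : M, TangentSpace (𝓡 m) x} {x₀ : M}
    (hh : ContMDiffAt (𝓡 m) 𝓘(ℝ, F) ∞ h x₀) (hX : SmoothFieldAt X x₀) :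
    ContMDiffAt (𝓡 m) 𝓘(ℝ, F) ∞ (fun x => mvfderiv (𝓡 m) h x (X x)) x₀ := by
  refine ((contMDiffAt_mvfderiv hh).clm_apply (smoothFieldAt_iff.1 hX)).congr_of_eventuallyEq ?_
  filter_upwards [chart_source_eventually (m := m) x₀] with x hx
  simp [coordInv_coordAt hx]

/-- Composing with a left inverse of `Θ x₀` turns the equation into one with a square operator that
is the identity at `x₀`, hence invertible nearby with smooth inverse. No regularity of `c` is
assumed, so coefficients obtained by choice turn out to be smooth. -/
theorem ContMDiffAt.solve_injective [FiniteDimensional ℝ F] [FiniteDimensional ℝ G] {x₀ : M}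
    {Θ : M → G →L[ℝ] F} {k : M → F} {c : M → G}
    (hΘ : ContMDiffAt (𝓡 m) 𝓘(ℝ, G →L[ℝ] F) ∞ Θ x₀) (hinj : Function.Injective (Θ x₀))
    (hk : ContMDiffAt (𝓡 m) 𝓘(ℝ, F) ∞ k x₀) (hc : ∀ᶠ x in 𝓝 x₀, Θ x (c x) = k x) :
    ContMDiffAt (𝓡 m) 𝓘(ℝ, G) ∞ c x₀ := by
  obtain ⟨l, hl⟩ := LinearMap.exists_leftInverse_of_injective (Θ x₀).toLinearMap
    (LinearMap.ker_eq_bot.2 hinj)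
  let l' : F →L[ℝ] G := l.toContinuousLinearMap
  let A : M → G →L[ℝ] G := fun x => l' ∘L Θ x
  have hA : ContMDiffAt (𝓡 m) 𝓘(ℝ, G →L[ℝ] G) ∞ A x₀ :=
    (contMDiffAt_const (c := l')).clm_comp hΘ
  have hA0 : A x₀ = 1 := by
    ext v
    exact LinearMap.congr_fun hl v
  have hinv : ContMDiffAt (𝓡 m) 𝓘(ℝ, G →L[ℝ] G) ∞ (fun x => Ring.inverse (A x)) x₀ := by
    have h1 : ContDiffAt ℝ ∞ (Ring.inverse : (G →L[ℝ] G) → _) (A x₀) := by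
      rw [hA0]; exact contDiffAt_ringInverse ℝ 1
    exact h1.contMDiffAt.comp x₀ hA
  have hlk : ContMDiffAt (𝓡 m) 𝓘(ℝ, G) ∞ (fun x => l' (k x)) x₀ :=
    l'.contDiff.contDiffAt.contMDiffAt.comp x₀ hk
  refine (hinv.clm_apply hlk).congr_of_eventuallyEq ?_
  have hunit : ∀ᶠ x in 𝓝 x₀, IsUnit (A x) := by
    apply hA.continuousAt.eventually
    rw [hA0]
    exact Units.isOpen.mem_nhds isUnit_one
  filter_upwards [hc, hunit] with x hx hu
  rw [← hx]
  change c x = (Ring.inverse (A x) * A x) (c x)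
  rw [Ring.inverse_mul_cancel _ hu]; rfl

/-- An immersion into a vector space detects smoothness. Tangent fields defined pointwise through a
left inverse are treated in this way. -/
theorem smoothFieldAt_of_mvfderiv [FiniteDimensional ℝ F] {h : M → F} {x₀ : M}
    (hh : ContMDiffAt (𝓡 m) 𝓘(ℝ, F) ∞ h x₀) (hinj : Function.Injective (mvfderiv (𝓡 m) h x₀))
    {X : Π x : M, TangentSpace (𝓡 m) x}
    (hX : ContMDiffAt (𝓡 m) 𝓘(ℝ, F) ∞ (fun x => mvfderiv (𝓡 m) h x (X x)) x₀) :
    SmoothFieldAt X x₀ := by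
  rw [smoothFieldAt_iff]
  refine ContMDiffAt.solve_injective (contMDiffAt_mvfderiv hh) ?_ hX ?_
  · have h2 : Function.Injective (coordInv x₀ x₀ : EuclideanSpace ℝ (Fin m) →L[ℝ] _) :=
      Function.LeftInverse.injective
        (coordAt_coordInv (mem_chart_source (EuclideanSpace ℝ (Fin m)) x₀))
    exact hinj.comp h2
  · filter_upwards [chart_source_eventually (m := m) x₀] with x hx
    simp [coordInv_coordAt hx]

/-! ### Rules for derivatives -/

theorem mvfderiv_comp_vec {k : ℕ} {L : Type*} [TopologicalSpace L]
    [ChartedSpace (EuclideanSpace ℝ (Fin k)) L] {h : L → F} {p : M → L} {x : M}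
    (hh : MDifferentiableAt (𝓡 k) 𝓘(ℝ, F) h (p x))
    (hp : MDifferentiableAt (𝓡 m) (𝓡 k) p x) (v : TangentSpace (𝓡 m) x) :
    mvfderiv (𝓡 m) (fun x => h (p x)) x v
      = mvfderiv (𝓡 k) h (p x) (mfderiv (𝓡 m) (𝓡 k) p x v) :=
  mfderiv_comp_apply x hh hp v

theorem mvfderiv_comp_fderiv {φ : F → G} {h : M → F} {x : M}
    (hφ : DifferentiableAt ℝ φ (h x))
    (hh : MDifferentiableAt (𝓡 m) 𝓘(ℝ, F) h x) (v : TangentSpace (𝓡 m) x) :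
    mvfderiv (𝓡 m) (fun x => φ (h x)) x v = fderiv ℝ φ (h x) (mvfderiv (𝓡 m) h x v) := by
  have := mfderiv_comp_apply x hφ.mdifferentiableAt hh v
  rw [mfderiv_eq_fderiv] at this
  exact this

theorem mvfderiv_bilin (b : F →L[ℝ] G →L[ℝ] K) {h : M → F} {k : M → G} {x : M}
    (hh : MDifferentiableAt (𝓡 m) 𝓘(ℝ, F) h x) (hk : MDifferentiableAt (𝓡 m) 𝓘(ℝ, G) k x)
    (v : TangentSpace (𝓡 m) x) :
    mvfderiv (𝓡 m) (fun x => b (h x) (k x)) x v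
      = b (mvfderiv (𝓡 m) h x v) (k x) + b (h x) (mvfderiv (𝓡 m) k x v) := by
  have h1 : MDifferentiableAt (𝓡 m) 𝓘(ℝ, F × G) (fun x => (h x, k x)) x :=
    hh.prodMk_space hk
  have hb : DifferentiableAt ℝ (fun p : F × G => b p.1 p.2) (h x, k x) :=
    b.isBoundedBilinearMap.differentiableAt _
  have h3 := mvfderiv_comp_fderiv (φ := fun p : F × G => b p.1 p.2) (h := fun x => (h x, k x))
    hb h1 v
  change mvfderiv (𝓡 m) (fun x => b (h x) (k x)) x v = _ at h3
  rw [h3]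
  have h2 : mvfderiv (𝓡 m) (fun x => (h x, k x)) x v
      = (mvfderiv (𝓡 m) h x v, mvfderiv (𝓡 m) k x v) := by
    have e1 := mvfderiv_comp_fderiv (φ := (Prod.fst : F × G → F)) (h := fun x => (h x, k x))
      (x := x) differentiableAt_fst h1 v
    have e2 := mvfderiv_comp_fderiv (φ := (Prod.snd : F × G → G)) (h := fun x => (h x, k x))
      (x := x) differentiableAt_snd h1 v
    rw [fderiv_fst] at e1
    rw [fderiv_snd] at e2
    exact Prod.ext e1.symm e2.symm
  rw [h2, (b.isBoundedBilinearMap.hasFDerivAt (h x, k x)).fderiv]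
  simp [add_comm]

theorem mvfderiv_smul_vec {a : M → ℝ} {h : M → F} {x : M}
    (ha : MDifferentiableAt (𝓡 m) 𝓘(ℝ, ℝ) a x) (hh : MDifferentiableAt (𝓡 m) 𝓘(ℝ, F) h x)
    (v : TangentSpace (𝓡 m) x) :
    mvfderiv (𝓡 m) (fun x => a x • h x) x v
      = a x • mvfderiv (𝓡 m) h x v + mvfderiv (𝓡 m) a x v • h x := by
  have := mvfderiv_bilin (ContinuousLinearMap.lsmul ℝ ℝ) ha hh v
  simpa [add_comm] using this

theorem mvfderiv_congr {h k : M → F} {x : M} (e : h =ᶠ[𝓝 x] k) :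
    mvfderiv (𝓡 m) h x = mvfderiv (𝓡 m) k x := by
  ext v
  simp only [mvfderiv]
  have := e.mfderiv_eq (I := 𝓡 m) (I' := 𝓘(ℝ, F))
  change (mfderiv (𝓡 m) 𝓘(ℝ, F) h x v : F) = mfderiv (𝓡 m) 𝓘(ℝ, F) k x v
  rw [this]; rfl

end Calculus

/-! ### The Lie bracket as a commutator of derivatives -/

section Bracket

variable {m : ℕ} {M : Type*} [TopologicalSpace M] [ChartedSpace (EuclideanSpace ℝ (Fin m)) M]
  [IsManifold (𝓡 m) ∞ M]
  {F : Type*} [NormedAddCommGroup F] [NormedSpace ℝ F]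

/-- A vector field read in the chart at `x₀`. -/
noncomputable def fieldInChart (x₀ : M) (V : Π x : M, TangentSpace (𝓡 m) x) :
    EuclideanSpace ℝ (Fin m) → EuclideanSpace ℝ (Fin m) :=
  VectorField.mpullbackWithin 𝓘(ℝ, EuclideanSpace ℝ (Fin m)) (𝓡 m) (extChartAt (𝓡 m) x₀).symm V
    (Set.range (𝓡 m))

theorem mdifferentiableAt_extChartAt_symm {x₀ : M} {u : EuclideanSpace ℝ (Fin m)}
    (hu : u ∈ (extChartAt (𝓡 m) x₀).target) :
    MDifferentiableAt 𝓘(ℝ, EuclideanSpace ℝ (Fin m)) (𝓡 m) (extChartAt (𝓡 m) x₀).symm u := by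
  have := mdifferentiableWithinAt_extChartAt_symm (I := 𝓡 m) hu
  rwa [ModelWithCorners.range_eq_univ, mdifferentiableWithinAt_univ] at this

theorem fderiv_comp_extChartAt_symm {x₀ : M} {h : M → F} {u : EuclideanSpace ℝ (Fin m)}
    (hu : u ∈ (extChartAt (𝓡 m) x₀).target)
    (hh : MDifferentiableAt (𝓡 m) 𝓘(ℝ, F) h ((extChartAt (𝓡 m) x₀).symm u))
    (v : EuclideanSpace ℝ (Fin m)) :
    fderiv ℝ (h ∘ (extChartAt (𝓡 m) x₀).symm) u v
      = mvfderiv (𝓡 m) h ((extChartAt (𝓡 m) x₀).symm u)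
        (mfderiv 𝓘(ℝ, EuclideanSpace ℝ (Fin m)) (𝓡 m) (extChartAt (𝓡 m) x₀).symm u v) := by
  have := mfderiv_comp_apply u hh (mdifferentiableAt_extChartAt_symm hu) v
  rw [mfderiv_eq_fderiv] at this
  exact this

theorem mfderiv_fieldInChart {x₀ : M} {u : EuclideanSpace ℝ (Fin m)}
    (hu : u ∈ (extChartAt (𝓡 m) x₀).target) (V : Π x : M, TangentSpace (𝓡 m) x) :
    mfderiv 𝓘(ℝ, EuclideanSpace ℝ (Fin m)) (𝓡 m) (extChartAt (𝓡 m) x₀).symm u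
      (fieldInChart x₀ V u) = V ((extChartAt (𝓡 m) x₀).symm u) := by
  have h1 := isInvertible_mfderivWithin_extChartAt_symm (I := 𝓡 m) hu
  rw [fieldInChart, VectorField.mpullbackWithin_apply]
  rw [ModelWithCorners.range_eq_univ, mfderivWithin_univ] at h1 ⊢
  exact h1.self_apply_inverse _

theorem fderiv_fieldInChart {x₀ : M} {h : M → F} {u : EuclideanSpace ℝ (Fin m)}
    (hu : u ∈ (extChartAt (𝓡 m) x₀).target)
    (hh : MDifferentiableAt (𝓡 m) 𝓘(ℝ, F) h ((extChartAt (𝓡 m) x₀).symm u))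
    (V : Π x : M, TangentSpace (𝓡 m) x) :
    fderiv ℝ (h ∘ (extChartAt (𝓡 m) x₀).symm) u (fieldInChart x₀ V u)
      = dirDeriv V h ((extChartAt (𝓡 m) x₀).symm u) := by
  rw [fderiv_comp_extChartAt_symm hu hh, mfderiv_fieldInChart hu]; rfl

theorem differentiableAt_fieldInChart {x₀ : M} {V : Π x : M, TangentSpace (𝓡 m) x}
    (hV : SmoothFieldAt V x₀) :
    DifferentiableAt ℝ (fieldInChart x₀ V) (extChartAt (𝓡 m) x₀ x₀) := by
  have := MDifferentiableWithinAt.differentiableWithinAt_mpullbackWithin_vectorField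
    (hV.mdiff.mdifferentiableWithinAt (s := Set.univ))
  rw [Set.preimage_univ, Set.univ_inter] at this
  have h2 : DifferentiableWithinAt ℝ (fieldInChart x₀ V) (Set.range (𝓡 m))
      (extChartAt (𝓡 m) x₀ x₀) := this
  rwa [ModelWithCorners.range_eq_univ, differentiableWithinAt_univ] at h2

theorem extChartAt_target_eventually (x₀ : M) :
    ∀ᶠ u in 𝓝 (extChartAt (𝓡 m) x₀ x₀), u ∈ (extChartAt (𝓡 m) x₀).target :=
  extChartAt_target_mem_nhds x₀

theorem contDiffAt_comp_extChartAt_symm {x₀ : M} {h : M → F}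
    (hh : ContMDiffAt (𝓡 m) 𝓘(ℝ, F) ∞ h x₀) :
    ContDiffAt ℝ ∞ (h ∘ (extChartAt (𝓡 m) x₀).symm) (extChartAt (𝓡 m) x₀ x₀) := by
  rw [← contMDiffAt_iff_contDiffAt]
  refine ContMDiffAt.comp_of_eq (I' := 𝓡 m) (y := x₀) hh ?_ (extChartAt_to_inv x₀)
  exact (contMDiffOn_extChartAt_symm (n := ∞) x₀).contMDiffAt (extChartAt_target_mem_nhds x₀)

/-- The product rule in the chart separates the second derivative of `h`, which is symmetric and
cancels in the commutator, from the first order term that produces the bracket. -/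
theorem dirDeriv_dirDeriv_chart {x₀ : M} {h : M → F} {V W : Π x : M, TangentSpace (𝓡 m) x}
    (hh : ContMDiffAt (𝓡 m) 𝓘(ℝ, F) ∞ h x₀) (hW : SmoothFieldAt W x₀) :
    dirDeriv V (dirDeriv W h) x₀
      = fderiv ℝ (fderiv ℝ (h ∘ (extChartAt (𝓡 m) x₀).symm)) (extChartAt (𝓡 m) x₀ x₀)
          (fieldInChart x₀ V (extChartAt (𝓡 m) x₀ x₀))
          (fieldInChart x₀ W (extChartAt (𝓡 m) x₀ x₀))
        + fderiv ℝ (h ∘ (extChartAt (𝓡 m) x₀).symm) (extChartAt (𝓡 m) x₀ x₀)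
          (fderiv ℝ (fieldInChart x₀ W) (extChartAt (𝓡 m) x₀ x₀)
            (fieldInChart x₀ V (extChartAt (𝓡 m) x₀ x₀))) := by
  set u₀ := extChartAt (𝓡 m) x₀ x₀ with hu₀
  have hut : u₀ ∈ (extChartAt (𝓡 m) x₀).target := mem_extChartAt_target x₀
  have hs : (extChartAt (𝓡 m) x₀).symm u₀ = x₀ := extChartAt_to_inv x₀
  have hWh : ContMDiffAt (𝓡 m) 𝓘(ℝ, F) ∞ (dirDeriv W h) x₀ := contMDiffAt_mvfderiv_apply hh hW
  have h1 := fderiv_fieldInChart (h := dirDeriv W h) hut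
    (by rw [hs]; exact hWh.mdifferentiableAt (by simp)) V
  rw [hs] at h1
  rw [← h1]
  have h2 : (dirDeriv W h) ∘ (extChartAt (𝓡 m) x₀).symm =ᶠ[𝓝 u₀]
      fun u => fderiv ℝ (h ∘ (extChartAt (𝓡 m) x₀).symm) u (fieldInChart x₀ W u) := by
    have hd : ∀ᶠ x in 𝓝 x₀, MDifferentiableAt (𝓡 m) 𝓘(ℝ, F) h x := by
      have := (contMDiffAt_iff_contMDiffAt_nhds (n := 1) (by simp)).1 (hh.of_le (by simp))
      filter_upwards [this] with x hx
      exact hx.mdifferentiableAt (by simp)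
    have hc : Tendsto (extChartAt (𝓡 m) x₀).symm (𝓝 u₀) (𝓝 x₀) := by
      have := continuousAt_extChartAt_symm (I := 𝓡 m) x₀
      rwa [ContinuousAt, hs] at this
    filter_upwards [hc.eventually hd, extChartAt_target_eventually x₀] with u hu1 hu2
    rw [fderiv_fieldInChart hu2 hu1]; rfl
  rw [h2.fderiv_eq]
  have hc := contDiffAt_comp_extChartAt_symm hh
  have hd1 : DifferentiableAt ℝ (fderiv ℝ (h ∘ (extChartAt (𝓡 m) x₀).symm)) u₀ :=
    (hc.fderiv_right (m := 1) (by norm_cast)).differentiableAt (by simp)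
  rw [fderiv_clm_apply hd1 (differentiableAt_fieldInChart hW)]
  simp [add_comm]

/-- Symmetry of the second derivative in the chart leaves only the derivatives of the fields.
Applied to an immersion `h`, this identity determines the bracket. -/
theorem mvfderiv_mlieBracket {x₀ : M} {h : M → F} {V W : Π x : M, TangentSpace (𝓡 m) x}
    (hh : ContMDiffAt (𝓡 m) 𝓘(ℝ, F) ∞ h x₀) (hV : SmoothFieldAt V x₀) (hW : SmoothFieldAt W x₀) :
    mvfderiv (𝓡 m) h x₀ (VectorField.mlieBracket (𝓡 m) V W x₀)
      = dirDeriv V (dirDeriv W h) x₀ - dirDeriv W (dirDeriv V h) x₀ := by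
  rw [dirDeriv_dirDeriv_chart hh hW, dirDeriv_dirDeriv_chart hh hV]
  have hsym := (contDiffAt_comp_extChartAt_symm hh).isSymmSndFDerivAt
    (by simpa using (ENat.LEInfty.out : (2 : ℕ∞ω) ≤ ∞))
  rw [hsym.eq]
  have hut : extChartAt (𝓡 m) x₀ x₀ ∈ (extChartAt (𝓡 m) x₀).target := mem_extChartAt_target x₀
  have hs : (extChartAt (𝓡 m) x₀).symm (extChartAt (𝓡 m) x₀ x₀) = x₀ := extChartAt_to_inv x₀
  have hid := mfderivWithin_range_extChartAt_symm (I := 𝓡 m) (x := x₀)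
  rw [ModelWithCorners.range_eq_univ, mfderivWithin_univ] at hid
  have key : ∀ z : EuclideanSpace ℝ (Fin m),
      fderiv ℝ (h ∘ (extChartAt (𝓡 m) x₀).symm) (extChartAt (𝓡 m) x₀ x₀) z
        = mvfderiv (𝓡 m) h x₀ z := by
    intro z
    rw [fderiv_comp_extChartAt_symm hut (by rw [hs]; exact hh.mdifferentiableAt (by simp)), hid]
    rw [hs]; rfl
  -- The derivative of the chart at its own centre is the identity, so the pull-back in the
  -- definition of the bracket has no effect there.
  have hbr : VectorField.mlieBracket (𝓡 m) V W x₀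
      = VectorField.lieBracket ℝ (fieldInChart x₀ V) (fieldInChart x₀ W)
        (extChartAt (𝓡 m) x₀ x₀) := by
    rw [← VectorField.lieBracketWithin_univ, VectorField.mlieBracket,
      VectorField.mlieBracketWithin_apply, mfderiv_extChartAt_self,
      Set.preimage_univ, Set.univ_inter]
    change ContinuousLinearMap.inverse (ContinuousLinearMap.id ℝ (EuclideanSpace ℝ (Fin m)))
      (VectorField.lieBracketWithin ℝ (fieldInChart x₀ V) (fieldInChart x₀ W)
        (Set.range (𝓡 m)) (extChartAt (𝓡 m) x₀ x₀)) = _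
    rw [ContinuousLinearMap.inverse_id, ModelWithCorners.range_eq_univ]
    rfl
  rw [hbr, VectorField.lieBracket_eq, add_sub_add_left_eq_sub, ← map_sub, key]

end Bracket

/-! ### Global fields, tensoriality -/

section Fields

variable {m : ℕ} {M : Type*} [TopologicalSpace M] [ChartedSpace (EuclideanSpace ℝ (Fin m)) M]
  [IsManifold (𝓡 m) ∞ M]
  {F : Type*} [NormedAddCommGroup F] [NormedSpace ℝ F]

theorem SmoothFieldAt.add {X Y : Π x : M, TangentSpace (𝓡 m) x} {x : M}
    (hX : SmoothFieldAt X x) (hY : SmoothFieldAt Y x) :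
    SmoothFieldAt (fun x => X x + Y x) x :=
  ContMDiffAt.add_section hX hY

theorem SmoothFieldAt.sub {X Y : Π x : M, TangentSpace (𝓡 m) x} {x : M}
    (hX : SmoothFieldAt X x) (hY : SmoothFieldAt Y x) :
    SmoothFieldAt (fun x => X x - Y x) x :=
  ContMDiffAt.sub_section hX hY

theorem SmoothFieldAt.smul {a : M → ℝ} {X : Π x : M, TangentSpace (𝓡 m) x} {x : M}
    (ha : ContMDiffAt (𝓡 m) 𝓘(ℝ, ℝ) ∞ a x) (hX : SmoothFieldAt X x) :
    SmoothFieldAt (fun x => a x • X x) x :=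
  ContMDiffAt.smul_section ha hX

theorem SmoothFieldAt.sum {ι : Type*} {s : Finset ι} {X : ι → Π x : M, TangentSpace (𝓡 m) x} {x : M}
    (hX : ∀ i ∈ s, SmoothFieldAt (X i) x) :
    SmoothFieldAt (fun x => ∑ i ∈ s, X i x) x :=
  ContMDiffAt.sum_section hX

theorem SmoothFieldAt.congr {X Y : Π x : M, TangentSpace (𝓡 m) x} {x : M}
    (hX : SmoothFieldAt X x) (h : ∀ᶠ y in 𝓝 x, Y y = X y) : SmoothFieldAt Y x := by
  refine ContMDiffAt.congr_of_eventuallyEq hX ?_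
  filter_upwards [h] with y hy
  rw [hy]

theorem SmoothField.add {X Y : Π x : M, TangentSpace (𝓡 m) x}
    (hX : SmoothField X) (hY : SmoothField Y) : SmoothField (fun x => X x + Y x) :=
  fun x => (hX.at x).add (hY.at x)

theorem SmoothField.sub {X Y : Π x : M, TangentSpace (𝓡 m) x}
    (hX : SmoothField X) (hY : SmoothField Y) : SmoothField (fun x => X x - Y x) :=
  fun x => (hX.at x).sub (hY.at x)

theorem SmoothField.smul {a : M → ℝ} {X : Π x : M, TangentSpace (𝓡 m) x}
    (ha : ContMDiff (𝓡 m) 𝓘(ℝ, ℝ) ∞ a) (hX : SmoothField X) : SmoothField (fun x => a x • X x) :=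
  fun x => (hX.at x).smul (ha x)

theorem ContMDiff.dirDeriv {h : M → F} {X : Π x : M, TangentSpace (𝓡 m) x}
    (hh : ContMDiff (𝓡 m) 𝓘(ℝ, F) ∞ h) (hX : SmoothField X) :
    ContMDiff (𝓡 m) 𝓘(ℝ, F) ∞ (dirDeriv X h) :=
  fun x => contMDiffAt_mvfderiv_apply (hh x) (hX x)

theorem SmoothField.of_mvfderiv [FiniteDimensional ℝ F] {h : M → F}
    (hh : ContMDiff (𝓡 m) 𝓘(ℝ, F) ∞ h) (hinj : ∀ x, Function.Injective (mvfderiv (𝓡 m) h x))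
    {X : Π x : M, TangentSpace (𝓡 m) x}
    (hX : ContMDiff (𝓡 m) 𝓘(ℝ, F) ∞ (fun x => mvfderiv (𝓡 m) h x (X x))) :
    SmoothField X :=
  fun x => smoothFieldAt_of_mvfderiv (hh x) (hinj x) (hX x)

theorem SmoothField.zero : SmoothField (fun x : M => (0 : TangentSpace (𝓡 m) x)) :=
  Bundle.contMDiff_zeroSection ℝ (TangentSpace (𝓡 m))

theorem exists_smooth_bump [T2Space M] {x₀ : M} {U : Set M} (hU : U ∈ 𝓝 x₀) :
    ∃ χ : M → ℝ, ContMDiff (𝓡 m) 𝓘(ℝ, ℝ) ∞ χ ∧ (∀ᶠ x in 𝓝 x₀, χ x = 1) ∧ tsupport χ ⊆ U := by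
  obtain ⟨f, -, hf⟩ := (SmoothBumpFunction.nhds_basis_tsupport (I := 𝓡 m) x₀).mem_iff.1 hU
  exact ⟨f, f.contMDiff, f.eventuallyEq_one, hf⟩

/-- A function supported inside a set where it is smooth is smooth. -/
theorem contMDiff_smul_of_tsupport {χ : M → ℝ} (hχ : ContMDiff (𝓡 m) 𝓘(ℝ, ℝ) ∞ χ) {U : Set M}
    (hs : tsupport χ ⊆ U) {g : M → F} (hg : ∀ x ∈ U, ContMDiffAt (𝓡 m) 𝓘(ℝ, F) ∞ g x) :
    ContMDiff (𝓡 m) 𝓘(ℝ, F) ∞ (fun x => χ x • g x) := by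
  refine contMDiff_of_tsupport fun x hx => ?_
  exact (hχ x).smul (hg x (hs (tsupport_smul_subset_left _ _ hx)))

theorem smoothField_smul_of_tsupport {χ : M → ℝ} (hχ : ContMDiff (𝓡 m) 𝓘(ℝ, ℝ) ∞ χ) {U : Set M}
    (hs : tsupport χ ⊆ U) {X : Π x : M, TangentSpace (𝓡 m) x} (hX : ∀ x ∈ U, SmoothFieldAt X x) :
    SmoothField (fun x => χ x • X x) := by
  intro x
  by_cases hx : x ∈ tsupport χ
  · exact (hX x (hs hx)).smul (hχ x)
  · refine (SmoothField.zero.at x).congr ?_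
    filter_upwards [(isClosed_tsupport χ).isOpen_compl.mem_nhds hx] with y hy
    rw [image_eq_zero_of_notMem_tsupport hy, zero_smul]

theorem exists_smoothField_eventuallyEq [T2Space M] {x₀ : M} {U : Set M} (hU : U ∈ 𝓝 x₀)
    {X : Π x : M, TangentSpace (𝓡 m) x} (hX : ∀ x ∈ U, SmoothFieldAt X x) :
    ∃ Y : Π x : M, TangentSpace (𝓡 m) x, SmoothField Y ∧ ∀ᶠ x in 𝓝 x₀, Y x = X x := by
  obtain ⟨χ, hχ, h1, hs⟩ := exists_smooth_bump (m := m) hU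
  refine ⟨_, smoothField_smul_of_tsupport hχ hs hX, ?_⟩
  filter_upwards [h1] with x hx
  rw [hx, one_smul]

theorem exists_smoothField_apply [T2Space M] (x₀ : M) (v : TangentSpace (𝓡 m) x₀) :
    ∃ X : Π x : M, TangentSpace (𝓡 m) x, SmoothField X ∧ X x₀ = v := by
  obtain ⟨X, hX, he⟩ := exists_smoothField_eventuallyEq (x₀ := x₀) (m := m)
    ((chartAt (EuclideanSpace ℝ (Fin m)) x₀).open_source.mem_nhds (mem_chart_source _ x₀))
    (X := fun x => coordInv x₀ x (coordAt x₀ x₀ v))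
    (fun x hx => smoothFieldAt_coordInv hx contMDiffAt_const)
  exact ⟨X, hX, he.self_of_nhds.trans (coordInv_coordAt (mem_chart_source _ x₀) v)⟩

/-- An operation on smooth vector fields that is linear over smooth functions at `x₀` depends only
on the values at `x₀`. -/
theorem eq_zero_of_tensorial [T2Space M] {A : Type*} [AddCommGroup A] [Module ℝ A] {x₀ : M}
    (Φ : (Π x : M, TangentSpace (𝓡 m) x) → A)
    (hadd : ∀ X Y, SmoothField X → SmoothField Y → Φ (fun x => X x + Y x) = Φ X + Φ Y)
    (hsmul : ∀ (a : M → ℝ) X, ContMDiff (𝓡 m) 𝓘(ℝ, ℝ) ∞ a → SmoothField X →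
      Φ (fun x => a x • X x) = a x₀ • Φ X)
    {X : Π x : M, TangentSpace (𝓡 m) x} (hX : SmoothField X) (h0 : X x₀ = 0) : Φ X = 0 := by
  have hU := (chartAt (EuclideanSpace ℝ (Fin m)) x₀).open_source.mem_nhds (mem_chart_source _ x₀)
  obtain ⟨χ, hχ, h1, hs⟩ := exists_smooth_bump (m := m) hU
  have hχ1 : χ x₀ = 1 := h1.self_of_nhds
  let b := EuclideanSpace.basisFun (Fin m) ℝ
  let e : Fin m → Π x : M, TangentSpace (𝓡 m) x := fun i x => χ x • coordInv x₀ x (b i)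
  have he : ∀ i, SmoothField (e i) := fun i =>
    smoothField_smul_of_tsupport hχ hs fun x hx => smoothFieldAt_coordInv hx contMDiffAt_const
  let c : Fin m → M → ℝ := fun i x => χ x • (coordAt x₀ x (X x)) i
  have hc : ∀ i, ContMDiff (𝓡 m) 𝓘(ℝ, ℝ) ∞ (c i) := fun i =>
    contMDiff_smul_of_tsupport hχ hs fun x hx => by
      have h2 := (smoothFieldAt_iff_of_mem hx).1 (hX.at x)
      exact (EuclideanSpace.proj i : EuclideanSpace ℝ (Fin m) →L[ℝ] ℝ).contDiff.contDiffAt.contMDiffAt.comp x h2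
  have hz : Φ (fun _ => 0) = 0 := by
    have := hsmul (fun _ => 0) X contMDiff_const hX
    simpa using this
  have hsum : ∀ s : Finset (Fin m),
      SmoothField (fun x => ∑ i ∈ s, c i x • e i x) ∧
      Φ (fun x => ∑ i ∈ s, c i x • e i x) = ∑ i ∈ s, c i x₀ • Φ (e i) := by
    intro s
    induction s using Finset.induction_on with
    | empty =>
      refine ⟨?_, by simpa using hz⟩
      simpa using SmoothField.zero (m := m) (M := M)
    | insert a s ha ih =>
      simp only [Finset.sum_insert ha]
      refine ⟨((he a).smul (hc a)).add ih.1, ?_⟩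
      rw [hadd _ _ ((he a).smul (hc a)) ih.1, hsmul _ _ (hc a) (he a), ih.2]
  -- One factor of the bump function makes the coordinate frame global, the other the coefficients;
  -- both equal 1 at `x₀`.
  have hdec : (fun x => (χ x * χ x) • X x) = fun x => ∑ i, c i x • e i x := by
    funext x
    by_cases hx : x ∈ (chartAt (EuclideanSpace ℝ (Fin m)) x₀).source
    · have h3 : coordAt x₀ x (X x) = ∑ i, (coordAt x₀ x (X x)) i • b i := by
        conv_lhs => rw [← b.sum_repr (coordAt x₀ x (X x))]
        simp [b]
      have h4 := coordInv_coordAt hx (X x)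
      rw [h3, map_sum] at h4
      rw [← h4, Finset.smul_sum]
      refine Finset.sum_congr rfl fun i _ => ?_
      simp only [c, e, map_smul, smul_smul, smul_eq_mul]
      congr 1; ring
    · have : χ x = 0 := image_eq_zero_of_notMem_tsupport fun h => hx (hs h)
      simp [c, this]
  have h5 := hsmul (fun x => χ x * χ x) X (hχ.mul hχ) hX
  rw [hdec, (hsum _).2] at h5
  have h6 : ∀ i, c i x₀ = 0 := fun i => by simp [c, h0]
  simpa [h6, hχ1] using h5.symm

theorem eq_of_tensorial [T2Space M] {A : Type*} [AddCommGroup A] [Module ℝ A] {x₀ : M}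
    (Φ : (Π x : M, TangentSpace (𝓡 m) x) → A)
    (hadd : ∀ X Y, SmoothField X → SmoothField Y → Φ (fun x => X x + Y x) = Φ X + Φ Y)
    (hsmul : ∀ (a : M → ℝ) X, ContMDiff (𝓡 m) 𝓘(ℝ, ℝ) ∞ a → SmoothField X →
      Φ (fun x => a x • X x) = a x₀ • Φ X)
    {X Y : Π x : M, TangentSpace (𝓡 m) x} (hX : SmoothField X) (hY : SmoothField Y)
    (h0 : X x₀ = Y x₀) : Φ X = Φ Y := by
  have h1 := eq_zero_of_tensorial Φ hadd hsmul (hX.sub hY) (sub_eq_zero.2 h0)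
  have h2 := hadd _ _ (hX.sub hY) hY
  simpa [h1] using h2

/-! ### Exterior derivatives of vector valued one-forms -/

/-- A vector valued one-form that maps smooth vector fields to smooth functions. -/
def SmoothVecForm (Ω : Π x : M, TangentSpace (𝓡 m) x →ₗ[ℝ] F) : Prop :=
  ∀ X : Π x : M, TangentSpace (𝓡 m) x, SmoothField X →
    ContMDiff (𝓡 m) 𝓘(ℝ, F) ∞ (fun x => Ω x (X x))

/-- The exterior derivative of a vector valued one-form, evaluated on vector fields. -/
noncomputable def extDerivVec (Ω : Π x : M, TangentSpace (𝓡 m) x →ₗ[ℝ] F)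
    (X Y : Π x : M, TangentSpace (𝓡 m) x) (x : M) : F :=
  dirDeriv X (fun y => Ω y (Y y)) x - dirDeriv Y (fun y => Ω y (X y)) x
    - Ω x (VectorField.mlieBracket (𝓡 m) X Y x)

theorem extDerivVec_swap (Ω : Π x : M, TangentSpace (𝓡 m) x →ₗ[ℝ] F)
    (X Y : Π x : M, TangentSpace (𝓡 m) x) (x : M) :
    extDerivVec Ω X Y x = - extDerivVec Ω Y X x := by
  rw [extDerivVec, extDerivVec, VectorField.mlieBracket_swap_apply, map_neg]
  abel

/-- The derivative of the factor `a` arising from `Ω (a X)` cancels against the one in the bracket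
`[a X, Y]`. Hence the exterior derivative at a point may be computed with any convenient extensions
of the given vectors. -/
theorem extDerivVec_congr_left [T2Space M] {Ω : Π x : M, TangentSpace (𝓡 m) x →ₗ[ℝ] F}
    (hΩ : SmoothVecForm Ω) {X X' Y : Π x : M, TangentSpace (𝓡 m) x} (hX : SmoothField X)
    (hX' : SmoothField X') {x : M} (h : X x = X' x) :
    extDerivVec Ω X Y x = extDerivVec Ω X' Y x := by
  refine eq_of_tensorial (x₀ := x) (fun X => extDerivVec Ω X Y x) ?_ ?_ hX hX' h
  · intro X Z hX hZ
    have h1 : VectorField.mlieBracket (𝓡 m) (fun x => X x + Z x) Y x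
        = VectorField.mlieBracket (𝓡 m) X Y x + VectorField.mlieBracket (𝓡 m) Z Y x :=
      VectorField.mlieBracket_add_left (hX.at x).mdiff (hZ.at x).mdiff
    have h2 : mvfderiv (𝓡 m) (fun y => Ω y (X y + Z y)) x (Y x)
        = mvfderiv (𝓡 m) (fun y => Ω y (X y)) x (Y x)
          + mvfderiv (𝓡 m) (fun y => Ω y (Z y)) x (Y x) := by
      simp only [map_add]
      rw [mvfderiv_fun_add ((hΩ X hX x).mdifferentiableAt (by simp))
        ((hΩ Z hZ x).mdifferentiableAt (by simp))]
      rfl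
    simp only [extDerivVec, dirDeriv]
    rw [h1, h2, map_add, map_add]
    abel
  · intro a X ha hX
    have h1 : VectorField.mlieBracket (𝓡 m) (fun x => a x • X x) Y x
        = - mvfderiv (𝓡 m) a x (Y x) • X x + a x • VectorField.mlieBracket (𝓡 m) X Y x :=
      VectorField.mlieBracket_smul_left ((ha x).mdifferentiableAt (by simp)) (hX.at x).mdiff
    have h2 : mvfderiv (𝓡 m) (fun y => Ω y (a y • X y)) x (Y x)
        = a x • mvfderiv (𝓡 m) (fun y => Ω y (X y)) x (Y x)
          + mvfderiv (𝓡 m) a x (Y x) • Ω x (X x) := by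
      simp only [map_smul]
      exact mvfderiv_smul_vec ((ha x).mdifferentiableAt (by simp))
        ((hΩ X hX x).mdifferentiableAt (by simp)) _
    simp only [extDerivVec, dirDeriv]
    rw [h1, h2]
    simp only [map_add, map_smul, smul_sub, neg_smul, map_neg]
    abel

theorem extDerivVec_congr [T2Space M] {Ω : Π x : M, TangentSpace (𝓡 m) x →ₗ[ℝ] F}
    (hΩ : SmoothVecForm Ω) {X X' Y Y' : Π x : M, TangentSpace (𝓡 m) x} (hX : SmoothField X)
    (hX' : SmoothField X') (hY : SmoothField Y) (hY' : SmoothField Y') {x : M}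
    (h : X x = X' x) (h' : Y x = Y' x) :
    extDerivVec Ω X Y x = extDerivVec Ω X' Y' x := by
  rw [extDerivVec_congr_left hΩ hX hX' h, extDerivVec_swap,
    extDerivVec_congr_left hΩ hY hY' h', ← extDerivVec_swap]

end Fields

/-! ### The Levi-Civita connection of an induced metric -/

section LeviCivita

variable {m : ℕ} {M : Type*} [TopologicalSpace M] [ChartedSpace (EuclideanSpace ℝ (Fin m)) M]
  [IsManifold (𝓡 m) ∞ M]
  {E : Type*} [NormedAddCommGroup E] [NormedSpace ℝ E]

instance finiteDimensional_tangentSpace (x : M) : FiniteDimensional ℝ (TangentSpace (𝓡 m) x) :=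
  inferInstanceAs (FiniteDimensional ℝ (EuclideanSpace ℝ (Fin m)))

theorem finrank_tangentSpace (x : M) : Module.finrank ℝ (TangentSpace (𝓡 m) x) = m :=
  (finrank_euclideanSpace (𝕜 := ℝ) (ι := Fin m)).trans (Fintype.card_fin m)

/-- Each term of the Koszul formula is a pairing of second derivatives of `h`, brackets being
commutators, and all but one kind cancel. Only the symmetry of `b` enters, so Lorentzian ambient
spaces are covered. -/
theorem koszul_induced (b : E →L[ℝ] E →L[ℝ] ℝ) (hb : ∀ p q, b p q = b q p) {h : M → E}
    (hh : ContMDiff (𝓡 m) 𝓘(ℝ, E) ∞ h)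
    {g : Π x : M, TangentSpace (𝓡 m) x → TangentSpace (𝓡 m) x → ℝ}
    (hg : ∀ x v u, g x v u = b (mvfderiv (𝓡 m) h x v) (mvfderiv (𝓡 m) h x u))
    {X Y Z : Π x : M, TangentSpace (𝓡 m) x} (hX : SmoothField X) (hY : SmoothField Y)
    (hZ : SmoothField Z) (x : M) :
    koszul g X Y Z x
      = 2 * b (dirDeriv X (dirDeriv Y h) x) (mvfderiv (𝓡 m) h x (Z x)) := by
  have hd : ∀ {V : Π x : M, TangentSpace (𝓡 m) x}, SmoothField V →
      MDifferentiableAt (𝓡 m) 𝓘(ℝ, E) (dirDeriv V h) x := fun hV =>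
    (hh.dirDeriv hV x).mdifferentiableAt (by simp)
  have hprod : ∀ {U V W : Π x : M, TangentSpace (𝓡 m) x}, SmoothField V → SmoothField W →
      dirDeriv U (fun y => g y (V y) (W y)) x
        = b (dirDeriv U (dirDeriv V h) x) (dirDeriv W h x)
          + b (dirDeriv V h x) (dirDeriv U (dirDeriv W h) x) := by
    intro U V W hV hW
    have : (fun y => g y (V y) (W y)) = fun y => b (dirDeriv V h y) (dirDeriv W h y) := by
      funext y; exact hg y _ _
    rw [this]
    exact mvfderiv_bilin b (hd hV) (hd hW) (U x)
  have hbr : ∀ {V W : Π x : M, TangentSpace (𝓡 m) x}, SmoothField V → SmoothField W →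
      mvfderiv (𝓡 m) h x (VectorField.mlieBracket (𝓡 m) V W x)
        = dirDeriv V (dirDeriv W h) x - dirDeriv W (dirDeriv V h) x := fun hV hW =>
    mvfderiv_mlieBracket (hh x) (hV.at x) (hW.at x)
  have hD : ∀ V : Π x : M, TangentSpace (𝓡 m) x, mvfderiv (𝓡 m) h x (V x) = dirDeriv V h x :=
    fun _ => rfl
  rw [koszul, hprod hY hZ, hprod hZ hX, hprod hX hY, hg, hg, hg, hbr hX hY, hbr hY hZ, hbr hZ hX,
    hD, hD, hD]
  simp only [map_sub, _root_.sub_apply]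
  rw [hb (dirDeriv Z h x) (dirDeriv Y (dirDeriv X h) x),
    hb (dirDeriv Y h x) (dirDeriv X (dirDeriv Z h) x),
    hb (dirDeriv X h x) (dirDeriv Z (dirDeriv Y h) x)]
  ring

/-- The Levi-Civita connection of an induced metric is the tangential part of the flat
derivative. -/
theorem leviCivita_induced [T2Space M] (b : E →L[ℝ] E →L[ℝ] ℝ) (hb : ∀ p q, b p q = b q p) {h : M → E}
    (hh : ContMDiff (𝓡 m) 𝓘(ℝ, E) ∞ h)
    {g : Π x : M, TangentSpace (𝓡 m) x → TangentSpace (𝓡 m) x → ℝ}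
    (hg : ∀ x v u, g x v u = b (mvfderiv (𝓡 m) h x v) (mvfderiv (𝓡 m) h x u))
    {x : M} (hnd : ∀ v, (∀ u, g x v u = 0) → v = 0)
    {Y : Π x : M, TangentSpace (𝓡 m) x} (hY : SmoothField Y) (v z : TangentSpace (𝓡 m) x) :
    b (mvfderiv (𝓡 m) h x (leviCivita g Y x v)) (mvfderiv (𝓡 m) h x z)
      = b (mvfderiv (𝓡 m) (dirDeriv Y h) x v) (mvfderiv (𝓡 m) h x z) := by
  -- `leviCivita` has the default value 0 if no such map exists. Nondegeneracy makes the metric an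
  -- isomorphism onto the dual, and its inverse provides the map.
  have hex : ∃ B : TangentSpace (𝓡 m) x →ₗ[ℝ] TangentSpace (𝓡 m) x,
      ∀ X Z : Π x : M, TangentSpace (𝓡 m) x, SmoothField X → SmoothField Z →
        2 * g x (B (X x)) (Z x) = koszul g X Y Z x := by
    let G : TangentSpace (𝓡 m) x →ₗ[ℝ] Module.Dual ℝ (TangentSpace (𝓡 m) x) :=
      LinearMap.mk₂ ℝ (fun v u => b (mvfderiv (𝓡 m) h x v) (mvfderiv (𝓡 m) h x u))
        (by intros; simp) (by intros; simp) (by intros; simp) (by intros; simp)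
    have hG : Function.Injective G := by
      rw [injective_iff_map_eq_zero]
      intro v hv
      exact hnd v fun u => (hg x v u).trans (LinearMap.congr_fun hv u)
    let e := LinearEquiv.ofInjectiveOfFinrankEq G hG
      (by rw [Subspace.dual_finrank_eq])
    let R : TangentSpace (𝓡 m) x →ₗ[ℝ] Module.Dual ℝ (TangentSpace (𝓡 m) x) :=
      LinearMap.mk₂ ℝ (fun v u => b (mvfderiv (𝓡 m) (dirDeriv Y h) x v) (mvfderiv (𝓡 m) h x u))
        (by intros; simp) (by intros; simp) (by intros; simp) (by intros; simp)
    refine ⟨e.symm.toLinearMap ∘ₗ R, fun X Z hX hZ => ?_⟩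
    rw [koszul_induced b hb hh hg hX hY hZ, hg]
    congr 1
    exact LinearMap.congr_fun (e.apply_symm_apply (R (X x))) (Z x)
  rw [leviCivita, dif_pos hex]
  obtain ⟨X, hX, rfl⟩ := exists_smoothField_apply x v
  obtain ⟨Z, hZ, rfl⟩ := exists_smoothField_apply x z
  have h1 := hex.choose_spec X Z hX hZ
  rw [koszul_induced b hb hh hg hX hY hZ, hg] at h1
  exact mul_left_cancel₀ two_ne_zero h1

end LeviCivita

/-! ### Lorentz products -/

section Lorentz

variable {k : ℕ}

theorem lorentz_comm (x y : Minkowski k) : lorentz x y = lorentz y x := by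
  simp only [lorentz, mul_comm]

/-- The Lorentz product as a continuous bilinear map. -/
noncomputable def lorentzL (k : ℕ) : Minkowski k →L[ℝ] Minkowski k →L[ℝ] ℝ :=
  LinearMap.toContinuousLinearMap
    (LinearMap.toContinuousLinearMap.toLinearMap ∘ₗ
      (LinearMap.mk₂ ℝ (fun x y : Minkowski k => lorentz x y)
        (by intros; simp only [lorentz, PiLp.add_apply, add_mul, Finset.sum_add_distrib]; ring)
        (by intros; simp only [lorentz, PiLp.smul_apply, smul_eq_mul, mul_add, Finset.mul_sum, mul_assoc]; ring)
        (by intros; simp only [lorentz, PiLp.add_apply, mul_add, Finset.sum_add_distrib]; ring)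
        (by
          intros
          simp only [lorentz, PiLp.smul_apply, smul_eq_mul, mul_add, Finset.mul_sum, mul_left_comm]
          ring)))

theorem lorentzL_apply (x y : Minkowski k) : lorentzL k x y = lorentz x y := rfl

theorem lorentz_add_left (x y z : Minkowski k) : lorentz (x + y) z = lorentz x z + lorentz y z := by
  simp only [← lorentzL_apply, map_add, _root_.add_apply]

theorem lorentz_add_right (x y z : Minkowski k) :
    lorentz x (y + z) = lorentz x y + lorentz x z := by
  simp only [← lorentzL_apply, map_add]

theorem lorentz_sub_left (x y z : Minkowski k) : lorentz (x - y) z = lorentz x z - lorentz y z := by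
  simp only [← lorentzL_apply, map_sub, _root_.sub_apply]

theorem lorentz_sub_right (x y z : Minkowski k) :
    lorentz x (y - z) = lorentz x y - lorentz x z := by
  simp only [← lorentzL_apply, map_sub]

theorem lorentz_neg_left (x y : Minkowski k) : lorentz (-x) y = -lorentz x y := by
  simp only [← lorentzL_apply, map_neg, _root_.neg_apply]

theorem lorentz_neg_right (x y : Minkowski k) : lorentz x (-y) = -lorentz x y := by
  simp only [← lorentzL_apply, map_neg]

theorem lorentz_smul_left (c : ℝ) (x y : Minkowski k) : lorentz (c • x) y = c * lorentz x y := by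
  simp only [← lorentzL_apply, map_smul, _root_.smul_apply, smul_eq_mul]

theorem lorentz_smul_right (c : ℝ) (x y : Minkowski k) : lorentz x (c • y) = c * lorentz x y := by
  simp only [← lorentzL_apply, map_smul, smul_eq_mul]

theorem lorentz_zero_left (x : Minkowski k) : lorentz 0 x = 0 := by
  simp only [← lorentzL_apply, map_zero, _root_.zero_apply]

theorem lorentz_zero_right (x : Minkowski k) : lorentz x 0 = 0 := by
  simp only [← lorentzL_apply, map_zero]

theorem lorentz_sum_left {ι : Type*} (s : Finset ι) (f : ι → Minkowski k) (y : Minkowski k) :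
    lorentz (∑ i ∈ s, f i) y = ∑ i ∈ s, lorentz (f i) y := by
  simp only [← lorentzL_apply, map_sum, _root_.sum_apply]

/-- The Lorentz product is nondegenerate. -/
theorem eq_zero_of_lorentz {x : Minkowski k} (h : ∀ y, lorentz x y = 0) : x = 0 := by
  ext i
  have := h (EuclideanSpace.single i 1)
  refine Fin.cases ?_ (fun j => ?_) i this
  · intro h0
    simpa [lorentz, Fin.succ_ne_zero] using h0
  · intro hj
    simpa [lorentz, (Fin.succ_ne_zero j).symm, Pi.single_apply, Fin.succ_inj] using hj

/-- A vector orthogonal to a time-like vector is space-like. -/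
theorem lorentz_pos_of_orthogonal {t z : Minkowski k} (ht : lorentz t t < 0)
    (h : lorentz z t = 0) (hz : z ≠ 0) : 0 < lorentz z z := by
  simp only [lorentz] at ht h ⊢
  have cs := Finset.sum_mul_sq_le_sq_mul_sq Finset.univ (fun i : Fin k => z i.succ)
    (fun i => t i.succ)
  set a := ∑ i : Fin k, z i.succ * t i.succ
  have e1 : ∑ i : Fin k, t i.succ * t i.succ = ∑ i : Fin k, t i.succ ^ 2 := by simp only [sq]
  have e2 : ∑ i : Fin k, z i.succ * z i.succ = ∑ i : Fin k, z i.succ ^ 2 := by simp only [sq]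
  rw [e1] at ht
  rw [e2]
  have hb : 0 ≤ ∑ i : Fin k, t i.succ ^ 2 := Finset.sum_nonneg fun i _ => sq_nonneg _
  have hc : 0 ≤ ∑ i : Fin k, z i.succ ^ 2 := Finset.sum_nonneg fun i _ => sq_nonneg _
  by_contra hcon
  push Not at hcon
  set c := ∑ i : Fin k, z i.succ ^ 2 with hcdef
  set d := ∑ i : Fin k, t i.succ ^ 2
  have ha : a = z 0 * t 0 := by linarith
  rw [ha] at cs
  have ht0 : d < t 0 * t 0 := by linarith
  -- For `c > 0`, Cauchy-Schwarz and `d < t₀²` would give `z₀² t₀² ≤ c d < c t₀² ≤ z₀² t₀²`.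
  have hc0 : c = 0 := by
    by_contra hne
    have hpos : 0 < c := lt_of_le_of_ne hc (Ne.symm hne)
    nlinarith [mul_pos hpos (sub_pos.2 ht0), mul_nonneg (sub_nonneg.2 (by linarith : c ≤ z 0 * z 0)) (by nlinarith : 0 ≤ t 0 * t 0)]
  have hz0 : z 0 = 0 := by
    have h1 : (z 0 * t 0) ^ 2 ≤ 0 := by rw [hc0] at cs; linarith
    have h2 : z 0 * t 0 = 0 := by nlinarith
    rcases mul_eq_zero.1 h2 with h3 | h3
    · exact h3
    · rw [h3] at ht0; linarith
  apply hz
  ext i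
  refine Fin.cases hz0 (fun j => ?_) i
  have h4 := (Finset.sum_eq_zero_iff_of_nonneg (fun i _ => sq_nonneg _)).1 (hcdef.symm.trans hc0) j
    (Finset.mem_univ _)
  simpa using h4

end Lorentz

/-! ### Products and derivative of the light-cone embedding -/

namespace LightConeModel

variable {k : ℕ} (P : LightConeModel k)

theorem lorentz_w_p₀ : lorentz P.w P.p₀ = 1 := by rw [lorentz_comm]; exact P.p₀_w
theorem lorentz_p₀_C (x) : lorentz P.p₀ (P.C x) = 0 := by rw [lorentz_comm]; exact P.C_p₀ x
theorem lorentz_w_C (x) : lorentz P.w (P.C x) = 0 := by rw [lorentz_comm]; exact P.C_w x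

/-- The vectors p₀, w and the image of C span Minkowski space: the products with w, p₀ and C x read
off the coefficients of a combination, so the map `T` is injective, and the dimensions agree. -/
theorem eq_zero_of_orthogonal {z : Minkowski (k + 1)} (h0 : lorentz z P.p₀ = 0)
    (hw : lorentz z P.w = 0) (hC : ∀ x, lorentz z (P.C x) = 0) : z = 0 := by
  let T : (EuclideanSpace ℝ (Fin k) × ℝ × ℝ) →ₗ[ℝ] Minkowski (k + 1) :=
    P.C ∘ₗ LinearMap.fst ℝ _ _ + (LinearMap.toSpanSingleton ℝ _ P.p₀) ∘ₗ
      (LinearMap.fst ℝ _ _ ∘ₗ LinearMap.snd ℝ _ _) + (LinearMap.toSpanSingleton ℝ _ P.w) ∘ₗ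
      (LinearMap.snd ℝ _ _ ∘ₗ LinearMap.snd ℝ _ _)
  have hT : ∀ p, T p = P.C p.1 + p.2.1 • P.p₀ + p.2.2 • P.w := fun p => rfl
  have hinj : Function.Injective T := by
    rw [injective_iff_map_eq_zero]
    rintro ⟨x, a, b⟩ hp
    rw [hT] at hp
    have e1 : lorentz (P.C x + a • P.p₀ + b • P.w) P.w = 0 := by rw [hp, lorentz_zero_left]
    have e2 : lorentz (P.C x + a • P.p₀ + b • P.w) P.p₀ = 0 := by rw [hp, lorentz_zero_left]
    have e3 : lorentz (P.C x + a • P.p₀ + b • P.w) (P.C x) = 0 := by rw [hp, lorentz_zero_left]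
    simp only [lorentz_add_left, lorentz_smul_left, P.C_w, P.p₀_w, P.w_null, P.C_p₀, P.p₀_null,
      P.lorentz_w_p₀, P.C_isometry, P.lorentz_p₀_C, P.lorentz_w_C] at e1 e2 e3
    have ha : a = 0 := by linarith
    have hb : b = 0 := by linarith
    have hx : x = 0 := by
      apply inner_self_eq_zero (𝕜 := ℝ).1
      linarith
    simp [ha, hb, hx]
  have hsurj : Function.Surjective T := by
    refine (LinearMap.injective_iff_surjective_of_finrank_eq_finrank ?_).1 hinj
    simp
  refine eq_zero_of_lorentz fun y => ?_
  obtain ⟨p, rfl⟩ := hsurj y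
  rw [hT, lorentz_add_right, lorentz_add_right, lorentz_smul_right, lorentz_smul_right, hC, h0, hw]
  simp

theorem lorentz_Psi_w (x) : lorentz (P.Psi x) P.w = 1 := by
  simp only [Psi, lorentz_sub_left, lorentz_add_left, lorentz_smul_left, P.p₀_w, P.C_w, P.w_null]
  ring

theorem lorentz_Psi_p₀ (x) : lorentz (P.Psi x) P.p₀ = -(1 / 2) * ‖x‖ ^ 2 := by
  simp only [Psi, lorentz_sub_left, lorentz_add_left, lorentz_smul_left, P.p₀_null, P.C_p₀,
    P.lorentz_w_p₀]
  ring

theorem lorentz_Psi_C (x y) : lorentz (P.Psi x) (P.C y) = inner ℝ x y := by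
  simp only [Psi, lorentz_sub_left, lorentz_add_left, lorentz_smul_left, P.lorentz_p₀_C,
    P.C_isometry, P.lorentz_w_C]
  ring

theorem lorentz_Psi_Psi (x y) : lorentz (P.Psi x) (P.Psi y) = -(1 / 2) * ‖x - y‖ ^ 2 := by
  conv_lhs => rw [Psi.eq_def P y]
  rw [lorentz_sub_right, lorentz_add_right, lorentz_smul_right, lorentz_Psi_p₀, lorentz_Psi_C,
    lorentz_Psi_w, @norm_sub_sq_real]
  ring

/-- The derivative of the light-cone embedding. -/
noncomputable def dPsi (x : EuclideanSpace ℝ (Fin k)) :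
    EuclideanSpace ℝ (Fin k) →L[ℝ] Minkowski (k + 1) :=
  P.C.toContinuousLinearMap - (innerSL ℝ x).smulRight P.w

theorem dPsi_apply (x v) : P.dPsi x v = P.C v - (inner ℝ x v) • P.w := rfl

theorem hasFDerivAt_Psi (x) : HasFDerivAt P.Psi (P.dPsi x) x := by
  have h1 : HasFDerivAt (fun x => P.p₀ + P.C x) P.C.toContinuousLinearMap x :=
    (P.C.toContinuousLinearMap.hasFDerivAt).const_add _
  have h2 : HasFDerivAt (fun x : EuclideanSpace ℝ (Fin k) => (1 / 2 : ℝ) * ‖x‖ ^ 2)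
      ((1 / 2 : ℝ) • (2 • (innerSL ℝ x))) x :=
    (hasStrictFDerivAt_norm_sq x).hasFDerivAt.const_mul _
  have h3 := h1.sub (h2.smul_const P.w)
  have h4 : P.dPsi x = P.C.toContinuousLinearMap
      - ((1 / 2 : ℝ) • (2 • (innerSL ℝ x))).smulRight P.w := by
    rw [dPsi]
    congr 2
    ext v
    simp
  rw [h4]
  exact h3

theorem fderiv_Psi (x) : fderiv ℝ P.Psi x = P.dPsi x := (P.hasFDerivAt_Psi x).fderiv

theorem contDiff_Psi : ContDiff ℝ ∞ P.Psi := by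
  have h1 : ContDiff ℝ ∞ (fun x => P.C x) := P.C.toContinuousLinearMap.contDiff
  exact (contDiff_const.add h1).sub ((contDiff_const.mul (contDiff_norm_sq ℝ)).smul contDiff_const)

theorem lorentz_dPsi_dPsi (x u v) : lorentz (P.dPsi x u) (P.dPsi x v) = inner ℝ u v := by
  simp only [dPsi_apply, lorentz_sub_left, lorentz_sub_right, lorentz_smul_left,
    lorentz_smul_right, P.C_isometry, P.C_w, P.lorentz_w_C, P.w_null]
  ring

theorem lorentz_dPsi_Psi (x u) : lorentz (P.dPsi x u) (P.Psi x) = 0 := by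
  rw [lorentz_comm, dPsi_apply, lorentz_sub_right, lorentz_smul_right, lorentz_Psi_C,
    lorentz_Psi_w]
  ring

theorem lorentz_dPsi_w (x u) : lorentz (P.dPsi x u) P.w = 0 := by
  rw [dPsi_apply, lorentz_sub_left, lorentz_smul_left, P.C_w, P.w_null]; ring

theorem eq_zero_of_orthogonal_dPsi {z : Minkowski (k + 1)} (x : EuclideanSpace ℝ (Fin k))
    (h0 : lorentz z (P.Psi x) = 0) (hw : lorentz z P.w = 0)
    (hC : ∀ v, lorentz z (P.dPsi x v) = 0) : z = 0 := by
  have hC' : ∀ v, lorentz z (P.C v) = 0 := by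
    intro v
    have := hC v
    rwa [dPsi_apply, lorentz_sub_right, lorentz_smul_right, hw, mul_zero, sub_zero] at this
  refine P.eq_zero_of_orthogonal ?_ hw hC'
  rw [Psi, lorentz_sub_right, lorentz_add_right, lorentz_smul_right, hC', hw] at h0
  linarith

end LightConeModel

/-! ### The moving frame F_*TM, ξ, F, w along the hypersurface -/

namespace OrientedHypersurface

variable {n : ℕ} {M : Type*} [TopologicalSpace M] [ChartedSpace (EuclideanSpace ℝ (Fin n)) M]
  [IsManifold (𝓡 n) ∞ M]
  (H : OrientedHypersurface n M) (P : LightConeModel (n + 1)) (lam : M → ℝ)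

theorem exists_tangent_add_normal (x : M) (y : EuclideanSpace ℝ (Fin (n + 1))) :
    ∃ (v : TangentSpace (𝓡 n) x) (c : ℝ), y = mvfderiv (𝓡 n) H.f x v + c • H.N x := by
  let T : (TangentSpace (𝓡 n) x × ℝ) →ₗ[ℝ] EuclideanSpace ℝ (Fin (n + 1)) :=
    (mvfderiv (𝓡 n) H.f x).toLinearMap ∘ₗ LinearMap.fst ℝ _ _ +
      (LinearMap.toSpanSingleton ℝ _ (H.N x)) ∘ₗ LinearMap.snd ℝ _ _
  have hT : ∀ p, T p = mvfderiv (𝓡 n) H.f x p.1 + p.2 • H.N x := fun p => rfl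
  have hinj : Function.Injective T := by
    rw [injective_iff_map_eq_zero]
    rintro ⟨v, c⟩ hp
    rw [hT] at hp
    have e1 : inner ℝ (mvfderiv (𝓡 n) H.f x v + c • H.N x) (H.N x) = 0 := by
      rw [hp, inner_zero_left]
    rw [inner_add_left, H.normal, real_inner_smul_left, real_inner_self_eq_norm_sq, H.unit] at e1
    have hc : c = 0 := by linarith
    have hv : v = 0 := by
      apply H.immersion x
      rw [map_zero]
      simpa [hc] using hp
    simp [hc, hv]
  have hsurj : Function.Surjective T := by
    refine (LinearMap.injective_iff_surjective_of_finrank_eq_finrank ?_).1 hinj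
    simp [finrank_tangentSpace]
  obtain ⟨⟨v, c⟩, hp⟩ := hsurj y
  exact ⟨v, c, hp.symm⟩

theorem mdifferentiableAt_f (x : M) : MDifferentiableAt (𝓡 n) 𝓘(ℝ, EuclideanSpace ℝ (Fin (n + 1))) H.f x :=
  (H.smooth_f x).mdifferentiableAt (by simp)

theorem mdifferentiableAt_N (x : M) : MDifferentiableAt (𝓡 n) 𝓘(ℝ, EuclideanSpace ℝ (Fin (n + 1))) H.N x :=
  (H.smooth_N x).mdifferentiableAt (by simp)

/-- Since N has unit length, N_* v is orthogonal to N and therefore tangent. So the left inverse in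
the definition of `shape` really inverts f_* on it. -/
theorem mvfderiv_f_shape (x : M) (v : TangentSpace (𝓡 n) x) :
    mvfderiv (𝓡 n) H.f x (H.shape x v) = - mvfderiv (𝓡 n) H.N x v := by
  obtain ⟨u, c, hu⟩ := H.exists_tangent_add_normal x (mvfderiv (𝓡 n) H.N x v)
  have h1 : inner ℝ (mvfderiv (𝓡 n) H.N x v) (H.N x) = 0 := by
    have h2 : mvfderiv (𝓡 n) (fun y => (innerSL ℝ (H.N y) (H.N y))) x v = 0 := by
      have : (fun y => (innerSL ℝ (H.N y) (H.N y))) = fun _ => (1 : ℝ) := by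
        funext y
        rw [innerSL_apply_apply, real_inner_self_eq_norm_sq, H.unit]; norm_num
      rw [this, mvfderiv_const]; rfl
    rw [mvfderiv_bilin (innerSL ℝ) (H.mdifferentiableAt_N x) (H.mdifferentiableAt_N x)] at h2
    change inner ℝ (mvfderiv (𝓡 n) H.N x v) (H.N x)
      + inner ℝ (H.N x) (mvfderiv (𝓡 n) H.N x v) = 0 at h2
    rw [real_inner_comm (mvfderiv (𝓡 n) H.N x v) (H.N x)] at h2
    linarith
  have hc : c = 0 := by
    rw [hu, inner_add_left, H.normal, real_inner_smul_left, real_inner_self_eq_norm_sq, H.unit] at h1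
    linarith
  rw [hc, zero_smul, add_zero] at hu
  have h3 : H.shape x v = - u := by
    have h4 : (mvfderiv (𝓡 n) H.f x).toLinearMap.leftInverse (mvfderiv (𝓡 n) H.N x v) = u := by
      rw [hu]
      exact LinearMap.leftInverse_apply_of_inj (LinearMap.ker_eq_bot.2 (H.immersion x)) u
    simpa [shape] using h4
  rw [h3, map_neg, hu]

/-- The composition of the immersion with the light-cone embedding. -/
noncomputable def lc (x : M) : Minkowski (n + 2) := P.Psi (H.f x)

/-- The image of the normal vector field under the light-cone embedding. -/
noncomputable def xi (x : M) : Minkowski (n + 2) := P.dPsi (H.f x) (H.N x)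

theorem smooth_lc : ContMDiff (𝓡 n) 𝓘(ℝ, Minkowski (n + 2)) ∞ (H.lc P) :=
  P.contDiff_Psi.contMDiff.comp H.smooth_f

theorem smooth_xi : ContMDiff (𝓡 n) 𝓘(ℝ, Minkowski (n + 2)) ∞ (H.xi P) := by
  have h1 : ContMDiff (𝓡 n) 𝓘(ℝ, Minkowski (n + 2)) ∞ (fun x => P.C (H.N x)) :=
    (P.C.toContinuousLinearMap.contDiff (n := ∞)).contMDiff.comp H.smooth_N
  have h2 : ContMDiff (𝓡 n) 𝓘(ℝ, ℝ) ∞ (fun x => innerSL ℝ (H.f x) (H.N x)) :=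
    ((innerSL ℝ (E := EuclideanSpace ℝ (Fin (n + 1)))).contDiff.contMDiff.comp H.smooth_f).clm_apply
      H.smooth_N
  exact h1.sub (h2.smul contMDiff_const)

theorem mvfderiv_lc (x : M) (v : TangentSpace (𝓡 n) x) :
    mvfderiv (𝓡 n) (H.lc P) x v = P.dPsi (H.f x) (mvfderiv (𝓡 n) H.f x v) := by
  rw [← P.fderiv_Psi]
  exact mvfderiv_comp_fderiv (P.hasFDerivAt_Psi _).differentiableAt (H.mdifferentiableAt_f x) v

/-- In the derivative of C N - ⟨f, N⟩ w the term ⟨f_* v, N⟩ vanishes, and what is left is Ψ_* of N_*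
v. So the Weingarten formula passes to the light cone without correction. -/
theorem mvfderiv_xi (x : M) (v : TangentSpace (𝓡 n) x) :
    mvfderiv (𝓡 n) (H.xi P) x v = - mvfderiv (𝓡 n) (H.lc P) x (H.shape x v) := by
  have h1 : ContMDiff (𝓡 n) 𝓘(ℝ, Minkowski (n + 2)) ∞ (fun x => P.C (H.N x)) :=
    (P.C.toContinuousLinearMap.contDiff (n := ∞)).contMDiff.comp H.smooth_N
  have h2 : ContMDiff (𝓡 n) 𝓘(ℝ, ℝ) ∞ (fun x => innerSL ℝ (H.f x) (H.N x)) :=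
    ((innerSL ℝ (E := EuclideanSpace ℝ (Fin (n + 1)))).contDiff.contMDiff.comp H.smooth_f).clm_apply
      H.smooth_N
  have h3 : mvfderiv (𝓡 n) (H.xi P) x v
      = mvfderiv (𝓡 n) (fun x => P.C (H.N x)) x v
        - mvfderiv (𝓡 n) (fun x => innerSL ℝ (H.f x) (H.N x) • P.w) x v := by
    have := mvfderiv_fun_sub (I := 𝓡 n) ((h1 x).mdifferentiableAt (by simp))
      (((h2.smul (contMDiff_const (c := P.w))) x).mdifferentiableAt (by simp))
    exact congrArg (fun L => L v) this
  rw [h3, mvfderiv_smul_vec ((h2 x).mdifferentiableAt (by simp)) mdifferentiableAt_const,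
    mvfderiv_bilin (innerSL ℝ) (H.mdifferentiableAt_f x) (H.mdifferentiableAt_N x)]
  have h4 : mvfderiv (𝓡 n) (fun x => P.C (H.N x)) x v = P.C (mvfderiv (𝓡 n) H.N x v) := by
    have := mvfderiv_comp_fderiv (φ := P.C.toContinuousLinearMap)
      P.C.toContinuousLinearMap.differentiableAt (H.mdifferentiableAt_N x) v
    rw [ContinuousLinearMap.fderiv] at this
    exact this
  rw [h4, mvfderiv_const, H.mvfderiv_lc, H.mvfderiv_f_shape, P.dPsi_apply]
  change P.C (mvfderiv (𝓡 n) H.N x v) - (inner ℝ (H.f x) (H.N x) • 0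
    + (inner ℝ (mvfderiv (𝓡 n) H.f x v) (H.N x) + inner ℝ (H.f x) (mvfderiv (𝓡 n) H.N x v)) • P.w)
    = _
  rw [H.normal, map_neg, inner_neg_right, smul_zero, zero_add, zero_add, neg_smul]
  abel

/-! The table of products of the moving frame. -/

theorem lorentz_lc_lc (x : M) : lorentz (H.lc P x) (H.lc P x) = 0 := by
  rw [lc, P.lorentz_Psi_Psi]; simp

theorem lorentz_lc_w (x : M) : lorentz (H.lc P x) P.w = 1 := P.lorentz_Psi_w _

theorem lorentz_xi_xi (x : M) : lorentz (H.xi P x) (H.xi P x) = 1 := by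
  rw [xi, P.lorentz_dPsi_dPsi, real_inner_self_eq_norm_sq, H.unit]; norm_num

theorem lorentz_xi_lc (x : M) : lorentz (H.xi P x) (H.lc P x) = 0 := P.lorentz_dPsi_Psi _ _

theorem lorentz_xi_w (x : M) : lorentz (H.xi P x) P.w = 0 := P.lorentz_dPsi_w _ _

theorem lorentz_dlc_lc (x : M) (v) : lorentz (mvfderiv (𝓡 n) (H.lc P) x v) (H.lc P x) = 0 := by
  rw [mvfderiv_lc]; exact P.lorentz_dPsi_Psi _ _

theorem lorentz_dlc_w (x : M) (v) : lorentz (mvfderiv (𝓡 n) (H.lc P) x v) P.w = 0 := by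
  rw [mvfderiv_lc]; exact P.lorentz_dPsi_w _ _

theorem lorentz_dlc_xi (x : M) (v) : lorentz (mvfderiv (𝓡 n) (H.lc P) x v) (H.xi P x) = 0 := by
  rw [mvfderiv_lc, xi, P.lorentz_dPsi_dPsi, H.normal]

theorem metric_eq_lorentz (x : M) (v u) :
    H.metric x v u
      = lorentz (mvfderiv (𝓡 n) (H.lc P) x v) (mvfderiv (𝓡 n) (H.lc P) x u) := by
  rw [mvfderiv_lc, mvfderiv_lc, P.lorentz_dPsi_dPsi]; rfl

/-- The tangent space and N together span ℝ^{n+1}, so the orthogonality test for F, w and Ψ_*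
applies. -/
theorem eq_zero_of_orthogonal_frame {z : Minkowski (n + 2)} (x : M)
    (h0 : lorentz z (H.lc P x) = 0) (hw : lorentz z P.w = 0) (hx : lorentz z (H.xi P x) = 0)
    (ht : ∀ v, lorentz z (mvfderiv (𝓡 n) (H.lc P) x v) = 0) : z = 0 := by
  refine P.eq_zero_of_orthogonal_dPsi (H.f x) h0 hw fun y => ?_
  obtain ⟨v, c, rfl⟩ := H.exists_tangent_add_normal x y
  rw [map_add, map_smul, lorentz_add_right, lorentz_smul_right, ← H.mvfderiv_lc, ht]
  change 0 + c * lorentz z (H.xi P x) = 0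
  rw [hx]; ring

theorem metric_comm (x : M) (v u) : H.metric x v u = H.metric x u v := real_inner_comm _ _

theorem metric_add_left (x : M) (v u t) :
    H.metric x (v + u) t = H.metric x v t + H.metric x u t := by
  simp [metric, inner_add_left]

theorem metric_add_right (x : M) (v u t) :
    H.metric x t (v + u) = H.metric x t v + H.metric x t u := by
  simp [metric, inner_add_right]

theorem metric_sub_left (x : M) (v u t) :
    H.metric x (v - u) t = H.metric x v t - H.metric x u t := by
  simp [metric, inner_sub_left]

theorem metric_sub_right (x : M) (v u t) :
    H.metric x t (v - u) = H.metric x t v - H.metric x t u := by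
  simp [metric, inner_sub_right]

theorem metric_smul_left (x : M) (c : ℝ) (v u) : H.metric x (c • v) u = c * H.metric x v u := by
  simp [metric, real_inner_smul_left]

theorem metric_smul_right (x : M) (c : ℝ) (v u) : H.metric x v (c • u) = c * H.metric x v u := by
  simp [metric, real_inner_smul_right]

theorem eq_zero_of_metric_self {x : M} {v : TangentSpace (𝓡 n) x} (h : H.metric x v v = 0) :
    v = 0 := by
  apply H.immersion x
  rw [map_zero]
  exact inner_self_eq_zero (𝕜 := ℝ).1 h

theorem eq_zero_of_metric {x : M} {v : TangentSpace (𝓡 n) x} (h : ∀ u, H.metric x v u = 0) :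
    v = 0 := H.eq_zero_of_metric_self (h v)

theorem lc_injective (x : M) : Function.Injective (mvfderiv (𝓡 n) (H.lc P) x) := by
  rw [injective_iff_map_eq_zero]
  intro v hv
  apply H.eq_zero_of_metric_self
  rw [H.metric_eq_lorentz P, hv, lorentz_zero_left]

end OrientedHypersurface

theorem mvfderiv_lorentz {m k : ℕ} {M : Type*} [TopologicalSpace M]
    [ChartedSpace (EuclideanSpace ℝ (Fin m)) M] {h l : M → Minkowski k} {x : M}
    [IsManifold (𝓡 m) ∞ M]
    (hh : ContMDiffAt (𝓡 m) 𝓘(ℝ, Minkowski k) ∞ h x)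
    (hl : ContMDiffAt (𝓡 m) 𝓘(ℝ, Minkowski k) ∞ l x) (v : TangentSpace (𝓡 m) x) :
    mvfderiv (𝓡 m) (fun y => lorentz (h y) (l y)) x v
      = lorentz (mvfderiv (𝓡 m) h x v) (l x) + lorentz (h x) (mvfderiv (𝓡 m) l x v) :=
  mvfderiv_bilin (lorentzL k) (hh.mdifferentiableAt (by simp)) (hl.mdifferentiableAt (by simp)) v

theorem lorentz_mvfderiv_of_eventually_const {m k : ℕ} {M : Type*} [TopologicalSpace M]
    [ChartedSpace (EuclideanSpace ℝ (Fin m)) M] {h l : M → Minkowski k} {x : M}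
    [IsManifold (𝓡 m) ∞ M]
    (hh : ContMDiffAt (𝓡 m) 𝓘(ℝ, Minkowski k) ∞ h x)
    (hl : ContMDiffAt (𝓡 m) 𝓘(ℝ, Minkowski k) ∞ l x) {c : ℝ}
    (hc : ∀ᶠ y in 𝓝 x, lorentz (h y) (l y) = c) (v : TangentSpace (𝓡 m) x) :
    lorentz (mvfderiv (𝓡 m) h x v) (l x) = - lorentz (h x) (mvfderiv (𝓡 m) l x v) := by
  have h1 := mvfderiv_lorentz hh hl v
  have h2 : (fun y => lorentz (h y) (l y)) =ᶠ[𝓝 x] fun _ => c := hc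
  rw [mvfderiv_congr h2, mvfderiv_const] at h1
  have h3 : (0 : ℝ) = lorentz (mvfderiv (𝓡 m) h x v) (l x)
    + lorentz (h x) (mvfderiv (𝓡 m) l x v) := h1
  linarith

theorem lorentz_mvfderiv_of_const {m k : ℕ} {M : Type*} [TopologicalSpace M]
    [ChartedSpace (EuclideanSpace ℝ (Fin m)) M] {h l : M → Minkowski k} {x : M}
    [IsManifold (𝓡 m) ∞ M]
    (hh : ContMDiff (𝓡 m) 𝓘(ℝ, Minkowski k) ∞ h)
    (hl : ContMDiff (𝓡 m) 𝓘(ℝ, Minkowski k) ∞ l) {c : ℝ}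
    (hc : ∀ y, lorentz (h y) (l y) = c) (v : TangentSpace (𝓡 m) x) :
    lorentz (mvfderiv (𝓡 m) h x v) (l x) = - lorentz (h x) (mvfderiv (𝓡 m) l x v) :=
  lorentz_mvfderiv_of_eventually_const (hh x) (hl x) (Eventually.of_forall hc) v

/-! ### The Gauss formula and the splitting TM = Δ^⊥ ⊕ Δ -/

namespace OrientedHypersurface

variable {n : ℕ} {M : Type*} [TopologicalSpace M] [T2Space M]
  [ChartedSpace (EuclideanSpace ℝ (Fin n)) M] [IsManifold (𝓡 n) ∞ M]
  (H : OrientedHypersurface n M) (P : LightConeModel (n + 1)) (lam : M → ℝ)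

/-- The Gauss formula of the light-cone representative. -/
theorem gauss {Y : Π x : M, TangentSpace (𝓡 n) x} (hY : SmoothField Y) (x : M)
    (v : TangentSpace (𝓡 n) x) :
    mvfderiv (𝓡 n) (dirDeriv Y (H.lc P)) x v
      = mvfderiv (𝓡 n) (H.lc P) x (leviCivita H.metric Y x v)
        + H.metric x (H.shape x v) (Y x) • H.xi P x - H.metric x v (Y x) • P.w := by
  have hF := H.smooth_lc P
  have hFY := hF.dirDeriv hY
  have hξ := H.smooth_xi P
  -- A vector is determined by its products with F, ξ, w and F_*TM. The first three come from
  -- differentiating the constant products of F_*Y. As ⟨F, w⟩ = 1, the product with F is responsible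
  -- for the w-term.
  have e1 := lorentz_mvfderiv_of_const hFY hF (c := 0) (fun y => H.lorentz_dlc_lc P y (Y y)) v
  have e2 := lorentz_mvfderiv_of_const hFY hξ (c := 0) (fun y => H.lorentz_dlc_xi P y (Y y)) v
  have e3 := lorentz_mvfderiv_of_const hFY (contMDiff_const (c := P.w)) (c := 0)
    (fun y => H.lorentz_dlc_w P y (Y y)) v
  have e4 := leviCivita_induced (lorentzL (n + 2)) lorentz_comm hF
    (H.metric_eq_lorentz P) (x := x) (fun _ => H.eq_zero_of_metric) hY v
  rw [mvfderiv_const] at e3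
  have e3' : lorentz (mvfderiv (𝓡 n) (dirDeriv Y (H.lc P)) x v) P.w = 0 := by
    rw [e3]
    change -lorentz _ (0 : Minkowski (n + 2)) = 0
    rw [lorentz_zero_right, neg_zero]
  rw [H.mvfderiv_xi, lorentz_neg_right] at e2
  simp only [lorentzL_apply] at e4
  have hY' : dirDeriv Y (H.lc P) x = mvfderiv (𝓡 n) (H.lc P) x (Y x) := rfl
  rw [hY', ← H.metric_eq_lorentz] at e1 e2
  have hww : lorentz P.w P.w = 0 := P.w_null
  have hwF : lorentz P.w (H.lc P x) = 1 := by rw [lorentz_comm]; exact H.lorentz_lc_w P x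
  have hwξ : lorentz P.w (H.xi P x) = 0 := by rw [lorentz_comm]; exact H.lorentz_xi_w P x
  have hwd : ∀ u, lorentz P.w (mvfderiv (𝓡 n) (H.lc P) x u) = 0 := fun u => by
    rw [lorentz_comm]; exact H.lorentz_dlc_w P x u
  have hξd : ∀ u, lorentz (H.xi P x) (mvfderiv (𝓡 n) (H.lc P) x u) = 0 := fun u => by
    rw [lorentz_comm]; exact H.lorentz_dlc_xi P x u
  rw [← sub_eq_zero]
  refine H.eq_zero_of_orthogonal_frame P x ?_ ?_ ?_ fun u => ?_
  · simp only [lorentz_sub_left, lorentz_add_left, lorentz_smul_left, e1, H.lorentz_dlc_lc,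
      H.lorentz_xi_lc, hwF, H.metric_comm x v]
    ring
  · simp only [lorentz_sub_left, lorentz_add_left, lorentz_smul_left, e3', H.lorentz_dlc_w,
      H.lorentz_xi_w, hww]
    ring
  · simp only [lorentz_sub_left, lorentz_add_left, lorentz_smul_left, e2, H.lorentz_dlc_xi,
      H.lorentz_xi_xi, hwξ, H.metric_comm x (H.shape x v)]
    ring
  · simp only [lorentz_sub_left, lorentz_add_left, lorentz_smul_left, e4, hξd, hwd]
    ring

/-- The ξ-components of X(Y(F)) and Y(X(F)) agree because their difference [X,Y](F) is tangent. -/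
theorem metric_shape (P : LightConeModel (n + 1)) (x : M) (v u) : H.metric x (H.shape x v) u = H.metric x v (H.shape x u) := by
  obtain ⟨X, hX, rfl⟩ := exists_smoothField_apply x v
  obtain ⟨Y, hY, rfl⟩ := exists_smoothField_apply x u
  have e1 := congrArg (fun z => lorentz z (H.xi P x)) (H.gauss P hY x (X x))
  have e2 := congrArg (fun z => lorentz z (H.xi P x)) (H.gauss P hX x (Y x))
  have e3 := congrArg (fun z => lorentz z (H.xi P x))
    (mvfderiv_mlieBracket (H.smooth_lc P x) (hX.at x) (hY.at x))
  have hwξ : lorentz P.w (H.xi P x) = 0 := by rw [lorentz_comm]; exact H.lorentz_xi_w P x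
  simp only [dirDeriv, lorentz_sub_left, lorentz_add_left, lorentz_smul_left, H.lorentz_dlc_xi,
    H.lorentz_xi_xi, hwξ] at e1 e2 e3
  rw [e1, e2] at e3
  rw [H.metric_comm x (X x)]
  linarith

/-- Once A is symmetric, the ξ- and w-terms of the Gauss formula drop out under antisymmetrisation.
-/
theorem leviCivita_sub (P : LightConeModel (n + 1)) {X Y : Π x : M, TangentSpace (𝓡 n) x}
    (hX : SmoothField X) (hY : SmoothField Y) (x : M) :
    leviCivita H.metric Y x (X x) - leviCivita H.metric X x (Y x)
      = VectorField.mlieBracket (𝓡 n) X Y x := by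
  apply H.lc_injective P x
  rw [mvfderiv_mlieBracket (H.smooth_lc P x) (hX.at x) (hY.at x), map_sub]
  have e1 := H.gauss P hY x (X x)
  have e2 := H.gauss P hX x (Y x)
  rw [H.metric_shape P x (Y x) (X x), H.metric_comm x (Y x) (H.shape x (X x)),
    H.metric_comm x (Y x) (X x)] at e2
  simp only [dirDeriv] at e1 e2 ⊢
  rw [e1, e2]
  abel

theorem metric_shapeSub (P : LightConeModel (n + 1)) (lam : M → ℝ) (x : M) (v u) :
    H.metric x (H.shapeSub lam x v) u = H.metric x v (H.shapeSub lam x u) := by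
  simp only [shapeSub, LinearMap.sub_apply, LinearMap.smul_apply, LinearMap.id_apply,
    metric_sub_left, metric_sub_right, metric_smul_left, metric_smul_right, H.metric_shape P]

theorem mem_Δ {x : M} {v : TangentSpace (𝓡 n) x} : v ∈ H.Δ lam x ↔ H.shapeSub lam x v = 0 :=
  LinearMap.mem_ker

theorem shapeSub_mem_hor (P : LightConeModel (n + 1)) (lam : M → ℝ) (x : M) (v) : H.shapeSub lam x v ∈ H.hor lam x := by
  intro t ht
  rw [H.metric_shapeSub P, (H.mem_Δ lam).1 ht]
  simp [metric]

theorem disjoint_hor_Δ (x : M) : Disjoint (H.hor lam x) (H.Δ lam x) := by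
  rw [Submodule.disjoint_def]
  intro v hv ht
  exact H.eq_zero_of_metric_self (hv v ht)

/-- The orthogonal decomposition with respect to f_*Δ is taken in Euclidean space and pulled back.
As a consequence the default value 0 in `horProj` never occurs. -/
theorem isCompl_hor (x : M) : IsCompl (H.hor lam x) (H.Δ lam x) := by
  refine ⟨H.disjoint_hor_Δ lam x, ?_⟩
  rw [codisjoint_iff, eq_top_iff]
  intro v _
  let K := (H.Δ lam x).map (mvfderiv (𝓡 n) H.f x).toLinearMap
  obtain ⟨p, hp, q, hq, hpq⟩ := K.exists_add_mem_mem_orthogonal (mvfderiv (𝓡 n) H.f x v)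
  obtain ⟨t, ht, rfl⟩ := hp
  refine Submodule.mem_sup.2 ⟨v - t, ?_, t, ht, sub_add_cancel _ _⟩
  intro u hu
  have h1 : mvfderiv (𝓡 n) H.f x (v - t) = q := by
    rw [map_sub, hpq]
    exact add_sub_cancel_left _ _
  have h2 := hq (mvfderiv (𝓡 n) H.f x u) ⟨u, hu, rfl⟩
  rw [metric, h1, real_inner_comm]
  exact h2

theorem horProj_of_mem {x : M} (v : H.hor lam x) : H.horProj lam x v = v := by
  rw [horProj, dif_pos (H.isCompl_hor lam x)]
  exact Submodule.projectionOnto_apply_left _ v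

theorem horProj_of_mem_Δ {x : M} {v : TangentSpace (𝓡 n) x} (hv : v ∈ H.Δ lam x) :
    H.horProj lam x v = 0 := by
  rw [horProj, dif_pos (H.isCompl_hor lam x)]
  exact Submodule.projectionOnto_apply_of_mem_right _ hv

theorem sub_horProj_mem (x : M) (v : TangentSpace (𝓡 n) x) :
    v - H.horProj lam x v ∈ H.Δ lam x := by
  obtain ⟨a, ha, t, ht, rfl⟩ := Submodule.mem_sup.1
    ((H.isCompl_hor lam x).sup_eq_top ▸ Submodule.mem_top : v ∈ H.hor lam x ⊔ H.Δ lam x)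
  rw [map_add, H.horProj_of_mem lam ⟨a, ha⟩, H.horProj_of_mem_Δ lam ht]
  simpa using ht

theorem metric_horProj (x : M) {v u : TangentSpace (𝓡 n) x} (hv : v ∈ H.hor lam x) :
    H.metric x v (H.horProj lam x u) = H.metric x v u := by
  have := hv _ (H.sub_horProj_mem lam x u)
  rw [metric_sub_right] at this
  linarith

theorem extend_apply_of_mem (D : Π x : M, H.hor lam x →ₗ[ℝ] H.hor lam x) {x : M}
    (v : H.hor lam x) : H.extend lam D x v = D x v := by
  simp [extend, H.horProj_of_mem]

theorem extend_apply (D : Π x : M, H.hor lam x →ₗ[ℝ] H.hor lam x) {x : M}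
    (v : TangentSpace (𝓡 n) x) : H.extend lam D x v = D x (H.horProj lam x v) := rfl

theorem extend_mem (D : Π x : M, H.hor lam x →ₗ[ℝ] H.hor lam x) {x : M}
    (v : TangentSpace (𝓡 n) x) : H.extend lam D x v ∈ H.hor lam x := (D x _).2

end OrientedHypersurface

/-! ### First order geometry of the congruence, horizontal lifts -/

namespace OrientedHypersurface.Envelops

variable {n : ℕ} {M : Type*} [TopologicalSpace M] [T2Space M]
  [ChartedSpace (EuclideanSpace ℝ (Fin n)) M] [IsManifold (𝓡 n) ∞ M]
  {L : Type*} [TopologicalSpace L] [T2Space L]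
  [ChartedSpace (EuclideanSpace ℝ (Fin 2)) L] [IsManifold (𝓡 2) ∞ L]
  {H : OrientedHypersurface n M} {lam : M → ℝ}
  {P : LightConeModel (n + 1)} {π : M → L} {s : L → Minkowski (n + 2)}
  (hs : H.Envelops lam P π s)
include hs

theorem smooth_surf : ContMDiff (𝓡 2) 𝓘(ℝ, Minkowski (n + 2)) ∞ s := hs.smooth_s

theorem smooth_comp : ContMDiff (𝓡 n) 𝓘(ℝ, Minkowski (n + 2)) ∞ (fun x => s (π x)) :=
  hs.smooth_surf.comp hs.smooth_π

theorem comp_eq (x : M) : s (π x) = H.xi P x + lam x • H.lc P x := by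
  rw [hs.envelope x, P.fderiv_Psi]
  rfl

theorem surjective : Function.Surjective π := fun y => (hs.connected_fibre y).nonempty

theorem mvfderiv_comp (x : M) (v : TangentSpace (𝓡 n) x) :
    mvfderiv (𝓡 n) (fun x => s (π x)) x v
      = mvfderiv (𝓡 2) s (π x) (mfderiv (𝓡 n) (𝓡 2) π x v) :=
  mvfderiv_comp_vec ((hs.smooth_surf (π x)).mdifferentiableAt (by simp))
    ((hs.smooth_π x).mdifferentiableAt (by simp)) v

/-- Differentiate ξ + λF with ξ_* v = -F_* A v. The first order geometry of s on M is read off from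
this formula. -/
theorem mvfderiv_eq (x : M) (v : TangentSpace (𝓡 n) x) :
    mvfderiv (𝓡 n) (fun x => s (π x)) x v
      = -mvfderiv (𝓡 n) (H.lc P) x (H.shapeSub lam x v)
        + mvfderiv (𝓡 n) lam x v • H.lc P x := by
  have h1 : (fun x => s (π x)) = fun x => H.xi P x + lam x • H.lc P x := funext hs.comp_eq
  have hF := (H.smooth_lc P x).mdifferentiableAt (n := ∞) (by simp)
  have hl := (hs.smooth_lam x).mdifferentiableAt (n := ∞) (by simp)
  have hξ := (H.smooth_xi P x).mdifferentiableAt (n := ∞) (by simp)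
  have h2 : mvfderiv (𝓡 n) (fun x => H.xi P x + lam x • H.lc P x) x v
      = mvfderiv (𝓡 n) (H.xi P) x v + mvfderiv (𝓡 n) (fun x => lam x • H.lc P x) x v := by
    have h3 : MDifferentiableAt (𝓡 n) 𝓘(ℝ, Minkowski (n + 2)) (fun x => lam x • H.lc P x) x :=
      hl.smul hF
    rw [mvfderiv_fun_add hξ h3]
    rfl
  rw [h1, h2, H.mvfderiv_xi, mvfderiv_smul_vec hl hF]
  simp only [shapeSub, LinearMap.sub_apply, LinearMap.smul_apply, LinearMap.id_apply, map_sub,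
    map_smul]
  module

theorem mfderiv_eq_zero_iff {x : M} {v : TangentSpace (𝓡 n) x} :
    mfderiv (𝓡 n) (𝓡 2) π x v = 0 ↔ v ∈ H.Δ lam x := by
  rw [← hs.ker_dπ x]; rfl

/-- The dλ-terms do not contribute, because F is light-like and orthogonal to F_*TM. -/
theorem lorentz_mvfderiv_mvfderiv (x : M) (v u : TangentSpace (𝓡 n) x) :
    lorentz (mvfderiv (𝓡 n) (fun x => s (π x)) x v) (mvfderiv (𝓡 n) (fun x => s (π x)) x u)
      = H.metric x (H.shapeSub lam x v) (H.shapeSub lam x u) := by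
  have h := lorentz_comm (H.lc P x) (mvfderiv (𝓡 n) (H.lc P) x (H.shapeSub lam x u))
  simp only [hs.mvfderiv_eq, lorentz_add_left, lorentz_add_right, lorentz_neg_left,
    lorentz_neg_right, lorentz_smul_left, lorentz_smul_right, H.lorentz_dlc_lc, H.lorentz_lc_lc, h,
    H.metric_eq_lorentz P]
  ring

theorem lorentz_mvfderiv_dlc (x : M) (v u : TangentSpace (𝓡 n) x) :
    lorentz (mvfderiv (𝓡 n) (fun x => s (π x)) x v) (mvfderiv (𝓡 n) (H.lc P) x u)
      = -H.metric x (H.shapeSub lam x v) u := by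
  have h := lorentz_comm (H.lc P x) (mvfderiv (𝓡 n) (H.lc P) x u)
  simp only [hs.mvfderiv_eq, lorentz_add_left, lorentz_neg_left,
    lorentz_smul_left, H.lorentz_dlc_lc, h,
    H.metric_eq_lorentz P]
  ring

theorem lorentz_mvfderiv_lc (x : M) (v : TangentSpace (𝓡 n) x) :
    lorentz (mvfderiv (𝓡 n) (fun x => s (π x)) x v) (H.lc P x) = 0 := by
  simp only [hs.mvfderiv_eq, lorentz_add_left, lorentz_neg_left,
    lorentz_smul_left, H.lorentz_dlc_lc, H.lorentz_lc_lc]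
  ring

theorem lorentz_comp_lc (x : M) : lorentz (s (π x)) (H.lc P x) = 0 := by
  simp only [hs.comp_eq, lorentz_add_left, lorentz_smul_left, H.lorentz_xi_lc, H.lorentz_lc_lc]
  ring

theorem lorentz_comp_dlc (x : M) (v : TangentSpace (𝓡 n) x) :
    lorentz (s (π x)) (mvfderiv (𝓡 n) (H.lc P) x v) = 0 := by
  rw [lorentz_comm]
  simp only [hs.comp_eq, lorentz_add_right, lorentz_smul_right, H.lorentz_dlc_xi, H.lorentz_dlc_lc]
  ring

theorem lorentz_surf (y : L) : lorentz (s y) (s y) = 1 := hs.mem_deSitter y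

theorem lorentz_dsurf_surf (y : L) (v : TangentSpace (𝓡 2) y) :
    lorentz (mvfderiv (𝓡 2) s y v) (s y) = 0 := by
  have h1 := lorentz_mvfderiv_of_const hs.smooth_surf hs.smooth_surf (c := 1) hs.lorentz_surf v
  have h2 := lorentz_comm (s y) (mvfderiv (𝓡 2) s y v)
  linarith

theorem surfMetric_mfderiv (x : M) (v u : TangentSpace (𝓡 n) x) :
    surfMetric s (π x) (mfderiv (𝓡 n) (𝓡 2) π x v) (mfderiv (𝓡 n) (𝓡 2) π x u)
      = H.metric x (H.shapeSub lam x v) (H.shapeSub lam x u) := by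
  rw [surfMetric, ← hs.mvfderiv_comp, ← hs.mvfderiv_comp, hs.lorentz_mvfderiv_mvfderiv]

theorem mem_Δ_of_mvfderiv_comp {x : M} {v : TangentSpace (𝓡 n) x}
    (h : mvfderiv (𝓡 n) (fun x => s (π x)) x v = 0) : v ∈ H.Δ lam x := by
  have h1 := hs.lorentz_mvfderiv_mvfderiv x v v
  rw [h, lorentz_zero_left] at h1
  exact (H.mem_Δ lam).2 (H.eq_zero_of_metric_self h1.symm)

theorem eq_zero_of_surfMetric_self {y : L} {v : TangentSpace (𝓡 2) y}
    (h : surfMetric s y v v = 0) : v = 0 := by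
  obtain ⟨x, rfl⟩ := hs.surjective y
  obtain ⟨u, rfl⟩ := hs.surjective_dπ x v
  rw [hs.surfMetric_mfderiv] at h
  exact hs.mfderiv_eq_zero_iff.2 ((H.mem_Δ lam).2 (H.eq_zero_of_metric_self h))

theorem injective_mvfderiv (y : L) : Function.Injective (mvfderiv (𝓡 2) s y) := by
  rw [injective_iff_map_eq_zero]
  intro v hv
  apply hs.eq_zero_of_surfMetric_self
  rw [surfMetric, hv, lorentz_zero_left]

/-- Horizontal vectors with the same image under `π` are equal. -/
theorem eq_of_mfderiv_eq {x : M} {v u : TangentSpace (𝓡 n) x} (hv : v ∈ H.hor lam x)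
    (hu : u ∈ H.hor lam x)
    (h : mfderiv (𝓡 n) (𝓡 2) π x v = mfderiv (𝓡 n) (𝓡 2) π x u) : v = u := by
  have h1 : v - u ∈ H.Δ lam x := by
    rw [← hs.mfderiv_eq_zero_iff, map_sub, h, sub_self]
  exact sub_eq_zero.1
    ((Submodule.disjoint_def.1 (H.disjoint_hor_Δ lam x)) _ (Submodule.sub_mem _ hv hu) h1)

theorem mfderiv_horProj (x : M) (v : TangentSpace (𝓡 n) x) :
    mfderiv (𝓡 n) (𝓡 2) π x (H.horProj lam x v) = mfderiv (𝓡 n) (𝓡 2) π x v := by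
  have := hs.mfderiv_eq_zero_iff.2 (H.sub_horProj_mem lam x v)
  rw [map_sub, sub_eq_zero] at this
  exact this.symm

theorem finrank_hor (x : M) : Module.finrank ℝ (H.hor lam x) = 2 := by
  have h1 := Submodule.finrank_add_eq_of_isCompl (H.isCompl_hor lam x)
  have h2 := hs.multiplicity x
  rw [finrank_tangentSpace] at h1
  omega

/-- The isomorphism of `Δ^⊥` onto the tangent space of `L` induced by `π`. -/
noncomputable def horEquiv (x : M) : H.hor lam x ≃ₗ[ℝ] TangentSpace (𝓡 2) (π x) :=
  LinearEquiv.ofBijective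
    ((mfderiv (𝓡 n) (𝓡 2) π x).toLinearMap ∘ₗ (H.hor lam x).subtype)
    ⟨fun v u h => Subtype.ext (hs.eq_of_mfderiv_eq v.2 u.2 h), fun w => by
      obtain ⟨v, rfl⟩ := hs.surjective_dπ x w
      exact ⟨H.horProj lam x v, hs.mfderiv_horProj x v⟩⟩

theorem horEquiv_apply {x : M} (v : H.hor lam x) :
    hs.horEquiv x v = mfderiv (𝓡 n) (𝓡 2) π x v := rfl

theorem mfderiv_horEquiv_symm {x : M} (v : TangentSpace (𝓡 2) (π x)) :
    mfderiv (𝓡 n) (𝓡 2) π x ((hs.horEquiv x).symm v) = v :=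
  (hs.horEquiv x).apply_symm_apply v

/-- Replaces the left inverse in the definition of `lift` by the inverse of an isomorphism, so that
a lift is a conjugate of the given tensor and inherits its algebraic properties. -/
theorem lift_eq (D' : Π y : L, TangentSpace (𝓡 2) y →ₗ[ℝ] TangentSpace (𝓡 2) y) (x : M) :
    H.lift lam π D' x = (hs.horEquiv x).symm.toLinearMap ∘ₗ D' (π x) ∘ₗ
      (hs.horEquiv x).toLinearMap := by
  have h1 : ((mfderiv (𝓡 n) (𝓡 2) π x).toLinearMap ∘ₗ (H.hor lam x).subtype).leftInverse
      = (hs.horEquiv x).symm.toLinearMap := by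
    apply LinearMap.ext
    intro v
    obtain ⟨u, rfl⟩ := (hs.horEquiv x).surjective v
    have h2 := LinearMap.leftInverse_comp_of_inj
      (f := (mfderiv (𝓡 n) (𝓡 2) π x).toLinearMap ∘ₗ (H.hor lam x).subtype)
      (LinearMap.ker_eq_bot.2 (hs.horEquiv x).injective)
    refine (LinearMap.congr_fun h2 u).trans ?_
    exact ((hs.horEquiv x).symm_apply_apply u).symm
  rw [lift, h1]
  rfl

theorem mfderiv_lift (D' : Π y : L, TangentSpace (𝓡 2) y →ₗ[ℝ] TangentSpace (𝓡 2) y) (x : M)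
    (v : H.hor lam x) : mfderiv (𝓡 n) (𝓡 2) π x (H.lift lam π D' x v)
      = D' (π x) (mfderiv (𝓡 n) (𝓡 2) π x v) := by
  rw [hs.lift_eq]
  exact hs.mfderiv_horEquiv_symm _

theorem mfderiv_extend_lift (D' : Π y : L, TangentSpace (𝓡 2) y →ₗ[ℝ] TangentSpace (𝓡 2) y)
    (x : M) (v : TangentSpace (𝓡 n) x) :
    mfderiv (𝓡 n) (𝓡 2) π x (H.extend lam (H.lift lam π D') x v)
      = D' (π x) (mfderiv (𝓡 n) (𝓡 2) π x v) := by
  rw [H.extend_apply, hs.mfderiv_lift, hs.mfderiv_horProj]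

/-! ### Smooth fields -/

/-- The shape operator is defined pointwise, so smoothness is obtained from F_*(A - λI)X = dλ(X)F -
X(s ∘ π), whose right-hand side is smooth. -/
theorem smoothField_shapeSub {X : Π x : M, TangentSpace (𝓡 n) x} (hX : SmoothField X) :
    SmoothField (fun x => H.shapeSub lam x (X x)) := by
  refine SmoothField.of_mvfderiv (H.smooth_lc P) (H.lc_injective P) ?_
  have h1 : (fun x => mvfderiv (𝓡 n) (H.lc P) x (H.shapeSub lam x (X x)))
      = fun x => dirDeriv X lam x • H.lc P x - dirDeriv X (fun x => s (π x)) x := by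
    funext x
    simp only [dirDeriv]
    rw [hs.mvfderiv_eq]
    abel
  rw [h1]
  exact ((hs.smooth_lam.dirDeriv hX).smul (H.smooth_lc P)).sub (hs.smooth_comp.dirDeriv hX)

theorem injOn_mvfderiv_hor {x : M} {v : TangentSpace (𝓡 n) x} (hv : v ∈ H.hor lam x)
    (h : mvfderiv (𝓡 n) (fun x => s (π x)) x v = 0) : v = 0 :=
  Submodule.disjoint_def.1 (H.disjoint_hor_Δ lam x) _ hv (hs.mem_Δ_of_mvfderiv_comp h)

/-- A - λI takes values in Δ^⊥ and is injective there, so it turns smooth fields extending a basis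
of Δ^⊥ at `x₀` into global smooth sections. Independence is tested after applying s_* π_*, where it
is an open condition in a fixed vector space. -/
theorem exists_hor_frame (x₀ : M) : ∃ E : Fin 2 → Π x : M, TangentSpace (𝓡 n) x,
    (∀ j, H.SectionHor lam (E j)) ∧
    (∀ᶠ x in 𝓝 x₀, LinearIndependent ℝ
      (fun j => mvfderiv (𝓡 n) (fun x => s (π x)) x (E j x))) := by
  let b := (Module.finBasisOfFinrankEq ℝ (H.hor lam x₀) (hs.finrank_hor x₀))
  choose e he heb using fun j => exists_smoothField_apply x₀ (b j : TangentSpace (𝓡 n) x₀)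
  refine ⟨fun j x => H.shapeSub lam x (e j x), fun j => ⟨hs.smoothField_shapeSub (he j),
    fun x => H.shapeSub_mem_hor P lam x _⟩, ?_⟩
  have hcont : ContinuousAt (fun x => fun j : Fin 2 =>
      mvfderiv (𝓡 n) (fun x => s (π x)) x (H.shapeSub lam x (e j x))) x₀ :=
    (continuous_pi fun j =>
      (hs.smooth_comp.dirDeriv (hs.smoothField_shapeSub (he j))).continuous).continuousAt
  refine Tendsto.eventually (p := fun z : Fin 2 → Minkowski (n + 2) => LinearIndependent ℝ z)
    hcont ?_
  apply (isOpen_setOfPred_linearIndependent (𝕜 := ℝ) (E := Minkowski (n + 2))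
    (ι := Fin 2)).mem_nhds
  change LinearIndependent ℝ _
  rw [Fintype.linearIndependent_iff]
  intro g hg
  have h1 : mvfderiv (𝓡 n) (fun x => s (π x)) x₀
      (H.shapeSub lam x₀ ((∑ j, g j • b j : H.hor lam x₀) : TangentSpace (𝓡 n) x₀)) = 0 := by
    rw [← hg]
    simp only [Submodule.coe_sum, Submodule.coe_smul, map_sum, map_smul, ← heb]
  have h2 := hs.injOn_mvfderiv_hor (H.shapeSub_mem_hor P lam x₀ _) h1
  have h3 := Submodule.disjoint_def.1 (H.disjoint_hor_Δ lam x₀) _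
    (∑ j, g j • b j : H.hor lam x₀).2 ((H.mem_Δ lam).2 h2)
  exact Fintype.linearIndependent_iff.1 b.linearIndependent g (Subtype.ext h3)

/-- A pointwise horizontal field is smooth if its image under the differential of the congruence
is. -/
theorem smoothField_of_hor {X : Π x : M, TangentSpace (𝓡 n) x} (hX : ∀ x, X x ∈ H.hor lam x)
    (h : ContMDiff (𝓡 n) 𝓘(ℝ, Minkowski (n + 2)) ∞
      (fun x => mvfderiv (𝓡 n) (fun x => s (π x)) x (X x))) : SmoothField X := by
  intro x₀
  obtain ⟨E, hE, hli⟩ := hs.exists_hor_frame x₀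
  have hspan : ∀ᶠ x in 𝓝 x₀, ∃ c : Fin 2 → ℝ, X x = ∑ j, c j • E j x := by
    filter_upwards [hli] with x hx
    let e : Fin 2 → H.hor lam x := fun j => ⟨E j x, (hE j).2 x⟩
    have h1 : LinearIndependent ℝ e := LinearIndependent.of_comp
      ((mvfderiv (𝓡 n) (fun x => s (π x)) x).toLinearMap ∘ₗ (H.hor lam x).subtype) hx
    have h2 : Submodule.span ℝ (Set.range e) = ⊤ :=
      h1.span_eq_top_of_card_eq_finrank (by rw [hs.finrank_hor]; simp)
    have h3 : (⟨X x, hX x⟩ : H.hor lam x) ∈ Submodule.span ℝ (Set.range e) :=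
      h2 ▸ Submodule.mem_top
    obtain ⟨c, hc⟩ := (Submodule.mem_span_range_iff_exists_fun ℝ).1 h3
    refine ⟨c, ?_⟩
    have := congrArg Subtype.val hc
    refine this.symm.trans ?_
    simp [e]
  classical
  choose! c hc using fun (x : M) (h : ∃ c : Fin 2 → ℝ, X x = ∑ j, c j • E j x) => h
  let Θ : M → (Fin 2 → ℝ) →L[ℝ] Minkowski (n + 2) := fun x =>
    ∑ j, (ContinuousLinearMap.proj (R := ℝ) j : (Fin 2 → ℝ) →L[ℝ] ℝ).smulRight
      (mvfderiv (𝓡 n) (fun x => s (π x)) x (E j x))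
  have hΘa : ∀ x a, Θ x a = ∑ j, a j • mvfderiv (𝓡 n) (fun x => s (π x)) x (E j x) := by
    intro x a
    simp [Θ]
  have hΘ : ContMDiffAt (𝓡 n) 𝓘(ℝ, (Fin 2 → ℝ) →L[ℝ] Minkowski (n + 2)) ∞ Θ x₀ := by
    refine ContMDiffAt.sum fun j _ => ?_
    have h1 : ContMDiffAt (𝓡 n) 𝓘(ℝ, Minkowski (n + 2)) ∞
      (dirDeriv (E j) (fun x => s (π x))) x₀ := hs.smooth_comp.dirDeriv (hE j).1 x₀
    exact (ContinuousLinearMap.smulRightL ℝ (Fin 2 → ℝ) (Minkowski (n + 2))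
      (ContinuousLinearMap.proj j)).contDiff.contDiffAt.contMDiffAt.comp x₀ h1
  have hcs : ContMDiffAt (𝓡 n) 𝓘(ℝ, Fin 2 → ℝ) ∞ c x₀ := by
    refine ContMDiffAt.solve_injective hΘ ?_ (h x₀) ?_
    · rw [injective_iff_map_eq_zero]
      intro a ha
      rw [hΘa] at ha
      exact funext (Fintype.linearIndependent_iff.1 hli.self_of_nhds a ha)
    · filter_upwards [hspan] with x hx
      rw [hΘa, hc x hx, map_sum]
      simp only [map_smul]
  refine SmoothFieldAt.congr (X := fun x => ∑ j, c x j • E j x) ?_ ?_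
  · refine SmoothFieldAt.sum fun j _ => SmoothFieldAt.smul ?_ ((hE j).1.at x₀)
    exact (ContinuousLinearMap.proj (R := ℝ) j :
      (Fin 2 → ℝ) →L[ℝ] ℝ).contDiff.contDiffAt.contMDiffAt.comp x₀ hcs
  · filter_upwards [hspan] with x hx
    exact hc x hx

/-- The vertical part is invisible to s_* π_*, so the image of the projected field is the smooth
function X(s ∘ π). -/
theorem sectionHor_horProj {X : Π x : M, TangentSpace (𝓡 n) x} (hX : SmoothField X) :
    H.SectionHor lam (fun x => H.horProj lam x (X x)) := by
  refine ⟨hs.smoothField_of_hor (fun x => (H.horProj lam x (X x)).2) ?_, fun x =>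
    (H.horProj lam x (X x)).2⟩
  have h1 : (fun x => mvfderiv (𝓡 n) (fun x => s (π x)) x (H.horProj lam x (X x)))
      = dirDeriv X (fun x => s (π x)) := by
    funext x
    rw [hs.mvfderiv_comp, hs.mfderiv_horProj, ← hs.mvfderiv_comp]
    rfl
  rw [h1]
  exact hs.smooth_comp.dirDeriv hX

theorem exists_sectionHor {x : M} {v : TangentSpace (𝓡 n) x} (hv : v ∈ H.hor lam x) :
    ∃ X, H.SectionHor lam X ∧ X x = v := by
  obtain ⟨X, hX, h⟩ := exists_smoothField_apply x v
  refine ⟨_, hs.sectionHor_horProj hX, ?_⟩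
  rw [h]
  exact congrArg Subtype.val (H.horProj_of_mem lam ⟨v, hv⟩)

theorem exists_sectionΔ {x : M} {v : TangentSpace (𝓡 n) x} (hv : v ∈ H.Δ lam x) :
    ∃ T, H.SectionΔ lam T ∧ T x = v := by
  obtain ⟨X, hX, h⟩ := exists_smoothField_apply x v
  refine ⟨fun x => X x - H.horProj lam x (X x),
    ⟨hX.sub (hs.sectionHor_horProj hX).1, fun x => H.sub_horProj_mem lam x (X x)⟩, ?_⟩
  simp only
  rw [h, H.horProj_of_mem_Δ lam hv]
  simp

/-- The horizontal lift of a vector field. -/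
noncomputable def liftField (_hs : H.Envelops lam P π s) (Y : Π y : L, TangentSpace (𝓡 2) y) (x : M) : TangentSpace (𝓡 n) x :=
  (_hs.horEquiv x).symm (Y (π x))

theorem mfderiv_liftField (Y : Π y : L, TangentSpace (𝓡 2) y) (x : M) :
    mfderiv (𝓡 n) (𝓡 2) π x (hs.liftField Y x) = Y (π x) := hs.mfderiv_horEquiv_symm _

theorem sectionHor_liftField {Y : Π y : L, TangentSpace (𝓡 2) y} (hY : SmoothField Y) :
    H.SectionHor lam (hs.liftField Y) := by
  have hm : ∀ x, hs.liftField Y x ∈ H.hor lam x := fun x => ((hs.horEquiv x).symm (Y (π x))).2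
  refine ⟨hs.smoothField_of_hor hm ?_, hm⟩
  have h1 : (fun x => mvfderiv (𝓡 n) (fun x => s (π x)) x (hs.liftField Y x))
      = fun x => dirDeriv Y s (π x) := by
    funext x
    rw [hs.mvfderiv_comp, hs.mfderiv_liftField]
    rfl
  rw [h1]
  exact (hs.smooth_surf.dirDeriv hY).comp hs.smooth_π

end OrientedHypersurface.Envelops

/-! ### Submersions: local sections and descent to the quotient -/

section Submersion

/-- Local normal form of a submersion between Euclidean spaces. -/
theorem exists_straightening {E F : Type*} [NormedAddCommGroup E] [NormedSpace ℝ E]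
    [FiniteDimensional ℝ E] [NormedAddCommGroup F] [NormedSpace ℝ F] [FiniteDimensional ℝ F]
    {g : E → F} {O : Set E} (hO : IsOpen O) (hg : ContDiffOn ℝ ∞ g O) {p : E} (hp : p ∈ O)
    (hsurj : Function.Surjective (fderiv ℝ g p)) :
    ∃ (K : Submodule ℝ E) (e : OpenPartialHomeomorph E (F × K)), p ∈ e.source ∧ e.source ⊆ O ∧
      (∀ x, (e x).1 = g x) ∧ ∀ z ∈ e.target, ContDiffAt ℝ ∞ e.symm z := by
  have : CompleteSpace E := FiniteDimensional.complete ℝ E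
  have : CompleteSpace F := FiniteDimensional.complete ℝ F
  let K : Submodule ℝ E := LinearMap.ker (fderiv ℝ g p).toLinearMap
  obtain ⟨l, hl⟩ := LinearMap.exists_leftInverse_of_injective K.subtype
    (LinearMap.ker_eq_bot.2 K.injective_subtype)
  have hl' : ∀ k : K, l k = k := fun k => LinearMap.congr_fun hl k
  let l' : E →L[ℝ] K := LinearMap.toContinuousLinearMap l
  -- The map is completed to a local diffeomorphism by a linear retraction onto the kernel of its
  -- derivative at `p`.
  let Φ : E → F × K := fun x => (g x, l' x)
  have hΦ : ContDiffOn ℝ ∞ Φ O := hg.prodMk l'.contDiff.contDiffOn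
  have hΦa : ∀ x ∈ O, ContDiffAt ℝ ∞ Φ x := fun x hx => hΦ.contDiffAt (hO.mem_nhds hx)
  have hd : HasFDerivAt Φ ((fderiv ℝ g p).prod l') p :=
    (((hg.contDiffAt (hO.mem_nhds hp)).differentiableAt (by simp)).hasFDerivAt).prodMk
      l'.hasFDerivAt
  have hbij : Function.Bijective ((fderiv ℝ g p).prod l') := by
    constructor
    · rw [injective_iff_map_eq_zero]
      intro v hv
      have h1 : fderiv ℝ g p v = 0 := congrArg Prod.fst hv
      have h2 : l v = 0 := congrArg Prod.snd hv
      have h3 := hl' ⟨v, h1⟩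
      rw [h2] at h3
      exact (congrArg Subtype.val h3).symm
    · rintro ⟨a, k⟩
      obtain ⟨v, hv⟩ := hsurj a
      refine ⟨v + (k - l v : K), ?_⟩
      have h1 : fderiv ℝ g p ((k - l v : K) : E) = 0 := (k - l v : K).2
      have h2 : l ((k - l v : K) : E) = k - l v := hl' _
      refine Prod.ext ?_ ?_
      · change fderiv ℝ g p _ = a
        rw [map_add, hv, h1, add_zero]
      · change l _ = k
        rw [map_add, h2, add_sub_cancel]
  let T : E ≃L[ℝ] F × K := (LinearEquiv.ofBijective _ hbij).toContinuousLinearEquiv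
  have hT : (T : E →L[ℝ] F × K) = (fderiv ℝ g p).prod l' := by ext v <;> rfl
  let e₀ := (hΦa p hp).toOpenPartialHomeomorph Φ (f' := T) (by rw [hT]; exact hd) (by simp)
  have he₀ : ∀ x, e₀ x = Φ x := fun x => rfl
  have hcont : ContinuousOn (fderiv ℝ Φ) O := (hΦ.continuousOn_fderiv_of_isOpen hO (by simp))
  -- On `O'` the derivative is invertible everywhere, which makes the inverse smooth on the whole
  -- target and not only at the image of `p`.
  let O' : Set E := O ∩ fderiv ℝ Φ ⁻¹'
    Set.range ((↑) : (E ≃L[ℝ] F × K) → E →L[ℝ] F × K)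
  have hO' : IsOpen O' := hcont.isOpen_inter_preimage hO ContinuousLinearEquiv.isOpen
  have hp' : p ∈ O' := ⟨hp, T, by rw [hd.fderiv, hT]⟩
  refine ⟨K, e₀.restrOpen O' hO', ?_, ?_, fun x => rfl, ?_⟩
  · rw [OpenPartialHomeomorph.restrOpen_source]
    exact ⟨ContDiffAt.mem_toOpenPartialHomeomorph_source (hΦa p hp) _ _, hp'⟩
  · rw [OpenPartialHomeomorph.restrOpen_source]
    exact fun x hx => hx.2.1
  · intro z hz
    have hx := (e₀.restrOpen O' hO').map_target hz
    have hx' := hx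
    rw [OpenPartialHomeomorph.restrOpen_source] at hx'
    obtain ⟨T', hT'⟩ := hx'.2.2
    refine (e₀.restrOpen O' hO').contDiffAt_symm (f₀' := T') hz ?_ (hΦa _ hx'.2.1)
    rw [hT']
    exact ((hΦa _ hx'.2.1).differentiableAt (by simp)).hasFDerivAt

variable {m k : ℕ} {M : Type*} [TopologicalSpace M] [ChartedSpace (EuclideanSpace ℝ (Fin m)) M]
  [IsManifold (𝓡 m) ∞ M] {L : Type*} [TopologicalSpace L]
  [ChartedSpace (EuclideanSpace ℝ (Fin k)) L] [IsManifold (𝓡 k) ∞ L]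

/-- A submersion has local sections, and functions with derivative zero along its fibres factor
locally. -/
theorem exists_local_section {π : M → L} (hπ : ContMDiff (𝓡 m) (𝓡 k) ∞ π) {x₀ : M}
    (hsurj : Function.Surjective (mfderiv (𝓡 m) (𝓡 k) π x₀)) {U : Set M} (hU : U ∈ 𝓝 x₀) :
    ∃ (U' : Set M) (V : Set L) (ρ : L → M), IsOpen U' ∧ x₀ ∈ U' ∧ U' ⊆ U ∧ IsOpen V ∧
      (∀ x ∈ U', π x ∈ V) ∧
      (∀ y ∈ V, ContMDiffAt (𝓡 k) (𝓡 m) ∞ ρ y ∧ ρ y ∈ U' ∧ π (ρ y) = y) ∧ ρ (π x₀) = x₀ ∧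
      ∀ (F : Type) [NormedAddCommGroup F] [NormedSpace ℝ F] (u : M → F),
        (∀ x ∈ U', MDifferentiableAt (𝓡 m) 𝓘(ℝ, F) u x ∧
          ∀ v, mfderiv (𝓡 m) (𝓡 k) π x v = 0 → mvfderiv (𝓡 m) u x v = 0) →
        ∀ x ∈ U', u x = u (ρ (π x)) := by
  let φ := extChartAt (𝓡 m) x₀
  let χ := extChartAt (𝓡 k) (π x₀)
  have hφo : IsOpen φ.target := isOpen_extChartAt_target x₀
  have hφs : ContMDiffOn 𝓘(ℝ, EuclideanSpace ℝ (Fin m)) (𝓡 m) ∞ φ.symm φ.target :=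
    contMDiffOn_extChartAt_symm x₀
  have hχo : IsOpen χ.source := isOpen_extChartAt_source (π x₀)
  have hχt : IsOpen χ.target := isOpen_extChartAt_target (π x₀)
  have hχ : ContMDiffOn (𝓡 k) 𝓘(ℝ, EuclideanSpace ℝ (Fin k)) ∞ χ χ.source := by
    have := contMDiffOn_extChartAt (I := 𝓡 k) (n := ∞) (x := π x₀)
    rwa [← extChartAt_source (𝓡 k)] at this
  obtain ⟨U₁, hU₁U, hU₁, hxU₁⟩ := mem_nhds_iff.1 hU
  let O : Set (EuclideanSpace ℝ (Fin m)) := φ.target ∩ φ.symm ⁻¹' (U₁ ∩ π ⁻¹' χ.source)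
  have hO : IsOpen O := hφs.continuousOn.isOpen_inter_preimage hφo
    (hU₁.inter (hχo.preimage hπ.continuous))
  let g : EuclideanSpace ℝ (Fin m) → EuclideanSpace ℝ (Fin k) := fun u => χ (π (φ.symm u))
  have hg : ContDiffOn ℝ ∞ g O := by
    rw [← contMDiffOn_iff_contDiffOn]
    exact hχ.comp (hπ.comp_contMDiffOn (hφs.mono Set.inter_subset_left)) fun u hu => hu.2.2
  have hx₀ : x₀ ∈ φ.source := mem_extChartAt_source x₀
  have hp : φ x₀ ∈ O := ⟨mem_extChartAt_target x₀, by
    change φ.symm (φ x₀) ∈ U₁ ∩ π ⁻¹' χ.source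
    rw [φ.left_inv hx₀]
    exact ⟨hxU₁, mem_extChartAt_source _⟩⟩
  have hgs : Function.Surjective (fderiv ℝ g (φ x₀)) := by
    have h1 : (fun x => g (φ x)) =ᶠ[𝓝 x₀] fun x => χ (π x) := by
      filter_upwards [extChartAt_source_mem_nhds (I := 𝓡 m) x₀] with x hx
      simp only [g]
      rw [φ.left_inv hx]
    have hφd : MDifferentiableAt (𝓡 m) 𝓘(ℝ, EuclideanSpace ℝ (Fin m)) φ x₀ :=
      mdifferentiableAt_extChartAt (mem_chart_source _ x₀)
    have hχd : MDifferentiableAt (𝓡 k) 𝓘(ℝ, EuclideanSpace ℝ (Fin k)) χ (π x₀) :=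
      mdifferentiableAt_extChartAt (mem_chart_source _ (π x₀))
    have hgd : DifferentiableAt ℝ g (φ x₀) :=
      (hg.contDiffAt (hO.mem_nhds hp)).differentiableAt (by simp)
    have hπd : MDifferentiableAt (𝓡 m) (𝓡 k) π x₀ := (hπ x₀).mdifferentiableAt (by simp)
    intro w
    obtain ⟨w', hw'⟩ := (isInvertible_mfderiv_extChartAt (I := 𝓡 k)
      (mem_extChartAt_source (π x₀))).bijective.surjective w
    obtain ⟨v, rfl⟩ := hsurj w'
    refine ⟨mfderiv (𝓡 m) 𝓘(ℝ, EuclideanSpace ℝ (Fin m)) φ x₀ v, ?_⟩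
    have e1 := mfderiv_comp_apply x₀ hgd.mdifferentiableAt hφd v
    have e2 := mfderiv_comp_apply x₀ hχd hπd v
    rw [mfderiv_eq_fderiv] at e1
    refine e1.symm.trans (Eq.trans ?_ (e2.trans hw'))
    have e3 := h1.mfderiv_eq (I := 𝓡 m) (I' := 𝓘(ℝ, EuclideanSpace ℝ (Fin k)))
    exact congrArg (fun l : EuclideanSpace ℝ (Fin m) →L[ℝ] EuclideanSpace ℝ (Fin k) => l v) e3
  obtain ⟨K, e, hpe, heO, heg, hes⟩ := exists_straightening hO hg hp hgs
  obtain ⟨r, hr, hball⟩ := Metric.isOpen_iff.1 e.open_target _ (e.map_source hpe)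
  set q := e (φ x₀) with hq
  have hq1 : q.1 = χ (π x₀) := by rw [hq, heg]; simp only [g]; rw [φ.left_inv hx₀]
  let W : Set (EuclideanSpace ℝ (Fin m)) := e.source ∩ e ⁻¹' Metric.ball q r
  have hW : IsOpen W := e.isOpen_inter_preimage Metric.isOpen_ball
  let σ : EuclideanSpace ℝ (Fin k) × K → M := fun z => φ.symm (e.symm z)
  have hσt : ∀ z ∈ Metric.ball q r, e.symm z ∈ O := fun z hz => heO (e.map_target (hball hz))
  have hσs : ∀ z ∈ Metric.ball q r,
      ContMDiffAt 𝓘(ℝ, EuclideanSpace ℝ (Fin k) × K) (𝓡 m) ∞ σ z := fun z hz =>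
    ContMDiffAt.comp z (hφs.contMDiffAt (hφo.mem_nhds (hσt z hz).1))
      (hes z (hball hz)).contMDiffAt
  have hσφ : ∀ z ∈ Metric.ball q r, σ z ∈ φ.source ∧ φ (σ z) = e.symm z := fun z hz =>
    ⟨φ.map_target (hσt z hz).1, φ.right_inv (hσt z hz).1⟩
  have hχπσ : ∀ z ∈ Metric.ball q r, χ (π (σ z)) = z.1 := fun z hz => by
    change g (e.symm z) = z.1
    rw [← heg, e.right_inv (hball hz)]
  have hπσ : ∀ z ∈ Metric.ball q r, π (σ z) ∈ χ.source := fun z hz => (hσt z hz).2.2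
  have hmem : ∀ y k', y ∈ Metric.ball q.1 r → k' ∈ Metric.ball q.2 r →
      (y, k') ∈ Metric.ball q r := by
    intro y k' hy hk
    rw [← Prod.mk.eta (p := q), ← ball_prod_same]
    exact ⟨hy, hk⟩
  have hq2 : q.2 ∈ Metric.ball q.2 r := Metric.mem_ball_self hr
  -- The section is the slice of the straightened coordinates whose second component is that of the
  -- base point.
  refine ⟨φ.source ∩ φ ⁻¹' W, χ.source ∩ χ ⁻¹' Metric.ball q.1 r, fun y => σ (χ y, q.2),
    (continuousOn_extChartAt x₀).isOpen_inter_preimage (isOpen_extChartAt_source x₀) hW,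
    ⟨hx₀, hpe, Metric.mem_ball_self hr⟩, ?_,
    (continuousOn_extChartAt (π x₀)).isOpen_inter_preimage hχo Metric.isOpen_ball, ?_, ?_, ?_, ?_⟩
  · rintro x ⟨hx, hxW⟩
    have := (heO hxW.1).2.1
    rw [φ.left_inv hx] at this
    exact hU₁U this
  · rintro x ⟨hx, hxW⟩
    have h1 := (heO hxW.1).2.2
    change π (φ.symm (φ x)) ∈ χ.source at h1
    rw [φ.left_inv hx] at h1
    refine ⟨h1, ?_⟩
    have h2 : (e (φ x)).1 = χ (π x) := by rw [heg]; simp only [g]; rw [φ.left_inv hx]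
    have h3 := hxW.2
    rw [Set.mem_preimage, ← Prod.mk.eta (p := q), ← ball_prod_same] at h3
    rw [Set.mem_preimage, ← h2]
    exact h3.1
  · rintro y ⟨hy, hyb⟩
    have hz := hmem _ _ hyb hq2
    refine ⟨?_, ⟨(hσφ _ hz).1, ?_⟩, ?_⟩
    · refine ContMDiffAt.comp (I' := 𝓘(ℝ, EuclideanSpace ℝ (Fin k) × K)) (g := σ)
        (f := fun y => (χ y, q.2)) y (hσs _ hz) ?_
      exact (hχ.contMDiffAt (hχo.mem_nhds hy)).prodMk_space contMDiffAt_const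
    · rw [Set.mem_preimage, (hσφ _ hz).2]
      exact ⟨e.map_target (hball hz), by rw [Set.mem_preimage, e.right_inv (hball hz)]; exact hz⟩
    · exact χ.injOn (hπσ _ hz) hy (hχπσ _ hz)
  · change φ.symm (e.symm (χ (π x₀), q.2)) = x₀
    rw [← hq1, Prod.mk.eta, hq, e.left_inv hpe, φ.left_inv hx₀]
  · rintro F _ _ u hu x ⟨hx, hxW⟩
    have h2 : (e (φ x)).1 = χ (π x) := by rw [heg]; simp only [g]; rw [φ.left_inv hx]
    have h3 := hxW.2
    rw [Set.mem_preimage, ← Prod.mk.eta (p := q), ← ball_prod_same] at h3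
    let y := (e (φ x)).1
    let τ : K → M := fun κ => σ (y, κ)
    have hUσ : ∀ z ∈ Metric.ball q r, σ z ∈ φ.source ∩ φ ⁻¹' W := fun z hz =>
      ⟨(hσφ _ hz).1, by
        rw [Set.mem_preimage, (hσφ _ hz).2]
        exact ⟨e.map_target (hball hz), by rw [Set.mem_preimage, e.right_inv (hball hz)]; exact hz⟩⟩
    have hτ : ∀ κ ∈ Metric.ball q.2 r, MDifferentiableAt 𝓘(ℝ, K) (𝓡 m) τ κ := fun κ hκ => by
      refine MDifferentiableAt.comp (I' := 𝓘(ℝ, EuclideanSpace ℝ (Fin k) × K)) (g := σ)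
        (f := fun κ => (y, κ)) κ
        ((hσs _ (hmem _ _ h3.1 hκ)).mdifferentiableAt (by simp)) ?_
      exact (mdifferentiableAt_const).prodMk_space mdifferentiableAt_id
    -- With the first component fixed, `π ∘ τ` is constant, so τ moves inside a fibre, where the
    -- derivative of `u` vanishes. Balls are convex, hence `u ∘ τ` is constant.
    have hder : ∀ κ ∈ Metric.ball q.2 r, HasFDerivAt (fun κ => u (τ κ)) (0 : K →L[ℝ] F) κ := by
      intro κ hκ
      have hz := hmem _ _ h3.1 hκ
      have h5 := hu _ (hUσ _ hz)
      have hcomp : MDifferentiableAt 𝓘(ℝ, K) 𝓘(ℝ, F) (fun κ => u (τ κ)) κ :=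
        MDifferentiableAt.comp (I' := 𝓡 m) κ h5.1 (hτ κ hκ)
      have hz0 : mfderiv 𝓘(ℝ, K) 𝓘(ℝ, F) (fun κ => u (τ κ)) κ = (0 : K →L[ℝ] F) := by
        apply ContinuousLinearMap.ext
        intro v
        refine (mfderiv_comp_apply (I' := 𝓡 m) κ h5.1 (hτ κ hκ) v).trans ?_
        refine h5.2 _ ?_
        have h6 := mfderiv_comp_apply (I' := 𝓡 m) κ
          ((hπ (τ κ)).mdifferentiableAt (n := ∞) (by simp)) (hτ κ hκ) v
        refine h6.symm.trans ?_
        have h7 : (π ∘ τ) =ᶠ[𝓝 κ] fun _ => π (τ κ) := by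
          filter_upwards [Metric.isOpen_ball.mem_nhds hκ] with κ' hκ'
          have hz' := hmem _ _ h3.1 hκ'
          refine χ.injOn (hπσ _ hz') (hπσ _ hz) ?_
          rw [hχπσ _ hz', hχπσ _ hz]
        rw [h7.mfderiv_eq, mfderiv_const]
        rfl
      have h8 := (hcomp.differentiableAt).hasFDerivAt
      rw [← mfderiv_eq_fderiv, hz0] at h8
      exact h8
    have hconst := Metric.isOpen_ball.is_const_of_fderiv_eq_zero (𝕜 := ℝ)
      (convex_ball q.2 r).isPreconnected
      (fun κ hκ => (hder κ hκ).differentiableAt.differentiableWithinAt)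
      (fun κ hκ => (hder κ hκ).fderiv) h3.2 hq2
    have h9 : τ (e (φ x)).2 = x := by
      change φ.symm (e.symm ((e (φ x)).1, (e (φ x)).2)) = x
      rw [Prod.mk.eta, e.left_inv hxW.1, φ.left_inv hx]
    change u (τ (e (φ x)).2) = u (τ q.2) at hconst
    rw [h9] at hconst
    rw [hconst]
    change u (σ ((e (φ x)).1, q.2)) = u (σ (χ (π x), q.2))
    rw [h2]

/-- By the local normal form `u` is locally constant on each fibre, hence constant since fibres are
connected. The quotient function is smooth because it equals `u ∘ ρ` for a local section `ρ`. -/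
theorem exists_descent {π : M → L} (hπ : ContMDiff (𝓡 m) (𝓡 k) ∞ π)
    (hsurj : ∀ x, Function.Surjective (mfderiv (𝓡 m) (𝓡 k) π x))
    (hconn : ∀ y, IsConnected (π ⁻¹' {y})) {F : Type} [NormedAddCommGroup F] [NormedSpace ℝ F]
    {u : M → F} (hu : ContMDiff (𝓡 m) 𝓘(ℝ, F) ∞ u)
    (hker : ∀ x v, mfderiv (𝓡 m) (𝓡 k) π x v = 0 → mvfderiv (𝓡 m) u x v = 0) :
    ∃ u' : L → F, ContMDiff (𝓡 k) 𝓘(ℝ, F) ∞ u' ∧ ∀ x, u x = u' (π x) := by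
  have hloc : ∀ x x', π x = π x' → u x = u x' := by
    intro x x' h
    have hlc : IsLocallyConstant (fun z : π ⁻¹' {π x'} => u z) := by
      rw [IsLocallyConstant.iff_eventually_eq]
      intro z
      obtain ⟨U', V, ρ, hU', hz, -, -, -, -, hρ, hF⟩ := exists_local_section hπ (hsurj z)
        (Filter.univ_mem (f := 𝓝 (z : M)))
      filter_upwards [continuous_subtype_val.continuousAt.preimage_mem_nhds (hU'.mem_nhds hz)]
        with z' hz'
      have h1 := hF F u fun x _ => ⟨(hu x).mdifferentiableAt (by simp), hker x⟩
      rw [h1 _ hz', h1 _ hz]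
      have h2 : π (z' : M) = π (z : M) := z'.2.trans z.2.symm
      rw [h2]
    have : PreconnectedSpace (π ⁻¹' {π x'}) :=
      isPreconnected_iff_preconnectedSpace.1 (hconn (π x')).isPreconnected
    exact hlc.apply_eq_of_preconnectedSpace ⟨x, h⟩ ⟨x', rfl⟩
  choose r hr using fun y => (hconn y).nonempty
  have hr' : ∀ y, π (r y) = y := hr
  refine ⟨fun y => u (r y), fun y => ?_, fun x => hloc _ _ (hr' _).symm⟩
  obtain ⟨U', V, ρ, hU', hz, -, hV, hUV, hρV, hρ, -⟩ := exists_local_section hπ (hsurj (r y))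
    (Filter.univ_mem (f := 𝓝 (r y)))
  have hy : y ∈ V := hr' y ▸ hUV _ hz
  refine ContMDiffAt.congr_of_eventuallyEq (ContMDiffAt.comp (I' := 𝓡 m) y (hu _) (hρV y hy).1) ?_
  filter_upwards [hV.mem_nhds hy] with z hz'
  exact hloc _ _ ((hr' z).trans (hρV z hz').2.2.symm)

/-- The pull-back of a smooth vector valued one-form is smooth. -/
theorem SmoothVecForm.pullback [T2Space L] {π : M → L} (hπ : ContMDiff (𝓡 m) (𝓡 k) ∞ π)
    {F : Type*} [NormedAddCommGroup F] [NormedSpace ℝ F]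
    {Ω : Π y : L, TangentSpace (𝓡 k) y →ₗ[ℝ] F} (hΩ : SmoothVecForm Ω) :
    SmoothVecForm (fun x => Ω (π x) ∘ₗ (mfderiv (𝓡 m) (𝓡 k) π x).toLinearMap) := by
  intro X hX x₀
  let y₀ := π x₀
  let b := EuclideanSpace.basisFun (Fin k) ℝ
  have hsrc := (chartAt (EuclideanSpace ℝ (Fin k)) y₀).open_source.mem_nhds (mem_chart_source _ y₀)
  choose e he hee using fun i => exists_smoothField_eventuallyEq (m := k) hsrc
    (X := fun y => coordInv y₀ y (b i))
    (fun y hy => smoothFieldAt_coordInv hy contMDiffAt_const)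
  have h1 : ContMDiffAt (𝓡 m) (𝓡 k).tangent ∞
      (fun x => (⟨π x, mfderiv (𝓡 m) (𝓡 k) π x (X x)⟩ : TangentBundle (𝓡 k) L)) x₀ :=
    ContMDiffAt.comp x₀ ((hπ.contMDiff_tangentMap (m := ∞) (by simp)) _) (hX x₀)
  have h2 : ContMDiffAt (𝓡 m) 𝓘(ℝ, EuclideanSpace ℝ (Fin k)) ∞
      (fun x => coordAt y₀ (π x) (mfderiv (𝓡 m) (𝓡 k) π x (X x))) x₀ := by
    refine ((Bundle.contMDiffAt_totalSpace.1 h1).2).congr_of_eventuallyEq ?_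
    filter_upwards [hπ.continuous.continuousAt.preimage_mem_nhds hsrc] with x hx
    rw [coordAt, Bundle.Trivialization.continuousLinearMapAt_apply,
      Bundle.Trivialization.linearMapAt_apply, if_pos (by simpa using hx)]
  have h3 : ContMDiffAt (𝓡 m) 𝓘(ℝ, F) ∞ (fun x => ∑ i,
      (coordAt y₀ (π x) (mfderiv (𝓡 m) (𝓡 k) π x (X x))) i • Ω (π x) (e i (π x))) x₀ := by
    refine ContMDiffAt.sum fun i _ => ?_
    have h4 : ContMDiffAt (𝓡 m) 𝓘(ℝ, ℝ) ∞
        (fun x => (coordAt y₀ (π x) (mfderiv (𝓡 m) (𝓡 k) π x (X x))) i) x₀ :=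
      (EuclideanSpace.proj i :
        EuclideanSpace ℝ (Fin k) →L[ℝ] ℝ).contDiff.contDiffAt.contMDiffAt.comp x₀ h2
    exact h4.smul (ContMDiffAt.comp (I' := 𝓡 k) x₀ (hΩ _ (he i) _) (hπ x₀))
  refine h3.congr_of_eventuallyEq ?_
  have h4 : ∀ᶠ y in 𝓝 y₀, ∀ i, e i y = coordInv y₀ y (b i) := by
    rw [eventually_all]; exact hee
  filter_upwards [hπ.continuous.continuousAt.preimage_mem_nhds hsrc,
    hπ.continuous.continuousAt.eventually h4] with x hx hx'
  set v := mfderiv (𝓡 m) (𝓡 k) π x (X x) with hv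
  have h5 : coordAt y₀ (π x) v = ∑ i, (coordAt y₀ (π x) v) i • b i := by
    conv_lhs => rw [← b.sum_repr (coordAt y₀ (π x) v)]
    simp [b]
  have h6 := coordInv_coordAt hx v
  rw [h5, map_sum] at h6
  change Ω (π x) v = _
  conv_lhs => rw [← h6]
  rw [map_sum]
  refine Finset.sum_congr rfl fun i _ => ?_
  rw [map_smul, map_smul, hx' i]

end Submersion

/-! ### Pull-back of fields, forms and tensors along π -/

namespace OrientedHypersurface.Envelops

variable {n : ℕ} {M : Type*} [TopologicalSpace M] [T2Space M]
  [ChartedSpace (EuclideanSpace ℝ (Fin n)) M] [IsManifold (𝓡 n) ∞ M]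
  {L : Type*} [TopologicalSpace L] [T2Space L]
  [ChartedSpace (EuclideanSpace ℝ (Fin 2)) L] [IsManifold (𝓡 2) ∞ L]
  {H : OrientedHypersurface n M} {lam : M → ℝ}
  {P : LightConeModel (n + 1)} {π : M → L} {s : L → Minkowski (n + 2)}
  (hs : H.Envelops lam P π s)
include hs

/-- The derivative of a function that factors through `π`. -/
theorem mvfderiv_comp_π {F : Type*} [NormedAddCommGroup F] [NormedSpace ℝ F] {u : L → F}
    (hu : ContMDiff (𝓡 2) 𝓘(ℝ, F) ∞ u) (x : M) (v : TangentSpace (𝓡 n) x) :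
    mvfderiv (𝓡 n) (fun x => u (π x)) x v
      = mvfderiv (𝓡 2) u (π x) (mfderiv (𝓡 n) (𝓡 2) π x v) :=
  mvfderiv_comp_vec ((hu (π x)).mdifferentiableAt (by simp))
    ((hs.smooth_π x).mdifferentiableAt (by simp)) v

theorem dirDeriv_comp {X : Π x : M, TangentSpace (𝓡 n) x} {X' : Π y : L, TangentSpace (𝓡 2) y}
    (h : ∀ x, mfderiv (𝓡 n) (𝓡 2) π x (X x) = X' (π x)) :
    dirDeriv X (fun x => s (π x)) = fun x => dirDeriv X' s (π x) := by
  funext x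
  rw [dirDeriv, hs.mvfderiv_comp, h]
  rfl

/-- As s is an immersion, it suffices to compare derivatives of s, where both brackets are
commutators. -/
theorem mfderiv_mlieBracket {X Y : Π x : M, TangentSpace (𝓡 n) x}
    {X' Y' : Π y : L, TangentSpace (𝓡 2) y} (hX : SmoothField X) (hY : SmoothField Y)
    (hX' : SmoothField X') (hY' : SmoothField Y')
    (hXX : ∀ x, mfderiv (𝓡 n) (𝓡 2) π x (X x) = X' (π x))
    (hYY : ∀ x, mfderiv (𝓡 n) (𝓡 2) π x (Y x) = Y' (π x)) (x : M) :
    mfderiv (𝓡 n) (𝓡 2) π x (VectorField.mlieBracket (𝓡 n) X Y x)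
      = VectorField.mlieBracket (𝓡 2) X' Y' (π x) := by
  apply hs.injective_mvfderiv (π x)
  rw [← hs.mvfderiv_comp, mvfderiv_mlieBracket (hs.smooth_comp x) (hX.at x) (hY.at x),
    mvfderiv_mlieBracket (hs.smooth_surf (π x)) (hX'.at _) (hY'.at _), hs.dirDeriv_comp hXX,
    hs.dirDeriv_comp hYY]
  rw [dirDeriv, dirDeriv, hs.mvfderiv_comp_π (hs.smooth_surf.dirDeriv hX'),
    hs.mvfderiv_comp_π (hs.smooth_surf.dirDeriv hY'), hXX, hYY]
  rfl

/-- There is a field on `M` that is projectable to a given field and has a given value. -/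
theorem exists_related {X' : Π y : L, TangentSpace (𝓡 2) y} (hX' : SmoothField X') {x : M}
    {v : TangentSpace (𝓡 n) x} (hv : mfderiv (𝓡 n) (𝓡 2) π x v = X' (π x)) :
    ∃ X : Π x : M, TangentSpace (𝓡 n) x, SmoothField X ∧ X x = v ∧
      ∀ x, mfderiv (𝓡 n) (𝓡 2) π x (X x) = X' (π x) := by
  have h1 : v - hs.liftField X' x ∈ H.Δ lam x := by
    rw [← hs.mfderiv_eq_zero_iff, map_sub, hv, hs.mfderiv_liftField, sub_self]
  obtain ⟨T, hT, hTx⟩ := hs.exists_sectionΔ h1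
  refine ⟨fun x => hs.liftField X' x + T x, (hs.sectionHor_liftField hX').1.add hT.1, ?_,
    fun x => ?_⟩
  · simp only [hTx, add_sub_cancel]
  · rw [map_add, hs.mfderiv_liftField, hs.mfderiv_eq_zero_iff.2 (hT.2 x), add_zero]

/-- The exterior derivative commutes with the pull-back by `π`. -/
theorem extDerivVec_pullback {F : Type*} [NormedAddCommGroup F] [NormedSpace ℝ F]
    {Ω : Π y : L, TangentSpace (𝓡 2) y →ₗ[ℝ] F} (hΩ : SmoothVecForm Ω)
    {X Y : Π x : M, TangentSpace (𝓡 n) x}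
    {X' Y' : Π y : L, TangentSpace (𝓡 2) y} (hX : SmoothField X) (hY : SmoothField Y)
    (hX' : SmoothField X') (hY' : SmoothField Y') {x : M}
    (hXX : mfderiv (𝓡 n) (𝓡 2) π x (X x) = X' (π x))
    (hYY : mfderiv (𝓡 n) (𝓡 2) π x (Y x) = Y' (π x)) :
    extDerivVec (fun x => Ω (π x) ∘ₗ (mfderiv (𝓡 n) (𝓡 2) π x).toLinearMap) X Y x
      = extDerivVec Ω X' Y' (π x) := by
  -- By tensoriality the fields may be replaced by π-related ones with the same values at `x`, for
  -- which derivatives and brackets project.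
  obtain ⟨X₁, hX₁, hXx, hXr⟩ := hs.exists_related hX' hXX
  obtain ⟨Y₁, hY₁, hYx, hYr⟩ := hs.exists_related hY' hYY
  rw [extDerivVec_congr (hΩ.pullback hs.smooth_π) hX hX₁ hY hY₁ hXx.symm hYx.symm]
  have h1 : (fun y => (Ω (π y) ∘ₗ (mfderiv (𝓡 n) (𝓡 2) π y).toLinearMap) (Y₁ y))
      = fun y => Ω (π y) (Y' (π y)) := by
    funext y; exact congrArg (Ω (π y)) (hYr y)
  have h2 : (fun y => (Ω (π y) ∘ₗ (mfderiv (𝓡 n) (𝓡 2) π y).toLinearMap) (X₁ y))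
      = fun y => Ω (π y) (X' (π y)) := by
    funext y; exact congrArg (Ω (π y)) (hXr y)
  rw [extDerivVec, extDerivVec, h1, h2, dirDeriv, dirDeriv, dirDeriv, dirDeriv,
    hs.mvfderiv_comp_π (hΩ Y' hY'), hs.mvfderiv_comp_π (hΩ X' hX'), hXr, hYr]
  congr 1
  exact congrArg (Ω (π x)) (hs.mfderiv_mlieBracket hX₁ hY₁ hX' hY' hXr hYr x)

theorem extDerivVec_pullback_Δ {F : Type*} [NormedAddCommGroup F] [NormedSpace ℝ F]
    {Ω : Π y : L, TangentSpace (𝓡 2) y →ₗ[ℝ] F} (hΩ : SmoothVecForm Ω)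
    {X T : Π x : M, TangentSpace (𝓡 n) x} (hX : SmoothField X) (hT : H.SectionΔ lam T) (x : M) :
    extDerivVec (fun x => Ω (π x) ∘ₗ (mfderiv (𝓡 n) (𝓡 2) π x).toLinearMap) T X x = 0 := by
  obtain ⟨X', hX', hv⟩ := exists_smoothField_apply (π x) (mfderiv (𝓡 n) (𝓡 2) π x (X x))
  have h0 : (fun y : L => (0 : TangentSpace (𝓡 2) y)) = 0 := rfl
  rw [hs.extDerivVec_pullback hΩ hT.1 hX SmoothField.zero hX'
    (hs.mfderiv_eq_zero_iff.2 (hT.2 x)) hv.symm, extDerivVec, h0, VectorField.mlieBracket_zero_left]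
  simp only [dirDeriv, map_zero, Pi.zero_apply, sub_zero, zero_sub, neg_eq_zero]
  rw [mvfderiv_const]
  rfl

/-- T projects to the zero field, so a pulled back form vanishes on T and its exterior derivative
vanishes when contracted with T. Only two terms of the exterior derivative remain. -/
theorem mvfderiv_pullback_of_Δ {F : Type*} [NormedAddCommGroup F] [NormedSpace ℝ F]
    {Ω : Π y : L, TangentSpace (𝓡 2) y →ₗ[ℝ] F} (hΩ : SmoothVecForm Ω)
    {X T : Π x : M, TangentSpace (𝓡 n) x} (hX : SmoothField X) (hT : H.SectionΔ lam T) (x : M) :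
    mvfderiv (𝓡 n) (fun x => Ω (π x) (mfderiv (𝓡 n) (𝓡 2) π x (X x))) x (T x)
      = Ω (π x) (mfderiv (𝓡 n) (𝓡 2) π x (VectorField.mlieBracket (𝓡 n) T X x)) := by
  have h1 := hs.extDerivVec_pullback_Δ hΩ hX hT x
  have h2 : (fun y => (Ω (π y) ∘ₗ (mfderiv (𝓡 n) (𝓡 2) π y).toLinearMap) (T y)) = fun _ => 0 := by
    funext y
    change Ω (π y) (mfderiv (𝓡 n) (𝓡 2) π y (T y)) = 0
    rw [hs.mfderiv_eq_zero_iff.2 (hT.2 y), map_zero]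
  rw [extDerivVec, h2] at h1
  simp only [dirDeriv, mvfderiv_const] at h1
  change mvfderiv (𝓡 n) (fun x => Ω (π x) (mfderiv (𝓡 n) (𝓡 2) π x (X x))) x (T x) - (0 : F)
    - Ω (π x) (mfderiv (𝓡 n) (𝓡 2) π x (VectorField.mlieBracket (𝓡 n) T X x)) = 0 at h1
  rw [sub_zero, sub_eq_zero] at h1
  exact h1

/-- The projection of a bracket with a section of `Δ`. -/
theorem mfderiv_bracket_Δ {X T : Π x : M, TangentSpace (𝓡 n) x} (hX : H.SectionHor lam X)
    (hT : H.SectionΔ lam T) (x : M) :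
    mfderiv (𝓡 n) (𝓡 2) π x (VectorField.mlieBracket (𝓡 n) T X x)
      = hs.horEquiv x (H.horProj lam x (leviCivita H.metric X x (T x))
          + H.splitting lam T x ⟨X x, hX.2 x⟩) := by
  rw [← H.leviCivita_sub P hT.1 hX.1, ← hs.mfderiv_horProj, map_sub]
  rw [hs.horEquiv_apply]
  congr 1

theorem smoothVecForm_mvfderiv : SmoothVecForm (fun y => (mvfderiv (𝓡 2) s y).toLinearMap) :=
  fun _ hX => hs.smooth_surf.dirDeriv hX

/-- Differentiation along `Δ` of the image of a horizontal field. -/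
theorem mvfderiv_dirDeriv_of_Δ {X T : Π x : M, TangentSpace (𝓡 n) x} (hX : H.SectionHor lam X)
    (hT : H.SectionΔ lam T) (x : M) :
    mvfderiv (𝓡 n) (dirDeriv X (fun x => s (π x))) x (T x)
      = mvfderiv (𝓡 2) s (π x) (hs.horEquiv x (H.horProj lam x (leviCivita H.metric X x (T x))
          + H.splitting lam T x ⟨X x, hX.2 x⟩)) := by
  have h1 : dirDeriv X (fun x => s (π x))
      = fun x => mvfderiv (𝓡 2) s (π x) (mfderiv (𝓡 n) (𝓡 2) π x (X x)) := by
    funext x; exact hs.mvfderiv_comp x (X x)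
  rw [h1, ← hs.mfderiv_bracket_Δ hX hT]
  exact hs.mvfderiv_pullback_of_Δ hs.smoothVecForm_mvfderiv hX.1 hT x

theorem smoothVecForm_comp {D' : Π y : L, TangentSpace (𝓡 2) y →ₗ[ℝ] TangentSpace (𝓡 2) y}
    (hD : SmoothEnd D') :
    SmoothVecForm (fun y => (mvfderiv (𝓡 2) s y).toLinearMap ∘ₗ D' y) :=
  fun X hX => hs.smooth_surf.dirDeriv (hD X hX)

theorem smoothHorEnd_lift {D' : Π y : L, TangentSpace (𝓡 2) y →ₗ[ℝ] TangentSpace (𝓡 2) y}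
    (hD : SmoothEnd D') : H.SmoothHorEnd lam (H.lift lam π D') := by
  intro X hX
  refine hs.smoothField_of_hor (fun x => H.extend_mem lam _ _) ?_
  have h1 : (fun x => mvfderiv (𝓡 n) (fun x => s (π x)) x
        (H.extend lam (H.lift lam π D') x (X x)))
      = fun x => mvfderiv (𝓡 2) s (π x) (D' (π x) (mfderiv (𝓡 n) (𝓡 2) π x (X x))) := by
    funext x
    rw [hs.mvfderiv_comp, hs.mfderiv_extend_lift]
  rw [h1]
  exact (hs.smoothVecForm_comp hD).pullback hs.smooth_π X hX

theorem SectionHor_extend {D : Π x : M, H.hor lam x →ₗ[ℝ] H.hor lam x}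
    (hD : H.SmoothHorEnd lam D) {X : Π x : M, TangentSpace (𝓡 n) x} (hX : SmoothField X) :
    H.SectionHor lam (fun x => H.extend lam D x (X x)) :=
  ⟨hD X hX, fun _ => H.extend_mem lam _ _⟩

/-- The horizontal derivative of a lifted tensor is its commutator with the splitting tensor. -/
theorem horDeriv_lift {D' : Π y : L, TangentSpace (𝓡 2) y →ₗ[ℝ] TangentSpace (𝓡 2) y}
    (hD : SmoothEnd D') {X T : Π x : M, TangentSpace (𝓡 n) x} (hX : H.SectionHor lam X)
    (hT : H.SectionΔ lam T) (x : M) :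
    H.horProj lam x (leviCivita H.metric
        (fun y => H.extend lam (H.lift lam π D') y (X y)) x (T x))
      + H.splitting lam T x (H.lift lam π D' x ⟨X x, hX.2 x⟩)
    = H.lift lam π D' x (H.horProj lam x (leviCivita H.metric X x (T x))
      + H.splitting lam T x ⟨X x, hX.2 x⟩) := by
  have hDX := hs.SectionHor_extend (hs.smoothHorEnd_lift hD) hX.1
  -- The same function s_* D' π_* X is differentiated along T twice: as the image of the horizontal
  -- field D X, and as the pulled back form s_* D' evaluated on X.
  have h1 := hs.mvfderiv_dirDeriv_of_Δ hDX hT x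
  have h2 : dirDeriv (fun y => H.extend lam (H.lift lam π D') y (X y)) (fun x => s (π x))
      = fun x => mvfderiv (𝓡 2) s (π x) (D' (π x) (mfderiv (𝓡 n) (𝓡 2) π x (X x))) := by
    funext x
    rw [dirDeriv, hs.mvfderiv_comp, hs.mfderiv_extend_lift]
  have h3 := hs.mvfderiv_pullback_of_Δ (hs.smoothVecForm_comp hD) hX.1 hT x
  rw [h2] at h1
  have h4 := hs.injective_mvfderiv _ (h1.symm.trans h3)
  rw [hs.mfderiv_bracket_Δ hX hT] at h4
  have h5 : H.lift lam π D' x ⟨X x, hX.2 x⟩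
      = ⟨H.extend lam (H.lift lam π D') x (X x), hDX.2 x⟩ :=
    Subtype.ext (H.extend_apply_of_mem lam (H.lift lam π D') ⟨X x, hX.2 x⟩).symm
  apply (hs.horEquiv x).injective
  rw [h5, hs.lift_eq D' x]
  simp only [LinearMap.comp_apply, LinearEquiv.coe_coe, LinearEquiv.apply_symm_apply]
  exact h4

end OrientedHypersurface.Envelops

/-! ### Second order geometry of the congruence -/

namespace OrientedHypersurface.Envelops

variable {n : ℕ} {M : Type*} [TopologicalSpace M] [T2Space M]
  [ChartedSpace (EuclideanSpace ℝ (Fin n)) M] [IsManifold (𝓡 n) ∞ M]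
  {L : Type*} [TopologicalSpace L] [T2Space L]
  [ChartedSpace (EuclideanSpace ℝ (Fin 2)) L] [IsManifold (𝓡 2) ∞ L]
  {H : OrientedHypersurface n M} {lam : M → ℝ}
  {P : LightConeModel (n + 1)} {π : M → L} {s : L → Minkowski (n + 2)}
  (hs : H.Envelops lam P π s)
include hs

/-- Differentiate the relation ⟨s_* π_* Y, F⟩ = 0. -/
theorem lorentz_second_lc {Y : Π x : M, TangentSpace (𝓡 n) x} (hY : SmoothField Y) (x : M)
    (v : TangentSpace (𝓡 n) x) :
    lorentz (mvfderiv (𝓡 n) (dirDeriv Y (fun x => s (π x))) x v) (H.lc P x)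
      = H.metric x (H.shapeSub lam x (Y x)) v := by
  rw [lorentz_mvfderiv_of_const (hs.smooth_comp.dirDeriv hY) (H.smooth_lc P) (c := 0)
    (fun x => hs.lorentz_mvfderiv_lc x (Y x)) v]
  change -lorentz (mvfderiv (𝓡 n) (fun x => s (π x)) x (Y x)) _ = _
  rw [hs.lorentz_mvfderiv_dlc, neg_neg]

theorem lorentz_mvfderiv_xi (x : M) (v : TangentSpace (𝓡 n) x) :
    lorentz (mvfderiv (𝓡 n) (fun x => s (π x)) x v) (H.xi P x) = 0 := by
  have h := lorentz_comm (H.lc P x) (H.xi P x)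
  simp only [hs.mvfderiv_eq, lorentz_add_left, lorentz_neg_left, lorentz_smul_left,
    H.lorentz_dlc_xi, h, H.lorentz_xi_lc]
  ring

/-- Differentiate ⟨s_* π_* Y, F_*T⟩ = 0 and insert the Gauss formula for F_*T. The w-term vanishes
as v is horizontal, the ξ-term as s_* π_* Y is orthogonal to ξ, and of ∇_v T only the horizontal
part -C_T v is seen. -/
theorem lorentz_second_dlc {Y T : Π x : M, TangentSpace (𝓡 n) x} (hY : SmoothField Y)
    (hT : H.SectionΔ lam T) {x : M} (v : H.hor lam x) :
    lorentz (mvfderiv (𝓡 n) (dirDeriv Y (fun x => s (π x))) x v)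
        (mvfderiv (𝓡 n) (H.lc P) x (T x))
      = -H.metric x (H.shapeSub lam x (Y x)) (H.splitting lam T x v) := by
  have h1 := lorentz_mvfderiv_of_const (hs.smooth_comp.dirDeriv hY)
    ((H.smooth_lc P).dirDeriv hT.1) (c := 0)
    (fun x => by
      change lorentz (mvfderiv (𝓡 n) (fun x => s (π x)) x (Y x))
        (mvfderiv (𝓡 n) (H.lc P) x (T x)) = 0
      rw [hs.lorentz_mvfderiv_dlc, H.metric_shapeSub P, (H.mem_Δ lam).1 (hT.2 x)]
      simp [metric]) (x := x) v
  refine h1.trans ?_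
  rw [H.gauss P hT.1]
  change -lorentz (mvfderiv (𝓡 n) (fun x => s (π x)) x (Y x)) _ = _
  rw [v.2 _ (hT.2 x), lorentz_sub_right, lorentz_add_right, lorentz_smul_right,
    lorentz_smul_right, hs.lorentz_mvfderiv_dlc, hs.lorentz_mvfderiv_xi]
  have h2 := H.metric_horProj lam x (u := leviCivita H.metric T x v)
    (H.shapeSub_mem_hor P lam x (Y x))
  rw [← h2, splitting, LinearMap.neg_apply, LinearMap.comp_apply, LinearMap.comp_apply,
    Submodule.subtype_apply, Submodule.coe_neg]
  have h3 := H.metric_smul_right x (-1) (H.shapeSub lam x (Y x))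
    (H.horProj lam x (leviCivita H.metric T x v))
  rw [neg_one_smul] at h3
  rw [h3]
  ring

theorem second_symm {X Y : Π x : M, TangentSpace (𝓡 n) x} (hX : SmoothField X)
    (hY : SmoothField Y) (x : M) :
    mvfderiv (𝓡 n) (dirDeriv Y (fun x => s (π x))) x (X x)
      - mvfderiv (𝓡 n) (dirDeriv X (fun x => s (π x))) x (Y x)
      = mvfderiv (𝓡 n) (fun x => s (π x)) x (VectorField.mlieBracket (𝓡 n) X Y x) :=
  (mvfderiv_mlieBracket (hs.smooth_comp x) (hX.at x) (hY.at x)).symm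

/-- `(A - λ I) C_T` is symmetric. -/
theorem metric_splitting {T : Π x : M, TangentSpace (𝓡 n) x} (hT : H.SectionΔ lam T) {x : M}
    (v u : H.hor lam x) :
    H.metric x (H.shapeSub lam x v) (H.splitting lam T x u)
      = H.metric x (H.shapeSub lam x u) (H.splitting lam T x v) := by
  obtain ⟨X, hX, hXv⟩ := hs.exists_sectionHor v.2
  obtain ⟨Y, hY, hYu⟩ := hs.exists_sectionHor u.2
  have h1 := hs.lorentz_second_dlc hX.1 hT u
  have h2 := hs.lorentz_second_dlc hY.1 hT v
  -- The two second derivatives differ by the image of the bracket [X,Y], which is orthogonal to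
  -- F_*T.
  have h3 := congrArg (fun z => lorentz z (mvfderiv (𝓡 n) (H.lc P) x (T x)))
    (hs.second_symm hX.1 hY.1 x)
  simp only [lorentz_sub_left] at h3
  rw [hXv, hYu, h1, h2, hs.lorentz_mvfderiv_dlc,
    H.metric_shapeSub P lam x (VectorField.mlieBracket (𝓡 n) X Y x),
    (H.mem_Δ lam).1 (hT.2 x), hXv, hYu] at h3
  have h4 : H.metric x (VectorField.mlieBracket (𝓡 n) X Y x) 0 = 0 := by simp [metric]
  rw [h4] at h3
  linarith

/-! ### The second fundamental form of the congruence -/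

theorem surfMetric_nondeg {y : L} {v : TangentSpace (𝓡 2) y}
    (h : ∀ u, surfMetric s y v u = 0) : v = 0 := hs.eq_zero_of_surfMetric_self (h v)

theorem lorentz_leviCivita_surf {Y : Π y : L, TangentSpace (𝓡 2) y} (hY : SmoothField Y) {y : L}
    (v z : TangentSpace (𝓡 2) y) :
    lorentz (mvfderiv (𝓡 2) s y (leviCivita (surfMetric s) Y y v)) (mvfderiv (𝓡 2) s y z)
      = lorentz (mvfderiv (𝓡 2) (dirDeriv Y s) y v) (mvfderiv (𝓡 2) s y z) :=
  leviCivita_induced (lorentzL (n + 2)) lorentz_comm hs.smooth_surf (fun _ _ _ => rfl)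
    (fun _ => hs.surfMetric_nondeg) hY v z

theorem leviCivita_surf_sub {X Y : Π y : L, TangentSpace (𝓡 2) y} (hX : SmoothField X)
    (hY : SmoothField Y) (y : L) :
    leviCivita (surfMetric s) Y y (X y) - leviCivita (surfMetric s) X y (Y y)
      = VectorField.mlieBracket (𝓡 2) X Y y := by
  rw [← sub_eq_zero]
  apply hs.surfMetric_nondeg
  intro u
  have h1 := congrArg (fun z => lorentz z (mvfderiv (𝓡 2) s y u))
    (mvfderiv_mlieBracket (hs.smooth_surf y) (hX.at y) (hY.at y))
  simp only [lorentz_sub_left] at h1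
  rw [surfMetric, map_sub, map_sub, lorentz_sub_left, lorentz_sub_left, h1,
    hs.lorentz_leviCivita_surf hY, hs.lorentz_leviCivita_surf hX]
  exact sub_self _

theorem surfMetric_comm (y : L) (v u : TangentSpace (𝓡 2) y) :
    surfMetric s y v u = surfMetric s y u v := lorentz_comm _ _

theorem surfSff_symm {X Y : Π y : L, TangentSpace (𝓡 2) y} (hX : SmoothField X)
    (hY : SmoothField Y) (y : L) : surfSff s X Y y = surfSff s Y X y := by
  have h1 := mvfderiv_mlieBracket (hs.smooth_surf y) (hX.at y) (hY.at y)
  rw [← hs.leviCivita_surf_sub hX hY, map_sub] at h1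
  rw [surfSff, surfSff, hs.surfMetric_comm y (X y)]
  congr 1
  have h2 : dirDeriv X (fun z => mvfderiv (𝓡 2) s z (Y z)) y = dirDeriv X (dirDeriv Y s) y := rfl
  have h3 : dirDeriv Y (fun z => mvfderiv (𝓡 2) s z (X z)) y = dirDeriv Y (dirDeriv X s) y := rfl
  rw [h2, h3, sub_eq_sub_iff_sub_eq_sub, ← h1]

omit hs in
-- Only the value of X at the point enters, and linearly. Combined with the symmetry of α',
-- pointwise relations with non-smooth coefficients can be used in either argument.
theorem surfSff_add_smul {X X₁ X₂ Y : Π y : L, TangentSpace (𝓡 2) y} {y : L} {a b : ℝ}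
    (h : X y = a • X₁ y + b • X₂ y) :
    surfSff s X Y y = a • surfSff s X₁ Y y + b • surfSff s X₂ Y y := by
  simp only [surfSff, dirDeriv, h, map_add, map_smul, surfMetric, lorentz_add_left,
    lorentz_smul_left]
  module

theorem lorentz_surfSff_surf {X Y : Π y : L, TangentSpace (𝓡 2) y} (hY : SmoothField Y) (y : L) :
    lorentz (surfSff s X Y y) (s y) = 0 := by
  have h1 := lorentz_mvfderiv_of_const (hs.smooth_surf.dirDeriv hY) hs.smooth_surf (c := 0)
    (fun y => hs.lorentz_dsurf_surf y (Y y)) (X y)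
  rw [surfSff, lorentz_add_left, lorentz_sub_left, lorentz_smul_left, hs.lorentz_dsurf_surf,
    hs.lorentz_surf]
  have h2 : lorentz (dirDeriv X (fun z => mvfderiv (𝓡 2) s z (Y z)) y) (s y)
    = -surfMetric s y (X y) (Y y) := by
    rw [hs.surfMetric_comm]
    exact h1
  rw [h2]
  ring

theorem lorentz_surfSff_dsurf {X Y : Π y : L, TangentSpace (𝓡 2) y} (hY : SmoothField Y) {y : L}
    (v : TangentSpace (𝓡 2) y) :
    lorentz (surfSff s X Y y) (mvfderiv (𝓡 2) s y v) = 0 := by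
  have h3 := lorentz_comm (s y) (mvfderiv (𝓡 2) s y v)
  rw [surfSff, lorentz_add_left, lorentz_sub_left, lorentz_smul_left,
    hs.lorentz_leviCivita_surf hY, h3, hs.lorentz_dsurf_surf]
  simp only [mul_zero, add_zero]
  exact sub_self _

theorem shapeSub_congr {x : M} {v u : TangentSpace (𝓡 n) x}
    (h : mfderiv (𝓡 n) (𝓡 2) π x v = mfderiv (𝓡 n) (𝓡 2) π x u) :
    H.shapeSub lam x v = H.shapeSub lam x u := by
  have h1 : v - u ∈ H.Δ lam x := by
    rw [← hs.mfderiv_eq_zero_iff, map_sub, h, sub_self]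
  have := (H.mem_Δ lam).1 h1
  rwa [map_sub, sub_eq_zero] at this

theorem second_surf_eq {X Y : Π y : L, TangentSpace (𝓡 2) y} (hY : SmoothField Y)
    {x : M} {v : TangentSpace (𝓡 n) x} (hv : mfderiv (𝓡 n) (𝓡 2) π x v = X (π x)) :
    dirDeriv X (dirDeriv Y s) (π x)
      = mvfderiv (𝓡 n) (dirDeriv (hs.liftField Y) (fun x => s (π x))) x v := by
  rw [hs.dirDeriv_comp (hs.mfderiv_liftField Y), hs.mvfderiv_comp_π (hs.smooth_surf.dirDeriv hY),
    hv]
  rfl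

/-- The parts of α' tangent to s and along s are orthogonal to F, so only the flat second derivative
counts. Pairing with F thus recovers A - λI from α'. -/
theorem lorentz_surfSff_lc {X Y : Π y : L, TangentSpace (𝓡 2) y} (hY : SmoothField Y)
    {x : M} {v u : TangentSpace (𝓡 n) x} (hv : mfderiv (𝓡 n) (𝓡 2) π x v = X (π x))
    (hu : mfderiv (𝓡 n) (𝓡 2) π x u = Y (π x)) :
    lorentz (surfSff s X Y (π x)) (H.lc P x) = H.metric x (H.shapeSub lam x u) v := by
  have h1 : dirDeriv X (fun z => mvfderiv (𝓡 2) s z (Y z)) (π x) = _ := hs.second_surf_eq hY hv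
  obtain ⟨z, hz⟩ := hs.surjective_dπ x (leviCivita (surfMetric s) Y (π x) (X (π x)))
  rw [surfSff, h1, lorentz_add_left, lorentz_sub_left, lorentz_smul_left, hs.lorentz_comp_lc,
    hs.lorentz_second_lc (hs.sectionHor_liftField hY).1, ← hz, ← hs.mvfderiv_comp,
    hs.lorentz_mvfderiv_lc, hs.shapeSub_congr ((hs.mfderiv_liftField Y x).trans hu.symm)]
  ring

/-- The correction terms in α' are orthogonal to F_*T as well. Pairing with F_*T recovers the
splitting tensor from α'. -/
theorem lorentz_surfSff_dlc {X Y : Π y : L, TangentSpace (𝓡 2) y} (hY : SmoothField Y)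
    {T : Π x : M, TangentSpace (𝓡 n) x} (hT : H.SectionΔ lam T)
    {x : M} {v : H.hor lam x} {u : TangentSpace (𝓡 n) x}
    (hv : mfderiv (𝓡 n) (𝓡 2) π x v = X (π x))
    (hu : mfderiv (𝓡 n) (𝓡 2) π x u = Y (π x)) :
    lorentz (surfSff s X Y (π x)) (mvfderiv (𝓡 n) (H.lc P) x (T x))
      = -H.metric x (H.shapeSub lam x u) (H.splitting lam T x v) := by
  have h1 : dirDeriv X (fun z => mvfderiv (𝓡 2) s z (Y z)) (π x) = _ := hs.second_surf_eq hY hv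
  obtain ⟨z, hz⟩ := hs.surjective_dπ x (leviCivita (surfMetric s) Y (π x) (X (π x)))
  have h2 : H.metric x z 0 = 0 := by simp [metric]
  rw [surfSff, h1, lorentz_add_left, lorentz_sub_left, lorentz_smul_left, hs.lorentz_comp_dlc,
    hs.lorentz_second_dlc (hs.sectionHor_liftField hY).1 hT, ← hz, ← hs.mvfderiv_comp,
    hs.lorentz_mvfderiv_dlc, H.metric_shapeSub P lam x z, (H.mem_Δ lam).1 (hT.2 x), h2,
    hs.shapeSub_congr ((hs.mfderiv_liftField Y x).trans hu.symm)]
  ring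

end OrientedHypersurface.Envelops

/-! ### Codazzi and Ricci conditions as one flat equation -/

namespace OrientedHypersurface.Envelops

variable {n : ℕ} {M : Type*} [TopologicalSpace M] [T2Space M]
  [ChartedSpace (EuclideanSpace ℝ (Fin n)) M] [IsManifold (𝓡 n) ∞ M]
  {L : Type*} [TopologicalSpace L] [T2Space L]
  [ChartedSpace (EuclideanSpace ℝ (Fin 2)) L] [IsManifold (𝓡 2) ∞ L]
  {H : OrientedHypersurface n M} {lam : M → ℝ}
  {P : LightConeModel (n + 1)} {π : M → L} {s : L → Minkowski (n + 2)}
  (hs : H.Envelops lam P π s)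
include hs

theorem hess_symm {X Y : Π x : M, TangentSpace (𝓡 n) x} (hX : SmoothField X)
    (hY : SmoothField Y) (x : M) : hess H.metric lam X Y x = hess H.metric lam Y X x := by
  have h1 := mvfderiv_mlieBracket (hs.smooth_lam x) (hX.at x) (hY.at x)
  rw [← H.leviCivita_sub P hX hY, map_sub] at h1
  simp only [hess]
  linarith

/-- The derivative of the image of `D Y` under the differential of the congruence. -/
theorem mvfderiv_dirDeriv_extend {Z : Π x : M, TangentSpace (𝓡 n) x} (hZ : SmoothField Z) (x : M)
    (v : TangentSpace (𝓡 n) x) :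
    mvfderiv (𝓡 n) (dirDeriv Z (fun x => s (π x))) x v
      = -mvfderiv (𝓡 n) (H.lc P) x
          (leviCivita H.metric (fun y => H.shapeSub lam y (Z y)) x v - dirDeriv Z lam x • v)
        - H.metric x (H.shape x v) (H.shapeSub lam x (Z x)) • H.xi P x
        + H.metric x v (H.shapeSub lam x (Z x)) • P.w
        + mvfderiv (𝓡 n) (dirDeriv Z lam) x v • H.lc P x := by
  have hBZ := hs.smoothField_shapeSub hZ
  have h1 : dirDeriv Z (fun x => s (π x))
      = fun x => dirDeriv Z lam x • H.lc P x - dirDeriv (fun y => H.shapeSub lam y (Z y)) (H.lc P) x := by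
    funext x
    simp only [dirDeriv]
    rw [hs.mvfderiv_eq]
    abel
  have hl := (hs.smooth_lam.dirDeriv hZ x).mdifferentiableAt (n := ∞) (by simp)
  have hF := (H.smooth_lc P x).mdifferentiableAt (n := ∞) (by simp)
  have hlF : MDifferentiableAt (𝓡 n) 𝓘(ℝ, Minkowski (n + 2))
      (fun x => dirDeriv Z lam x • H.lc P x) x := hl.smul hF
  have hd : MDifferentiableAt (𝓡 n) 𝓘(ℝ, Minkowski (n + 2))
      (fun x => dirDeriv (fun y => H.shapeSub lam y (Z y)) (H.lc P) x) x :=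
    ((H.smooth_lc P).dirDeriv hBZ x).mdifferentiableAt (n := ∞) (by simp)
  have h2 : mvfderiv (𝓡 n) (fun x => dirDeriv Z lam x • H.lc P x
        - dirDeriv (fun y => H.shapeSub lam y (Z y)) (H.lc P) x) x v
      = mvfderiv (𝓡 n) (fun x => dirDeriv Z lam x • H.lc P x) x v
        - mvfderiv (𝓡 n) (dirDeriv (fun y => H.shapeSub lam y (Z y)) (H.lc P)) x v := by
    rw [mvfderiv_fun_sub hlF hd]
    rfl
  rw [h1, h2, mvfderiv_smul_vec hl hF, H.gauss P hBZ, map_sub, map_smul]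
  module

variable {D : Π x : M, H.hor lam x →ₗ[ℝ] H.hor lam x}

/-- Antisymmetrise the second derivatives of s ∘ π and rewrite the bracket as ∇_X Y - ∇_Y X. The
components in the frame F_*TM, ξ, w, F then show the Codazzi-type expression as tangential part and
the Ricci-type one as coefficient of F. -/
theorem extDerivVec_extend (hD : H.SmoothHorEnd lam D) {X Y : Π x : M, TangentSpace (𝓡 n) x}
    (hX : SmoothField X) (hY : SmoothField Y) (x : M) :
    extDerivVec (fun x => (mvfderiv (𝓡 n) (fun x => s (π x)) x).toLinearMap ∘ₗ H.extend lam D x)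
      X Y x
    = -mvfderiv (𝓡 n) (H.lc P) x
        (covEnd H.metric (H.shapeD lam D) X Y x - covEnd H.metric (H.shapeD lam D) Y X x
          - (mvfderiv (𝓡 n) lam x (H.extend lam D x (Y x)) • X x
            - mvfderiv (𝓡 n) lam x (H.extend lam D x (X x)) • Y x))
      - (H.metric x (H.shape x (X x)) (H.shapeD lam D x (Y x))
          - H.metric x (H.shape x (Y x)) (H.shapeD lam D x (X x))) • H.xi P x
      + (H.metric x (X x) (H.shapeD lam D x (Y x))
          - H.metric x (Y x) (H.shapeD lam D x (X x))) • P.w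
      + (hess H.metric lam X (fun y => H.extend lam D y (Y y)) x
          - hess H.metric lam (fun y => H.extend lam D y (X y)) Y x
          + mvfderiv (𝓡 n) lam x
            (covEnd H.metric (H.extend lam D) X Y x - covEnd H.metric (H.extend lam D) Y X x))
        • H.lc P x := by
  have hDX := hD X hX
  have hDY := hD Y hY
  have e1 := hs.mvfderiv_dirDeriv_extend hDX x (Y x)
  have e2 := hs.mvfderiv_dirDeriv_extend hDY x (X x)
  rw [hs.hess_symm hDX hY]
  have e3 : extDerivVec (fun x => (mvfderiv (𝓡 n) (fun x => s (π x)) x).toLinearMap ∘ₗ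
      H.extend lam D x) X Y x
    = mvfderiv (𝓡 n) (dirDeriv (fun y => H.extend lam D y (Y y)) (fun x => s (π x))) x (X x)
      - mvfderiv (𝓡 n) (dirDeriv (fun y => H.extend lam D y (X y)) (fun x => s (π x))) x (Y x)
      - mvfderiv (𝓡 n) (fun x => s (π x)) x (H.extend lam D x
        (VectorField.mlieBracket (𝓡 n) X Y x)) := rfl
  rw [e3, e1, e2, hs.mvfderiv_eq, ← H.leviCivita_sub P hX hY]
  simp only [covEnd, shapeD, LinearMap.comp_apply, map_sub, map_smul, hess, dirDeriv]
  module

/-- The Codazzi- and Ricci-type conditions together form a single flat equation. -/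
theorem codazzi_ricci_iff (hD : H.SmoothHorEnd lam D)
    (hsym : ∀ x (v u : H.hor lam x),
      H.metric x (v : TangentSpace (𝓡 n) x) (H.shapeD lam D x u)
        = H.metric x (u : TangentSpace (𝓡 n) x) (H.shapeD lam D x v))
    (D' : Π x : M, H.hor lam x →ₗ[ℝ] H.hor lam x)
    (ψ : Π x : M, TangentSpace (𝓡 n) x →ₗ[ℝ] ℝ) (ε : ℝ) :
    (H.CodazziCond lam D D' ψ ε ∧ H.RicciCond lam D D' ψ ε) ↔
      ∀ X Y : Π x : M, TangentSpace (𝓡 n) x, H.SectionHor lam X → H.SectionHor lam Y → ∀ x,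
        extDerivVec (fun x => (mvfderiv (𝓡 n) (fun x => s (π x)) x).toLinearMap ∘ₗ
            H.extend lam D x) X Y x
          = ε • (ψ x (X x) • mvfderiv (𝓡 n) (fun x => s (π x)) x (H.extend lam D' x (Y x))
              - ψ x (Y x) • mvfderiv (𝓡 n) (fun x => s (π x)) x (H.extend lam D' x (X x)))
            - (H.metric x (H.shapeSub lam x (X x)) (H.shapeD lam D x (Y x))
              - H.metric x (H.shapeSub lam x (Y x)) (H.shapeD lam D x (X x))) • s (π x) := by
  -- Symmetry of (A - λI)D removes the w-component. Adding the multiple of s = ξ + λF cancels the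
  -- ξ-component and contributes to the F-component exactly the right-hand side of the Ricci-type
  -- condition.
  have key : ∀ X Y : Π x : M, TangentSpace (𝓡 n) x, H.SectionHor lam X → H.SectionHor lam Y → ∀ x,
      extDerivVec (fun x => (mvfderiv (𝓡 n) (fun x => s (π x)) x).toLinearMap ∘ₗ
            H.extend lam D x) X Y x
          - (ε • (ψ x (X x) • mvfderiv (𝓡 n) (fun x => s (π x)) x (H.extend lam D' x (Y x))
              - ψ x (Y x) • mvfderiv (𝓡 n) (fun x => s (π x)) x (H.extend lam D' x (X x)))
            - (H.metric x (H.shapeSub lam x (X x)) (H.shapeD lam D x (Y x))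
              - H.metric x (H.shapeSub lam x (Y x)) (H.shapeD lam D x (X x))) • s (π x))
      = -mvfderiv (𝓡 n) (H.lc P) x
        ((covEnd H.metric (H.shapeD lam D) X Y x - covEnd H.metric (H.shapeD lam D) Y X x)
          - ((mvfderiv (𝓡 n) lam x (H.extend lam D x (Y x)) • X x
          - mvfderiv (𝓡 n) lam x (H.extend lam D x (X x)) • Y x)
        + ε • (ψ x (X x) • H.shapeD lam D' x (Y x) - ψ x (Y x) • H.shapeD lam D' x (X x))))
        + (lam x * (H.metric x (H.shape x (X x)) (H.shapeD lam D x (Y x))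
        - H.metric x (H.shapeD lam D x (X x)) (H.shape x (Y x)))
          - (mvfderiv (𝓡 n) lam x
        (covEnd H.metric (H.extend lam D) Y X x - covEnd H.metric (H.extend lam D) X Y x)
      + hess H.metric lam (fun y => H.extend lam D y (X y)) Y x
      - hess H.metric lam X (fun y => H.extend lam D y (Y y)) x
      + ε * ψ x (X x) * mvfderiv (𝓡 n) lam x (H.extend lam D' x (Y x))
      - ε * ψ x (Y x) * mvfderiv (𝓡 n) lam x (H.extend lam D' x (X x)))) • H.lc P x := by
    intro X Y hX hY x
    have h1 := hsym x ⟨X x, hX.2 x⟩ ⟨Y x, hY.2 x⟩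
    have hA : ∀ v, H.shape x v = H.shapeSub lam x v + lam x • v := fun v => by
      simp [shapeSub]
    rw [hs.extDerivVec_extend hD hX.1 hY.1, hs.comp_eq, hs.mvfderiv_eq, hs.mvfderiv_eq,
      H.metric_comm x (H.shapeD lam D x (X x)), hA, hA]
    simp only [H.metric_add_left, H.metric_smul_left] at h1 ⊢
    rw [h1]
    simp only [shapeD, LinearMap.comp_apply, map_sub, map_add, map_smul]
    module
  constructor
  · rintro ⟨h1, h2⟩ X Y hX hY x
    have h := key X Y hX hY x
    rw [h1 X Y hX hY x, h2 X Y hX hY x, sub_self, sub_self, map_zero, neg_zero, zero_smul,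
      zero_add] at h
    exact sub_eq_zero.1 h
  · intro h
    have h0 : ∀ X Y : Π x : M, TangentSpace (𝓡 n) x, H.SectionHor lam X → H.SectionHor lam Y →
        ∀ x, _ ∧ _ := fun X Y hX hY x => by
      have h1 := key X Y hX hY x
      rw [h X Y hX hY x, sub_self] at h1
      -- The product with w reads off the coefficient of F; the tangential part then vanishes by
      -- injectivity of F_*.
      have h2 := congrArg (fun z => lorentz z P.w) h1
      simp only [lorentz_zero_left, lorentz_add_left, lorentz_neg_left, lorentz_smul_left,
        H.lorentz_dlc_w, H.lorentz_lc_w, neg_zero, zero_add, mul_one] at h2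
      rw [← h2, zero_smul, add_zero, eq_comm, neg_eq_zero] at h1
      refine And.intro (sub_eq_zero.1 (H.lc_injective P x (h1.trans (map_zero _).symm))) ?_
      exact (sub_eq_zero.1 h2.symm).symm
    exact ⟨fun X Y hX hY x => (h0 X Y hX hY x).1, fun X Y hX hY x => (h0 X Y hX hY x).2⟩

/-- The symmetry of α' with respect to D₁ cancels the normal parts of X(s_* D₁Y) - Y(s_* D₁X). What
is left is the tangential Codazzi expression and a multiple of s from the position of the surface in
the de Sitter sphere. -/
theorem surfCodazzi_iff {D₁ D₂ : Π y : L, TangentSpace (𝓡 2) y →ₗ[ℝ] TangentSpace (𝓡 2) y}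
    (hD : SmoothEnd D₁)
    (hsym : ∀ X Y, SmoothField X → SmoothField Y → ∀ y,
      surfSff s X (fun z => D₁ z (Y z)) y = surfSff s (fun z => D₁ z (X z)) Y y)
    (ψ : Π y : L, TangentSpace (𝓡 2) y →ₗ[ℝ] ℝ) (ε : ℝ) :
    SurfCodazziCond s D₁ D₂ ψ ε ↔ ∀ X Y, SmoothField X → SmoothField Y → ∀ y,
      extDerivVec (fun y => (mvfderiv (𝓡 2) s y).toLinearMap ∘ₗ D₁ y) X Y y
        = ε • (ψ y (X y) • mvfderiv (𝓡 2) s y (D₂ y (Y y))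
            - ψ y (Y y) • mvfderiv (𝓡 2) s y (D₂ y (X y)))
          - (surfMetric s y (X y) (D₁ y (Y y)) - surfMetric s y (Y y) (D₁ y (X y))) • s y := by
  have key : ∀ X Y, SmoothField X → SmoothField Y → ∀ y,
      extDerivVec (fun y => (mvfderiv (𝓡 2) s y).toLinearMap ∘ₗ D₁ y) X Y y
        = mvfderiv (𝓡 2) s y (covEnd (surfMetric s) D₁ X Y y - covEnd (surfMetric s) D₁ Y X y)
          - (surfMetric s y (X y) (D₁ y (Y y)) - surfMetric s y (Y y) (D₁ y (X y))) • s y := by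
    intro X Y hX hY y
    have h1 := hsym X Y hX hY y
    rw [hs.surfSff_symm (hD X hX) hY] at h1
    have e3 : extDerivVec (fun y => (mvfderiv (𝓡 2) s y).toLinearMap ∘ₗ D₁ y) X Y y
      = dirDeriv X (fun z => mvfderiv (𝓡 2) s z (D₁ z (Y z))) y
        - dirDeriv Y (fun z => mvfderiv (𝓡 2) s z (D₁ z (X z))) y
        - mvfderiv (𝓡 2) s y (D₁ y (VectorField.mlieBracket (𝓡 2) X Y y)) := rfl
    simp only [surfSff] at h1
    rw [e3, ← hs.leviCivita_surf_sub hX hY]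
    simp only [covEnd, map_sub]
    rw [← sub_eq_zero] at h1 ⊢
    rw [← h1]
    module
  constructor
  · intro h X Y hX hY y
    rw [key X Y hX hY y, h X Y hX hY y]
    simp only [map_smul, map_sub]
  · intro h X Y hX hY y
    have h1 := h X Y hX hY y
    rw [key X Y hX hY y, sub_left_inj] at h1
    apply hs.injective_mvfderiv y
    rw [h1]
    simp only [map_smul, map_sub]

end OrientedHypersurface.Envelops

/-! ### Linear algebra of the tensor J on a plane -/

section LinearAlgebra

variable {V W : Type*} [AddCommGroup V] [Module ℝ V] [AddCommGroup W] [Module ℝ W]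

theorem JType.holds_conj (κ : JType) (e : V ≃ₗ[ℝ] W) (J : V →ₗ[ℝ] V) :
    κ.Holds (e.conj J) ↔ κ.Holds J := by
  have h1 : e.conj J ∘ₗ e.conj J = e.conj (J ∘ₗ J) := (e.conj_comp J J).symm
  have h2 : (LinearMap.id : W →ₗ[ℝ] W) = e.conj LinearMap.id := e.conj_id.symm
  cases κ with
  | hyperbolic =>
    simp only [JType.Holds]
    rw [h1, h2, ← map_neg, e.conj.injective.eq_iff, e.conj.injective.ne_iff,
      e.conj.injective.ne_iff]
  | elliptic =>
    simp only [JType.Holds]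
    rw [h1, h2, ← map_neg, e.conj.injective.eq_iff]

theorem mem_span_id_conj (e : V ≃ₗ[ℝ] W) (D J : V →ₗ[ℝ] V) :
    e.conj D ∈ Submodule.span ℝ {LinearMap.id, e.conj J}
      ↔ D ∈ Submodule.span ℝ {LinearMap.id, J} := by
  have h2 : (LinearMap.id : W →ₗ[ℝ] W) = e.conj LinearMap.id := e.conj_id.symm
  simp only [Submodule.mem_span_pair]
  rw [h2]
  simp only [← map_smul, ← map_add, e.conj.injective.eq_iff]

theorem det_linearEquiv_conj (e : V ≃ₗ[ℝ] W) (D : V →ₗ[ℝ] V) :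
    LinearMap.det (e.conj D) = LinearMap.det D := by
  rw [LinearEquiv.conj_apply, LinearMap.comp_assoc, LinearMap.det_conj]

theorem finrank_range_conj (e : V ≃ₗ[ℝ] W) (D : V →ₗ[ℝ] V) :
    Module.finrank ℝ (LinearMap.range (e.conj D)) = Module.finrank ℝ (LinearMap.range D) := by
  rw [LinearEquiv.conj_apply, LinearMap.range_comp_of_range_eq_top _ (LinearEquiv.range _),
    LinearMap.range_comp]
  exact LinearEquiv.finrank_map_eq e _

/-- If every vector were an eigenvector, J would be a scalar c. Then c² = 1 gives J = ±I, excluded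
in the hyperbolic case, and c² = -1 is impossible over the reals. -/
theorem JType.Holds.exists_linearIndependent {κ : JType} {J : V →ₗ[ℝ] V} (hJ : κ.Holds J)
    [FiniteDimensional ℝ V] (hV : Module.finrank ℝ V = 2) :
    ∃ v, LinearIndependent ℝ ![v, J v] := by
  by_contra! h
  obtain ⟨c, hc⟩ := LinearMap.exists_eq_smul_id_of_forall_notLinearIndependent h
  replace hc : J = c • LinearMap.id := hc
  have hn : Nontrivial V := Module.nontrivial_of_finrank_pos (R := ℝ) (by omega)
  obtain ⟨v, hv⟩ := exists_ne (0 : V)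
  cases κ with
  | hyperbolic =>
    obtain ⟨h1, h2, h3⟩ := hJ
    have h4 := LinearMap.congr_fun h1 v
    rw [hc] at h4
    simp only [LinearMap.comp_apply, LinearMap.smul_apply, LinearMap.id_apply, smul_smul] at h4
    have h5 : c * c = 1 := by
      have : (c * c - 1) • v = 0 := by rw [sub_smul, h4, one_smul, sub_self]
      rcases smul_eq_zero.1 this with h | h
      · linarith
      · exact absurd h hv
    rcases mul_self_eq_one_iff.1 h5 with h | h
    · exact h2 (by rw [hc, h, one_smul])
    · exact h3 (by rw [hc, h, neg_one_smul])
  | elliptic =>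
    have h4 := LinearMap.congr_fun (show J ∘ₗ J = -LinearMap.id from hJ) v
    rw [hc] at h4
    simp only [LinearMap.comp_apply, LinearMap.smul_apply, LinearMap.id_apply, smul_smul,
      LinearMap.neg_apply] at h4
    have : (c * c + 1) • v = 0 := by rw [add_smul, h4, one_smul, neg_add_cancel]
    rcases smul_eq_zero.1 this with h | h
    · nlinarith [mul_self_nonneg c]
    · exact hv h

/-- In dimension two the endomorphisms that commute with a non-scalar one are its polynomials. -/
theorem mem_span_id_of_commute {κ : JType} {J C : V →ₗ[ℝ] V} (hJ : κ.Holds J)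
    [FiniteDimensional ℝ V] (hV : Module.finrank ℝ V = 2) (hC : J ∘ₗ C = C ∘ₗ J) :
    C ∈ Submodule.span ℝ {LinearMap.id, J} := by
  obtain ⟨v, hv⟩ := hJ.exists_linearIndependent hV
  let b := basisOfLinearIndependentOfCardEqFinrank hv (by simp [hV])
  have hb : ⇑b = ![v, J v] := coe_basisOfLinearIndependentOfCardEqFinrank hv _
  have h1 : C v = b.repr (C v) 0 • v + b.repr (C v) 1 • J v := by
    conv_lhs => rw [← b.sum_repr (C v)]
    rw [Fin.sum_univ_two, hb]
    simp
  rw [Submodule.mem_span_pair]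
  refine ⟨b.repr (C v) 0, b.repr (C v) 1, ?_⟩
  apply b.ext
  intro i
  have h2 : C (J v) = J (C v) := (LinearMap.congr_fun hC v).symm
  fin_cases i
  · rw [hb]
    simpa using h1.symm
  · rw [hb]
    have h3 := congrArg J h1
    rw [map_add, map_smul, map_smul] at h3
    simpa [h2] using h3.symm

theorem comp_comm_of_mem_span {J C D : V →ₗ[ℝ] V} (hC : C ∈ Submodule.span ℝ {LinearMap.id, J})
    (hD : D ∈ Submodule.span ℝ {LinearMap.id, J}) : D ∘ₗ C = C ∘ₗ D := by
  obtain ⟨a, b, rfl⟩ := Submodule.mem_span_pair.1 hC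
  obtain ⟨c, d, rfl⟩ := Submodule.mem_span_pair.1 hD
  ext v
  simp only [LinearMap.comp_apply, LinearMap.add_apply, LinearMap.smul_apply, LinearMap.id_apply,
    map_add, map_smul]
  module

end LinearAlgebra

/-! ### From the surface to the hypersurface -/

namespace OrientedHypersurface.Envelops

variable {n : ℕ} {M : Type*} [TopologicalSpace M] [T2Space M]
  [ChartedSpace (EuclideanSpace ℝ (Fin n)) M] [IsManifold (𝓡 n) ∞ M]
  {L : Type*} [TopologicalSpace L] [T2Space L]
  [ChartedSpace (EuclideanSpace ℝ (Fin 2)) L] [IsManifold (𝓡 2) ∞ L]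
  {H : OrientedHypersurface n M} {lam : M → ℝ}
  {P : LightConeModel (n + 1)} {π : M → L} {s : L → Minkowski (n + 2)}
  (hs : H.Envelops lam P π s)
include hs

theorem lift_eq_conj (D' : Π y : L, TangentSpace (𝓡 2) y →ₗ[ℝ] TangentSpace (𝓡 2) y) (x : M) :
    H.lift lam π D' x = (hs.horEquiv x).symm.conj (D' (π x)) := by
  rw [hs.lift_eq]
  rfl

theorem eq_zero_of_metric_shapeSub {x : M} {z : H.hor lam x}
    (h : ∀ u : H.hor lam x, H.metric x (H.shapeSub lam x u) z = 0) : z = 0 := by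
  have h1 : (z : TangentSpace (𝓡 n) x) ∈ H.Δ lam x := by
    rw [H.mem_Δ]
    apply H.eq_zero_of_metric_self
    rw [← H.metric_shapeSub P]
    exact h ⟨_, H.shapeSub_mem_hor P lam x z⟩
  exact Subtype.ext (Submodule.disjoint_def.1 (H.disjoint_hor_Δ lam x) _ z.2 h1)

section Symmetric

variable {D' : Π y : L, TangentSpace (𝓡 2) y →ₗ[ℝ] TangentSpace (𝓡 2) y} (hD : SmoothEnd D')
  (hα : ∀ X Y, SmoothField X → SmoothField Y → ∀ y,
      surfSff s X (fun z => D' z (Y z)) y = surfSff s (fun z => D' z (X z)) Y y)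
include hD hα

/-- The symmetry of α' paired with F. -/
theorem metric_lift (x : M) (v u : H.hor lam x) :
    H.metric x (H.shapeSub lam x (H.lift lam π D' x u)) v
      = H.metric x (H.shapeSub lam x u) (H.lift lam π D' x v) := by
  obtain ⟨X, hX, hXv⟩ := exists_smoothField_apply (π x) (mfderiv (𝓡 n) (𝓡 2) π x v)
  obtain ⟨Y, hY, hYu⟩ := exists_smoothField_apply (π x) (mfderiv (𝓡 n) (𝓡 2) π x u)
  have h1 := congrArg (fun z => lorentz z (H.lc P x)) (hα X Y hX hY (π x))
  rwa [hs.lorentz_surfSff_lc (hD Y hY) hXv.symm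
      (by rw [hs.mfderiv_lift D' x u, hYu]),
    hs.lorentz_surfSff_lc hY (v := H.lift lam π D' x v) (by rw [hs.mfderiv_lift D' x v, hXv])
      hYu.symm] at h1

/-- The symmetry of α' paired with F_*T gives the commutation after (A - λI), and A - λI is
nondegenerate on Δ^⊥. -/
theorem lift_comp_splitting {T : Π x : M, TangentSpace (𝓡 n) x} (hT : H.SectionΔ lam T) (x : M) :
    H.lift lam π D' x ∘ₗ H.splitting lam T x = H.splitting lam T x ∘ₗ H.lift lam π D' x := by
  ext1 v
  rw [← sub_eq_zero]
  apply hs.eq_zero_of_metric_shapeSub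
  intro u
  obtain ⟨X, hX, hXv⟩ := exists_smoothField_apply (π x) (mfderiv (𝓡 n) (𝓡 2) π x v)
  obtain ⟨Y, hY, hYu⟩ := exists_smoothField_apply (π x) (mfderiv (𝓡 n) (𝓡 2) π x u)
  have h1 := congrArg (fun z => lorentz z (mvfderiv (𝓡 n) (H.lc P) x (T x))) (hα X Y hX hY (π x))
  rw [hs.lorentz_surfSff_dlc (hD Y hY) hT hXv.symm
      (by rw [hs.mfderiv_lift D' x u, hYu]),
    hs.lorentz_surfSff_dlc hY hT (v := H.lift lam π D' x v)
      (by rw [hs.mfderiv_lift D' x v, hXv]) hYu.symm, hs.metric_lift hD hα] at h1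
  rw [LinearMap.comp_apply, LinearMap.comp_apply, Submodule.coe_sub, H.metric_sub_right]
  linarith

/-- The horizontal derivative of a lift is its commutator with C_T, which has just been seen to
vanish. -/
theorem horParallel_lift : H.HorParallel lam (H.lift lam π D') := by
  intro T X hT hX x
  have h1 := hs.horDeriv_lift hD hX hT x
  have h2 := LinearMap.congr_fun (hs.lift_comp_splitting hD hα hT x) ⟨X x, hX.2 x⟩
  simp only [LinearMap.comp_apply] at h2
  rw [map_add, h2] at h1
  rw [add_right_cancel h1, sub_self]

theorem shapeD_lift_symm (x : M) (v u : H.hor lam x) :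
    H.metric x (v : TangentSpace (𝓡 n) x) (H.shapeD lam (H.lift lam π D') x u)
      = H.metric x (u : TangentSpace (𝓡 n) x) (H.shapeD lam (H.lift lam π D') x v) := by
  simp only [shapeD, LinearMap.comp_apply, H.extend_apply_of_mem]
  rw [H.metric_comm x v, hs.metric_lift hD hα, H.metric_shapeSub P]

end Symmetric

/-- The condition is linear in the tensor at each point. The coefficients of D' in I and J' may
depend on the point without any smoothness, since α' depends only on values. -/
theorem surfSff_symm_of_mem_span {J' D' : Π y : L, TangentSpace (𝓡 2) y →ₗ[ℝ] TangentSpace (𝓡 2) y}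
    (hJ : SmoothEnd J') (hα : ∀ X Y, SmoothField X → SmoothField Y → ∀ y,
      surfSff s X (fun z => J' z (Y z)) y = surfSff s (fun z => J' z (X z)) Y y)
    (hD : SmoothEnd D') (hm : ∀ y, D' y ∈ Submodule.span ℝ {LinearMap.id, J' y})
    (X Y : Π y : L, TangentSpace (𝓡 2) y) (hX : SmoothField X) (hY : SmoothField Y) (y : L) :
    surfSff s X (fun z => D' z (Y z)) y = surfSff s (fun z => D' z (X z)) Y y := by
  obtain ⟨a, b, hab⟩ := Submodule.mem_span_pair.1 (hm y)
  have h1 : ∀ Z : Π y : L, TangentSpace (𝓡 2) y, D' y (Z y) = a • Z y + b • J' y (Z y) := by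
    intro Z
    rw [← hab]
    rfl
  rw [hs.surfSff_symm hX (hD Y hY),
    surfSff_add_smul (X := fun z => D' z (Y z)) (X₁ := Y) (X₂ := fun z => J' z (Y z)) (h1 Y),
    surfSff_add_smul (X := fun z => D' z (X z)) (X₁ := X) (X₂ := fun z => J' z (X z)) (h1 X),
    hs.surfSff_symm hY hX, hs.surfSff_symm (hJ Y hY) hX, hα X Y hX hY]

/-- C_T commutes with J, and on a plane the commutant of the non-scalar J is span {I, J}. -/
theorem isOfType_lift {κ : JType} {J' : Π y : L, TangentSpace (𝓡 2) y →ₗ[ℝ] TangentSpace (𝓡 2) y}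
    (hJ : SurfIsOfType s κ J') : H.IsOfType lam κ (H.lift lam π J') where
  smooth := hs.smoothHorEnd_lift hJ.smooth
  square x := by
    rw [hs.lift_eq_conj, κ.holds_conj]
    exact hJ.square (π x)
  parallel := hs.horParallel_lift hJ.smooth hJ.sff_symm
  splitting_mem T hT x := by
    refine mem_span_id_of_commute (κ := κ) ?_ (hs.finrank_hor x)
      (hs.lift_comp_splitting hJ.smooth hJ.sff_symm hT x)
    rw [hs.lift_eq_conj, κ.holds_conj]
    exact hJ.square (π x)

theorem pullback_mvfderiv_comp (D' : Π y : L, TangentSpace (𝓡 2) y →ₗ[ℝ] TangentSpace (𝓡 2) y) :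
    (fun x => (mvfderiv (𝓡 n) (fun x => s (π x)) x).toLinearMap ∘ₗ
        H.extend lam (H.lift lam π D') x)
      = fun x => ((mvfderiv (𝓡 2) s (π x)).toLinearMap ∘ₗ D' (π x)) ∘ₗ
        (mfderiv (𝓡 n) (𝓡 2) π x).toLinearMap := by
  funext x
  ext1 v
  change mvfderiv (𝓡 n) (fun x => s (π x)) x (H.extend lam (H.lift lam π D') x v) = _
  rw [hs.mvfderiv_comp, hs.mfderiv_extend_lift]
  rfl

theorem metric_shapeD_lift (D' : Π y : L, TangentSpace (𝓡 2) y →ₗ[ℝ] TangentSpace (𝓡 2) y)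
    (x : M) (v u : TangentSpace (𝓡 n) x) :
    H.metric x (H.shapeSub lam x v) (H.shapeD lam (H.lift lam π D') x u)
      = surfMetric s (π x) (mfderiv (𝓡 n) (𝓡 2) π x v)
        (D' (π x) (mfderiv (𝓡 n) (𝓡 2) π x u)) := by
  rw [shapeD, LinearMap.comp_apply, ← hs.surfMetric_mfderiv, hs.mfderiv_extend_lift]

/-- The conditions on a triple on `L` and on its lift are equivalent. -/
theorem codazzi_ricci_lift_iff
    {D₁ D₂ : Π y : L, TangentSpace (𝓡 2) y →ₗ[ℝ] TangentSpace (𝓡 2) y} (hD : SmoothEnd D₁)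
    (hα : ∀ X Y, SmoothField X → SmoothField Y → ∀ y,
      surfSff s X (fun z => D₁ z (Y z)) y = surfSff s (fun z => D₁ z (X z)) Y y)
    (ψ : Π y : L, TangentSpace (𝓡 2) y →ₗ[ℝ] ℝ) (ε : ℝ) :
    (H.CodazziCond lam (H.lift lam π D₁) (H.lift lam π D₂) (liftForm π ψ) ε ∧
      H.RicciCond lam (H.lift lam π D₁) (H.lift lam π D₂) (liftForm π ψ) ε) ↔
      SurfCodazziCond s D₁ D₂ ψ ε := by
  rw [hs.codazzi_ricci_iff (hs.smoothHorEnd_lift hD) (hs.shapeD_lift_symm hD hα),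
    hs.surfCodazzi_iff hD hα, hs.pullback_mvfderiv_comp]
  have hψ : ∀ x (v : TangentSpace (𝓡 n) x),
    liftForm π ψ x v = ψ (π x) (mfderiv (𝓡 n) (𝓡 2) π x v) := fun _ _ => rfl
  constructor
  · intro h X Y hX hY y
    obtain ⟨x, rfl⟩ := hs.surjective y
    have h1 := h _ _ (hs.sectionHor_liftField hX) (hs.sectionHor_liftField hY) x
    rwa [hs.extDerivVec_pullback (hs.smoothVecForm_comp hD) (hs.sectionHor_liftField hX).1
      (hs.sectionHor_liftField hY).1 hX hY (hs.mfderiv_liftField X x) (hs.mfderiv_liftField Y x),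
      hs.metric_shapeD_lift, hs.metric_shapeD_lift, hs.mvfderiv_comp, hs.mvfderiv_comp,
      hs.mfderiv_extend_lift, hs.mfderiv_extend_lift, hψ, hψ, hs.mfderiv_liftField,
      hs.mfderiv_liftField] at h1
  · intro h X Y hX hY x
    obtain ⟨X', hX', hXv⟩ := exists_smoothField_apply (π x) (mfderiv (𝓡 n) (𝓡 2) π x (X x))
    obtain ⟨Y', hY', hYu⟩ := exists_smoothField_apply (π x) (mfderiv (𝓡 n) (𝓡 2) π x (Y x))
    have h1 := h _ _ hX' hY' (π x)
    rw [hs.extDerivVec_pullback (hs.smoothVecForm_comp hD) hX.1 hY.1 hX' hY' hXv.symm hYu.symm,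
      hs.metric_shapeD_lift, hs.metric_shapeD_lift, hs.mvfderiv_comp, hs.mvfderiv_comp,
      hs.mfderiv_extend_lift, hs.mfderiv_extend_lift, hψ, hψ, ← hXv, ← hYu]
    exact h1

/-- Each (A - λI)D_i is symmetric, so the commutator can be distributed over both arguments, and A -
λI carries the products on M to the metric of s. -/
theorem metric_commutator {D₁ D₂ : Π y : L, TangentSpace (𝓡 2) y →ₗ[ℝ] TangentSpace (𝓡 2) y}
    (hD₁ : SmoothEnd D₁) (hD₂ : SmoothEnd D₂)
    (hα₁ : ∀ X Y, SmoothField X → SmoothField Y → ∀ y,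
      surfSff s X (fun z => D₁ z (Y z)) y = surfSff s (fun z => D₁ z (X z)) Y y)
    (hα₂ : ∀ X Y, SmoothField X → SmoothField Y → ∀ y,
      surfSff s X (fun z => D₂ z (Y z)) y = surfSff s (fun z => D₂ z (X z)) Y y)
    (x : M) (v u : H.hor lam x) :
    H.metric x (H.shapeD lam (H.lift lam π D₁) x (H.shapeD lam (H.lift lam π D₂) x v)
        - H.shapeD lam (H.lift lam π D₂) x (H.shapeD lam (H.lift lam π D₁) x v)) u
      = surfMetric s (π x) (D₂ (π x) (mfderiv (𝓡 n) (𝓡 2) π x v))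
          (D₁ (π x) (mfderiv (𝓡 n) (𝓡 2) π x u))
        - surfMetric s (π x) (D₁ (π x) (mfderiv (𝓡 n) (𝓡 2) π x v))
          (D₂ (π x) (mfderiv (𝓡 n) (𝓡 2) π x u)) := by
  have h1 := hs.shapeD_lift_symm hD₁ hα₁ x u
    ⟨_, H.shapeSub_mem_hor P lam x (H.extend lam (H.lift lam π D₂) x v)⟩
  have h2 := hs.shapeD_lift_symm hD₂ hα₂ x u
    ⟨_, H.shapeSub_mem_hor P lam x (H.extend lam (H.lift lam π D₁) x v)⟩
  simp only at h1 h2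
  rw [hs.metric_shapeD_lift, hs.mfderiv_extend_lift] at h1 h2
  rw [H.metric_sub_left, H.metric_comm x _ u, H.metric_comm x _ u]
  exact congrArg₂ (· - ·) h1 h2

theorem isTriple_lift {κ : JType}
    {J' D₁ D₂ : Π y : L, TangentSpace (𝓡 2) y →ₗ[ℝ] TangentSpace (𝓡 2) y}
    {ψ : Π y : L, TangentSpace (𝓡 2) y →ₗ[ℝ] ℝ} (hJ : SurfIsOfType s κ J')
    (h : SurfIsTriple s J' D₁ D₂ ψ) :
    H.IsTriple lam (H.lift lam π J') (H.lift lam π D₁) (H.lift lam π D₂) (liftForm π ψ) := by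
  have hα₁ := hs.surfSff_symm_of_mem_span hJ.smooth hJ.sff_symm h.smooth_D₁ h.mem_D₁
  have hα₂ := hs.surfSff_symm_of_mem_span hJ.smooth hJ.sff_symm h.smooth_D₂ h.mem_D₂
  have hc₁ := (hs.codazzi_ricci_lift_iff h.smooth_D₁ hα₁ (D₂ := D₂) ψ 1).2 h.b.1
  have hc₂ := (hs.codazzi_ricci_lift_iff h.smooth_D₂ hα₂ (D₂ := D₁) ψ (-1)).2 h.b.2
  have hψ : SmoothVecForm ψ := h.smooth_ψ
  refine ⟨hs.smoothHorEnd_lift h.smooth_D₁, hs.smoothHorEnd_lift h.smooth_D₂,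
    hψ.pullback hs.smooth_π, fun x => ?_, fun x => ?_, ?_⟩
  · rw [hs.lift_eq_conj, hs.lift_eq_conj, mem_span_id_conj]
    exact h.mem_D₁ _
  · rw [hs.lift_eq_conj, hs.lift_eq_conj, mem_span_id_conj]
    exact h.mem_D₂ _
  · refine ⟨fun x t ht => ?_, fun x => ?_, ⟨hs.horParallel_lift h.smooth_D₁ hα₁,
      hs.horParallel_lift h.smooth_D₂ hα₂⟩, fun T hT x =>
      ⟨hs.lift_comp_splitting h.smooth_D₁ hα₁ hT x, hs.lift_comp_splitting h.smooth_D₂ hα₂ hT x⟩,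
      ⟨hc₁.1, hc₂.1⟩, ⟨hc₁.2, hc₂.2⟩, fun Z T hZ hT x => ?_, fun X Y hX hY x => ?_, fun x => ?_,
      fun x => ?_⟩
    · rw [LinearMap.mem_ker]
      change ψ (π x) (mfderiv (𝓡 n) (𝓡 2) π x t) = 0
      rw [hs.mfderiv_eq_zero_iff.2 ht, map_zero]
    · rw [hs.lift_eq_conj, hs.lift_eq_conj, det_linearEquiv_conj, det_linearEquiv_conj]
      exact h.a _
    · have h1 := hs.extDerivVec_pullback_Δ hψ hZ hT x
      rw [extDerivVec_swap, neg_eq_zero] at h1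
      exact h1
    · obtain ⟨X', hX', hXv⟩ := exists_smoothField_apply (π x) (mfderiv (𝓡 n) (𝓡 2) π x (X x))
      obtain ⟨Y', hY', hYu⟩ := exists_smoothField_apply (π x) (mfderiv (𝓡 n) (𝓡 2) π x (Y x))
      have h1 := hs.metric_commutator h.smooth_D₁ h.smooth_D₂ hα₁ hα₂ x ⟨X x, hX.2 x⟩
        ⟨Y x, hY.2 x⟩
      rw [← hXv, ← hYu, ← h.c X' Y' hX' hY' (π x)] at h1
      refine Eq.trans ?_ h1.symm
      exact hs.extDerivVec_pullback hψ hX.1 hY.1 hX' hY' hXv.symm hYu.symm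
    · rw [hs.lift_eq_conj, hs.lift_eq_conj, ← LinearEquiv.conj_comp, ← LinearEquiv.conj_comp,
        ← map_neg, (LinearEquiv.conj _).injective.ne_iff, (LinearEquiv.conj _).injective.ne_iff]
      exact h.d _
    · have h2 : (LinearMap.id : H.hor lam x →ₗ[ℝ] H.hor lam x)
        = (hs.horEquiv x).symm.conj LinearMap.id := (LinearEquiv.conj_id _).symm
      rw [hs.lift_eq_conj, hs.lift_eq_conj, ← LinearEquiv.conj_comp, ← LinearEquiv.conj_comp, h2,
        ← map_add, ← map_sub, finrank_range_conj]
      exact h.e _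

end OrientedHypersurface.Envelops

/-- The identification of the tangent spaces at equal points. -/
noncomputable def tangentCast {m : ℕ} {L : Type*} [TopologicalSpace L]
    [ChartedSpace (EuclideanSpace ℝ (Fin m)) L] {y y' : L} (h : y = y') :
    TangentSpace (𝓡 m) y' →ₗ[ℝ] TangentSpace (𝓡 m) y :=
  Eq.rec (motive := fun z _ => TangentSpace (𝓡 m) z →ₗ[ℝ] TangentSpace (𝓡 m) y) LinearMap.id h

theorem tangentCast_apply {m : ℕ} {L : Type*} [TopologicalSpace L]
    [ChartedSpace (EuclideanSpace ℝ (Fin m)) L] {y y' : L} (h : y = y')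
    (X : Π y : L, TangentSpace (𝓡 m) y) : tangentCast h (X y') = X y := by
  subst h; rfl

/-! ### From the hypersurface to the surface -/

namespace OrientedHypersurface.Envelops

variable {n : ℕ} {M : Type*} [TopologicalSpace M] [T2Space M]
  [ChartedSpace (EuclideanSpace ℝ (Fin n)) M] [IsManifold (𝓡 n) ∞ M]
  {L : Type*} [TopologicalSpace L] [T2Space L]
  [ChartedSpace (EuclideanSpace ℝ (Fin 2)) L] [IsManifold (𝓡 2) ∞ L]
  {H : OrientedHypersurface n M} {lam : M → ℝ}
  {P : LightConeModel (n + 1)} {π : M → L} {s : L → Minkowski (n + 2)}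
  (hs : H.Envelops lam P π s)
include hs

theorem exists_descent {F : Type} [NormedAddCommGroup F] [NormedSpace ℝ F]
    {u : M → F} (hu : ContMDiff (𝓡 n) 𝓘(ℝ, F) ∞ u)
    (hΔ : ∀ T, H.SectionΔ lam T → ∀ x, mvfderiv (𝓡 n) u x (T x) = 0) :
    ∃ u' : L → F, ContMDiff (𝓡 2) 𝓘(ℝ, F) ∞ u' ∧ ∀ x, u x = u' (π x) := by
  refine _root_.exists_descent hs.smooth_π hs.surjective_dπ hs.connected_fibre hu fun x v hv => ?_
  obtain ⟨T, hT, rfl⟩ := hs.exists_sectionΔ (hs.mfderiv_eq_zero_iff.1 hv)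
  exact hΔ T hT x

/-- The image s_* π_* of a lifted field is constant along the leaves. Equivalently, the bracket of a
section of Δ with a lifted field is vertical. -/
theorem horProj_leviCivita_liftField {X : Π y : L, TangentSpace (𝓡 2) y} (hX : SmoothField X)
    {T : Π x : M, TangentSpace (𝓡 n) x} (hT : H.SectionΔ lam T) (x : M) :
    H.horProj lam x (leviCivita H.metric (hs.liftField X) x (T x))
      + H.splitting lam T x ⟨hs.liftField X x, (hs.sectionHor_liftField hX).2 x⟩ = 0 := by
  have h1 := hs.mvfderiv_dirDeriv_of_Δ (hs.sectionHor_liftField hX) hT x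
  rw [hs.dirDeriv_comp (hs.mfderiv_liftField X), hs.mvfderiv_comp_π (hs.smooth_surf.dirDeriv hX),
    hs.mfderiv_eq_zero_iff.2 (hT.2 x), map_zero] at h1
  have h2 := hs.injective_mvfderiv _ (h1.symm.trans (map_zero _).symm)
  exact (hs.horEquiv x).injective (h2.trans (map_zero _).symm)

/-- Tensors that are parallel along `Δ` and commute with the splitting tensor are projectable. -/
theorem exists_eq_lift {D : Π x : M, H.hor lam x →ₗ[ℝ] H.hor lam x} (hD : H.SmoothHorEnd lam D)
    (hpar : H.HorParallel lam D)
    (hcomm : ∀ T, H.SectionΔ lam T → ∀ x,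
      D x ∘ₗ H.splitting lam T x = H.splitting lam T x ∘ₗ D x) :
    ∃ D' : Π y : L, TangentSpace (𝓡 2) y →ₗ[ℝ] TangentSpace (𝓡 2) y,
      SmoothEnd D' ∧ D = H.lift lam π D' := by
  have hdesc : ∀ X : Π y : L, TangentSpace (𝓡 2) y, SmoothField X →
      ∃ u' : L → Minkowski (n + 2), ContMDiff (𝓡 2) 𝓘(ℝ, Minkowski (n + 2)) ∞ u' ∧
        ∀ x, mvfderiv (𝓡 n) (fun x => s (π x)) x (H.extend lam D x (hs.liftField X x))
          = u' (π x) := by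
    intro X hX
    have hX' := hs.sectionHor_liftField hX
    have hDX := hs.SectionHor_extend hD hX'.1
    -- The derivative along T is the image of (∇_T D X)^h + C_T D X. By parallelism and commutation
    -- this is D applied to (∇_T X)^h + C_T X, which is zero for a lifted field.
    refine hs.exists_descent (hs.smooth_comp.dirDeriv hDX.1) fun T hT x => ?_
    refine (hs.mvfderiv_dirDeriv_of_Δ hDX hT x).trans ?_
    have h1 := hpar T _ hT hX' x
    have h2 := LinearMap.congr_fun (hcomm T hT x) ⟨_, hX'.2 x⟩
    have h3 : (⟨H.extend lam D x (hs.liftField X x), hDX.2 x⟩ : H.hor lam x)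
        = D x ⟨_, hX'.2 x⟩ := Subtype.ext (H.extend_apply_of_mem lam D ⟨_, hX'.2 x⟩)
    simp only [LinearMap.comp_apply] at h2
    rw [sub_eq_zero] at h1
    rw [h3, ← h2, h1, ← map_add, hs.horProj_leviCivita_liftField hX hT, map_zero, map_zero,
      map_zero]
  -- D' is built at `y` from a chosen point of the fibre. `hval` shows that its values on smooth
  -- fields are the descended functions, so the choice does not matter. `tangentCast` is needed as
  -- `π (r y)` and `y` are only propositionally equal.
  choose r hr using hs.surjective
  let D' : Π y : L, TangentSpace (𝓡 2) y →ₗ[ℝ] TangentSpace (𝓡 2) y := fun y =>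
    (mfderiv (𝓡 n) (𝓡 2) π (r y)).toLinearMap ∘ₗ (H.hor lam (r y)).subtype ∘ₗ D (r y) ∘ₗ
      ((hs.horEquiv (r y)).symm.toLinearMap ∘ₗ tangentCast (hr y))
  have hval : ∀ (X : Π y : L, TangentSpace (𝓡 2) y), SmoothField X → ∀ u' : L → Minkowski (n + 2),
      (∀ x, mvfderiv (𝓡 n) (fun x => s (π x)) x (H.extend lam D x (hs.liftField X x))
          = u' (π x)) → ∀ y, mvfderiv (𝓡 2) s y (D' y (X y)) = u' y := by
    intro X hX u' hu' y
    have h1 := hu' (r y)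
    rw [hs.mvfderiv_comp, hr] at h1
    refine Eq.trans ?_ h1
    have h3 : D (r y) ((hs.horEquiv (r y)).symm (tangentCast (hr y) (X y)))
        = H.extend lam D (r y) (hs.liftField X (r y)) := by
      rw [tangentCast_apply (hr y) X]
      exact (H.extend_apply_of_mem lam D ((hs.horEquiv (r y)).symm (X (π (r y))))).symm
    exact congrArg (fun w : TangentSpace (𝓡 n) (r y) =>
      mvfderiv (𝓡 2) s y (mfderiv (𝓡 n) (𝓡 2) π (r y) w)) h3
  refine ⟨D', fun X hX => ?_, ?_⟩
  · obtain ⟨u', hu', hu⟩ := hdesc X hX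
    refine SmoothField.of_mvfderiv hs.smooth_surf hs.injective_mvfderiv ?_
    rw [funext (hval X hX u' hu)]
    exact hu'
  · funext x
    ext1 v
    obtain ⟨X, hX, hXv⟩ := exists_smoothField_apply (π x) (mfderiv (𝓡 n) (𝓡 2) π x v)
    obtain ⟨u', hu', hu⟩ := hdesc X hX
    have h1 := hval X hX u' hu (π x)
    have h2 := hu x
    have h3 : hs.liftField X x = v :=
      hs.eq_of_mfderiv_eq ((hs.sectionHor_liftField hX).2 x) v.2
        ((hs.mfderiv_liftField X x).trans hXv)
    rw [h3, ← h1, hXv, hs.mvfderiv_comp, H.extend_apply_of_mem] at h2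
    have h4 := hs.injective_mvfderiv _ h2
    rw [← hs.mfderiv_lift] at h4
    exact Subtype.ext (hs.eq_of_mfderiv_eq (D x v).2 (H.lift lam π D' x v).2 h4)

/-- For a lifted field X both ψ(T) and ψ([X,T]) vanish, so dψ(X,T) = 0 says that ψ(X) is constant
along the leaves. -/
theorem exists_eq_liftForm {ψ : Π x : M, TangentSpace (𝓡 n) x →ₗ[ℝ] ℝ} (hψ : SmoothForm ψ)
    (hker : ∀ x, H.Δ lam x ≤ LinearMap.ker (ψ x))
    (hd : ∀ Z T, SmoothField Z → H.SectionΔ lam T → ∀ x, extDerivForm ψ Z T x = 0) :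
    ∃ ψ' : Π y : L, TangentSpace (𝓡 2) y →ₗ[ℝ] ℝ, SmoothForm ψ' ∧ ψ = liftForm π ψ' := by
  have hdesc : ∀ X : Π y : L, TangentSpace (𝓡 2) y, SmoothField X →
      ∃ u' : L → ℝ, ContMDiff (𝓡 2) 𝓘(ℝ, ℝ) ∞ u' ∧
        ∀ x, ψ x (hs.liftField X x) = u' (π x) := by
    intro X hX
    have hX' := hs.sectionHor_liftField hX
    refine hs.exists_descent (hψ _ hX'.1) fun T hT x => ?_
    have h1 := hd _ T hX'.1 hT x
    have h2 : (fun y => ψ y (T y)) = fun _ => 0 := funext fun y => hker y (hT.2 y)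
    have h3 : ψ x (VectorField.mlieBracket (𝓡 n) (hs.liftField X) T x) = 0 := by
      apply hker x
      rw [VectorField.mlieBracket_swap_apply]
      apply Submodule.neg_mem
      rw [← hs.mfderiv_eq_zero_iff, hs.mfderiv_bracket_Δ hX' hT,
        hs.horProj_leviCivita_liftField hX hT, map_zero]
    rw [extDerivForm, h2, h3, dirDeriv, dirDeriv, mvfderiv_const] at h1
    have h4 : (0 : ℝ) - mvfderiv (𝓡 n) (fun y => ψ y (hs.liftField X y)) x (T x) - 0 = 0 := h1
    linarith
  choose r hr using hs.surjective
  let ψ' : Π y : L, TangentSpace (𝓡 2) y →ₗ[ℝ] ℝ := fun y =>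
    ψ (r y) ∘ₗ (H.hor lam (r y)).subtype ∘ₗ ((hs.horEquiv (r y)).symm.toLinearMap ∘ₗ tangentCast (hr y))
  have hval : ∀ (X : Π y : L, TangentSpace (𝓡 2) y), SmoothField X → ∀ u' : L → ℝ,
      (∀ x, ψ x (hs.liftField X x) = u' (π x)) → ∀ y, ψ' y (X y) = u' y := by
    intro X hX u' hu' y
    have h1 := hu' (r y)
    rw [hr] at h1
    rw [← h1, liftField, ← tangentCast_apply (hr y) X]
    rfl
  refine ⟨ψ', fun X hX => ?_, ?_⟩
  · obtain ⟨u', hu', hu⟩ := hdesc X hX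
    rw [funext (hval X hX u' hu)]
    exact hu'
  · funext x
    ext1 v
    obtain ⟨X, hX, hXv⟩ := exists_smoothField_apply (π x) (mfderiv (𝓡 n) (𝓡 2) π x v)
    obtain ⟨u', hu', hu⟩ := hdesc X hX
    have h1 := hval X hX u' hu (π x)
    have h2 := hu x
    have h3 : v - hs.liftField X x ∈ H.Δ lam x := by
      rw [← hs.mfderiv_eq_zero_iff, map_sub, hs.mfderiv_liftField, hXv, sub_self]
    have h4 : ψ x (v - hs.liftField X x) = 0 := hker x h3
    rw [map_sub, sub_eq_zero] at h4
    rw [h4, h2, ← h1, hXv]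
    rfl

/-- `A - λ I` restricts to an isomorphism of `Δ^⊥`. -/
theorem exists_shapeSub_eq {x : M} {u : TangentSpace (𝓡 n) x} (hu : u ∈ H.hor lam x) :
    ∃ v ∈ H.hor lam x, H.shapeSub lam x v = u := by
  let f : H.hor lam x →ₗ[ℝ] H.hor lam x := (H.shapeSub lam x).restrict
    fun v _ => H.shapeSub_mem_hor P lam x v
  have hf : Function.Injective f := by
    rw [injective_iff_map_eq_zero]
    intro v hv
    exact Subtype.ext (Submodule.disjoint_def.1 (H.disjoint_hor_Δ lam x) _ v.2
      ((H.mem_Δ lam).2 (congrArg Subtype.val hv)))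
  obtain ⟨v, hv⟩ := LinearMap.injective_iff_surjective.1 hf ⟨u, hu⟩
  exact ⟨v, v.2, congrArg Subtype.val hv⟩

theorem exists_ne_zero_Δ (hn : 3 ≤ n) (x : M) : ∃ t ∈ H.Δ lam x, t ≠ 0 := by
  have h1 := hs.multiplicity x
  have : H.Δ lam x ≠ ⊥ := by
    intro h
    rw [h, finrank_bot] at h1
    omega
  obtain ⟨t, ht, h0⟩ := Submodule.exists_mem_ne_zero_of_ne_bot this
  exact ⟨t, ht, h0⟩

/-- A function of π is constant along the leaves, so differentiating the vanishing product along T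
only hits F_*T. -/
theorem lorentz_second_leaf {g : L → Minkowski (n + 2)}
    (hg : ContMDiff (𝓡 2) 𝓘(ℝ, Minkowski (n + 2)) ∞ g) {T : Π x : M, TangentSpace (𝓡 n) x}
    (hT : H.SectionΔ lam T)
    (h : ∀ x, lorentz (g (π x)) (mvfderiv (𝓡 n) (H.lc P) x (T x)) = 0) (x : M) :
    lorentz (g (π x)) (mvfderiv (𝓡 n) (dirDeriv T (H.lc P)) x (T x)) = 0 := by
  have h1 := lorentz_mvfderiv_of_const (hg.comp hs.smooth_π) ((H.smooth_lc P).dirDeriv hT.1)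
    (c := 0) h (x := x) (T x)
  have h2 := hs.mvfderiv_comp_π hg x (T x)
  rw [hs.mfderiv_eq_zero_iff.2 (hT.2 x), map_zero] at h2
  change lorentz (mvfderiv (𝓡 n) (fun x => g (π x)) x (T x)) _ = _ at h1
  rw [h2, lorentz_zero_left] at h1
  have h3 : (0 : ℝ) = -lorentz (g (π x)) (mvfderiv (𝓡 n) (dirDeriv T (H.lc P)) x (T x)) := h1
  linarith

/-- Given orthogonality to F, the vector s yields ξ. The vectors s_* π_* v yield F_*Δ^⊥, because A -
λI is onto Δ^⊥, and F_*Δ completes F_*TM. Finally, the derivative of F_*T along T has w-coefficient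
-⟨T,T⟩ ≠ 0 and yields w. -/
theorem eq_zero_of_orthogonal_leaf {V : Minkowski (n + 2)} {x : M}
    (h0 : lorentz V (H.lc P x) = 0) (h1 : lorentz V (s (π x)) = 0)
    (h2 : ∀ v, lorentz V (mvfderiv (𝓡 n) (fun x => s (π x)) x v) = 0)
    (h3 : ∀ t ∈ H.Δ lam x, lorentz V (mvfderiv (𝓡 n) (H.lc P) x t) = 0)
    {T : Π x : M, TangentSpace (𝓡 n) x} (hT : H.SectionΔ lam T) (hTx : T x ≠ 0)
    (h4 : lorentz V (mvfderiv (𝓡 n) (dirDeriv T (H.lc P)) x (T x)) = 0) : V = 0 := by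
  have hξ : lorentz V (H.xi P x) = 0 := by
    rw [hs.comp_eq, lorentz_add_right, lorentz_smul_right, h0] at h1
    linarith
  have hd : ∀ u, lorentz V (mvfderiv (𝓡 n) (H.lc P) x u) = 0 := by
    intro u
    obtain ⟨v, -, hv⟩ := hs.exists_shapeSub_eq (H.horProj lam x u).2
    have h5 := h2 v
    rw [hs.mvfderiv_eq, lorentz_add_right, lorentz_neg_right, lorentz_smul_right, h0, hv] at h5
    have h6 := h3 _ (H.sub_horProj_mem lam x u)
    rw [map_sub, lorentz_sub_right] at h6
    linarith
  refine H.eq_zero_of_orthogonal_frame P x h0 ?_ hξ hd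
  rw [H.gauss P hT.1, lorentz_sub_right, lorentz_add_right, lorentz_smul_right,
    lorentz_smul_right, hd, hξ] at h4
  have h7 : H.metric x (T x) (T x) ≠ 0 := fun h => hTx (H.eq_zero_of_metric_self h)
  have h8 : H.metric x (T x) (T x) * lorentz V P.w = 0 := by linarith
  exact (mul_eq_zero.1 h8).resolve_left h7

/-- The difference of the two sides is normal to s in the de Sitter sphere. It is orthogonal to F by
`hB`, to F_*Δ by commutation with the splitting tensor, and to the derivative of F_*T along T by
differentiating along the leaf. A nonzero T is available since n ≥ 3. -/
theorem surfSff_symm_of_metric (hn : 3 ≤ n)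
    {D' : Π y : L, TangentSpace (𝓡 2) y →ₗ[ℝ] TangentSpace (𝓡 2) y} (hD : SmoothEnd D')
    (hB : ∀ x (v u : H.hor lam x), H.metric x (H.shapeSub lam x (H.lift lam π D' x u)) v
      = H.metric x (H.shapeSub lam x u) (H.lift lam π D' x v))
    (hcomm : ∀ T, H.SectionΔ lam T → ∀ x,
      H.lift lam π D' x ∘ₗ H.splitting lam T x = H.splitting lam T x ∘ₗ H.lift lam π D' x)
    (X Y : Π y : L, TangentSpace (𝓡 2) y) (hX : SmoothField X) (hY : SmoothField Y) (y : L) :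
    surfSff s X (fun z => D' z (Y z)) y = surfSff s (fun z => D' z (X z)) Y y := by
  have hDY := hD Y hY
  have hDX := hD X hX
  have hT0 : ∀ T, H.SectionΔ lam T → ∀ x,
      lorentz (surfSff s X (fun z => D' z (Y z)) (π x)) (mvfderiv (𝓡 n) (H.lc P) x (T x))
        = lorentz (surfSff s (fun z => D' z (X z)) Y (π x))
          (mvfderiv (𝓡 n) (H.lc P) x (T x)) := by
    intro T hT x
    let v := (hs.horEquiv x).symm (X (π x))
    let u := (hs.horEquiv x).symm (Y (π x))
    have hv : mfderiv (𝓡 n) (𝓡 2) π x v = X (π x) := hs.mfderiv_horEquiv_symm _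
    have hu : mfderiv (𝓡 n) (𝓡 2) π x u = Y (π x) := hs.mfderiv_horEquiv_symm _
    rw [hs.lorentz_surfSff_dlc hDY hT hv (u := H.lift lam π D' x u)
      (by rw [hs.mfderiv_lift, hu]),
      hs.lorentz_surfSff_dlc hY hT (v := H.lift lam π D' x v)
        (by rw [hs.mfderiv_lift, hv]) hu, hB]
    have h1 := LinearMap.congr_fun (hcomm T hT x) v
    simp only [LinearMap.comp_apply] at h1
    rw [h1]
  obtain ⟨x, rfl⟩ := hs.surjective y
  obtain ⟨t, ht, ht0⟩ := hs.exists_ne_zero_Δ hn x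
  obtain ⟨T, hT, rfl⟩ := hs.exists_sectionΔ ht
  rw [← sub_eq_zero]
  refine hs.eq_zero_of_orthogonal_leaf (x := x) (T := T) ?_ ?_ ?_ ?_ hT ht0 ?_
  · let v := (hs.horEquiv x).symm (X (π x))
    let u := (hs.horEquiv x).symm (Y (π x))
    have hv : mfderiv (𝓡 n) (𝓡 2) π x v = X (π x) := hs.mfderiv_horEquiv_symm _
    have hu : mfderiv (𝓡 n) (𝓡 2) π x u = Y (π x) := hs.mfderiv_horEquiv_symm _
    rw [lorentz_sub_left, hs.lorentz_surfSff_lc hDY hv (u := H.lift lam π D' x u)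
      (by rw [hs.mfderiv_lift, hu]),
      hs.lorentz_surfSff_lc hY (v := H.lift lam π D' x v)
        (by rw [hs.mfderiv_lift, hv]) hu, hB, sub_self]
  · rw [lorentz_sub_left, hs.lorentz_surfSff_surf hDY, hs.lorentz_surfSff_surf hY, sub_self]
  · intro v
    rw [hs.mvfderiv_comp, lorentz_sub_left, hs.lorentz_surfSff_dsurf hDY,
      hs.lorentz_surfSff_dsurf hY, sub_self]
  · intro t' ht'
    obtain ⟨T', hT', rfl⟩ := hs.exists_sectionΔ ht'
    rw [lorentz_sub_left, hT0 T' hT', sub_self]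
  · have hsurf : ∀ (y : L) (z : TangentSpace (𝓡 2) y) (x : M), π x = y →
        lorentz (mvfderiv (𝓡 2) s y z) (mvfderiv (𝓡 n) (H.lc P) x (T x)) = 0 := by
      rintro _ z x rfl
      obtain ⟨v, rfl⟩ := hs.surjective_dπ x z
      rw [← hs.mvfderiv_comp, hs.lorentz_mvfderiv_dlc, H.metric_shapeSub P,
        (H.mem_Δ lam).1 (hT.2 x)]
      simp [metric]
    have hdec : ∀ (X Y : Π y : L, TangentSpace (𝓡 2) y) (y : L), surfSff s X Y y
        = dirDeriv X (dirDeriv Y s) y - mvfderiv (𝓡 2) s y (leviCivita (surfMetric s) Y y (X y))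
          + surfMetric s y (X y) (Y y) • s y := fun _ _ _ => rfl
    -- The flat second derivatives stand in for α': the remaining terms are tangent to s or
    -- multiples of s and pair to zero with F_*T. So the smoothness of ∇' is not needed.
    have hW := hs.lorentz_second_leaf (g := fun y => dirDeriv X (dirDeriv (fun z => D' z (Y z)) s) y
        - dirDeriv (fun z => D' z (X z)) (dirDeriv Y s) y)
      (((hs.smooth_surf.dirDeriv hDY).dirDeriv hX).sub ((hs.smooth_surf.dirDeriv hY).dirDeriv hDX))
      hT (fun x => by
        have h1 := hT0 T hT x
        simp only [hdec, lorentz_add_left, lorentz_sub_left, lorentz_smul_left,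
          hsurf _ _ x rfl, hs.lorentz_comp_dlc] at h1 ⊢
        linarith) x
    have hS := hs.lorentz_second_leaf hs.smooth_surf hT (fun x => hs.lorentz_comp_dlc x (T x)) x
    have hZ : ∀ z : TangentSpace (𝓡 2) (π x), lorentz (mvfderiv (𝓡 2) s (π x) z)
        (mvfderiv (𝓡 n) (dirDeriv T (H.lc P)) x (T x)) = 0 := by
      intro z
      obtain ⟨Z, hZ, rfl⟩ := exists_smoothField_apply (π x) z
      exact hs.lorentz_second_leaf (hs.smooth_surf.dirDeriv hZ) hT
        (fun x => hsurf _ _ x rfl) x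
    simp only [hdec, lorentz_add_left, lorentz_sub_left, lorentz_smul_left, hS, hZ] at hW ⊢
    linarith

end OrientedHypersurface.Envelops

/-! ### The triple on the surface -/

namespace OrientedHypersurface.Envelops

variable {n : ℕ} {M : Type*} [TopologicalSpace M] [T2Space M]
  [ChartedSpace (EuclideanSpace ℝ (Fin n)) M] [IsManifold (𝓡 n) ∞ M]
  {L : Type*} [TopologicalSpace L] [T2Space L]
  [ChartedSpace (EuclideanSpace ℝ (Fin 2)) L] [IsManifold (𝓡 2) ∞ L]
  {H : OrientedHypersurface n M} {lam : M → ℝ}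
  {P : LightConeModel (n + 1)} {π : M → L} {s : L → Minkowski (n + 2)}
  (hs : H.Envelops lam P π s)
include hs

/-- The symmetry `hB` of (A - λI)J yields that of α' with respect to the descended tensor. After
that, the equivalences established for lifts are read in the opposite direction. -/
theorem exists_triple (hn : 3 ≤ n) {κ : JType} {J D₁ D₂ : Π x : M, H.hor lam x →ₗ[ℝ] H.hor lam x}
    {ψ : Π x : M, TangentSpace (𝓡 n) x →ₗ[ℝ] ℝ} (hJ : H.IsOfType lam κ J)
    (h : H.IsTriple lam J D₁ D₂ ψ)
    (hB : ∀ x (v u : H.hor lam x), H.metric x (H.shapeSub lam x (J x u)) v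
      = H.metric x (H.shapeSub lam x u) (J x v)) :
    ∃ (J' D₁' D₂' : Π y : L, TangentSpace (𝓡 2) y →ₗ[ℝ] TangentSpace (𝓡 2) y)
      (ψ' : Π y : L, TangentSpace (𝓡 2) y →ₗ[ℝ] ℝ),
      J = H.lift lam π J' ∧ D₁ = H.lift lam π D₁' ∧ D₂ = H.lift lam π D₂' ∧
      ψ = liftForm π ψ' ∧ SurfIsOfType s κ J' ∧ SurfIsTriple s J' D₁' D₂' ψ' := by
  have hid : ∀ x, J x ∈ Submodule.span ℝ {LinearMap.id, J x} := fun x =>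
    Submodule.subset_span (by simp)
  have hJcomm : ∀ T, H.SectionΔ lam T → ∀ x,
      J x ∘ₗ H.splitting lam T x = H.splitting lam T x ∘ₗ J x := fun T hT x =>
    comp_comm_of_mem_span (hJ.splitting_mem T hT x) (hid x)
  have hc := h.conditions
  obtain ⟨J', hJs, rfl⟩ := hs.exists_eq_lift hJ.smooth hJ.parallel hJcomm
  obtain ⟨D₁', hD₁, rfl⟩ := hs.exists_eq_lift h.smooth_D₁ hc.iii_parallel.1
    fun T hT x => (hc.iii_commute T hT x).1
  obtain ⟨D₂', hD₂, rfl⟩ := hs.exists_eq_lift h.smooth_D₂ hc.iii_parallel.2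
    fun T hT x => (hc.iii_commute T hT x).2
  obtain ⟨ψ', hψ, rfl⟩ := hs.exists_eq_liftForm h.smooth_ψ hc.i hc.vi
  have hα := hs.surfSff_symm_of_metric hn hJs hB hJcomm
  have hm₁ : ∀ y, D₁' y ∈ Submodule.span ℝ {LinearMap.id, J' y} := fun y => by
    obtain ⟨x, rfl⟩ := hs.surjective y
    have h1 := h.mem_D₁ x
    rwa [hs.lift_eq_conj, hs.lift_eq_conj, mem_span_id_conj] at h1
  have hm₂ : ∀ y, D₂' y ∈ Submodule.span ℝ {LinearMap.id, J' y} := fun y => by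
    obtain ⟨x, rfl⟩ := hs.surjective y
    have h1 := h.mem_D₂ x
    rwa [hs.lift_eq_conj, hs.lift_eq_conj, mem_span_id_conj] at h1
  have hα₁ := hs.surfSff_symm_of_mem_span hJs hα hD₁ hm₁
  have hα₂ := hs.surfSff_symm_of_mem_span hJs hα hD₂ hm₂
  refine ⟨J', D₁', D₂', ψ', rfl, rfl, rfl, rfl, ⟨hJs, fun y => ?_, hα⟩,
    ⟨hD₁, hD₂, hψ, hm₁, hm₂, fun y => ?_,
      ⟨(hs.codazzi_ricci_lift_iff hD₁ hα₁ ψ' 1).1 ⟨hc.iv.1, hc.v.1⟩,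
        (hs.codazzi_ricci_lift_iff hD₂ hα₂ ψ' (-1)).1 ⟨hc.iv.2, hc.v.2⟩⟩,
      fun X Y hX hY y => ?_, fun y => ?_, fun y => ?_⟩⟩ <;>
  obtain ⟨x, rfl⟩ := hs.surjective y
  · have h1 := hJ.square x
    rwa [hs.lift_eq_conj, κ.holds_conj] at h1
  · have h1 := hc.ii x
    rwa [hs.lift_eq_conj, hs.lift_eq_conj, det_linearEquiv_conj, det_linearEquiv_conj] at h1
  · have hX' := hs.sectionHor_liftField hX
    have hY' := hs.sectionHor_liftField hY
    have h1 := hs.metric_commutator hD₁ hD₂ hα₁ hα₂ x ⟨_, hX'.2 x⟩ ⟨_, hY'.2 x⟩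
    rw [hs.mfderiv_liftField, hs.mfderiv_liftField] at h1
    rw [← h1, ← hc.vii _ _ hX' hY' x]
    exact (hs.extDerivVec_pullback (F := ℝ) hψ hX'.1 hY'.1 hX hY (hs.mfderiv_liftField X x)
      (hs.mfderiv_liftField Y x)).symm
  · have h1 := hc.viii x
    rwa [hs.lift_eq_conj, hs.lift_eq_conj, ← LinearEquiv.conj_comp, ← LinearEquiv.conj_comp,
      ← map_neg, (LinearEquiv.conj _).injective.ne_iff, (LinearEquiv.conj _).injective.ne_iff]
      at h1
  · have h1 := hc.ix x
    have h2 : (LinearMap.id : H.hor lam x →ₗ[ℝ] H.hor lam x)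
      = (hs.horEquiv x).symm.conj LinearMap.id := (LinearEquiv.conj_id _).symm
    rwa [hs.lift_eq_conj, hs.lift_eq_conj, ← LinearEquiv.conj_comp, ← LinearEquiv.conj_comp, h2,
      ← map_add, ← map_sub, finrank_range_conj] at h1

end OrientedHypersurface.Envelops

/-! ### The case of a scalar splitting tensor -/

namespace OrientedHypersurface.Envelops

variable {n : ℕ} {M : Type*} [TopologicalSpace M] [T2Space M]
  [ChartedSpace (EuclideanSpace ℝ (Fin n)) M] [IsManifold (𝓡 n) ∞ M]
  {L : Type*} [TopologicalSpace L] [T2Space L]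
  [ChartedSpace (EuclideanSpace ℝ (Fin 2)) L] [IsManifold (𝓡 2) ∞ L]
  {H : OrientedHypersurface n M} {lam : M → ℝ}
  {P : LightConeModel (n + 1)} {π : M → L} {s : L → Minkowski (n + 2)}
  (hs : H.Envelops lam P π s)
include hs

/-- Where `(A - λ I) J` is not symmetric the splitting tensor is a multiple of the identity. -/
theorem eventually_splitting_eq_smul {κ : JType} {J : Π x : M, H.hor lam x →ₗ[ℝ] H.hor lam x}
    (hJ : H.IsOfType lam κ J) {x₀ : M} {v u : H.hor lam x₀}
    (hne : H.metric x₀ (H.shapeSub lam x₀ (J x₀ u)) v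
      ≠ H.metric x₀ (H.shapeSub lam x₀ u) (J x₀ v)) :
    ∀ᶠ x in 𝓝 x₀, ∀ T, H.SectionΔ lam T → ∃ c : ℝ, ∀ w, H.splitting lam T x w = c • w := by
  obtain ⟨X, hX, hXv⟩ := hs.exists_sectionHor v.2
  obtain ⟨Y, hY, hYu⟩ := hs.exists_sectionHor u.2
  have hsm : ∀ {Z W : Π x : M, TangentSpace (𝓡 n) x}, SmoothField Z → SmoothField W →
      Continuous (fun x => H.metric x (Z x) (W x)) := by
    intro Z W hZ hW
    have h1 : (fun x => H.metric x (Z x) (W x))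
        = fun x => lorentzL (n + 2) (dirDeriv Z (H.lc P) x) (dirDeriv W (H.lc P) x) := by
      funext x
      exact H.metric_eq_lorentz P x _ _
    rw [h1]
    exact ((lorentzL (n + 2)).continuous.comp ((H.smooth_lc P).dirDeriv hZ).continuous).clm_apply
      ((H.smooth_lc P).dirDeriv hW).continuous
  have hc1 := hsm (hs.smoothField_shapeSub (hJ.smooth Y hY.1)) hX.1
  have hc2 := hsm (hs.smoothField_shapeSub hY.1) (hJ.smooth X hX.1)
  have hx₀ : H.metric x₀ (H.shapeSub lam x₀ (H.extend lam J x₀ (Y x₀))) (X x₀)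
      ≠ H.metric x₀ (H.shapeSub lam x₀ (Y x₀)) (H.extend lam J x₀ (X x₀)) := by
    rw [hXv, hYu, H.extend_apply_of_mem, H.extend_apply_of_mem]
    exact hne
  have hopen := (isOpen_ne_fun hc1 hc2).mem_nhds hx₀
  filter_upwards [hopen] with x hx T hT
  obtain ⟨a, b, hab⟩ := Submodule.mem_span_pair.1 (hJ.splitting_mem T hT x)
  have hsp : ∀ w, H.splitting lam T x w = a • w + b • J x w := fun w => by
    rw [← hab]; rfl
  have h1 := hs.metric_splitting hT ⟨Y x, hY.2 x⟩ ⟨X x, hX.2 x⟩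
  simp only [hsp, Submodule.coe_add, Submodule.coe_smul, H.metric_add_right,
    H.metric_smul_right] at h1
  have hx' : H.metric x (H.shapeSub lam x (J x ⟨Y x, hY.2 x⟩)) (X x)
      ≠ H.metric x (H.shapeSub lam x (Y x)) (J x ⟨X x, hX.2 x⟩) := by
    rw [← H.extend_apply_of_mem lam J ⟨Y x, hY.2 x⟩, ← H.extend_apply_of_mem lam J ⟨X x, hX.2 x⟩]
    exact hx
  rw [H.metric_shapeSub P lam x (X x) (Y x), H.metric_comm x (X x),
    H.metric_shapeSub P lam x (X x) (J x ⟨Y x, hY.2 x⟩), H.metric_comm x (X x)] at h1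
  -- The symmetric operator (A - λI)C_T has the skew part of b(A - λI)J, which is nonzero unless b =
  -- 0.
  have hb : b = 0 := by
    by_contra hb
    exact hx' (mul_left_cancel₀ hb (by linarith))
  exact ⟨a, fun w => by rw [hsp, hb, zero_smul, add_zero]⟩

theorem mvfderiv_lorentz_leaf {g l : _} {x : M}
    (hg : ContMDiff (𝓡 2) 𝓘(ℝ, Minkowski (n + 2)) ∞ (g : L → Minkowski (n + 2)))
    (hl : ContMDiff (𝓡 n) 𝓘(ℝ, Minkowski (n + 2)) ∞ (l : M → Minkowski (n + 2)))
    {t : TangentSpace (𝓡 n) x} (ht : t ∈ H.Δ lam x) :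
    mvfderiv (𝓡 n) (fun x => lorentz (g (π x)) (l x)) x t
      = lorentz (g (π x)) (mvfderiv (𝓡 n) l x t) := by
  have h1 := mvfderiv_lorentz (hg.comp hs.smooth_π x) (hl x) t
  have h2 := hs.mvfderiv_comp_π hg x t
  rw [hs.mfderiv_eq_zero_iff.2 ht, map_zero] at h2
  refine h1.trans ?_
  change lorentz (mvfderiv (𝓡 n) (fun x => g (π x)) x t) _ + _ = _
  rw [h2, lorentz_zero_left, zero_add]
  rfl

theorem lorentz_dsurf_leaf {T : Π x : M, TangentSpace (𝓡 n) x} (hT : H.SectionΔ lam T) (x : M)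
    (z : TangentSpace (𝓡 2) (π x)) :
    lorentz (mvfderiv (𝓡 2) s (π x) z) (mvfderiv (𝓡 n) (H.lc P) x (T x)) = 0 := by
  obtain ⟨v, rfl⟩ := hs.surjective_dπ x z
  rw [← hs.mvfderiv_comp, hs.lorentz_mvfderiv_dlc, H.metric_shapeSub P, (H.mem_Δ lam).1 (hT.2 x)]
  simp [metric]

/-- The vector s and the tangent vectors of s are orthogonal to F_*T along whole leaves, hence also
to its derivative along T. -/
theorem lorentz_surfSff_second_leaf {T : Π x : M, TangentSpace (𝓡 n) x} (hT : H.SectionΔ lam T)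
    (X Y : Π y : L, TangentSpace (𝓡 2) y) (x : M) :
    lorentz (surfSff s X Y (π x)) (mvfderiv (𝓡 n) (dirDeriv T (H.lc P)) x (T x))
      = lorentz (dirDeriv X (dirDeriv Y s) (π x))
        (mvfderiv (𝓡 n) (dirDeriv T (H.lc P)) x (T x)) := by
  have hS := hs.lorentz_second_leaf hs.smooth_surf hT (fun x => hs.lorentz_comp_dlc x (T x)) x
  obtain ⟨Z, hZ, hZe⟩ := exists_smoothField_apply (π x)
    (leviCivita (surfMetric s) Y (π x) (X (π x)))
  have h1 := hs.lorentz_second_leaf (hs.smooth_surf.dirDeriv hZ) hT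
    (fun x => hs.lorentz_dsurf_leaf hT x (Z (π x))) x
  change lorentz (mvfderiv (𝓡 2) s (π x) (Z (π x))) _ = 0 at h1
  rw [hZe] at h1
  rw [surfSff, lorentz_add_left, lorentz_sub_left, lorentz_smul_left, hS, h1]
  change lorentz (dirDeriv X (dirDeriv Y s) (π x)) _ - 0 + _ = _
  ring

theorem lorentz_surfSff_lc_eq (X Y : Π y : L, TangentSpace (𝓡 2) y) (x : M) :
    lorentz (surfSff s X Y (π x)) (H.lc P x)
      = lorentz (dirDeriv X (dirDeriv Y s) (π x)) (H.lc P x) := by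
  obtain ⟨v, hv⟩ := hs.surjective_dπ x (leviCivita (surfMetric s) Y (π x) (X (π x)))
  have h1 := hs.lorentz_mvfderiv_lc x v
  rw [hs.mvfderiv_comp, hv] at h1
  rw [surfSff, lorentz_add_left, lorentz_sub_left, lorentz_smul_left, hs.lorentz_comp_lc, h1]
  change lorentz (dirDeriv X (dirDeriv Y s) (π x)) _ - 0 + _ = _
  ring

theorem lorentz_surfSff_dlc_eq {T : Π x : M, TangentSpace (𝓡 n) x} (hT : H.SectionΔ lam T)
    (X Y : Π y : L, TangentSpace (𝓡 2) y) (x : M) :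
    lorentz (surfSff s X Y (π x)) (mvfderiv (𝓡 n) (H.lc P) x (T x))
      = lorentz (dirDeriv X (dirDeriv Y s) (π x)) (mvfderiv (𝓡 n) (H.lc P) x (T x)) := by
  rw [surfSff, lorentz_add_left, lorentz_sub_left, lorentz_smul_left, hs.lorentz_comp_dlc,
    hs.lorentz_dsurf_leaf hT]
  change lorentz (dirDeriv X (dirDeriv Y s) (π x)) _ - 0 + _ = _
  ring

/-- If the splitting tensor is scalar, the second fundamental form of the congruence has rank
one. -/
theorem surfSff_proportional (hn : 3 ≤ n) {x : M}
    (hC : ∀ᶠ x in 𝓝 x, ∀ T, H.SectionΔ lam T → ∃ c : ℝ, ∀ w, H.splitting lam T x w = c • w)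
    {X Y Z W : Π y : L, TangentSpace (𝓡 2) y} (hX : SmoothField X) (hY : SmoothField Y)
    (hZ : SmoothField Z) (hW : SmoothField W) :
    lorentz (surfSff s Z W (π x)) (H.lc P x) • surfSff s X Y (π x)
      = lorentz (surfSff s X Y (π x)) (H.lc P x) • surfSff s Z W (π x) := by
  -- For C_T = cI the product of α' with F_*T is -c times the product with F, with the same c for
  -- all arguments.
  have hscal : ∀ {x : M}, (∀ T, H.SectionΔ lam T → ∃ c : ℝ, ∀ w, H.splitting lam T x w = c • w) →
      ∀ T, H.SectionΔ lam T → ∃ c : ℝ, ∀ {X Y : Π y : L, TangentSpace (𝓡 2) y}, SmoothField X →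
        SmoothField Y → lorentz (surfSff s X Y (π x)) (mvfderiv (𝓡 n) (H.lc P) x (T x))
          = -c * lorentz (surfSff s X Y (π x)) (H.lc P x) := by
    intro x hx T hT
    obtain ⟨c, hc⟩ := hx T hT
    refine ⟨c, fun {X Y} hX hY => ?_⟩
    let v := (hs.horEquiv x).symm (X (π x))
    let u := (hs.horEquiv x).symm (Y (π x))
    have hv : mfderiv (𝓡 n) (𝓡 2) π x v = X (π x) := hs.mfderiv_horEquiv_symm _
    have hu : mfderiv (𝓡 n) (𝓡 2) π x u = Y (π x) := hs.mfderiv_horEquiv_symm _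
    rw [hs.lorentz_surfSff_dlc hY hT hv hu, hs.lorentz_surfSff_lc hY hv hu, hc,
      Submodule.coe_smul, H.metric_smul_right]
    ring
  rw [← sub_eq_zero]
  obtain ⟨t, ht, ht0⟩ := hs.exists_ne_zero_Δ hn x
  obtain ⟨T, hT, rfl⟩ := hs.exists_sectionΔ ht
  refine hs.eq_zero_of_orthogonal_leaf (x := x) (T := T) ?_ ?_ ?_ ?_ hT ht0 ?_
  · rw [lorentz_sub_left, lorentz_smul_left, lorentz_smul_left]
    ring
  · rw [lorentz_sub_left, lorentz_smul_left, lorentz_smul_left, hs.lorentz_surfSff_surf hY,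
      hs.lorentz_surfSff_surf hW]
    ring
  · intro v
    rw [hs.mvfderiv_comp, lorentz_sub_left, lorentz_smul_left, lorentz_smul_left,
      hs.lorentz_surfSff_dsurf hY, hs.lorentz_surfSff_dsurf hW]
    ring
  · intro t' ht'
    obtain ⟨T', hT', rfl⟩ := hs.exists_sectionΔ ht'
    obtain ⟨c, hc⟩ := hscal hC.self_of_nhds T' hT'
    rw [lorentz_sub_left, lorentz_smul_left, lorentz_smul_left, hc hX hY, hc hZ hW]
    ring
  · let g := dirDeriv X (dirDeriv Y s)
    let k := dirDeriv Z (dirDeriv W s)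
    have hg : ContMDiff (𝓡 2) 𝓘(ℝ, Minkowski (n + 2)) ∞ g :=
      (hs.smooth_surf.dirDeriv hY).dirDeriv hX
    have hk : ContMDiff (𝓡 2) 𝓘(ℝ, Minkowski (n + 2)) ∞ k :=
      (hs.smooth_surf.dirDeriv hW).dirDeriv hZ
    have hF := H.smooth_lc P
    have hFT := hF.dirDeriv hT.1
    have hsm : ∀ {g : L → Minkowski (n + 2)} {l : M → Minkowski (n + 2)},
        ContMDiff (𝓡 2) 𝓘(ℝ, Minkowski (n + 2)) ∞ g →
        ContMDiff (𝓡 n) 𝓘(ℝ, Minkowski (n + 2)) ∞ l →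
        MDifferentiableAt (𝓡 n) 𝓘(ℝ, ℝ) (fun x => lorentz (g (π x)) (l x)) x := by
      intro g l hg hl
      have h1 : ContMDiffAt (𝓡 n) 𝓘(ℝ, ℝ) ∞
          (fun x => lorentzL (n + 2) (g (π x)) (l x)) x :=
        ((lorentzL (n + 2)).contDiff.contDiffAt.contMDiffAt.comp x
          (hg.comp hs.smooth_π x)).clm_apply (hl x)
      exact h1.mdifferentiableAt (by simp)
    -- Eliminating c, whose smoothness is unknown, gives an identity between smooth functions near
    -- `x`, which can be differentiated along T.
    have heq : (fun x => lorentz (k (π x)) (H.lc P x) • lorentz (g (π x)) (dirDeriv T (H.lc P) x))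
        =ᶠ[𝓝 x] fun x => lorentz (g (π x)) (H.lc P x) •
          lorentz (k (π x)) (dirDeriv T (H.lc P) x) := by
      filter_upwards [hC] with x' hx'
      obtain ⟨c, hc⟩ := hscal hx' T hT
      have h1 := hc hX hY
      have h2 := hc hZ hW
      rw [hs.lorentz_surfSff_dlc_eq hT, hs.lorentz_surfSff_lc_eq] at h1 h2
      simp only [smul_eq_mul]
      change _ * lorentz (dirDeriv X (dirDeriv Y s) (π x')) (mvfderiv (𝓡 n) (H.lc P) x' (T x'))
        = _ * lorentz (dirDeriv Z (dirDeriv W s) (π x')) (mvfderiv (𝓡 n) (H.lc P) x' (T x'))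
      rw [h1, h2]
      change lorentz (dirDeriv Z (dirDeriv W s) (π x')) _ * _
        = lorentz (dirDeriv X (dirDeriv Y s) (π x')) _ * _
      ring
    have h1 := congrArg (fun l => l (T x)) (mvfderiv_congr (m := n) heq)
    rw [mvfderiv_smul_vec (hsm hk hF) (hsm hg hFT), mvfderiv_smul_vec (hsm hg hF) (hsm hk hFT),
      hs.mvfderiv_lorentz_leaf hk hF (hT.2 x), hs.mvfderiv_lorentz_leaf hg hF (hT.2 x),
      hs.mvfderiv_lorentz_leaf hk hFT (hT.2 x), hs.mvfderiv_lorentz_leaf hg hFT (hT.2 x)] at h1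
    rw [lorentz_sub_left, lorentz_smul_left, lorentz_smul_left,
      hs.lorentz_surfSff_second_leaf hT, hs.lorentz_surfSff_second_leaf hT,
      hs.lorentz_surfSff_lc_eq, hs.lorentz_surfSff_lc_eq]
    simp only [smul_eq_mul] at h1
    have h3 : ∀ z, lorentz z (dirDeriv T (H.lc P) x)
      = lorentz z (mvfderiv (𝓡 n) (H.lc P) x (T x)) := fun _ => rfl
    rw [h3, h3] at h1
    linarith

end OrientedHypersurface.Envelops

/-! ### Moving frames of a constant subspace -/

section ConstantSpan

variable {m : ℕ} {M : Type*} [TopologicalSpace M] [ChartedSpace (EuclideanSpace ℝ (Fin m)) M]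
  [IsManifold (𝓡 m) ∞ M] {F : Type*} [NormedAddCommGroup F] [NormedSpace ℝ F]

theorem eventually_eq_of_mvfderiv_eq_zero {h : M → F} {x₀ : M}
    (hh : ∀ᶠ x in 𝓝 x₀, MDifferentiableAt (𝓡 m) 𝓘(ℝ, F) h x ∧ ∀ v, mvfderiv (𝓡 m) h x v = 0) :
    ∀ᶠ x in 𝓝 x₀, h x = h x₀ := by
  let φ := extChartAt (𝓡 m) x₀
  have hc : Tendsto φ.symm (𝓝 (φ x₀)) (𝓝 x₀) := by
    have := (continuousAt_extChartAt_symm (I := 𝓡 m) x₀).tendsto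
    rwa [extChartAt_to_inv] at this
  obtain ⟨r, hr, hb⟩ := Metric.eventually_nhds_iff_ball.1
    ((extChartAt_target_eventually (m := m) x₀).and (hc.eventually hh))
  have hconst : ∀ u ∈ Metric.ball (φ x₀) r, (h ∘ φ.symm) u = (h ∘ φ.symm) (φ x₀) := by
    intro u hu
    refine Metric.isOpen_ball.is_const_of_fderiv_eq_zero (𝕜 := ℝ)
      (convex_ball (φ x₀) r).isPreconnected ?_ ?_ hu (Metric.mem_ball_self hr)
    · intro u hu
      have h1 := (hb u hu).2.1.comp u (mdifferentiableAt_extChartAt_symm (hb u hu).1)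
      exact h1.differentiableAt.differentiableWithinAt
    · intro u hu
      ext v
      rw [fderiv_comp_extChartAt_symm (hb u hu).1 (hb u hu).2.1, (hb u hu).2.2]
      rfl
  have h1 : ∀ᶠ x in 𝓝 x₀, φ x ∈ Metric.ball (φ x₀) r :=
    (continuousAt_extChartAt x₀).eventually (Metric.ball_mem_nhds _ hr)
  filter_upwards [h1, extChartAt_source_mem_nhds (I := 𝓡 m) x₀] with x hx hxs
  have h2 := hconst _ hx
  simp only [Function.comp_apply] at h2
  rwa [φ.left_inv hxs, φ.left_inv (mem_extChartAt_source x₀)] at h2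

theorem mvfderiv_sum {ι : Type*} {s : Finset ι} {h : ι → M → F} {x : M}
    (hh : ∀ i ∈ s, MDifferentiableAt (𝓡 m) 𝓘(ℝ, F) (h i) x) (v : TangentSpace (𝓡 m) x) :
    mvfderiv (𝓡 m) (fun x => ∑ i ∈ s, h i x) x v = ∑ i ∈ s, mvfderiv (𝓡 m) (h i) x v := by
  classical
  suffices MDifferentiableAt (𝓡 m) 𝓘(ℝ, F) (fun x => ∑ i ∈ s, h i x) x ∧
    mvfderiv (𝓡 m) (fun x => ∑ i ∈ s, h i x) x v = ∑ i ∈ s, mvfderiv (𝓡 m) (h i) x v from this.2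
  induction s using Finset.induction_on with
  | empty =>
    simp only [Finset.sum_empty]
    exact ⟨mdifferentiableAt_const, by rw [mvfderiv_const]; rfl⟩
  | insert i s hi ih =>
    obtain ⟨h1, h2⟩ := ih fun j hj => hh j (Finset.mem_insert_of_mem hj)
    have h3 := hh i (Finset.mem_insert_self i s)
    simp only [Finset.sum_insert hi, ← h2]
    exact ⟨h3.add h1, congrArg (fun l => l v) (mvfderiv_add h3 h1)⟩

variable {ι : Type*} [Fintype ι]

/-- The linear map with values the combinations of the vectors `g i x`. -/
noncomputable def frameMap (g : ι → M → F) (x : M) : (ι → ℝ) →L[ℝ] F :=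
  ∑ i, (ContinuousLinearMap.proj (R := ℝ) i : (ι → ℝ) →L[ℝ] ℝ).smulRight (g i x)

theorem frameMap_apply (g : ι → M → F) (x : M) (a : ι → ℝ) :
    frameMap g x a = ∑ i, a i • g i x := by
  simp [frameMap]

theorem mem_span_iff_frameMap {g : ι → M → F} {x : M} {z : F} :
    z ∈ Submodule.span ℝ (Set.range (g · x)) ↔ ∃ a, frameMap g x a = z := by
  rw [Submodule.mem_span_range_iff_exists_fun]
  simp only [frameMap_apply]

theorem frameMap_injective {g : ι → M → F} {x : M} (hli : LinearIndependent ℝ (fun i => g i x)) :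
    Function.Injective (frameMap g x) := by
  rw [injective_iff_map_eq_zero]
  intro a ha
  rw [frameMap_apply] at ha
  exact funext (Fintype.linearIndependent_iff.1 hli a ha)

theorem contMDiff_frameMap {g : ι → M → F} (hg : ∀ i, ContMDiff (𝓡 m) 𝓘(ℝ, F) ∞ (g i)) :
    ContMDiff (𝓡 m) 𝓘(ℝ, (ι → ℝ) →L[ℝ] F) ∞ (frameMap g) := by
  refine contMDiff_finsetSum fun i _ => ?_
  exact (ContinuousLinearMap.smulRightL ℝ (ι → ℝ) F
    (ContinuousLinearMap.proj i)).contDiff.contMDiff.comp (hg i)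

theorem mvfderiv_frameMap_apply {g : ι → M → F} (hg : ∀ i, ContMDiff (𝓡 m) 𝓘(ℝ, F) ∞ (g i))
    {c : M → ι → ℝ} {x : M} (hc : MDifferentiableAt (𝓡 m) 𝓘(ℝ, ι → ℝ) c x)
    (v : TangentSpace (𝓡 m) x) :
    mvfderiv (𝓡 m) (fun x => frameMap g x (c x)) x v
      = ∑ i, c x i • mvfderiv (𝓡 m) (g i) x v + frameMap g x (mvfderiv (𝓡 m) c x v) := by
  have hci : ∀ i, MDifferentiableAt (𝓡 m) 𝓘(ℝ, ℝ) (fun x => c x i) x := fun i =>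
    ((ContinuousLinearMap.proj (R := ℝ) i :
      (ι → ℝ) →L[ℝ] ℝ).differentiableAt.mdifferentiableAt).comp x hc
  have hcd : ∀ i, mvfderiv (𝓡 m) (fun x => c x i) x v = mvfderiv (𝓡 m) c x v i := by
    intro i
    have := mvfderiv_comp_fderiv (φ := (ContinuousLinearMap.proj (R := ℝ) i : (ι → ℝ) →L[ℝ] ℝ))
      (ContinuousLinearMap.differentiableAt _) hc v
    rwa [ContinuousLinearMap.fderiv] at this
  have hgi := fun i => (hg i x).mdifferentiableAt (n := ∞) (by simp)
  have h1 : (fun x => frameMap g x (c x)) = fun x => ∑ i, c x i • g i x :=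
    funext fun x => frameMap_apply g x _
  rw [h1, mvfderiv_sum (h := fun i x => c x i • g i x) fun i _ => (hci i).smul (hgi i),
    frameMap_apply, ← Finset.sum_add_distrib]
  refine Finset.sum_congr rfl fun i _ => ?_
  rw [← hcd]
  exact mvfderiv_smul_vec (hci i) (hgi i) v

/-- The coefficients of a smooth function with respect to a smooth frame can be differentiated. -/
theorem exists_coeff_mvfderiv [FiniteDimensional ℝ F] {g : ι → M → F}
    (hg : ∀ i, ContMDiff (𝓡 m) 𝓘(ℝ, F) ∞ (g i)) {x : M} (hli : LinearIndependent ℝ (fun i => g i x))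
    {k : M → F} (hk : ContMDiffAt (𝓡 m) 𝓘(ℝ, F) ∞ k x)
    (hkg : ∀ᶠ x' in 𝓝 x, k x' ∈ Submodule.span ℝ (Set.range (g · x'))) :
    ∃ c : ι → ℝ, k x = ∑ i, c i • g i x ∧ ∀ v, mvfderiv (𝓡 m) k x v
      - ∑ i, c i • mvfderiv (𝓡 m) (g i) x v ∈ Submodule.span ℝ (Set.range (g · x)) := by
  choose! c hc using fun (x' : M) (h : ∃ a, frameMap g x' a = k x') => h
  have hkc : ∀ᶠ x' in 𝓝 x, frameMap g x' (c x') = k x' :=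
    hkg.mono fun x' hx' => hc x' (mem_span_iff_frameMap.1 hx')
  have hcs : ContMDiffAt (𝓡 m) 𝓘(ℝ, ι → ℝ) ∞ c x :=
    ContMDiffAt.solve_injective (contMDiff_frameMap hg x) (frameMap_injective hli) hk hkc
  refine ⟨c x, by rw [← frameMap_apply]; exact hkc.self_of_nhds.symm, fun v => ?_⟩
  have h1 := congrArg (fun l => l v) (mvfderiv_congr (m := m) hkc)
  rw [mvfderiv_frameMap_apply hg (hcs.mdifferentiableAt (by simp))] at h1
  rw [← h1, add_sub_cancel_left]
  exact mem_span_iff_frameMap.2 ⟨_, rfl⟩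

/-- A smooth frame whose derivatives are combinations of the frame spans a constant subspace. -/
theorem eventually_span_eq [FiniteDimensional ℝ F] [DecidableEq ι]
    {g : ι → M → F} (hg : ∀ i, ContMDiff (𝓡 m) 𝓘(ℝ, F) ∞ (g i)) {x₀ : M}
    (hli : LinearIndependent ℝ (fun i => g i x₀))
    (hd : ∀ᶠ x in 𝓝 x₀, ∀ i v, mvfderiv (𝓡 m) (g i) x v ∈ Submodule.span ℝ (Set.range (g · x))) :
    ∀ᶠ x in 𝓝 x₀, Submodule.span ℝ (Set.range (g · x))
      = Submodule.span ℝ (Set.range (g · x₀)) := by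
  let Θ := frameMap g
  have hΘm : ∀ x z, z ∈ Submodule.span ℝ (Set.range (g · x)) ↔ ∃ a, Θ x a = z := fun x z =>
    mem_span_iff_frameMap
  have hΘs := contMDiff_frameMap hg
  have hΘi : Function.Injective (Θ x₀) := frameMap_injective hli
  obtain ⟨l₀, hl₀⟩ := LinearMap.exists_leftInverse_of_injective (Θ x₀).toLinearMap
    (LinearMap.ker_eq_bot.2 hΘi)
  let l : F →L[ℝ] (ι → ℝ) := l₀.toContinuousLinearMap
  let A : M → (ι → ℝ) →L[ℝ] (ι → ℝ) := fun x => l ∘L Θ x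
  have hA : ContMDiff (𝓡 m) 𝓘(ℝ, (ι → ℝ) →L[ℝ] (ι → ℝ)) ∞ A :=
    (contMDiff_const (c := l)).clm_comp hΘs
  have hA0 : A x₀ = 1 := by
    ext1 v
    exact LinearMap.congr_fun hl₀ v
  have hu : ∀ᶠ x in 𝓝 x₀, IsUnit (A x) := by
    refine (hA.continuous.continuousAt (x := x₀)).eventually_mem (s := {B | IsUnit B}) ?_
    exact Units.isOpen.mem_nhds (by rw [hA0]; exact isUnit_one)
  have hAinj : ∀ x, IsUnit (A x) → ∀ z ∈ Submodule.span ℝ (Set.range (g · x)), l z = 0 → z = 0 := by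
    rintro x ⟨U, hU⟩ z hz hlz
    obtain ⟨a, rfl⟩ := (hΘm x z).1 hz
    have h1 : A x a = 0 := hlz
    have h2 : ((U⁻¹ : ((ι → ℝ) →L[ℝ] (ι → ℝ))ˣ) : (ι → ℝ) →L[ℝ] (ι → ℝ)) (A x a) = a := by
      rw [← hU]
      exact congrArg (fun B : (ι → ℝ) →L[ℝ] (ι → ℝ) => B a) U.inv_mul
    rw [← h2, h1, map_zero, map_zero]
  let c : ι → M → (ι → ℝ) := fun j x => Ring.inverse (A x) (Pi.single j 1)
  have hc : ∀ x, IsUnit (A x) → ∀ j, A x (c j x) = Pi.single j 1 := by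
    intro x hx j
    exact congrArg (fun B : (ι → ℝ) →L[ℝ] (ι → ℝ) => B (Pi.single j 1))
      (Ring.mul_inverse_cancel _ hx)
  have hue := hu.eventually_nhds
  have hcs : ∀ᶠ x in 𝓝 x₀, ∀ j, ContMDiffAt (𝓡 m) 𝓘(ℝ, ι → ℝ) ∞ (c j) x := by
    filter_upwards [hue] with x hx j
    refine ContMDiffAt.solve_injective (hA x) ?_
      (contMDiffAt_const (c := (Pi.single j 1 : ι → ℝ))) ?_
    · obtain ⟨U, hU⟩ := hx.self_of_nhds
      refine Function.LeftInverse.injective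
        (g := ((U⁻¹ : ((ι → ℝ) →L[ℝ] (ι → ℝ))ˣ) : (ι → ℝ) →L[ℝ] (ι → ℝ))) fun a => ?_
      rw [← hU]
      exact congrArg (fun B : (ι → ℝ) →L[ℝ] (ι → ℝ) => B a) U.inv_mul
    · filter_upwards [hx] with x' hx'
      exact hc x' hx' j
  -- The frame is normalised so that `l` maps it to the standard basis. The derivatives of `e j`
  -- then lie in the span and are killed by `l`, which is injective there; so the `e j` are locally
  -- constant.
  let e : ι → M → F := fun j x => Θ x (c j x)
  have hle : ∀ x, IsUnit (A x) → ∀ j, l (e j x) = Pi.single j 1 := hc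
  have hed : ∀ᶠ x in 𝓝 x₀, ∀ j, MDifferentiableAt (𝓡 m) 𝓘(ℝ, F) (e j) x ∧
      ∀ v, mvfderiv (𝓡 m) (e j) x v = 0 := by
    filter_upwards [hue, hcs, hd] with x hx hcx hdx j
    have hes : ContMDiffAt (𝓡 m) 𝓘(ℝ, F) ∞ (e j) x := (hΘs x).clm_apply (hcx j)
    have hem := hes.mdifferentiableAt (by simp)
    refine ⟨hem, fun v => hAinj x hx.self_of_nhds _ ?_ ?_⟩
    · rw [mvfderiv_frameMap_apply hg ((hcx j).mdifferentiableAt (by simp)) v]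
      exact add_mem (Submodule.sum_mem _ fun i _ => Submodule.smul_mem _ _ (hdx i v))
        ((hΘm x _).2 ⟨_, rfl⟩)
    · have h1 := mvfderiv_comp_fderiv (φ := l) (h := e j) (x := x) l.differentiableAt hem v
      rw [l.fderiv] at h1
      rw [← h1]
      have h2 : (fun x => l (e j x)) =ᶠ[𝓝 x] fun _ => Pi.single j 1 := by
        filter_upwards [hx] with x' hx'
        exact hle x' hx' j
      rw [mvfderiv_congr (m := m) h2, mvfderiv_const]; rfl
  have hee : ∀ᶠ x in 𝓝 x₀, ∀ j, e j x = e j x₀ := by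
    rw [eventually_all]
    intro j
    exact eventually_eq_of_mvfderiv_eq_zero (hed.mono fun x hx => hx j)
  have hcomb : ∀ x, IsUnit (A x) → ∀ z ∈ Submodule.span ℝ (Set.range (g · x)),
      z = ∑ j, l z j • e j x := by
    intro x hx z hz
    rw [← sub_eq_zero]
    refine hAinj x hx _ (sub_mem hz (Submodule.sum_mem _ fun j _ => Submodule.smul_mem _ _
      ((hΘm x _).2 ⟨_, rfl⟩))) ?_
    rw [map_sub, map_sum]
    simp only [map_smul, hle x hx]
    rw [sub_eq_zero]
    ext i
    simp [Finset.sum_apply, Pi.single_apply]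
  have hsub : ∀ x y, IsUnit (A x) → (∀ j, e j x = e j y) →
      Submodule.span ℝ (Set.range (g · x)) ≤ Submodule.span ℝ (Set.range (g · y)) := by
    intro x y hx hxy z hz
    rw [hcomb x hx z hz]
    refine Submodule.sum_mem _ fun j _ => Submodule.smul_mem _ _ ?_
    rw [hxy j]
    exact (hΘm y _).2 ⟨_, rfl⟩
  filter_upwards [hu, hee] with x hx hex
  exact le_antisymm (hsub x x₀ hx hex) (hsub x₀ x hu.self_of_nhds fun j => (hex j).symm)

end ConstantSpan

/-! ### Reduction to a four-dimensional subspace -/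

namespace OrientedHypersurface.Envelops

variable {n : ℕ} {M : Type*} [TopologicalSpace M] [T2Space M]
  [ChartedSpace (EuclideanSpace ℝ (Fin n)) M] [IsManifold (𝓡 n) ∞ M]
  {L : Type*} [TopologicalSpace L] [T2Space L]
  [ChartedSpace (EuclideanSpace ℝ (Fin 2)) L] [IsManifold (𝓡 2) ∞ L]
  {H : OrientedHypersurface n M} {lam : M → ℝ}
  {P : LightConeModel (n + 1)} {π : M → L} {s : L → Minkowski (n + 2)}
  (hs : H.Envelops lam P π s)
include hs

theorem eventually_exists_fibre {p : M → Prop} {x₀ : M} (h : ∀ᶠ x in 𝓝 x₀, p x) :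
    ∀ᶠ y in 𝓝 (π x₀), ∃ x, π x = y ∧ p x := by
  obtain ⟨U', V, ρ, -, hx₀, hU, hV, hπV, hρ, -⟩ :=
    exists_local_section hs.smooth_π (hs.surjective_dπ x₀) h
  filter_upwards [hV.mem_nhds (hπV x₀ hx₀)] with y hy
  exact ⟨ρ y, (hρ y hy).2.2, hU (hρ y hy).2.1⟩

/-- An orthogonal basis of the nondegenerate, possibly indefinite form ⟨(A - λI)·,·⟩ on the plane
Δ^⊥. Polarisation gives v₁, and v₂ is taken in the kernel of the product with v₁. -/
theorem exists_hor_basis (x : M) : ∃ v₁ v₂ : H.hor lam x,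
    H.metric x (H.shapeSub lam x v₁) v₁ ≠ 0 ∧ H.metric x (H.shapeSub lam x v₁) v₂ = 0 ∧
    H.metric x (H.shapeSub lam x v₂) v₂ ≠ 0 := by
  have hzero : ∀ v : H.hor lam x, (∀ u : H.hor lam x, H.metric x (H.shapeSub lam x v) u = 0) →
      v = 0 := by
    intro v hv
    have h1 := H.eq_zero_of_metric_self (hv ⟨_, H.shapeSub_mem_hor P lam x v⟩)
    exact Subtype.ext (Submodule.disjoint_def.1 (H.disjoint_hor_Δ lam x) _ v.2
      ((H.mem_Δ lam).2 h1))
  have hsymm : ∀ v u, H.metric x (H.shapeSub lam x v) u = H.metric x (H.shapeSub lam x u) v :=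
    fun v u => by rw [H.metric_shapeSub P, H.metric_comm]
  obtain ⟨v₁, h₁⟩ : ∃ v₁ : H.hor lam x, H.metric x (H.shapeSub lam x v₁) v₁ ≠ 0 := by
    by_contra! h
    have h0 : ∀ v : H.hor lam x, v = 0 := by
      intro v
      refine hzero v fun u => ?_
      have h1 := h (v + u)
      rw [Submodule.coe_add, map_add, H.metric_add_left, H.metric_add_right, H.metric_add_right,
        h v, h u, hsymm u v] at h1
      linarith
    have : Subsingleton (H.hor lam x) := ⟨fun a b => by rw [h0 a, h0 b]⟩
    have h2 := hs.finrank_hor x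
    rw [Module.finrank_zero_of_subsingleton] at h2
    omega
  let q : H.hor lam x →ₗ[ℝ] ℝ :=
    { toFun := fun u => H.metric x (H.shapeSub lam x v₁) u
      map_add' := fun a b => H.metric_add_right x _ _ _
      map_smul' := fun c a => H.metric_smul_right x _ _ _ }
  have hker : LinearMap.ker q ≠ ⊥ := by
    intro hb
    have h2 := LinearMap.finrank_range_add_finrank_ker q
    rw [hb, finrank_bot, hs.finrank_hor] at h2
    have h3 := Submodule.finrank_le (LinearMap.range q)
    rw [Module.finrank_self] at h3
    omega
  obtain ⟨v₂, h₂, h₂0⟩ := Submodule.exists_mem_ne_zero_of_ne_bot hker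
  have h₂' : H.metric x (H.shapeSub lam x v₁) v₂ = 0 := h₂
  refine ⟨v₁, v₂, h₁, h₂', fun h₃ => h₂0 (hzero v₂ fun u => ?_)⟩
  have hli : LinearIndependent ℝ ![v₁, v₂] := by
    rw [LinearIndependent.pair_iff]
    intro a b hab
    have h4 := congrArg q hab
    have h5 : q (a • v₁ + b • v₂) = a * H.metric x (H.shapeSub lam x v₁) v₁ := by
      rw [map_add, map_smul, map_smul, show q v₂ = 0 from h₂']
      simp [q]
    rw [h5, map_zero] at h4
    have ha : a = 0 := (mul_eq_zero.1 h4).resolve_right h₁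
    rw [ha, zero_smul, zero_add] at hab
    exact ⟨ha, (smul_eq_zero.1 hab).resolve_right h₂0⟩
  have hspan := hli.span_eq_top_of_card_eq_finrank (by rw [hs.finrank_hor]; simp)
  have hu : u ∈ Submodule.span ℝ (Set.range ![v₁, v₂]) := hspan ▸ Submodule.mem_top
  rw [Matrix.range_cons, Matrix.range_cons, Matrix.range_empty, Set.union_empty,
    Set.singleton_union] at hu
  obtain ⟨a, b, rfl⟩ := Submodule.mem_span_pair.1 hu
  rw [Submodule.coe_add, Submodule.coe_smul, Submodule.coe_smul, H.metric_add_right,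
    H.metric_smul_right, H.metric_smul_right, h₃, hsymm v₂ v₁, h₂']
  ring

end OrientedHypersurface.Envelops

namespace OrientedHypersurface.Envelops

variable {n : ℕ} {M : Type*} [TopologicalSpace M] [T2Space M]
  [ChartedSpace (EuclideanSpace ℝ (Fin n)) M] [IsManifold (𝓡 n) ∞ M]
  {L : Type*} [TopologicalSpace L] [T2Space L]
  [ChartedSpace (EuclideanSpace ℝ (Fin 2)) L] [IsManifold (𝓡 2) ∞ L]
  {H : OrientedHypersurface n M} {lam : M → ℝ}
  {P : LightConeModel (n + 1)} {π : M → L} {s : L → Minkowski (n + 2)}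
  (hs : H.Envelops lam P π s)
include hs

theorem lorentz_dsurf_lc (x : M) (z : TangentSpace (𝓡 2) (π x)) :
    lorentz (mvfderiv (𝓡 2) s (π x) z) (H.lc P x) = 0 := by
  obtain ⟨v, rfl⟩ := hs.surjective_dπ x z
  rw [← hs.mvfderiv_comp, hs.lorentz_mvfderiv_lc]

theorem continuous_lorentz_leaf {g : L → Minkowski (n + 2)}
    (hg : ContMDiff (𝓡 2) 𝓘(ℝ, Minkowski (n + 2)) ∞ g) :
    Continuous (fun x => lorentz (g (π x)) (H.lc P x)) :=
  ((lorentzL (n + 2)).continuous.comp (hg.continuous.comp hs.smooth_π.continuous)).clm_apply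
    (H.smooth_lc P).continuous

/-- If the splitting tensor is scalar, the congruence lies locally in a four-dimensional subspace. -/
theorem exists_constant_span (hn : 3 ≤ n) {x₀ : M}
    (hC : ∀ᶠ x in 𝓝 x₀, ∀ T, H.SectionΔ lam T → ∃ c : ℝ, ∀ w, H.splitting lam T x w = c • w) :
    ∃ b : Fin 4 → Minkowski (n + 2), LinearIndependent ℝ b ∧ b 0 = s (π x₀) ∧
      (∃ v, b 1 = mvfderiv (𝓡 2) s (π x₀) v) ∧ (∃ v, b 2 = mvfderiv (𝓡 2) s (π x₀) v) ∧
      lorentz (b 3) (H.lc P x₀) ≠ 0 ∧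
      ∀ᶠ y in 𝓝 (π x₀), s y ∈ Submodule.span ℝ (Set.range b) ∧
        ∀ v, mvfderiv (𝓡 2) s y v ∈ Submodule.span ℝ (Set.range b) := by
  obtain ⟨v₁, v₂, h11, h12, h22⟩ := hs.exists_hor_basis x₀
  have hsymm : ∀ v u, H.metric x₀ (H.shapeSub lam x₀ v) u = H.metric x₀ (H.shapeSub lam x₀ u) v :=
    fun v u => by rw [H.metric_shapeSub P, H.metric_comm]
  obtain ⟨X₁, hX₁, hX₁v⟩ := exists_smoothField_apply (π x₀) (mfderiv (𝓡 n) (𝓡 2) π x₀ v₁)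
  obtain ⟨X₂, hX₂, hX₂v⟩ := exists_smoothField_apply (π x₀) (mfderiv (𝓡 n) (𝓡 2) π x₀ v₂)
  have hS := hs.smooth_surf
  have hg₁ := hS.dirDeriv hX₁
  have hg₂ := hS.dirDeriv hX₂
  -- As α' has rank one, these four vectors should span all second derivatives of s. The aim is to
  -- show that the span is constant.
  let g : Fin 4 → L → Minkowski (n + 2) :=
    ![s, dirDeriv X₁ s, dirDeriv X₂ s, dirDeriv X₁ (dirDeriv X₁ s)]
  have hg : ∀ i, ContMDiff (𝓡 2) 𝓘(ℝ, Minkowski (n + 2)) ∞ (g i) := by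
    intro i
    fin_cases i
    exacts [hS, hg₁, hg₂, hg₁.dirDeriv hX₁]
  have hmem : ∀ i y, g i y ∈ Submodule.span ℝ (Set.range (g · y)) := fun i y =>
    Submodule.subset_span ⟨i, rfl⟩
  have hq : ∀ {X Y : Π y : L, TangentSpace (𝓡 2) y}, SmoothField X → SmoothField Y →
      ∀ {v u : TangentSpace (𝓡 n) x₀}, X (π x₀) = mfderiv (𝓡 n) (𝓡 2) π x₀ v →
      Y (π x₀) = mfderiv (𝓡 n) (𝓡 2) π x₀ u →
      lorentz (dirDeriv X (dirDeriv Y s) (π x₀)) (H.lc P x₀)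
        = H.metric x₀ (H.shapeSub lam x₀ u) v := by
    intro X Y hX hY v u hv hu
    rw [← hs.lorentz_surfSff_lc_eq, hs.lorentz_surfSff_lc hY hv.symm hu.symm]
  have hq11 := hq hX₁ hX₁ hX₁v hX₁v
  have hq12 := hq hX₁ hX₂ hX₁v hX₂v
  have hq21 := hq hX₂ hX₁ hX₂v hX₁v
  have hq22 := hq hX₂ hX₂ hX₂v hX₂v
  rw [hsymm, h12] at hq12
  rw [h12] at hq21
  -- Only the last frame vector has a product with F, so this product isolates its coefficient.
  have hpair : ∀ x (a : Fin 4 → ℝ), lorentz (∑ i, a i • g i (π x)) (H.lc P x)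
      = a 3 * lorentz (dirDeriv X₁ (dirDeriv X₁ s) (π x)) (H.lc P x) := by
    intro x a
    rw [Fin.sum_univ_four, lorentz_add_left, lorentz_add_left, lorentz_add_left,
      lorentz_smul_left, lorentz_smul_left, lorentz_smul_left, lorentz_smul_left]
    change a 0 * lorentz (s (π x)) _ + a 1 * lorentz (mvfderiv (𝓡 2) s (π x) (X₁ (π x))) _
      + a 2 * lorentz (mvfderiv (𝓡 2) s (π x) (X₂ (π x))) _ + a 3 * _ = _
    rw [hs.lorentz_comp_lc, hs.lorentz_dsurf_lc, hs.lorentz_dsurf_lc]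
    change _ + a 3 * lorentz (dirDeriv X₁ (dirDeriv X₁ s) (π x)) _ = _
    ring
  have hli : LinearIndependent ℝ (fun i => g i (π x₀)) := by
    rw [Fintype.linearIndependent_iff]
    intro a ha
    have h3 : a 3 = 0 := by
      have h := hpair x₀ a
      rw [ha, lorentz_zero_left, hq11] at h
      exact (mul_eq_zero.1 h.symm).resolve_right h11
    rw [Fin.sum_univ_four, h3, zero_smul, add_zero] at ha
    change a 0 • s (π x₀) + a 1 • mvfderiv (𝓡 2) s (π x₀) (X₁ (π x₀))
      + a 2 • mvfderiv (𝓡 2) s (π x₀) (X₂ (π x₀)) = 0 at ha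
    have h0 : a 0 = 0 := by
      have h := congrArg (fun z => lorentz z (s (π x₀))) ha
      simp only [lorentz_add_left, lorentz_smul_left, hs.lorentz_surf, hs.lorentz_dsurf_surf,
        lorentz_zero_left] at h
      linarith
    rw [h0, zero_smul, zero_add, hX₁v, hX₂v] at ha
    have h7 : mvfderiv (𝓡 2) s (π x₀) (mfderiv (𝓡 n) (𝓡 2) π x₀
        (a 1 • (v₁ : TangentSpace (𝓡 n) x₀) + a 2 • (v₂ : TangentSpace (𝓡 n) x₀))) = 0 := by
      rw [map_add, map_add, map_smul, map_smul, map_smul, map_smul]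
      exact ha
    have h4 := hs.injective_mvfderiv (π x₀) (h7.trans (map_zero _).symm)
    have h5 : a 1 • (v₁ : TangentSpace (𝓡 n) x₀) + a 2 • (v₂ : TangentSpace (𝓡 n) x₀) = 0 :=
      Submodule.disjoint_def.1 (H.disjoint_hor_Δ lam x₀) _
        (add_mem (Submodule.smul_mem _ _ v₁.2) (Submodule.smul_mem _ _ v₂.2))
        (hs.mfderiv_eq_zero_iff.1 h4)
    have h6 : ∀ w, a 1 * H.metric x₀ w v₁ + a 2 * H.metric x₀ w v₂ = 0 := by
      intro w
      rw [← H.metric_smul_right, ← H.metric_smul_right, ← H.metric_add_right, h5]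
      simp [metric]
    have h1 := h6 (H.shapeSub lam x₀ v₁)
    have h2 := h6 (H.shapeSub lam x₀ v₂)
    rw [h12, mul_zero, add_zero] at h1
    rw [hsymm v₂ v₁, h12, mul_zero, zero_add] at h2
    intro i
    fin_cases i
    exacts [h0, (mul_eq_zero.1 h1).resolve_right h11, (mul_eq_zero.1 h2).resolve_right h22, h3]
  have hlie : ∀ᶠ y in 𝓝 (π x₀), LinearIndependent ℝ (fun i => g i y) := by
    refine Tendsto.eventually (p := fun z : Fin 4 → Minkowski (n + 2) => LinearIndependent ℝ z)
      (continuous_pi fun i => (hg i).continuous).continuousAt ?_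
    exact (isOpen_setOfPred_linearIndependent (𝕜 := ℝ) (E := Minkowski (n + 2))
      (ι := Fin 4)).mem_nhds hli
  have hframe : ∀ y, LinearIndependent ℝ (fun i => g i y) → ∀ v : TangentSpace (𝓡 2) y,
      ∃ a b : ℝ, v = a • X₁ y + b • X₂ y := by
    intro y hy v
    have h1 : LinearIndependent ℝ ![X₁ y, X₂ y] := by
      rw [LinearIndependent.pair_iff]
      intro a b hab
      have h2 := Fintype.linearIndependent_iff.1 hy ![0, a, b, 0] (by
        rw [Fin.sum_univ_four]
        change (0 : ℝ) • s y + a • mvfderiv (𝓡 2) s y (X₁ y) + b • mvfderiv (𝓡 2) s y (X₂ y)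
          + (0 : ℝ) • _ = 0
        rw [zero_smul, zero_smul, zero_add, add_zero, ← map_smul, ← map_smul, ← map_add, hab,
          map_zero])
      exact ⟨h2 1, h2 2⟩
    have hspan := h1.span_eq_top_of_card_eq_finrank (by rw [finrank_tangentSpace]; simp)
    have hu : v ∈ Submodule.span ℝ (Set.range ![X₁ y, X₂ y]) := hspan ▸ Submodule.mem_top
    rw [Matrix.range_cons, Matrix.range_cons, Matrix.range_empty, Set.union_empty,
      Set.singleton_union] at hu
    obtain ⟨a, b, h⟩ := Submodule.mem_span_pair.1 hu
    exact ⟨a, b, h.symm⟩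
  have hds : ∀ y, LinearIndependent ℝ (fun i => g i y) → ∀ v : TangentSpace (𝓡 2) y,
      mvfderiv (𝓡 2) s y v ∈ Submodule.span ℝ (Set.range (g · y)) := by
    intro y hy v
    obtain ⟨a, b, rfl⟩ := hframe y hy v
    rw [map_add, map_smul, map_smul]
    exact add_mem (Submodule.smul_mem _ _ (hmem 1 y)) (Submodule.smul_mem _ _ (hmem 2 y))
  have hc11 := hs.continuous_lorentz_leaf (hg₁.dirDeriv hX₁)
  have hc12 := hs.continuous_lorentz_leaf (hg₂.dirDeriv hX₁)
  have hc21 := hs.continuous_lorentz_leaf (hg₁.dirDeriv hX₂)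
  have hc22 := hs.continuous_lorentz_leaf (hg₂.dirDeriv hX₂)
  have hne11 : ∀ᶠ x in 𝓝 x₀,
      lorentz (dirDeriv X₁ (dirDeriv X₁ s) (π x)) (H.lc P x) ≠ 0 :=
    hc11.continuousAt.eventually_ne (by rw [hq11]; exact h11)
  -- Nondegeneracy of the bilinear form ⟨α'(·,·), F⟩, expressed by its determinant in the frame X₁,
  -- X₂.
  have hne22 : ∀ᶠ x in 𝓝 x₀,
      lorentz (dirDeriv X₁ (dirDeriv X₁ s) (π x)) (H.lc P x)
          * lorentz (dirDeriv X₂ (dirDeriv X₂ s) (π x)) (H.lc P x)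
        - lorentz (dirDeriv X₁ (dirDeriv X₂ s) (π x)) (H.lc P x)
          * lorentz (dirDeriv X₂ (dirDeriv X₁ s) (π x)) (H.lc P x) ≠ 0 := by
    refine ((hc11.mul hc22).sub (hc12.mul hc21)).continuousAt.eventually_ne ?_
    simp only [Pi.sub_apply, Pi.mul_apply]
    rw [hq11, hq12, hq22, zero_mul, sub_zero]
    exact mul_ne_zero h11 h22
  have hsec : ∀ᶠ y in 𝓝 (π x₀), ∀ X Y : Π y : L, TangentSpace (𝓡 2) y, SmoothField X →
      SmoothField Y →
      dirDeriv X (dirDeriv Y s) y ∈ Submodule.span ℝ (Set.range (g · y)) := by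
    filter_upwards [hs.eventually_exists_fibre (hC.eventually_nhds.and hne11), hlie]
      with y hy hliy X Y hX hY
    obtain ⟨x, rfl, hCx, hx⟩ := hy
    have hα : ∀ {X Y : Π y : L, TangentSpace (𝓡 2) y}, dirDeriv X (dirDeriv Y s) (π x)
        - surfSff s X Y (π x) ∈ Submodule.span ℝ (Set.range (g · (π x))) := by
      intro X Y
      have h1 : dirDeriv X (dirDeriv Y s) (π x) - surfSff s X Y (π x)
          = mvfderiv (𝓡 2) s (π x) (leviCivita (surfMetric s) Y (π x) (X (π x)))
            - surfMetric s (π x) (X (π x)) (Y (π x)) • s (π x) := by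
        rw [surfSff]
        change dirDeriv X (dirDeriv Y s) (π x) - (dirDeriv X (dirDeriv Y s) (π x) - _ + _) = _
        abel
      rw [h1]
      exact sub_mem (hds _ hliy _) (Submodule.smul_mem _ _ (hmem 0 _))
    have h2 := hs.surfSff_proportional hn hCx hX hY hX₁ hX₁
    rw [hs.lorentz_surfSff_lc_eq] at h2
    have h3 : surfSff s X Y (π x) ∈ Submodule.span ℝ (Set.range (g · (π x))) := by
      rw [← Submodule.smul_mem_iff _ hx, h2]
      refine Submodule.smul_mem _ _ ?_
      have h4 := sub_mem (hmem 3 (π x)) (hα (X := X₁) (Y := X₁))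
      rwa [show g 3 (π x) = dirDeriv X₁ (dirDeriv X₁ s) (π x) from rfl, sub_sub_cancel] at h4
    have h5 := add_mem (hα (X := X) (Y := Y)) h3
    rwa [sub_add_cancel] at h5
  -- This is the Codazzi equation for a rank one second fundamental form. Modulo the span, the
  -- derivative of X_i X_j s is c_ij times that of X₁X₁s. Applying [X₁,X₂] to X₁s and to X₂s gives
  -- c₂₁D₁ ≡ D₂ and c₂₂D₁ ≡ c₁₂D₂. The determinant of this system is nonzero, so the third
  -- derivatives D₁, D₂ lie in the span.
  have hd : ∀ᶠ y in 𝓝 (π x₀), ∀ i v,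
      mvfderiv (𝓡 2) (g i) y v ∈ Submodule.span ℝ (Set.range (g · y)) := by
    filter_upwards [hs.eventually_exists_fibre (hne11.and hne22), hlie, hsec.eventually_nhds]
      with y hy hliy hsecy
    obtain ⟨x, rfl, hx11, hx22⟩ := hy
    have hdg : ∀ {Y : Π y : L, TangentSpace (𝓡 2) y}, SmoothField Y → ∀ v,
        mvfderiv (𝓡 2) (dirDeriv Y s) (π x) v
          ∈ Submodule.span ℝ (Set.range (g · (π x))) := by
      intro Y hY v
      obtain ⟨a, b, rfl⟩ := hframe _ hliy v
      rw [map_add, map_smul, map_smul]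
      exact add_mem (Submodule.smul_mem _ _ (hsecy.self_of_nhds X₁ Y hX₁ hY))
        (Submodule.smul_mem _ _ (hsecy.self_of_nhds X₂ Y hX₂ hY))
    have hcoef : ∀ {X Y : Π y : L, TangentSpace (𝓡 2) y}, SmoothField X → SmoothField Y →
        ∃ c : ℝ, lorentz (dirDeriv X (dirDeriv Y s) (π x)) (H.lc P x)
            = c * lorentz (dirDeriv X₁ (dirDeriv X₁ s) (π x)) (H.lc P x) ∧
          ∀ v, mvfderiv (𝓡 2) (dirDeriv X (dirDeriv Y s)) (π x) v
            - c • mvfderiv (𝓡 2) (dirDeriv X₁ (dirDeriv X₁ s)) (π x) v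
              ∈ Submodule.span ℝ (Set.range (g · (π x))) := by
      intro X Y hX hY
      obtain ⟨c, hc, hcv⟩ := exists_coeff_mvfderiv hg hliy ((hS.dirDeriv hY).dirDeriv hX (π x))
        (hsecy.mono fun y' hy' => hy' X Y hX hY)
      refine ⟨c 3, by rw [hc, hpair], fun v => ?_⟩
      have h1 := hcv v
      rw [Fin.sum_univ_four] at h1
      have h2 : c 0 • mvfderiv (𝓡 2) (g 0) (π x) v + c 1 • mvfderiv (𝓡 2) (g 1) (π x) v
          + c 2 • mvfderiv (𝓡 2) (g 2) (π x) v ∈ Submodule.span ℝ (Set.range (g · (π x))) :=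
        add_mem (add_mem (Submodule.smul_mem _ _ (hds _ hliy v))
          (Submodule.smul_mem _ _ (hdg hX₁ v))) (Submodule.smul_mem _ _ (hdg hX₂ v))
      have h3 := add_mem h1 h2
      rwa [← sub_sub, sub_add_eq_add_sub, sub_add_cancel] at h3
    obtain ⟨c12, e12, m12⟩ := hcoef hX₁ hX₂
    obtain ⟨c21, e21, m21⟩ := hcoef hX₂ hX₁
    obtain ⟨c22, e22, m22⟩ := hcoef hX₂ hX₂
    have b1 := hdg hX₁ (VectorField.mlieBracket (𝓡 2) X₁ X₂ (π x))
    have b2 := hdg hX₂ (VectorField.mlieBracket (𝓡 2) X₁ X₂ (π x))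
    rw [mvfderiv_mlieBracket (hg₁ (π x)) (hX₁.at _) (hX₂.at _)] at b1
    rw [mvfderiv_mlieBracket (hg₂ (π x)) (hX₁.at _) (hX₂.at _)] at b2
    set D₁ := mvfderiv (𝓡 2) (dirDeriv X₁ (dirDeriv X₁ s)) (π x) (X₁ (π x)) with hD₁
    set D₂ := mvfderiv (𝓡 2) (dirDeriv X₁ (dirDeriv X₁ s)) (π x) (X₂ (π x)) with hD₂
    have r1 : c21 • D₁ - D₂ ∈ Submodule.span ℝ (Set.range (g · (π x))) := by
      have h := sub_mem b1 (m21 (X₁ (π x)))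
      convert h using 1
      change _ = (mvfderiv (𝓡 2) (dirDeriv X₂ (dirDeriv X₁ s)) (π x) (X₁ (π x)) - D₂)
        - (mvfderiv (𝓡 2) (dirDeriv X₂ (dirDeriv X₁ s)) (π x) (X₁ (π x)) - c21 • D₁)
      abel
    have r2 : c22 • D₁ - c12 • D₂ ∈ Submodule.span ℝ (Set.range (g · (π x))) := by
      have h := add_mem (sub_mem b2 (m22 (X₁ (π x)))) (m12 (X₂ (π x)))
      convert h using 1
      change _ = (mvfderiv (𝓡 2) (dirDeriv X₂ (dirDeriv X₂ s)) (π x) (X₁ (π x))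
          - mvfderiv (𝓡 2) (dirDeriv X₁ (dirDeriv X₂ s)) (π x) (X₂ (π x)))
        - (mvfderiv (𝓡 2) (dirDeriv X₂ (dirDeriv X₂ s)) (π x) (X₁ (π x)) - c22 • D₁)
        + (mvfderiv (𝓡 2) (dirDeriv X₁ (dirDeriv X₂ s)) (π x) (X₂ (π x)) - c12 • D₂)
      abel
    have hdet : c22 - c12 * c21 ≠ 0 := by
      intro h0
      apply hx22
      rw [e12, e21, e22]
      linear_combination
        (lorentz (dirDeriv X₁ (dirDeriv X₁ s) (π x)) (H.lc P x)) ^ 2 * h0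
    have m1 : D₁ ∈ Submodule.span ℝ (Set.range (g · (π x))) := by
      rw [← Submodule.smul_mem_iff _ hdet]
      have h := sub_mem r2 (Submodule.smul_mem _ c12 r1)
      convert h using 1
      module
    have m2 : D₂ ∈ Submodule.span ℝ (Set.range (g · (π x))) := by
      have h := sub_mem (Submodule.smul_mem _ c21 m1) r1
      rwa [sub_sub_cancel] at h
    have hd3 : ∀ v, mvfderiv (𝓡 2) (dirDeriv X₁ (dirDeriv X₁ s)) (π x) v
        ∈ Submodule.span ℝ (Set.range (g · (π x))) := by
      intro v
      obtain ⟨a, b, rfl⟩ := hframe _ hliy v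
      rw [map_add, map_smul, map_smul]
      exact add_mem (Submodule.smul_mem _ _ m1) (Submodule.smul_mem _ _ m2)
    intro i v
    fin_cases i
    exacts [hds _ hliy v, hdg hX₁ v, hdg hX₂ v, hd3 v]
  refine ⟨fun i => g i (π x₀), hli, rfl, ⟨_, rfl⟩, ⟨_, rfl⟩, hq11.trans_ne h11, ?_⟩
  filter_upwards [eventually_span_eq hg hli hd, hlie] with y hy hliy
  rw [← hy]
  exact ⟨hmem 0 y, hds y hliy⟩

end OrientedHypersurface.Envelops

/-! ### Orthonormal families in Minkowski space -/

/-- The positive definite form is installed as an inner product, and the orthonormal family is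
completed there. -/
theorem exists_orthonormal_extension {V : Type*} [AddCommGroup V] [Module ℝ V]
    [FiniteDimensional ℝ V] (B : V →ₗ[ℝ] V →ₗ[ℝ] ℝ) (hsymm : ∀ v u, B v u = B u v)
    (hpos : ∀ v, v ≠ 0 → 0 < B v v) {d : ℕ} (hd : Module.finrank ℝ V = d) (s : Set (Fin d))
    (v : Fin d → V) (hv : ∀ i ∈ s, ∀ j ∈ s, B (v i) (v j) = if i = j then 1 else 0) :
    ∃ b : Fin d → V, (∀ i j, B (b i) (b j) = if i = j then 1 else 0) ∧ ∀ i ∈ s, b i = v i := by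
  let c : InnerProductSpace.Core ℝ V :=
    { inner := fun x y => B x y
      conj_inner_symm := fun x y => hsymm y x
      re_inner_nonneg := fun x => by
        by_cases hx : x = 0
        · simp [hx]
        · exact (hpos x hx).le
      add_left := fun x y z => by simp
      smul_left := fun x y r => by simp
      definite := fun x hx => by
        by_contra h
        exact (hpos x h).ne' hx }
  let _ : NormedAddCommGroup V := @InnerProductSpace.Core.toNormedAddCommGroup ℝ V _ _ _ c
  let _ : InnerProductSpace ℝ V := InnerProductSpace.ofCore c.toCore
  have hin : ∀ x y : V, inner ℝ x y = B x y := fun _ _ => rfl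
  have ho : Orthonormal ℝ (s.domRestrict v) := by
    rw [orthonormal_iff_ite]
    rintro ⟨i, hi⟩ ⟨j, hj⟩
    simp only [Set.domRestrict_apply, hin, hv i hi j hj, Subtype.mk.injEq]
  obtain ⟨b, hb⟩ := ho.exists_orthonormalBasis_extension_of_card_eq (by rw [hd]; simp)
  refine ⟨b, fun i j => ?_, hb⟩
  rw [← hin]
  exact orthonormal_iff_ite.1 b.orthonormal i j

theorem lorentz_exists_orthonormal {k d : ℕ} (U : Submodule ℝ (Minkowski k))
    (hpos : ∀ z ∈ U, z ≠ 0 → 0 < lorentz z z) (hd : Module.finrank ℝ U = d) (s : Set (Fin d))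
    (v : Fin d → Minkowski k) (hvU : ∀ i ∈ s, v i ∈ U)
    (hv : ∀ i ∈ s, ∀ j ∈ s, lorentz (v i) (v j) = if i = j then 1 else 0) :
    ∃ b : Fin d → Minkowski k, (∀ i, b i ∈ U) ∧
      (∀ i j, lorentz (b i) (b j) = if i = j then 1 else 0) ∧ ∀ i ∈ s, b i = v i := by
  classical
  let B : U →ₗ[ℝ] U →ₗ[ℝ] ℝ := LinearMap.mk₂ ℝ (fun x y => lorentz (x : Minkowski k) y)
    (fun x y z => lorentz_add_left _ _ _) (fun c x y => lorentz_smul_left _ _ _)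
    (fun x y z => lorentz_add_right _ _ _) (fun c x y => lorentz_smul_right _ _ _)
  have hB : ∀ x y : U, B x y = lorentz (x : Minkowski k) y := fun _ _ => rfl
  let v' : Fin d → U := fun i => if h : i ∈ s then ⟨v i, hvU i h⟩ else 0
  have hv' : ∀ i ∈ s, (v' i : Minkowski k) = v i := fun i hi => by simp [v', hi]
  obtain ⟨b, hb, hbs⟩ := exists_orthonormal_extension B (fun x y => lorentz_comm _ _)
    (fun x hx => hpos x x.2 (by simpa using hx)) hd s v' (fun i hi j hj => by
      rw [hB, hv' i hi, hv' j hj, hv i hi j hj])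
  exact ⟨fun i => b i, fun i => (b i).2, hb, fun i hi => by
    change (b i : Minkowski k) = _
    rw [hbs i hi, hv' i hi]⟩

/-- The orthogonal complement of a vector of Minkowski space. -/
noncomputable def lorentzCompl {k : ℕ} (t : Minkowski k) : Submodule ℝ (Minkowski k) :=
  LinearMap.ker (lorentzL k t).toLinearMap

theorem finrank_lorentzCompl {k : ℕ} {t : Minkowski k} (ht : t ≠ 0) :
    Module.finrank ℝ (lorentzCompl t) = k := by
  have h1 := LinearMap.finrank_range_add_finrank_ker (lorentzL k t).toLinearMap
  have h2 : LinearMap.range (lorentzL k t).toLinearMap = ⊤ := by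
    rw [LinearMap.range_eq_top]
    obtain ⟨y, hy⟩ : ∃ y, lorentz t y ≠ 0 := by
      by_contra! h
      exact ht (eq_zero_of_lorentz h)
    intro r
    refine ⟨(r / lorentz t y) • y, ?_⟩
    change lorentz t ((r / lorentz t y) • y) = r
    rw [lorentz_smul_right, div_mul_cancel₀ _ hy]
  rw [h2, finrank_top, Module.finrank_self, finrank_euclideanSpace_fin] at h1
  change Module.finrank ℝ (LinearMap.ker (lorentzL k t).toLinearMap) = k
  omega

/-- An orthonormal family in the complement of a unit time-like vector can be completed. -/
theorem exists_orthonormal_of_timelike {k : ℕ} {t : Minkowski k} (ht : lorentz t t = -1)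
    (s : Set (Fin k)) (v : Fin k → Minkowski k) (hvt : ∀ i ∈ s, lorentz t (v i) = 0)
    (hv : ∀ i ∈ s, ∀ j ∈ s, lorentz (v i) (v j) = if i = j then 1 else 0) :
    ∃ b : Fin k → Minkowski k, (∀ i, lorentz t (b i) = 0) ∧
      (∀ i j, lorentz (b i) (b j) = if i = j then 1 else 0) ∧ ∀ i ∈ s, b i = v i := by
  have ht0 : t ≠ 0 := by
    rintro rfl
    rw [lorentz_zero_left] at ht
    norm_num at ht
  exact lorentz_exists_orthonormal (lorentzCompl t)
    (fun z hz h0 => lorentz_pos_of_orthogonal (t := t) (by rw [ht]; norm_num)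
      (by rw [lorentz_comm]; exact hz) h0) (finrank_lorentzCompl ht0) s v hvt hv

/-- There is a unit time-like vector orthogonal to a given orthonormal family. -/
theorem exists_timelike_orthogonal {k : ℕ} {ι : Type*} [Fintype ι] [DecidableEq ι]
    (a : ι → Minkowski k) (ha : ∀ i j, lorentz (a i) (a j) = if i = j then 1 else 0) :
    ∃ t : Minkowski k, lorentz t t = -1 ∧ ∀ i, lorentz t (a i) = 0 := by
  let t₀ : Minkowski k := EuclideanSpace.single 0 1
  have ht₀ : lorentz t₀ t₀ = -1 := by simp [lorentz, t₀]
  -- Removing the components along the orthonormal family lowers the square of the time axis to -1 -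
  -- Σ⟨t₀, a_i⟩². So the result stays time-like and can be normalised.
  let t := t₀ - ∑ i, lorentz t₀ (a i) • a i
  have hta : ∀ j, lorentz t (a j) = 0 := by
    intro j
    simp [t, lorentz_sub_left, lorentz_sum_left, lorentz_smul_left, ha]
  have htt : lorentz t t = -1 - ∑ i, lorentz t₀ (a i) ^ 2 := by
    have h1 : lorentz t t = lorentz t t₀ := by
      have h2 : lorentz t (∑ i, lorentz t₀ (a i) • a i) = 0 := by
        rw [lorentz_comm, lorentz_sum_left]
        refine Finset.sum_eq_zero fun i _ => ?_
        rw [lorentz_smul_left, lorentz_comm (a i) t, hta, mul_zero]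
      conv_lhs => rw [show t = t₀ - ∑ i, lorentz t₀ (a i) • a i from rfl, lorentz_sub_right]
      change lorentz t t₀ - lorentz t _ = _
      rw [h2, sub_zero]
    rw [h1]
    simp only [t, lorentz_sub_left, lorentz_sum_left, lorentz_smul_left, ht₀]
    congr 1
    exact Finset.sum_congr rfl fun i _ => by rw [lorentz_comm (a i), sq]
  have hneg : 0 < -lorentz t t := by
    rw [htt]
    have := Finset.sum_nonneg fun i (_ : i ∈ Finset.univ) => sq_nonneg (lorentz t₀ (a i))
    linarith
  refine ⟨(√(-lorentz t t))⁻¹ • t, ?_, fun i => by rw [lorentz_smul_left, hta, mul_zero]⟩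
  rw [lorentz_smul_left, lorentz_smul_right]
  have h1 := Real.mul_self_sqrt hneg.le
  have h2 : √(-lorentz t t) ≠ 0 := (Real.sqrt_pos.2 hneg).ne'
  field_simp
  nlinarith

namespace LightConeModel

/-- The light-cone model determined by a unit time-like vector and an orthonormal basis of its
orthogonal complement. -/
theorem exists_of_orthonormal {k : ℕ} {t : Minkowski (k + 1)} (ht : lorentz t t = -1)
    (e : Fin (k + 1) → Minkowski (k + 1)) (hte : ∀ i, lorentz t (e i) = 0)
    (he : ∀ i j, lorentz (e i) (e j) = if i = j then 1 else 0) :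
    ∃ Q : LightConeModel k, Q.p₀ = (1 / 2 : ℝ) • (e (Fin.last k) + t) ∧
      Q.w = e (Fin.last k) - t ∧
      ∀ i : Fin k, Q.C (EuclideanSpace.single i 1) = e i.castSucc := by
  have het : ∀ i, lorentz (e i) t = 0 := fun i => by rw [lorentz_comm, hte]
  have hww : lorentz (e (Fin.last k) - t) (e (Fin.last k) - t) = 0 := by
    simp only [lorentz_sub_left, lorentz_sub_right, he, hte, het, ht]
    simp
  have hpw : lorentz ((1 / 2 : ℝ) • (e (Fin.last k) + t)) (e (Fin.last k) - t) = 1 := by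
    simp only [lorentz_smul_left, lorentz_add_left, lorentz_sub_right, he, hte, het, ht]
    norm_num
  let C : EuclideanSpace ℝ (Fin k) →ₗ[ℝ] Minkowski (k + 1) :=
    ∑ i, (EuclideanSpace.proj i : EuclideanSpace ℝ (Fin k) →L[ℝ] ℝ).toLinearMap.smulRight
      (e i.castSucc)
  have hC : ∀ x, C x = ∑ i, x i • e i.castSucc := fun x => by simp [C]
  have hCe : ∀ x z, (∀ i : Fin k, lorentz (e i.castSucc) z = 0) → lorentz (C x) z = 0 := by
    intro x z hz
    rw [hC, lorentz_sum_left]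
    exact Finset.sum_eq_zero fun i _ => by rw [lorentz_smul_left, hz, mul_zero]
  have hlast : ∀ i : Fin k, lorentz (e i.castSucc) (e (Fin.last k)) = 0 := fun i => by
    rw [he, if_neg (Fin.castSucc_lt_last i).ne]
  refine ⟨⟨(1 / 2 : ℝ) • (e (Fin.last k) + t), e (Fin.last k) - t, C, ?_, hww, ?_, hpw, ?_, ?_, ?_⟩,
    rfl, rfl, fun i => ?_⟩
  · intro h0
    rw [h0, lorentz_zero_right] at hpw
    exact zero_ne_one hpw
  · simp only [lorentz_smul_left, lorentz_smul_right, lorentz_add_left, lorentz_add_right, he, hte,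
      het, ht]
    norm_num
  · intro x y
    have h1 : ∀ i : Fin k, lorentz (e i.castSucc) (C y) = y i := by
      intro i
      rw [lorentz_comm, hC, lorentz_sum_left]
      simp [lorentz_smul_left, he, Fin.castSucc_inj]
    rw [hC x, lorentz_sum_left]
    simp only [lorentz_smul_left, h1]
    simp [PiLp.inner_apply, mul_comm]
  · intro x
    refine hCe x _ fun i => ?_
    rw [lorentz_smul_right, lorentz_add_right, hlast, het]
    ring
  · intro x
    refine hCe x _ fun i => ?_
    rw [lorentz_sub_right, hlast, het]
    ring
  · change C _ = _
    rw [hC]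
    simp

end LightConeModel

/-! ### Change of the light-cone model -/

namespace LightConeModel

variable {k : ℕ} (P Q : LightConeModel k)

/-- The adjoint of `C` with respect to the Lorentz product. -/
noncomputable def adj : Minkowski (k + 1) →ₗ[ℝ] EuclideanSpace ℝ (Fin k) :=
  ∑ i, ((lorentzL (k + 1)).flip (P.C (EuclideanSpace.single i 1))).toLinearMap.smulRight
    (EuclideanSpace.single i (1 : ℝ))

theorem inner_adj (z : Minkowski (k + 1)) (y : EuclideanSpace ℝ (Fin k)) :
    inner ℝ (P.adj z) y = lorentz z (P.C y) := by
  have h1 : lorentzL (k + 1) z (P.C y)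
      = ∑ i, y i * lorentz z (P.C (EuclideanSpace.single i 1)) := by
    conv_lhs => rw [← (EuclideanSpace.basisFun (Fin k) ℝ).sum_repr y]
    simp only [map_sum, map_smul, EuclideanSpace.basisFun_repr, EuclideanSpace.basisFun_apply,
      smul_eq_mul]
    rfl
  rw [← lorentzL_apply, h1, adj]
  simp only [LinearMap.sum_apply, LinearMap.smulRight_apply, sum_inner, real_inner_smul_left,
    EuclideanSpace.inner_single_left]
  refine Finset.sum_congr rfl fun i _ => ?_
  change lorentz z _ * _ = _
  simp [mul_comm]

theorem adj_apply (z : Minkowski (k + 1)) (i : Fin k) :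
    P.adj z i = lorentz z (P.C (EuclideanSpace.single i 1)) := by
  rw [← inner_adj, EuclideanSpace.inner_single_right]
  simp

theorem decomp (z : Minkowski (k + 1)) :
    z = lorentz z P.w • P.p₀ + lorentz z P.p₀ • P.w + P.C (P.adj z) := by
  rw [← sub_eq_zero]
  apply P.eq_zero_of_orthogonal
  · simp only [lorentz_sub_left, lorentz_add_left, lorentz_smul_left, P.p₀_null, P.lorentz_w_p₀,
      P.C_p₀]
    ring
  · simp only [lorentz_sub_left, lorentz_add_left, lorentz_smul_left, P.w_null, P.p₀_w,
      P.C_w]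
    ring
  · intro y
    simp only [lorentz_sub_left, lorentz_add_left, lorentz_smul_left, P.lorentz_w_C,
      P.lorentz_p₀_C, P.C_isometry, P.inner_adj]
    ring

theorem lorentz_eq (z z' : Minkowski (k + 1)) :
    lorentz z z' = lorentz z P.w * lorentz z' P.p₀ + lorentz z P.p₀ * lorentz z' P.w
      + inner ℝ (P.adj z) (P.adj z') := by
  conv_lhs => rw [P.decomp z]
  rw [lorentz_add_left, lorentz_add_left, lorentz_smul_left, lorentz_smul_left,
    lorentz_comm P.p₀, lorentz_comm P.w, lorentz_comm (P.C _), ← P.inner_adj z',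
    real_inner_comm]

theorem adj_Psi (x : EuclideanSpace ℝ (Fin k)) : P.adj (P.Psi x) = x := by
  refine ext_inner_right ℝ fun y => ?_
  rw [P.inner_adj, P.lorentz_Psi_C]

/-- For a light-like vector the p₀-product is forced by the other two components, so off the
hyperplane w^⊥ the light cone consists of multiples of Ψ. -/
theorem eq_smul_Psi {z : Minkowski (k + 1)} (hz : lorentz z z = 0) (hw : lorentz z P.w ≠ 0) :
    z = lorentz z P.w • P.Psi ((lorentz z P.w)⁻¹ • P.adj z) := by
  set t := lorentz z P.w with ht
  have h1 := P.lorentz_eq z z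
  rw [hz, real_inner_self_eq_norm_sq, ← ht] at h1
  have h3 : lorentz z P.p₀ = -(1 / 2) * (t * ‖t⁻¹ • P.adj z‖ ^ 2) := by
    rw [norm_smul, mul_pow, Real.norm_eq_abs, sq_abs]
    field_simp
    linarith
  conv_lhs => rw [P.decomp z]
  rw [h3, Psi, smul_sub, smul_add, map_smul, smul_smul t t⁻¹, mul_inv_cancel₀ hw, one_smul, ← ht]
  module

/-- A linear map into the complement of `w` preserving the products gives an isometry. -/
theorem exists_isometry {f : EuclideanSpace ℝ (Fin k) →ₗ[ℝ] Minkowski (k + 1)}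
    (hf : ∀ x, lorentz (f x) (f x) = inner ℝ x x) (hw : ∀ x, lorentz (f x) P.w = 0) :
    ∃ B : EuclideanSpace ℝ (Fin k) ≃ₗᵢ[ℝ] EuclideanSpace ℝ (Fin k), ∀ x, B x = P.adj (f x) := by
  let B₀ : EuclideanSpace ℝ (Fin k) →ₗᵢ[ℝ] EuclideanSpace ℝ (Fin k) :=
    { toLinearMap := P.adj ∘ₗ f
      norm_map' := fun x => by
        have h1 := P.lorentz_eq (f x) (f x)
        rw [hw, hf, real_inner_self_eq_norm_sq, real_inner_self_eq_norm_sq] at h1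
        change ‖P.adj (f x)‖ = ‖x‖
        rw [← sq_eq_sq₀ (norm_nonneg _) (norm_nonneg _)]
        linarith }
  exact ⟨B₀.toLinearIsometryEquiv rfl, fun x => rfl⟩

/-- Two light-cone models are related by a Möbius transformation. -/
theorem exists_isMobius : ∃ (Φ : EuclideanSpace ℝ (Fin k) → EuclideanSpace ℝ (Fin k))
    (D : Set (EuclideanSpace ℝ (Fin k))), IsMobius Φ D ∧
      ∀ (x q : EuclideanSpace ℝ (Fin k)) (c : ℝ), P.Psi x = c • Q.Psi q → q ∈ D ∧ Φ q = x := by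
  have hnull : 2 * (lorentz P.w Q.w * lorentz P.w Q.p₀) + ‖Q.adj P.w‖ ^ 2 = 0 := by
    have h := Q.lorentz_eq P.w P.w
    rw [P.w_null, real_inner_self_eq_norm_sq] at h
    linarith
  -- Orthogonal light-like vectors are proportional: then both models have the same point at
  -- infinity and differ by a similarity. Otherwise P.w is a multiple of some Q.Ψ(a), and a is the
  -- pole of an inversion.
  by_cases hw : lorentz P.w Q.w = 0
  · have h1 : Q.adj P.w = 0 := by
      rw [hw, zero_mul, mul_zero, zero_add] at hnull
      simpa using hnull
    have h2 := Q.decomp P.w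
    rw [hw, h1, zero_smul, zero_add, map_zero, add_zero] at h2
    set α := lorentz P.w Q.p₀
    have hα : α ≠ 0 := by
      intro h
      rw [h, zero_smul] at h2
      exact P.w_ne_zero h2
    have hQw : Q.w = α⁻¹ • P.w := by rw [h2, smul_smul, inv_mul_cancel₀ hα, one_smul]
    obtain ⟨B, hB⟩ := P.exists_isometry (f := Q.C) (fun x => Q.C_isometry x x) (fun x => by
      rw [h2, lorentz_smul_right, Q.C_w, mul_zero])
    refine ⟨fun q => α⁻¹ • B q + α⁻¹ • P.adj Q.p₀, Set.univ,
      ⟨α⁻¹, B, _, inv_ne_zero hα, Or.inl ⟨rfl, fun _ => rfl⟩⟩, fun x q c h => ⟨trivial, ?_⟩⟩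
    have hc : c = α⁻¹ := by
      have h3 := P.lorentz_Psi_w x
      rw [h, h2, lorentz_smul_left, lorentz_smul_right, Q.lorentz_Psi_w, mul_one] at h3
      exact eq_inv_of_mul_eq_one_left h3
    have hadjw : P.adj P.w = 0 := by
      refine ext_inner_right ℝ fun y => ?_
      rw [P.inner_adj, P.lorentz_w_C, inner_zero_left]
    beta_reduce
    rw [← P.adj_Psi x, h, hc, Psi, map_smul, map_sub, map_add, map_smul, hQw, map_smul, hadjw,
      smul_zero, smul_zero, sub_zero, hB, smul_add, add_comm]
  · set β := lorentz P.w Q.w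
    obtain ⟨a, hadef⟩ : ∃ a, a = β⁻¹ • Q.adj P.w := ⟨_, rfl⟩
    have ha : P.w = β • Q.Psi a := by
      conv_lhs => rw [Q.decomp P.w]
      have h3 : lorentz P.w Q.p₀ = -(1 / 2) * (β * ‖a‖ ^ 2) := by
        rw [hadef, norm_smul, mul_pow, Real.norm_eq_abs, sq_abs]
        field_simp
        linarith
      rw [h3, Psi, smul_sub, smul_add, show Q.C a = β⁻¹ • Q.C (Q.adj P.w) by rw [hadef, map_smul],
        smul_smul β β⁻¹, mul_inv_cancel₀ hw, one_smul]
      module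
    obtain ⟨B, hB⟩ := P.exists_isometry (f := (Q.dPsi a).toLinearMap)
      (fun x => Q.lorentz_dPsi_dPsi a x x) (fun x => by
        rw [ha, lorentz_smul_right]
        exact mul_eq_zero_of_right _ (Q.lorentz_dPsi_Psi a x))
    refine ⟨fun q => (-(2 / β)) • B (EuclideanGeometry.inversion a 1 q)
      + ((2 / β) • B a + β⁻¹ • P.adj Q.w), {a}ᶜ,
      ⟨-(2 / β), B, _, neg_ne_zero.2 (div_ne_zero two_ne_zero hw), Or.inr ⟨a, rfl, fun _ => rfl⟩⟩,
      fun x q c h => ?_⟩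
    have hadjw : P.adj (Q.Psi a) = 0 := by
      have h4 : P.adj P.w = 0 := by
        refine ext_inner_right ℝ fun y => ?_
        rw [P.inner_adj, P.lorentz_w_C, inner_zero_left]
      rw [ha, map_smul] at h4
      exact (smul_eq_zero.1 h4).resolve_left hw
    -- The product with P.w fixes the factor; it also shows q ≠ a.
    have hc : c * (β * (-(1 / 2) * ‖q - a‖ ^ 2)) = 1 := by
      have h3 := P.lorentz_Psi_w x
      rwa [h, ha, lorentz_smul_left, lorentz_smul_right, Q.lorentz_Psi_Psi] at h3
    have hqa : q ≠ a := by
      rintro rfl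
      simp at hc
    have hn : ‖q - a‖ ≠ 0 := norm_ne_zero_iff.2 (sub_ne_zero.2 hqa)
    refine ⟨hqa, ?_⟩
    -- The exact Taylor expansion of the quadratic map Ψ at a. Its constant term is a multiple of
    -- P.w and disappears under `P.adj`.
    have hPsi : Q.Psi q = Q.Psi a + Q.dPsi a (q - a) - ((1 / 2 : ℝ) * ‖q - a‖ ^ 2) • Q.w := by
      have h5 : ‖q‖ ^ 2 = ‖a‖ ^ 2 + 2 * inner ℝ a (q - a) + ‖q - a‖ ^ 2 := by
        have := norm_add_sq_real a (q - a)
        rwa [add_sub_cancel] at this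
      rw [Psi, Psi, dPsi_apply, h5, map_sub]
      module
    have hinv : EuclideanGeometry.inversion a 1 q = a + (1 / ‖q - a‖ ^ 2) • (q - a) := by
      rw [EuclideanGeometry.inversion, dist_eq_norm, vsub_eq_sub, vadd_eq_add, add_comm]
      congr 2
      rw [div_pow, one_pow]
    have hc' : c = -(2 / β) * (1 / ‖q - a‖ ^ 2) := by
      field_simp at hc ⊢
      linarith
    have hx : x = c • (B (q - a) - ((1 / 2 : ℝ) * ‖q - a‖ ^ 2) • P.adj Q.w) := by
      rw [← P.adj_Psi x, h, map_smul, hPsi, map_sub, map_add, hadjw, zero_add, map_smul, hB]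
      rfl
    beta_reduce
    rw [hx, hinv, map_add B, map_smul B, hc', smul_sub, smul_smul]
    have h6 : -(2 / β) * (1 / ‖q - a‖ ^ 2) * (1 / 2 * ‖q - a‖ ^ 2) = -β⁻¹ := by
      field_simp
    rw [h6]
    module

end LightConeModel

/-! ### Regular surfaces -/

/-- A smooth map with injective derivative is an embedding near the point. -/
theorem exists_isEmbedding_restrict {E F : Type*} [NormedAddCommGroup E] [NormedSpace ℝ E]
    [FiniteDimensional ℝ E] [NormedAddCommGroup F] [NormedSpace ℝ F] [FiniteDimensional ℝ F]
    {σ : E → F} {u₀ : E}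
    (hinj : Function.Injective (fderiv ℝ σ u₀)) {N : Set E} (hN : N ∈ 𝓝 u₀)
    (hσN : ∀ u ∈ N, ContDiffAt ℝ ∞ σ u) :
    ∃ W ⊆ N, IsOpen W ∧ u₀ ∈ W ∧ ContDiffOn ℝ ∞ σ W ∧
      (∀ u ∈ W, Function.Injective (fderiv ℝ σ u)) ∧ Topology.IsEmbedding (W.domRestrict σ) := by
  have hσ := hσN u₀ (mem_of_mem_nhds hN)
  obtain ⟨l₀, hl₀⟩ := LinearMap.exists_leftInverse_of_injective (fderiv ℝ σ u₀).toLinearMap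
    (LinearMap.ker_eq_bot.2 hinj)
  let l : F →L[ℝ] E := l₀.toContinuousLinearMap
  -- A linear left inverse of the derivative makes `l ∘ σ` a local homeomorphism. Since a
  -- composition with `l` is an embedding, so is the restriction of `σ`.
  have hstrict : HasStrictFDerivAt (fun u => l (σ u)) (ContinuousLinearEquiv.refl ℝ E : E →L[ℝ] E)
      u₀ := by
    have h1 := l.hasStrictFDerivAt.comp u₀ (hσ.hasStrictFDerivAt (by simp))
    have h2 : l ∘L fderiv ℝ σ u₀ = (ContinuousLinearEquiv.refl ℝ E : E →L[ℝ] E) := by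
      ext v
      exact LinearMap.congr_fun hl₀ v
    rwa [h2] at h1
  let e := hstrict.toOpenPartialHomeomorph (fun u => l (σ u))
  have hinje : ∀ᶠ u in 𝓝 u₀, Function.Injective (fderiv ℝ σ u) := by
    have hc : ContinuousAt (fderiv ℝ σ) u₀ := (hσ.fderiv_right (m := 0) (by simp)).continuousAt
    have := hc.eventually (ContinuousLinearMap.isOpen_injective.mem_nhds hinj)
    exact this
  obtain ⟨W, hW, hWo, hu₀⟩ := mem_nhds_iff.1 (Filter.inter_mem hN (Filter.inter_mem
    (e.open_source.mem_nhds hstrict.mem_toOpenPartialHomeomorph_source)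
    hinje))
  refine ⟨W, fun u hu => (hW hu).1, hWo, hu₀,
    fun u hu => (hσN u (hW hu).1).contDiffWithinAt, fun u hu => (hW hu).2.2, ?_⟩
  have hcont : Continuous (W.domRestrict σ) :=
    continuousOn_iff_continuous_domRestrict.1
      fun u hu => (hσN u (hW hu).1).continuousAt.continuousWithinAt
  refine Topology.IsEmbedding.of_comp hcont l.continuous ?_
  exact e.toPartialHomeomorph.isEmbedding_restrict.comp
    (Topology.IsEmbedding.inclusion fun u hu => (hW hu).2.1)

section
variable {n : ℕ} {M : Type*} [TopologicalSpace M]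
  [ChartedSpace (EuclideanSpace ℝ (Fin n)) M] [IsManifold (𝓡 n) ∞ M]
  {L : Type*} [TopologicalSpace L]
  [ChartedSpace (EuclideanSpace ℝ (Fin 2)) L] [IsManifold (𝓡 2) ∞ L]

/-- A map that factors through a submersion onto a surface, with derivative of rank two, has
locally a regular surface as image. -/
theorem exists_isRegularSurface_image {π : M → L} (hπ : ContMDiff (𝓡 n) (𝓡 2) ∞ π) {x₀ : M}
    (hsurj : Function.Surjective (mfderiv (𝓡 n) (𝓡 2) π x₀)) {U : Set M} (hU : U ∈ 𝓝 x₀)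
    {k : ℕ} {h : M → EuclideanSpace ℝ (Fin k)}
    (hh : ∀ x ∈ U, ContMDiffAt (𝓡 n) 𝓘(ℝ, EuclideanSpace ℝ (Fin k)) ∞ h x)
    (hd : ∀ x ∈ U, ∀ v, mvfderiv (𝓡 n) h x v = 0 ↔ mfderiv (𝓡 n) (𝓡 2) π x v = 0) :
    ∃ V ⊆ U, IsOpen V ∧ x₀ ∈ V ∧ IsRegularSurface (h '' V) := by
  obtain ⟨U', V, ρ, hU', hx₀, hUU, hV, hπV, hρ, hρx, hfac⟩ := exists_local_section hπ hsurj hU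
  have hfac' := hfac _ h fun x hx => ⟨(hh x (hUU hx)).mdifferentiableAt (by simp),
    fun v hv => (hd x (hUU hx) v).2 hv⟩
  let χ := extChartAt (𝓡 2) (π x₀)
  let hb : L → EuclideanSpace ℝ (Fin k) := fun y => h (ρ y)
  have hbs : ∀ y ∈ V, ContMDiffAt (𝓡 2) 𝓘(ℝ, EuclideanSpace ℝ (Fin k)) ∞ hb y := fun y hy =>
    (hh _ (hUU (hρ y hy).2.1)).comp (g := h) (f := ρ) y (hρ y hy).1
  have hy₀ : π x₀ ∈ V := hπV x₀ hx₀
  let σ := hb ∘ χ.symm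
  have hbm := (hbs _ hy₀).mdifferentiableAt (n := ∞) (by simp)
  have hinj : Function.Injective (mvfderiv (𝓡 2) hb (π x₀)) := by
    rw [injective_iff_map_eq_zero]
    intro z hz
    obtain ⟨v, rfl⟩ := hsurj z
    rw [← hd x₀ (hUU hx₀) v]
    have h1 : h =ᶠ[𝓝 x₀] fun x => hb (π x) := by
      filter_upwards [hU'.mem_nhds hx₀] with x hx
      exact hfac' x hx
    rw [mvfderiv_congr (m := n) h1]
    exact (mvfderiv_comp_vec hbm ((hπ x₀).mdifferentiableAt (by simp)) v).trans hz
  have hc : ContinuousAt χ.symm (χ (π x₀)) := continuousAt_extChartAt_symm (I := 𝓡 2) (π x₀)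
  have hN : χ.target ∩ χ.symm ⁻¹' V ∈ 𝓝 (χ (π x₀)) := by
    refine Filter.inter_mem (extChartAt_target_mem_nhds _) (hc ?_)
    rw [extChartAt_to_inv]
    exact hV.mem_nhds hy₀
  have hσ : ∀ u ∈ χ.target ∩ χ.symm ⁻¹' V, ContDiffAt ℝ ∞ σ u := by
    rintro u ⟨hu, huV⟩
    rw [← contMDiffAt_iff_contDiffAt]
    exact (hbs _ huV).comp u ((contMDiffOn_extChartAt_symm (n := ∞) (π x₀)).contMDiffAt
      ((isOpen_extChartAt_target (π x₀)).mem_nhds hu))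
  have hσinj : Function.Injective (fderiv ℝ σ (χ (π x₀))) := by
    rw [injective_iff_map_eq_zero]
    intro w hw
    obtain ⟨A, hA⟩ := isInvertible_mfderiv_extChartAt (I := 𝓡 2) (mem_extChartAt_source (π x₀))
    obtain ⟨z, rfl⟩ := A.surjective w
    have h1 : hb =ᶠ[𝓝 (π x₀)] fun y => σ (χ y) := by
      filter_upwards [extChartAt_source_mem_nhds (I := 𝓡 2) (π x₀)] with y hy
      change hb y = hb (χ.symm (χ y))
      rw [χ.left_inv hy]
    have h2 := mvfderiv_comp_fderiv (φ := σ) (h := χ) (x := π x₀)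
      ((hσ _ (mem_of_mem_nhds hN)).differentiableAt (by simp))
      (mdifferentiableAt_extChartAt (mem_chart_source _ _)) z
    have h3 : mvfderiv (𝓡 2) χ (π x₀) z = A z :=
      (congrArg (fun l => l z) hA).symm
    rw [← mvfderiv_congr (m := 2) h1, h3, hw] at h2
    have h4 := hinj (h2.trans (map_zero _).symm)
    rw [h4, map_zero]
    rfl
  obtain ⟨W, hWN, hWo, hu₀, hWs, hWi, hWe⟩ := exists_isEmbedding_restrict hσinj hN hσ
  have hχo : IsOpen (χ.source ∩ χ ⁻¹' W) :=
    (continuousOn_extChartAt (π x₀)).isOpen_inter_preimage (isOpen_extChartAt_source _) hWo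
  -- Inside `U'` the neighbourhood is cut out by a condition on π alone, so its image under `h` is
  -- the single parametrised piece `σ '' W`.
  refine ⟨U' ∩ π ⁻¹' (χ.source ∩ χ ⁻¹' W), fun x hx => hUU hx.1,
    hU'.inter (hχo.preimage hπ.continuous), ⟨hx₀, mem_extChartAt_source _, hu₀⟩, ?_⟩
  have himg : h '' (U' ∩ π ⁻¹' (χ.source ∩ χ ⁻¹' W)) = σ '' W := by
    ext z
    constructor
    · rintro ⟨x, ⟨hx, hxs, hxW⟩, rfl⟩
      refine ⟨χ (π x), hxW, ?_⟩
      change h (ρ (χ.symm (χ (π x)))) = _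
      rw [χ.left_inv hxs, hfac' x hx]
    · rintro ⟨u, hu, rfl⟩
      have h1 := hρ _ (hWN hu).2
      refine ⟨ρ (χ.symm u), ⟨h1.2.1, ?_⟩, rfl⟩
      rw [Set.mem_preimage, h1.2.2]
      exact ⟨χ.map_target (hWN hu).1, by
        change χ (χ.symm u) ∈ W
        rwa [χ.right_inv (hWN hu).1]⟩
  intro p _
  exact ⟨Set.univ, isOpen_univ, trivial, W, σ, hWo, hWs, hWi, hWe, by
    rw [himg, Set.inter_univ]⟩

end

/-! ### The leaves seen from the four-dimensional subspace -/

namespace OrientedHypersurface.Envelops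

variable {n : ℕ} {M : Type*} [TopologicalSpace M] [T2Space M]
  [ChartedSpace (EuclideanSpace ℝ (Fin n)) M] [IsManifold (𝓡 n) ∞ M]
  {L : Type*} [TopologicalSpace L] [T2Space L]
  [ChartedSpace (EuclideanSpace ℝ (Fin 2)) L] [IsManifold (𝓡 2) ∞ L]
  {H : OrientedHypersurface n M} {lam : M → ℝ}
  {P : LightConeModel (n + 1)} {π : M → L} {s : L → Minkowski (n + 2)}
  (hs : H.Envelops lam P π s)
include hs

/-- A four-dimensional subspace that contains the congruence to first order is spanned by it and
any further vector. -/
theorem exists_eq_add_smul {W : Submodule ℝ (Minkowski (n + 2))} (hW : Module.finrank ℝ W = 4)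
    {y : L} (hsW : s y ∈ W) (hdW : ∀ v, mvfderiv (𝓡 2) s y v ∈ W) {z : Minkowski (n + 2)}
    (hz : z ∈ W) (hz' : ∀ (r : ℝ) v, z ≠ r • s y + mvfderiv (𝓡 2) s y v)
    {b : Minkowski (n + 2)} (hb : b ∈ W) :
    ∃ (r c : ℝ) (v : TangentSpace (𝓡 2) y), b = r • s y + mvfderiv (𝓡 2) s y v + c • z := by
  let E : (ℝ × TangentSpace (𝓡 2) y) →ₗ[ℝ] Minkowski (n + 2) :=
    LinearMap.coprod (LinearMap.toSpanSingleton ℝ _ (s y)) (mvfderiv (𝓡 2) s y).toLinearMap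
  have hE : ∀ r v, E (r, v) = r • s y + mvfderiv (𝓡 2) s y v := fun _ _ => rfl
  have hEinj : Function.Injective E := by
    rw [injective_iff_map_eq_zero]
    rintro ⟨r, v⟩ h
    rw [hE] at h
    have h1 := congrArg (fun z => lorentz z (s y)) h
    simp only [lorentz_add_left, lorentz_smul_left, hs.lorentz_surf, hs.lorentz_dsurf_surf,
      lorentz_zero_left] at h1
    have hr : r = 0 := by linarith
    rw [hr, zero_smul, zero_add] at h
    have hv := hs.injective_mvfderiv y (h.trans (map_zero _).symm)
    rw [hr, hv]
    rfl
  have hfr : Module.finrank ℝ (LinearMap.range E) = 3 := by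
    rw [LinearMap.finrank_range_of_inj hEinj, Module.finrank_prod, Module.finrank_self,
      finrank_tangentSpace]
  have hle : LinearMap.range E ⊔ Submodule.span ℝ {z} ≤ W := by
    refine sup_le ?_ ?_
    · rintro _ ⟨⟨r, v⟩, rfl⟩
      rw [hE]
      exact add_mem (Submodule.smul_mem _ _ hsW) (hdW v)
    · rwa [Submodule.span_singleton_le_iff_mem]
  have hlt : LinearMap.range E < LinearMap.range E ⊔ Submodule.span ℝ {z} := by
    rw [left_lt_sup, Submodule.span_singleton_le_iff_mem]
    rintro ⟨⟨r, v⟩, h⟩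
    exact hz' r v (h.symm.trans (hE r v))
  have h4 := Submodule.finrank_lt_finrank_of_lt hlt
  have heq := Submodule.eq_of_le_of_finrank_le hle (by omega)
  rw [← heq] at hb
  obtain ⟨_, ⟨⟨r, v⟩, rfl⟩, _, hc, rfl⟩ := Submodule.mem_sup.1 hb
  obtain ⟨c, rfl⟩ := Submodule.mem_span_singleton.1 hc
  exact ⟨r, c, v, rfl⟩

variable {ι : Type*} {A : ι → Minkowski (n + 2)}
  (hA : Module.finrank ℝ (Submodule.span ℝ (Set.range A)) = 4) {x : M}
  (hsA : s (π x) ∈ Submodule.span ℝ (Set.range A))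
  (hdA : ∀ v, mvfderiv (𝓡 2) s (π x) v ∈ Submodule.span ℝ (Set.range A))
  (hFA : ∃ i, lorentz (A i) (H.lc P x) ≠ 0)
include hA hsA hdA hFA

/-- The leaves are the directions in which the part of the light-cone representative in the
four-dimensional subspace moves along a line. -/
theorem mem_Δ_iff_exists_mul {v : TangentSpace (𝓡 n) x} :
    v ∈ H.Δ lam x ↔ ∃ μ : ℝ, ∀ i, lorentz (mvfderiv (𝓡 n) (H.lc P) x v) (A i)
      = μ * lorentz (H.lc P x) (A i) := by
  constructor
  · intro hv
    obtain ⟨i₀, hi₀⟩ := hFA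
    obtain ⟨T, hT, rfl⟩ := hs.exists_sectionΔ hv
    refine ⟨lorentz (A i₀) (mvfderiv (𝓡 n) (H.lc P) x (T x)) / lorentz (A i₀) (H.lc P x),
      fun i => ?_⟩
    -- Modulo s and s_*TL, which are orthogonal to F and to F_*T, every A i is a multiple of A i₀.
    -- Hence one ratio μ serves all indices.
    obtain ⟨r, c, u, h⟩ := hs.exists_eq_add_smul hA hsA hdA (Submodule.subset_span ⟨i₀, rfl⟩)
      (fun r v h => hi₀ (by
        rw [h, lorentz_add_left, lorentz_smul_left, hs.lorentz_comp_lc, hs.lorentz_dsurf_lc]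
        ring)) (Submodule.subset_span ⟨i, rfl⟩)
    rw [lorentz_comm _ (A i), lorentz_comm _ (A i), h]
    simp only [lorentz_add_left, lorentz_smul_left, hs.lorentz_comp_lc, hs.lorentz_dsurf_lc,
      hs.lorentz_comp_dlc, hs.lorentz_dsurf_leaf hT]
    field_simp
    ring
  · rintro ⟨μ, hμ⟩
    have hW : ∀ z ∈ Submodule.span ℝ (Set.range A), lorentz (mvfderiv (𝓡 n) (H.lc P) x v) z
        = μ * lorentz (H.lc P x) z := by
      intro z hz
      induction hz using Submodule.span_induction with
      | mem z hz => obtain ⟨i, rfl⟩ := hz; exact hμ i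
      | zero => rw [lorentz_zero_right, lorentz_zero_right, mul_zero]
      | add a b _ _ ha hb => rw [lorentz_add_right, lorentz_add_right, ha, hb, mul_add]
      | smul c a _ ha => rw [lorentz_smul_right, lorentz_smul_right, ha]; ring
    rw [H.mem_Δ]
    apply H.eq_zero_of_metric
    intro u
    -- The subspace contains s_* π_* u. This vector is orthogonal to F, and its product with F_*v is
    -- -⟨(A - λI)u, v⟩.
    have h1 := hW _ (hdA (mfderiv (𝓡 n) (𝓡 2) π x u))
    rw [lorentz_comm (H.lc P x), hs.lorentz_dsurf_lc, lorentz_comm, ← hs.mvfderiv_comp,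
      hs.lorentz_mvfderiv_dlc] at h1
    rw [H.metric_comm, ← H.metric_shapeSub P lam x u v]
    linarith

/-- F is not tangent to the congruence, so together with s and s_*TL it would span the subspace. All
these vectors are orthogonal to F, contrary to `hFA`. -/
theorem lc_notMem_span : H.lc P x ∉ Submodule.span ℝ (Set.range A) := by
  intro hF
  obtain ⟨i, hi⟩ := hFA
  have h0 : ∀ (r : ℝ) v, H.lc P x ≠ r • s (π x) + mvfderiv (𝓡 2) s (π x) v := by
    intro r v h
    have h1 := hs.lorentz_comp_lc x
    rw [lorentz_comm, h, lorentz_add_left, lorentz_smul_left, hs.lorentz_surf,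
      hs.lorentz_dsurf_surf] at h1
    have hr : r = 0 := by linarith
    have h2 := H.lorentz_lc_lc P x
    rw [h, hr, zero_smul, zero_add] at h2
    have hv := hs.eq_zero_of_surfMetric_self h2
    have h3 := H.lorentz_lc_w P x
    rw [h, hr, hv, zero_smul, zero_add, map_zero, lorentz_zero_left] at h3
    exact zero_ne_one h3
  obtain ⟨r, c, u, h⟩ := hs.exists_eq_add_smul hA hsA hdA hF h0 (Submodule.subset_span ⟨i, rfl⟩)
  apply hi
  rw [h, lorentz_add_left, lorentz_add_left, lorentz_smul_left, lorentz_smul_left,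
    hs.lorentz_comp_lc, hs.lorentz_dsurf_lc, H.lorentz_lc_lc]
  ring

end OrientedHypersurface.Envelops

/-! ### Adapted bases and light-cone models -/

theorem exists_mul_self_mul (r : ℝ) : ∃ c : ℝ, c ≠ 0 ∧
    (c * (c * r) = 1 ∨ c * (c * r) = 0 ∨ c * (c * r) = -1) := by
  rcases lt_trichotomy r 0 with h | h | h
  · have h1 : 0 < √(-r) := Real.sqrt_pos.2 (by linarith)
    have h2 := Real.mul_self_sqrt (show 0 ≤ -r by linarith)
    refine ⟨(√(-r))⁻¹, inv_ne_zero h1.ne', Or.inr (Or.inr ?_)⟩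
    field_simp
    linarith
  · exact ⟨1, one_ne_zero, Or.inr (Or.inl (by rw [h]; ring))⟩
  · have h1 : 0 < √r := Real.sqrt_pos.2 h
    have h2 := Real.mul_self_sqrt h.le
    refine ⟨(√r)⁻¹, inv_ne_zero h1.ne', Or.inl ?_⟩
    field_simp
    linarith

/-- An orthogonal basis of a four-dimensional subspace with a space-like three-dimensional part. -/
theorem exists_orthogonal_basis {k : ℕ} {b : Fin 4 → Minkowski k} (hb : LinearIndependent ℝ b)
    (hpos : ∀ z ∈ Submodule.span ℝ (Set.range fun i : Fin 3 => b i.castSucc), z ≠ 0 →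
      0 < lorentz z z) :
    ∃ (A : Fin 4 → Minkowski k) (ε : ℝ), (ε = 1 ∨ ε = 0 ∨ ε = -1) ∧ A 3 ≠ 0 ∧
      (∀ i j, lorentz (A i) (A j) = if i = j then ![1, 1, 1, ε] i else 0) ∧
      Module.finrank ℝ (Submodule.span ℝ (Set.range A)) = 4 ∧
      Submodule.span ℝ (Set.range A) = Submodule.span ℝ (Set.range b) := by
  have hli3 : LinearIndependent ℝ (fun i : Fin 3 => b i.castSucc) :=
    hb.comp _ (Fin.castSucc_injective 3)
  set U := Submodule.span ℝ (Set.range fun i : Fin 3 => b i.castSucc) with hU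
  have hUf : Module.finrank ℝ U = 3 := by rw [hU, finrank_span_eq_card hli3]; simp
  have hUW : U ≤ Submodule.span ℝ (Set.range b) :=
    Submodule.span_mono (Set.range_subset_iff.2 fun i => ⟨i.castSucc, rfl⟩)
  obtain ⟨a, haU, ha, -⟩ := lorentz_exists_orthonormal U hpos hUf ∅ 0 (by simp) (by simp)
  -- Gram-Schmidt against the space-like part. The square of ζ may have either sign or vanish, and
  -- this is the type ε of the subspace.
  let ζ := b 3 - ∑ i, lorentz (b 3) (a i) • a i
  have hζa : ∀ i, lorentz ζ (a i) = 0 := fun i => by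
    simp [ζ, lorentz_sub_left, lorentz_sum_left, lorentz_smul_left, ha]
  have hζ0 : ζ ≠ 0 := by
    intro h
    have h1 : b 3 ∈ U := by
      rw [sub_eq_zero.1 h]
      exact Submodule.sum_mem _ fun i _ => Submodule.smul_mem _ _ (haU i)
    have h2 : b (Fin.last 3) ∉ U := by
      have h3 : (Set.range fun i : Fin 3 => b i.castSucc) = b '' {Fin.last 3}ᶜ := by
        ext z
        constructor
        · rintro ⟨i, rfl⟩
          exact ⟨i.castSucc, (Fin.castSucc_lt_last i).ne, rfl⟩
        · rintro ⟨i, hi, rfl⟩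
          exact ⟨i.castPred hi, congrArg b (Fin.castSucc_castPred i hi)⟩
      rw [hU, h3]
      exact hb.notMem_span_image (by simp)
    exact h2 h1
  have hζW : ζ ∈ Submodule.span ℝ (Set.range b) :=
    sub_mem (Submodule.subset_span ⟨3, rfl⟩) (Submodule.sum_mem _ fun i _ =>
      Submodule.smul_mem _ _ (hUW (haU i)))
  obtain ⟨c, hc, hε⟩ := exists_mul_self_mul (lorentz ζ ζ)
  let A : Fin 4 → Minkowski k := ![a 0, a 1, a 2, c • ζ]
  have hA : ∀ i j, lorentz (A i) (A j)
      = if i = j then ![1, 1, 1, c * (c * lorentz ζ ζ)] i else 0 := by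
    have hζa' : ∀ i, lorentz (a i) ζ = 0 := fun i => by rw [lorentz_comm, hζa]
    intro i j
    fin_cases i <;> fin_cases j <;>
      simp [A, ha, lorentz_smul_left, lorentz_smul_right, hζa, hζa']
  have hA3 : A 3 ≠ 0 := smul_ne_zero hc hζ0
  have hAli : LinearIndependent ℝ A := by
    rw [Fintype.linearIndependent_iff]
    intro g hg
    have h1 : ∀ j, g j * ![1, 1, 1, c * (c * lorentz ζ ζ)] j = 0 := by
      intro j
      have h2 := congrArg (fun z => lorentz z (A j)) hg
      simpa [lorentz_sum_left, lorentz_smul_left, hA, lorentz_zero_left] using h2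
    have g0 : g 0 = 0 := by simpa using h1 0
    have g1 : g 1 = 0 := by simpa using h1 1
    have g2 : g 2 = 0 := by simpa using h1 2
    rw [Fin.sum_univ_four, g0, g1, g2, zero_smul, zero_smul, zero_smul, zero_add, zero_add,
      zero_add] at hg
    -- For ε = 0 the products do not detect this coefficient, but A 3 ≠ 0 does.
    have g3 : g 3 = 0 := (smul_eq_zero.1 hg).resolve_right hA3
    intro i
    fin_cases i
    exacts [g0, g1, g2, g3]
  have hAf : Module.finrank ℝ (Submodule.span ℝ (Set.range A)) = 4 := by
    rw [finrank_span_eq_card hAli]; simp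
  refine ⟨A, _, hε, hA3, hA, hAf, Submodule.eq_of_le_of_finrank_eq ?_ ?_⟩
  · rw [Submodule.span_le]
    rintro _ ⟨i, rfl⟩
    fin_cases i
    exacts [hUW (haU 0), hUW (haU 1), hUW (haU 2), Submodule.smul_mem _ _ hζW]
  · rw [hAf, finrank_span_eq_card hb]; simp

namespace LightConeModel

variable {k m : ℕ}

/-- A light-cone model with prescribed isotropic plane and prescribed first vectors. -/
theorem exists_of_plane (hm : m ≤ k) {t σ : Minkowski (k + 1)} (ht : lorentz t t = -1)
    (hσ : lorentz σ σ = 1) (htσ : lorentz t σ = 0) (A : Fin m → Minkowski (k + 1))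
    (htA : ∀ i, lorentz t (A i) = 0) (hσA : ∀ i, lorentz σ (A i) = 0)
    (hA : ∀ i j, lorentz (A i) (A j) = if i = j then 1 else 0) :
    ∃ Q : LightConeModel k, Q.p₀ = (1 / 2 : ℝ) • (σ + t) ∧ Q.w = σ - t ∧
      ∀ (i : Fin k) (j : Fin m), i.val = j.val → Q.C (EuclideanSpace.single i 1) = A j := by
  -- The prescribed vectors take the first `m` places and σ the last one; the values in between lie
  -- outside `S` and are irrelevant.
  let v : Fin (k + 1) → Minkowski (k + 1) := fun i => if h : i.val < m then A ⟨i.val, h⟩ else σ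
  let S : Set (Fin (k + 1)) := {i | i.val < m ∨ i = Fin.last k}
  have hvl : v (Fin.last k) = σ := by
    have : ¬ (Fin.last k).val < m := by rw [Fin.val_last]; omega
    simp only [v, dif_neg this]
  have hvA : ∀ (i : Fin (k + 1)) (h : i.val < m), v i = A ⟨i.val, h⟩ := fun i h => by
    simp only [v, dif_pos h]
  obtain ⟨e, hte, he, hev⟩ := exists_orthonormal_of_timelike ht S v (by
      rintro i (hi | rfl)
      · rw [hvA i hi, htA]
      · rw [hvl, htσ]) (by
      rintro i (hi | rfl) j (hj | rfl)
      · rw [hvA i hi, hvA j hj, hA]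
        simp [Fin.ext_iff]
      · rw [hvA i hi, hvl, lorentz_comm, hσA, if_neg]
        rintro rfl
        rw [Fin.val_last] at hi
        omega
      · rw [hvA j hj, hvl, hσA, if_neg]
        rintro rfl
        rw [Fin.val_last] at hj
        omega
      · rw [hvl, hσ, if_pos rfl])
  obtain ⟨Q, hp, hw, hC⟩ := exists_of_orthonormal ht e hte he
  rw [hev _ (Or.inr rfl), hvl] at hp hw
  refine ⟨Q, hp, hw, fun i j hij => ?_⟩
  have hi : i.castSucc.val < m := by rw [Fin.val_castSucc, hij]; exact j.2
  rw [hC, hev _ (Or.inl hi), hvA _ hi]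
  exact congrArg A (Fin.ext hij)

/-- A light-cone model with prescribed first vectors. -/
theorem exists_of_orthonormal_family (hm : m ≤ k) (A : Fin m → Minkowski (k + 1))
    (hA : ∀ i j, lorentz (A i) (A j) = if i = j then 1 else 0) :
    ∃ Q : LightConeModel k,
      ∀ (i : Fin k) (j : Fin m), i.val = j.val → Q.C (EuclideanSpace.single i 1) = A j := by
  obtain ⟨t, ht, htA⟩ := exists_timelike_orthogonal A hA
  obtain ⟨e, hte, he, hev⟩ := exists_orthonormal_of_timelike ht {i | i.val < m}
    (fun i => if h : i.val < m then A ⟨i.val, h⟩ else 0) (fun i hi => by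
      rw [dif_pos (show i.val < m from hi), htA]) (fun i hi j hj => by
      rw [dif_pos (show i.val < m from hi), dif_pos (show j.val < m from hj), hA]
      simp [Fin.ext_iff])
  have hσA : ∀ j, lorentz (e (Fin.last k)) (A j) = 0 := by
    intro j
    have hj : (⟨j.val, by omega⟩ : Fin (k + 1)).val < m := j.2
    have h1 := hev ⟨j.val, by omega⟩ hj
    rw [dif_pos hj] at h1
    change _ = A j at h1
    rw [← h1, he, if_neg]
    rw [Fin.ext_iff, Fin.val_last]
    have := j.2
    change k ≠ j.val
    omega
  obtain ⟨Q, -, -, hQ⟩ := exists_of_plane hm ht (by rw [he, if_pos rfl]) (hte (Fin.last k)) A htA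
    hσA hA
  exact ⟨Q, hQ⟩

/-- A light-cone model whose point at infinity is a prescribed light-like direction. -/
theorem exists_of_null (hm : m ≤ k) {z : Minkowski (k + 1)} (hz : z ≠ 0) (hzz : lorentz z z = 0)
    (A : Fin m → Minkowski (k + 1)) (hzA : ∀ i, lorentz z (A i) = 0)
    (hA : ∀ i j, lorentz (A i) (A j) = if i = j then 1 else 0) :
    ∃ (Q : LightConeModel k) (c : ℝ), c ≠ 0 ∧ Q.w = c • z ∧
      ∀ (i : Fin k) (j : Fin m), i.val = j.val → Q.C (EuclideanSpace.single i 1) = A j := by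
  obtain ⟨t, ht, htA⟩ := exists_timelike_orthogonal A hA
  have hβ : lorentz z t ≠ 0 := by
    intro h
    have := lorentz_pos_of_orthogonal (t := t) (by rw [ht]; norm_num) h hz
    rw [hzz] at this
    exact lt_irrefl _ this
  set c := (lorentz z t)⁻¹ with hc
  have hct : c * lorentz z t = 1 := inv_mul_cancel₀ hβ
  have htc : lorentz t z = lorentz z t := lorentz_comm _ _
  -- Since c⟨z, t⟩ = 1, the vector σ = cz + t is a unit vector orthogonal to t, and σ - t = cz
  -- becomes the point at infinity.
  obtain ⟨Q, -, hw, hQ⟩ := exists_of_plane hm ht (σ := c • z + t) (by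
      simp only [lorentz_add_left, lorentz_add_right, lorentz_smul_left, lorentz_smul_right, hzz,
        ht, htc]
      linarith) (by
      rw [lorentz_add_right, lorentz_smul_right, htc, hct, ht]
      ring) A htA (fun i => by
      rw [lorentz_add_left, lorentz_smul_left, hzA, htA]
      ring) hA
  exact ⟨Q, c, inv_ne_zero hβ, by rw [hw, add_sub_cancel_right], hQ⟩

end LightConeModel

/-! ### Surface-like hypersurfaces from a constant subspace -/

namespace OrientedHypersurface

variable {n : ℕ} {M : Type*} [TopologicalSpace M]
  [ChartedSpace (EuclideanSpace ℝ (Fin n)) M] [IsManifold (𝓡 n) ∞ M]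
  (H : OrientedHypersurface n M) (P : LightConeModel (n + 1))

theorem mvfderiv_comp_lc_eq_zero_iff {k : ℕ} {G : Minkowski (n + 2) → EuclideanSpace ℝ (Fin k)}
    {x : M} {v : TangentSpace (𝓡 n) x} (hG : DifferentiableAt ℝ G (H.lc P x)) {d : Fin k → ℝ}
    (hd : ∀ i, HasDerivAt (fun r : ℝ => G (H.lc P x + r • mvfderiv (𝓡 n) (H.lc P) x v) i) (d i) 0) :
    mvfderiv (𝓡 n) (fun x => G (H.lc P x)) x v = 0 ↔ ∀ i, d i = 0 := by
  set u := mvfderiv (𝓡 n) (H.lc P) x v with hu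
  have hline : HasDerivAt (fun r : ℝ => H.lc P x + r • u) u 0 := by
    simpa using ((hasDerivAt_id (0 : ℝ)).smul_const u).const_add (H.lc P x)
  have h1 : HasDerivAt (fun r : ℝ => G (H.lc P x + r • u)) (fderiv ℝ G (H.lc P x) u) 0 :=
    hG.hasFDerivAt.comp_hasDerivAt_of_eq 0 hline (by simp)
  have h2 : ∀ i, fderiv ℝ G (H.lc P x) u i = d i := fun i =>
    ((EuclideanSpace.proj i : EuclideanSpace ℝ (Fin k) →L[ℝ] ℝ).hasFDerivAt.comp_hasDerivAt 0
      h1).unique (hd i)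
  have h3 := mvfderiv_comp_fderiv hG (((H.smooth_lc P) x).mdifferentiableAt (by simp)) v
  rw [h3, ← hu]
  constructor
  · intro h i
    rw [← h2, h]
    rfl
  · intro h
    ext i
    rw [h2, h]
    rfl

theorem hasDerivAt_lorentz_line {k : ℕ} (z u a : Minkowski k) :
    HasDerivAt (fun r : ℝ => lorentz (z + r • u) a) (lorentz u a) 0 := by
  simp only [lorentz_add_left, lorentz_smul_left]
  simpa using ((hasDerivAt_id (0 : ℝ)).mul_const (lorentz u a)).const_add (lorentz z a)

theorem contDiff_lorentz_left {k : ℕ} (a : Minkowski k) :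
    ContDiff ℝ ∞ (fun z => lorentz z a) :=
  ((lorentzL k).flip a).contDiff

namespace Envelops

variable [T2Space M]
  {L : Type*} [TopologicalSpace L] [T2Space L]
  [ChartedSpace (EuclideanSpace ℝ (Fin 2)) L] [IsManifold (𝓡 2) ∞ L]
  {H : OrientedHypersurface n M} {lam : M → ℝ}
  {P : LightConeModel (n + 1)} {π : M → L} {s : L → Minkowski (n + 2)}
  (hs : H.Envelops lam P π s)
include hs

/-- If F were orthogonal to Q.w on an open set, the light-like F would be a multiple of Q.w, and ⟨F,
P.w⟩ = 1 would make it constant, although F is an immersion. -/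
theorem exists_lorentz_lc_ne_zero (hn : 3 ≤ n) (Q : LightConeModel (n + 1)) {x₀ : M} {U : Set M}
    (hU : U ∈ 𝓝 x₀) : ∃ x ∈ U, lorentz (H.lc P x) Q.w ≠ 0 := by
  by_contra! h
  have hF : ∀ x ∈ U, H.lc P x = (lorentz Q.w P.w)⁻¹ • Q.w := by
    intro x hx
    have h1 := Q.lorentz_eq (H.lc P x) (H.lc P x)
    rw [h x hx, H.lorentz_lc_lc, zero_mul, mul_zero, zero_add, zero_add,
      real_inner_self_eq_norm_sq] at h1
    have h2 : Q.adj (H.lc P x) = 0 := by simpa using h1.symm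
    have h3 := Q.decomp (H.lc P x)
    rw [h x hx, h2, zero_smul, zero_add, map_zero, add_zero] at h3
    have h4 := H.lorentz_lc_w P x
    rw [h3, lorentz_smul_left] at h4
    rw [← eq_inv_of_mul_eq_one_left h4, ← h3]
  obtain ⟨t, -, ht⟩ := hs.exists_ne_zero_Δ hn x₀
  apply ht
  have he : H.lc P =ᶠ[𝓝 x₀] fun _ => (lorentz Q.w P.w)⁻¹ • Q.w := by
    filter_upwards [hU] with x hx
    exact hF x hx
  have h5 : mvfderiv (𝓡 n) (H.lc P) x₀ t = 0 := by
    rw [mvfderiv_congr (m := n) he, mvfderiv_const]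
    rfl
  exact H.lc_injective P x₀ (h5.trans (map_zero _).symm)

/-- A map of the light-cone representative whose derivative has the leaves as kernel gives a
model hypersurface. -/
theorem conformallySurfaceLikeOn_of_map (Q : LightConeModel (n + 1)) {x₁ : M} {U : Set M}
    (hU : U ∈ 𝓝 x₁) (hτ : ∀ x ∈ U, lorentz (H.lc P x) Q.w ≠ 0) {k : ℕ}
    {G : Minkowski (n + 2) → EuclideanSpace ℝ (Fin k)}
    (hG : ∀ x ∈ U, ContDiffAt ℝ ∞ G (H.lc P x))
    (hd : ∀ x ∈ U, ∀ v, mvfderiv (𝓡 n) (fun x => G (H.lc P x)) x v = 0 ↔ v ∈ H.Δ lam x)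
    {model : Set (EuclideanSpace ℝ (Fin k)) → Set (EuclideanSpace ℝ (Fin (n + 1)))}
    (hmodel : ∀ V ⊆ U, IsRegularSurface ((fun x => G (H.lc P x)) '' V) →
      IsSurfaceLikeModel n (model ((fun x => G (H.lc P x)) '' V)))
    (hmem : ∀ x ∈ U, ∀ S, G (H.lc P x) ∈ S →
      (lorentz (H.lc P x) Q.w)⁻¹ • Q.adj (H.lc P x) ∈ model S) :
    ∃ V : Set M, IsOpen V ∧ V.Nonempty ∧ H.ConformallySurfaceLikeOn V := by
  obtain ⟨V, hVU, hVo, hxV, hreg⟩ := exists_isRegularSurface_image hs.smooth_π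
    (hs.surjective_dπ x₁) hU (h := fun x => G (H.lc P x))
    (fun x hx => (hG x hx).contMDiffAt.comp x (H.smooth_lc P x))
    (fun x hx v => (hd x hx v).trans hs.mfderiv_eq_zero_iff.symm)
  obtain ⟨Φ, D, hΦ, hΦD⟩ := P.exists_isMobius Q
  refine ⟨V, hVo, ⟨x₁, hxV⟩, Φ, D, _, hΦ, hmodel V hVU hreg, ?_⟩
  rintro _ ⟨x, hx, rfl⟩
  -- F = Ψ(f) is a multiple of Q.Ψ(q), where q is the point of the model hypersurface, so the
  -- transition between the models carries q to f(x).
  have h1 := hΦD (H.f x) _ _ (Q.eq_smul_Psi (H.lorentz_lc_lc P x) (hτ x (hVU hx)))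
  exact ⟨_, ⟨hmem x (hVU hx) _ ⟨x, hx, rfl⟩, h1.1⟩, h1.2⟩

variable {A : Fin 4 → Minkowski (n + 2)} {U : Set M} (hUo : IsOpen U)
  (hK : ∀ x ∈ U, ∀ v, v ∈ H.Δ lam x ↔ ∃ μ : ℝ, ∀ i,
    lorentz (mvfderiv (𝓡 n) (H.lc P) x v) (A i) = μ * lorentz (H.lc P x) (A i))
include hUo hK

/-- The light-like vector A 3 of the degenerate subspace is made the point at infinity. The
quotients ⟨F, A_i⟩/⟨F, Q.w⟩ are then three Euclidean coordinates, and their derivative vanishes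
exactly on Δ: a cylinder. -/
theorem exists_surfaceLike_of_null (hn : 3 ≤ n) (hne : U.Nonempty) (hA3 : A 3 ≠ 0)
    (hA : ∀ i j, lorentz (A i) (A j) = if i = j then ![1, 1, 1, (0 : ℝ)] i else 0) :
    ∃ V : Set M, IsOpen V ∧ V.Nonempty ∧ H.ConformallySurfaceLikeOn V := by
  obtain ⟨x₀, hx₀⟩ := hne
  obtain ⟨Q, c, hc, hw, hC⟩ := LightConeModel.exists_of_null (k := n + 1) (m := 3) (by omega) hA3
    (by rw [hA]; simp) (fun i => A i.castSucc)
    (fun i => by rw [hA, if_neg (show (3 : Fin 4) ≠ i.castSucc from (Fin.castSucc_lt_last i).ne')]) (fun i j => by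
      rw [hA]
      fin_cases i <;> fin_cases j <;> simp)
  obtain ⟨x₁, hx₁, hτ₁⟩ := hs.exists_lorentz_lc_ne_zero hn Q (hUo.mem_nhds hx₀)
  have hτc : Continuous (fun x => lorentz (H.lc P x) Q.w) :=
    (contDiff_lorentz_left Q.w).continuous.comp (H.smooth_lc P).continuous
  let G : Minkowski (n + 2) → EuclideanSpace ℝ (Fin 3) := fun z =>
    WithLp.toLp 2 (fun i => lorentz z (A i.castSucc) / lorentz z Q.w)
  have hG : ∀ z, lorentz z Q.w ≠ 0 → ContDiffAt ℝ ∞ G z := by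
    intro z hz
    rw [contDiffAt_euclidean]
    intro i
    exact (contDiff_lorentz_left _).contDiffAt.div (contDiff_lorentz_left _).contDiffAt hz
  refine hs.conformallySurfaceLikeOn_of_map Q (x₁ := x₁)
    (U := U ∩ {x | lorentz (H.lc P x) Q.w ≠ 0})
    ((hUo.inter (isOpen_ne_fun hτc continuous_const)).mem_nhds ⟨hx₁, hτ₁⟩)
    (fun x hx => hx.2) (G := G) (fun x hx => hG _ hx.2) (fun x hx v => ?_)
    (model := cylinderOver n) (fun V _ hV => Or.inl ⟨_, hV, rfl⟩) (fun x hx S hS => ?_)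
  · have hτ := hx.2
    rw [H.mvfderiv_comp_lc_eq_zero_iff P ((hG _ hx.2).differentiableAt (by simp)) (fun i =>
      (hasDerivAt_lorentz_line _ _ _).div (hasDerivAt_lorentz_line _ _ _) (by simpa using hx.2)),
      hK x hx.1]
    simp only [zero_smul, add_zero]
    have hτ' : lorentz (H.lc P x) (A 3) ≠ 0 := by
      intro h
      apply hτ
      rw [hw, lorentz_smul_right, h, mul_zero]
    constructor
    · intro h
      refine ⟨lorentz (mvfderiv (𝓡 n) (H.lc P) x v) (A 3) / lorentz (H.lc P x) (A 3), fun i => ?_⟩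
      refine Fin.lastCases ?_ (fun i => ?_) i
      · change lorentz _ (A 3) = _ * lorentz _ (A 3)
        rw [div_mul_cancel₀ _ hτ']
      · have h1 := h i
        rw [div_eq_zero_iff, or_iff_left (pow_ne_zero 2 hτ), hw, lorentz_smul_right,
          lorentz_smul_right] at h1
        have h2 : c * (lorentz (mvfderiv (𝓡 n) (H.lc P) x v) (A i.castSucc)
          * lorentz (H.lc P x) (A 3) - lorentz (H.lc P x) (A i.castSucc)
          * lorentz (mvfderiv (𝓡 n) (H.lc P) x v) (A 3)) = 0 := by linarith
        have h3 := (mul_eq_zero.1 h2).resolve_left hc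
        field_simp
        linarith
    · rintro ⟨μ, hμ⟩ i
      rw [hw, lorentz_smul_right, lorentz_smul_right, hμ, hμ]
      ring
  · have hval : ∀ (i : Fin (n + 1)) (j : Fin 3), i.val = j.val →
        ((lorentz (H.lc P x) Q.w)⁻¹ • Q.adj (H.lc P x)) i = G (H.lc P x) j := by
      intro i j hij
      change _ * Q.adj (H.lc P x) i = lorentz _ (A j.castSucc) / _
      rw [Q.adj_apply, hC i j hij, div_eq_inv_mul]
    change !₂[_, _, _] ∈ S
    convert hS using 1
    ext j
    fin_cases j
    exacts [hval 0 0 rfl, hval 1 1 (Nat.mod_eq_of_lt (show 1 < n + 1 by omega)),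
      hval 2 2 (Nat.mod_eq_of_lt (show 2 < n + 1 by omega))]

/-- The four unit vectors become the first four coordinate directions of the model. The direction of
the vector with components ⟨F, A_i⟩ has derivative vanishing exactly on Δ, and it traces a surface
in the unit sphere of ℝ⁴: a cone times a Euclidean factor. -/
theorem exists_surfaceLike_of_spacelike (hn : 3 ≤ n) (hne : U.Nonempty)
    (hN : ∀ x ∈ U, ∃ i, lorentz (A i) (H.lc P x) ≠ 0)
    (hA : ∀ i j, lorentz (A i) (A j) = if i = j then 1 else 0) :
    ∃ V : Set M, IsOpen V ∧ V.Nonempty ∧ H.ConformallySurfaceLikeOn V := by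
  obtain ⟨x₀, hx₀⟩ := hne
  obtain ⟨Q, hC⟩ := LightConeModel.exists_of_orthonormal_family (k := n + 1) (m := 4) (by omega) A hA
  obtain ⟨x₁, hx₁, hτ₁⟩ := hs.exists_lorentz_lc_ne_zero hn Q (hUo.mem_nhds hx₀)
  have hτc : Continuous (fun x => lorentz (H.lc P x) Q.w) :=
    (contDiff_lorentz_left Q.w).continuous.comp (H.smooth_lc P).continuous
  -- The sign of ⟨F, Q.w⟩ is absorbed into the surface, so that the parameter along the rays of the
  -- cone is positive.
  obtain ⟨η, hη, hη₁⟩ : ∃ η : ℝ, η * η = 1 ∧ 0 < η * lorentz (H.lc P x₁) Q.w := by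
    rcases lt_or_gt_of_ne hτ₁ with h | h
    · exact ⟨-1, by norm_num, by linarith⟩
    · exact ⟨1, by norm_num, by linarith⟩
  have hη0 : η ≠ 0 := by
    rintro rfl
    norm_num at hη
  let R : Minkowski (n + 2) → ℝ := fun z => ∑ i, lorentz z (A i) ^ 2
  have hR : ∀ x ∈ U, 0 < R (H.lc P x) := by
    intro x hx
    obtain ⟨i, hi⟩ := hN x hx
    refine Finset.sum_pos' (fun j _ => sq_nonneg _) ⟨i, Finset.mem_univ i, ?_⟩
    rw [lorentz_comm]
    positivity
  let G : Minkowski (n + 2) → EuclideanSpace ℝ (Fin 4) := fun z =>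
    WithLp.toLp 2 (fun i => η * lorentz z (A i) / √(R z))
  have hRs : ContDiff ℝ ∞ R := ContDiff.sum fun i _ => (contDiff_lorentz_left _).pow 2
  have hG : ∀ z, 0 < R z → ContDiffAt ℝ ∞ G z := by
    intro z hz
    rw [contDiffAt_euclidean]
    intro i
    exact (contDiff_const.mul (contDiff_lorentz_left _)).contDiffAt.div
      (hRs.contDiffAt.sqrt hz.ne') (Real.sqrt_pos.2 hz).ne'
  have hGi : ∀ z i, G z i = η * lorentz z (A i) / √(R z) := fun _ _ => rfl
  refine hs.conformallySurfaceLikeOn_of_map Q (x₁ := x₁)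
    (U := U ∩ {x | 0 < η * lorentz (H.lc P x) Q.w})
    ((hUo.inter (isOpen_lt continuous_const (continuous_const.mul hτc))).mem_nhds ⟨hx₁, hη₁⟩)
    (fun x hx => right_ne_zero_of_mul hx.2.ne') (G := G) (fun x hx => hG _ (hR x hx.1))
    (fun x hx v => ?_)
    (model := coneCylinderOver n) (fun V hVU hV => Or.inr (Or.inl ⟨_, hV, ?_, rfl⟩))
    (fun x hx S hS => ?_)
  · have hRx := hR x hx.1
    have hsq : √(R (H.lc P x)) ≠ 0 := (Real.sqrt_pos.2 hRx).ne'
    have hsq2 := Real.sq_sqrt hRx.le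
    set u := mvfderiv (𝓡 n) (H.lc P) x v with hu
    let R' := ∑ i, lorentz (H.lc P x) (A i) * lorentz u (A i)
    have hRd : HasDerivAt (fun r : ℝ => R (H.lc P x + r • u)) (2 * R') 0 := by
      refine (HasDerivAt.fun_sum (u := Finset.univ) fun i _ =>
        (hasDerivAt_lorentz_line (H.lc P x) u (A i)).fun_pow 2).congr_deriv ?_
      simp only [R', Finset.mul_sum, zero_smul, add_zero]
      refine Finset.sum_congr rfl fun i _ => ?_
      push_cast
      ring
    rw [H.mvfderiv_comp_lc_eq_zero_iff P ((hG _ hRx).differentiableAt (by simp)) (fun i =>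
      ((hasDerivAt_lorentz_line _ _ _).const_mul η).div (hRd.sqrt (by simpa using hRx.ne'))
        (by simpa using hsq)),
      hK x hx.1]
    simp only [zero_smul, add_zero]
    rw [← hu]
    have key : ∀ i, (η * lorentz u (A i) * √(R (H.lc P x))
        - η * lorentz (H.lc P x) (A i) * (2 * R' / (2 * √(R (H.lc P x))))) / √(R (H.lc P x)) ^ 2 = 0
        ↔ lorentz u (A i) * R (H.lc P x) = lorentz (H.lc P x) (A i) * R' := by
      intro i
      rw [div_eq_zero_iff, or_iff_left (pow_ne_zero 2 hsq)]
      have h1 : (η * lorentz u (A i) * √(R (H.lc P x))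
        - η * lorentz (H.lc P x) (A i) * (2 * R' / (2 * √(R (H.lc P x)))))
        = (η / √(R (H.lc P x)))
          * (lorentz u (A i) * R (H.lc P x) - lorentz (H.lc P x) (A i) * R') := by
        generalize √(R (H.lc P x)) = q at hsq hsq2 ⊢
        rw [← hsq2]
        field_simp
      rw [h1, mul_eq_zero, or_iff_right (div_ne_zero hη0 hsq), sub_eq_zero]
    simp only [key]
    constructor
    · intro h
      refine ⟨R' / R (H.lc P x), fun i => ?_⟩
      have := h i
      field_simp
      linarith
    · rintro ⟨μ, hμ⟩ i
      have h2 : R' = μ * R (H.lc P x) := by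
        simp only [R', R, Finset.mul_sum]
        refine Finset.sum_congr rfl fun i _ => ?_
        rw [hμ]
        ring
      rw [hμ, h2]
      ring
  · rintro _ ⟨x, hx, rfl⟩
    have hRx := hR x (hVU hx).1
    have h1 : ‖G (H.lc P x)‖ ^ 2 = 1 := by
      rw [EuclideanSpace.norm_sq_eq]
      simp only [hGi, Real.norm_eq_abs, sq_abs, div_pow, mul_pow, Real.sq_sqrt hRx.le, sq η, hη,
        one_mul]
      rw [← Finset.sum_div]
      exact div_self hRx.ne'
    exact (pow_eq_one_iff_of_nonneg (norm_nonneg _) two_ne_zero).1 h1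
  · have hRx := hR x hx.1
    have hτ : lorentz (H.lc P x) Q.w ≠ 0 := right_ne_zero_of_mul hx.2.ne'
    have hsq := Real.sqrt_pos.2 hRx
    refine ⟨√(R (H.lc P x)) / (η * lorentz (H.lc P x) Q.w), div_pos hsq hx.2, _, hS, ?_⟩
    have hval : ∀ (i : Fin (n + 1)) (j : Fin 4), i.val = j.val →
        ((lorentz (H.lc P x) Q.w)⁻¹ • Q.adj (H.lc P x)) i
          = (√(R (H.lc P x)) / (η * lorentz (H.lc P x) Q.w)) * G (H.lc P x) j := by
      intro i j hij
      change _ * Q.adj (H.lc P x) i = _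
      rw [Q.adj_apply, hC i j hij, hGi]
      field_simp
    ext j
    fin_cases j
    exacts [hval 0 0 rfl, hval 1 1 (Nat.mod_eq_of_lt (show 1 < n + 1 by omega)),
      hval 2 2 (Nat.mod_eq_of_lt (show 2 < n + 1 by omega)), hval 3 3 (Nat.mod_eq_of_lt (show 3 < n + 1 by omega))]

end Envelops

end OrientedHypersurface

/-! ### The rotation case and the symmetry of (A - λI)J -/

namespace LightConeModel

variable {k : ℕ} (Q : LightConeModel k)

theorem C_mem_span {W : Submodule ℝ (Minkowski (k + 1))}
    {y : EuclideanSpace ℝ (Fin k)} (h : ∀ i, y i = 0 ∨ Q.C (EuclideanSpace.single i 1) ∈ W) :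
    Q.C y ∈ W := by
  rw [← (EuclideanSpace.basisFun (Fin k) ℝ).sum_repr y, map_sum]
  refine Submodule.sum_mem _ fun i _ => ?_
  rw [map_smul, EuclideanSpace.basisFun_repr, EuclideanSpace.basisFun_apply]
  rcases h i with h | h
  · rw [h, zero_smul]
    exact zero_mem _
  · exact Submodule.smul_mem _ _ h

end LightConeModel

theorem sum_sq_eq_add {n : ℕ} (hn : 1 ≤ n) (a : Fin (n + 1) → ℝ) :
    ∑ i, a i ^ 2 = a 0 ^ 2 + a 1 ^ 2 + ∑ i : Fin (n + 1), if 2 ≤ i.val then a i ^ 2 else 0 := by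
  have h1v : ((1 : Fin (n + 1)) : ℕ) = 1 := Nat.mod_eq_of_lt (show 1 < n + 1 by omega)
  have h01 : (0 : Fin (n + 1)) ≠ 1 := by
    rw [Ne, Fin.ext_iff, h1v]
    exact zero_ne_one
  have h2 : ∑ i : Fin (n + 1), (if 2 ≤ i.val then 0 else a i ^ 2) = a 0 ^ 2 + a 1 ^ 2 := by
    rw [Fintype.sum_eq_add 0 1 h01]
    · rw [if_neg (by simp), if_neg (by omega)]
    · rintro i ⟨hi0, hi1⟩
      rw [Ne, Fin.ext_iff] at hi0 hi1
      rw [h1v] at hi1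
      rw [Fin.val_zero] at hi0
      rw [if_pos (by omega)]
  rw [← h2, ← Finset.sum_add_distrib]
  refine Finset.sum_congr rfl fun i _ => ?_
  split_ifs <;> ring

namespace OrientedHypersurface.Envelops

variable {n : ℕ} {M : Type*} [TopologicalSpace M] [T2Space M]
  [ChartedSpace (EuclideanSpace ℝ (Fin n)) M] [IsManifold (𝓡 n) ∞ M]
  {L : Type*} [TopologicalSpace L] [T2Space L]
  [ChartedSpace (EuclideanSpace ℝ (Fin 2)) L] [IsManifold (𝓡 2) ∞ L]
  {H : OrientedHypersurface n M} {lam : M → ℝ}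
  {P : LightConeModel (n + 1)} {π : M → L} {s : L → Minkowski (n + 2)}
  (hs : H.Envelops lam P π s)
include hs

/-- The plane of A 2 and A 3 carries p₀ and w, while A 0 and A 1 are the first two coordinate
directions. Since F is light-like, the squared length of its remaining coordinates is minus the
square of its W-part. So W sees them only through the radius: a rotation hypersurface. -/
theorem exists_surfaceLike_of_timelike {A : Fin 4 → Minkowski (n + 2)} {U : Set M} (hUo : IsOpen U)
    (hK : ∀ x ∈ U, ∀ v, v ∈ H.Δ lam x ↔ ∃ μ : ℝ, ∀ i,
      lorentz (mvfderiv (𝓡 n) (H.lc P) x v) (A i) = μ * lorentz (H.lc P x) (A i))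
    (hn : 3 ≤ n) (hne : U.Nonempty)
    (hF : ∀ x ∈ U, H.lc P x ∉ Submodule.span ℝ (Set.range A))
    (hA : ∀ i j, lorentz (A i) (A j) = if i = j then ![1, 1, 1, (-1 : ℝ)] i else 0) :
    ∃ V : Set M, IsOpen V ∧ V.Nonempty ∧ H.ConformallySurfaceLikeOn V := by
  obtain ⟨x₀, hx₀⟩ := hne
  obtain ⟨Q, hp, hw, hC⟩ := LightConeModel.exists_of_plane (k := n + 1) (m := 2) (by omega)
    (t := A 3) (σ := A 2) (by rw [hA]; simp) (by rw [hA]; simp) (by rw [hA]; simp)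
    ![A 0, A 1] (fun i => by fin_cases i <;> simp [hA]) (fun i => by fin_cases i <;> simp [hA])
    (fun i j => by fin_cases i <;> fin_cases j <;> simp [hA])
  obtain ⟨x₁, hx₁, hτ₁⟩ := hs.exists_lorentz_lc_ne_zero hn Q (hUo.mem_nhds hx₀)
  have hτc : Continuous (fun x => lorentz (H.lc P x) Q.w) :=
    (contDiff_lorentz_left Q.w).continuous.comp (H.smooth_lc P).continuous
  have h1v : ((1 : Fin (n + 1)) : ℕ) = 1 := Nat.mod_eq_of_lt (show 1 < n + 1 by omega)
  have ha0 : ∀ z, Q.adj z 0 = lorentz z (A 0) := fun z => by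
    rw [Q.adj_apply, hC 0 0 rfl]
    rfl
  have ha1 : ∀ z, Q.adj z 1 = lorentz z (A 1) := fun z => by
    rw [Q.adj_apply, hC 1 1 h1v]
    rfl
  let R : Minkowski (n + 2) → ℝ := fun z =>
    lorentz z (A 3) ^ 2 - lorentz z (A 0) ^ 2 - lorentz z (A 1) ^ 2 - lorentz z (A 2) ^ 2
  have hsum : ∀ x, (∑ i : Fin (n + 1), if 2 ≤ i.val then Q.adj (H.lc P x) i ^ 2 else 0)
      = R (H.lc P x) := by
    intro x
    have h1 := Q.lorentz_eq (H.lc P x) (H.lc P x)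
    have h2 := sum_sq_eq_add (by omega : 1 ≤ n) (fun i => Q.adj (H.lc P x) i)
    rw [H.lorentz_lc_lc, real_inner_self_eq_norm_sq, EuclideanSpace.norm_sq_eq, hw, hp,
      lorentz_smul_right, lorentz_sub_right, lorentz_add_right] at h1
    simp only [Real.norm_eq_abs, sq_abs] at h1
    rw [ha0, ha1] at h2
    rw [h2] at h1
    simp only [R]
    linarith
  -- Radius zero would put F into the subspace.
  have hR : ∀ x ∈ U, 0 < R (H.lc P x) := by
    intro x hx
    rw [← hsum]
    have hnn : ∀ i ∈ Finset.univ,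
        (0 : ℝ) ≤ if 2 ≤ (i : Fin (n + 1)).val then Q.adj (H.lc P x) i ^ 2 else 0 := by
      intro i _
      split_ifs
      · positivity
      · exact le_rfl
    refine lt_of_le_of_ne (Finset.sum_nonneg hnn) fun h0 => hF x hx ?_
    have h1 := (Finset.sum_eq_zero_iff_of_nonneg hnn).1 h0.symm
    have hmem : ∀ i, A i ∈ Submodule.span ℝ (Set.range A) := fun i =>
      Submodule.subset_span ⟨i, rfl⟩
    rw [Q.decomp (H.lc P x), hw, hp]
    refine add_mem (add_mem (Submodule.smul_mem _ _ (Submodule.smul_mem _ _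
      (add_mem (hmem 2) (hmem 3)))) (Submodule.smul_mem _ _ (sub_mem (hmem 2) (hmem 3)))) ?_
    refine Q.C_mem_span fun i => ?_
    by_cases hi : 2 ≤ i.val
    · left
      have h2 := h1 i (Finset.mem_univ i)
      rw [if_pos hi] at h2
      simpa using h2
    · right
      obtain h | h : i.val = 0 ∨ i.val = 1 := by omega
      · rw [hC i 0 h]
        exact hmem 0
      · rw [hC i 1 h]
        exact hmem 1
  let G : Minkowski (n + 2) → EuclideanSpace ℝ (Fin 3) := fun z =>
    !₂[lorentz z (A 0) / lorentz z Q.w, lorentz z (A 1) / lorentz z Q.w,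
      √(R z / lorentz z Q.w ^ 2)]
  have hRs : ContDiff ℝ ∞ R := ((((contDiff_lorentz_left _).pow 2).sub
    ((contDiff_lorentz_left _).pow 2)).sub ((contDiff_lorentz_left _).pow 2)).sub
    ((contDiff_lorentz_left _).pow 2)
  have hG : ∀ z, lorentz z Q.w ≠ 0 → 0 < R z → ContDiffAt ℝ ∞ G z := by
    intro z hz hRz
    have hq : ∀ a, ContDiffAt ℝ ∞ (fun z => lorentz z a / lorentz z Q.w) z := fun a =>
      (contDiff_lorentz_left _).contDiffAt.div (contDiff_lorentz_left _).contDiffAt hz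
    rw [contDiffAt_euclidean]
    intro i
    fin_cases i
    · exact hq _
    · exact hq _
    · have hpos : 0 < R z / lorentz z Q.w ^ 2 := by positivity
      exact (hRs.contDiffAt.div ((contDiff_lorentz_left _).pow 2).contDiffAt
        (pow_ne_zero 2 hz)).sqrt hpos.ne'
  refine hs.conformallySurfaceLikeOn_of_map Q (x₁ := x₁)
    (U := U ∩ {x | lorentz (H.lc P x) Q.w ≠ 0})
    ((hUo.inter (isOpen_ne_fun hτc continuous_const)).mem_nhds ⟨hx₁, hτ₁⟩)
    (fun x hx => hx.2) (G := G) (fun x hx => hG _ hx.2 (hR x hx.1)) (fun x hx v => ?_)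
    (model := rotationOver n) (fun V hVU hV => Or.inr (Or.inr ⟨_, hV, ?_, rfl⟩))
    (fun x hx S hS => ?_)
  · have hτ : lorentz (H.lc P x) Q.w ≠ 0 := hx.2
    have hRx := hR x hx.1
    have hpos : 0 < R (H.lc P x) / lorentz (H.lc P x) Q.w ^ 2 := by positivity
    set u := mvfderiv (𝓡 n) (H.lc P) x v with hu
    let R' := lorentz (H.lc P x) (A 3) * lorentz u (A 3) - lorentz (H.lc P x) (A 0) * lorentz u (A 0)
      - lorentz (H.lc P x) (A 1) * lorentz u (A 1) - lorentz (H.lc P x) (A 2) * lorentz u (A 2)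
    have hsq : ∀ a, HasDerivAt (fun r : ℝ => lorentz (H.lc P x + r • u) a ^ 2)
        (2 * (lorentz (H.lc P x) a * lorentz u a)) 0 := fun a =>
      ((hasDerivAt_lorentz_line (H.lc P x) u a).fun_pow 2).congr_deriv (by simp; ring)
    have hRd : HasDerivAt (fun r : ℝ => R (H.lc P x + r • u)) (2 * R') 0 :=
      ((((hsq _).fun_sub (hsq _)).fun_sub (hsq _)).fun_sub (hsq _)).congr_deriv
        (by simp only [R']; ring)
    have hq : ∀ a, HasDerivAt
        (fun r : ℝ => lorentz (H.lc P x + r • u) a / lorentz (H.lc P x + r • u) Q.w)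
        ((lorentz u a * lorentz (H.lc P x) Q.w - lorentz (H.lc P x) a * lorentz u Q.w)
          / lorentz (H.lc P x) Q.w ^ 2) 0 := fun a =>
      ((hasDerivAt_lorentz_line _ _ _).fun_div (hasDerivAt_lorentz_line _ _ _)
        (by simpa using hτ)).congr_deriv (by simp)
    have hr : HasDerivAt
        (fun r : ℝ => √(R (H.lc P x + r • u) / lorentz (H.lc P x + r • u) Q.w ^ 2))
        ((2 * R' * lorentz (H.lc P x) Q.w ^ 2
            - R (H.lc P x) * (2 * (lorentz (H.lc P x) Q.w * lorentz u Q.w)))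
          / (lorentz (H.lc P x) Q.w ^ 2) ^ 2
          / (2 * √(R (H.lc P x) / lorentz (H.lc P x) Q.w ^ 2))) 0 :=
      ((hRd.fun_div (hsq _) (by simpa using hτ)).sqrt (by simpa using ⟨hRx.ne', hτ⟩)).congr_deriv
        (by simp)
    rw [H.mvfderiv_comp_lc_eq_zero_iff P ((hG _ hτ hRx).differentiableAt (by simp))
      (d := ![_, _, _]) (fun i => by
        fin_cases i
        exacts [hq (A 0), hq (A 1), hr]), hK x hx.1, ← hu]
    have hs0 : (2 * √(R (H.lc P x) / lorentz (H.lc P x) Q.w ^ 2)) ≠ 0 :=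
      mul_ne_zero two_ne_zero (Real.sqrt_pos.2 hpos).ne'
    have hw' : ∀ z, lorentz z Q.w = lorentz z (A 2) - lorentz z (A 3) := fun z => by
      rw [hw, lorentz_sub_right]
    simp only [Fin.forall_fin_succ, Matrix.cons_val_zero, Matrix.cons_val_succ, IsEmpty.forall_iff,
      and_true, Fin.succ_zero_eq_one, Fin.succ_one_eq_two]
    rw [div_eq_zero_iff, or_iff_left (pow_ne_zero 2 hτ), div_eq_zero_iff,
      or_iff_left (pow_ne_zero 2 hτ), div_eq_zero_iff, or_iff_left hs0, div_eq_zero_iff,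
      or_iff_left (pow_ne_zero 2 (pow_ne_zero 2 hτ))]
    simp only [hw'] at hτ ⊢
    simp only [R', R]
    change _ ↔ ∃ μ, lorentz u (A 0) = μ * lorentz (H.lc P x) (A 0)
      ∧ lorentz u (A 1) = μ * lorentz (H.lc P x) (A 1)
      ∧ lorentz u (A 2) = μ * lorentz (H.lc P x) (A 2)
      ∧ lorentz u (A 3) = μ * lorentz (H.lc P x) (A 3)
    generalize lorentz (H.lc P x) (A 0) = l₀, lorentz (H.lc P x) (A 1) = l₁,
      lorentz (H.lc P x) (A 2) = l₂, lorentz (H.lc P x) (A 3) = l₃,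
      lorentz u (A 0) = d₀, lorentz u (A 1) = d₁, lorentz u (A 2) = d₂,
      lorentz u (A 3) = d₃ at hτ ⊢
    constructor
    · rintro ⟨e0, e1, e2⟩
      obtain ⟨μ, hμ⟩ : ∃ μ, d₂ - d₃ = μ * (l₂ - l₃) :=
        ⟨(d₂ - d₃) / (l₂ - l₃), (div_mul_cancel₀ _ hτ).symm⟩
      have f0 : d₀ = μ * l₀ := mul_right_cancel₀ hτ (by linear_combination e0 + l₀ * hμ)
      have f1 : d₁ = μ * l₁ := mul_right_cancel₀ hτ (by linear_combination e1 + l₁ * hμ)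
      -- The derivative of the radius controls d₂ + d₃ because R + l₀² + l₁² = -(l₂ - l₃)(l₂ + l₃),
      -- with l₂ - l₃ ≠ 0.
      have f2 : d₂ + d₃ = μ * (l₂ + l₃) := by
        refine mul_right_cancel₀ (pow_ne_zero 3 hτ) ?_
        rw [f0, f1] at e2
        linear_combination (-1 : ℝ) * e2
          + ((l₂ - l₃) ^ 2 * (l₂ + l₃) + 2 * (l₂ - l₃) * (l₀ ^ 2 + l₁ ^ 2)) * hμ
      exact ⟨μ, f0, f1, by linarith, by linarith⟩
    · rintro ⟨μ, rfl, rfl, rfl, rfl⟩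
      refine ⟨by ring, by ring, by ring⟩
  · rintro _ ⟨x, hx, rfl⟩
    have hτ : lorentz (H.lc P x) Q.w ≠ 0 := (hVU hx).2
    have hRx := hR x (hVU hx).1
    have hpos : 0 < R (H.lc P x) / lorentz (H.lc P x) Q.w ^ 2 := by positivity
    exact Real.sqrt_pos.2 hpos
  · change !₂[_, _, _] ∈ S
    convert hS using 1
    have hval : ∀ i, ((lorentz (H.lc P x) Q.w)⁻¹ • Q.adj (H.lc P x)) i
        = Q.adj (H.lc P x) i / lorentz (H.lc P x) Q.w := fun i => by
      rw [div_eq_inv_mul]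
      rfl
    have hval2 : (∑ i : Fin (n + 1),
        if 2 ≤ i.val then ((lorentz (H.lc P x) Q.w)⁻¹ • Q.adj (H.lc P x)) i ^ 2 else 0)
        = R (H.lc P x) / lorentz (H.lc P x) Q.w ^ 2 := by
      rw [← hsum, Finset.sum_div]
      refine Finset.sum_congr rfl fun i _ => ?_
      rw [hval]
      split_ifs
      · rw [div_pow]
      · rw [zero_div]
    rw [hval2, hval, hval, ha0, ha1]

/-- If no open part of the hypersurface is conformally surface-like, `(A - λ I) J` is symmetric. -/
theorem metric_symm_of_not_surfaceLike (hn : 3 ≤ n)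
    (hcsl : ∀ U : Set M, IsOpen U → U.Nonempty → ¬ H.ConformallySurfaceLikeOn U)
    {κ : JType} {J : Π x : M, H.hor lam x →ₗ[ℝ] H.hor lam x} (hJ : H.IsOfType lam κ J)
    (x : M) (v u : H.hor lam x) :
    H.metric x (H.shapeSub lam x (J x u)) v = H.metric x (H.shapeSub lam x u) (J x v) := by
  by_contra hne
  obtain ⟨b, hb, hb0, ⟨v₁, hb1⟩, ⟨v₂, hb2⟩, hb3, hbW⟩ :=
    hs.exists_constant_span hn (hs.eventually_splitting_eq_smul hJ hne)
  -- These vectors are combinations of the unit vector s and of tangent vectors of s, which are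
  -- orthogonal to s and space-like.
  have hpos : ∀ z ∈ Submodule.span ℝ (Set.range fun i : Fin 3 => b i.castSucc), z ≠ 0 →
      0 < lorentz z z := by
    intro z hz hz0
    obtain ⟨c, rfl⟩ := (Submodule.mem_span_range_iff_exists_fun ℝ).1 hz
    rw [Fin.sum_univ_three] at hz0 ⊢
    change c 0 • b 0 + c 1 • b 1 + c 2 • b 2 ≠ 0 at hz0
    change 0 < lorentz (c 0 • b 0 + c 1 • b 1 + c 2 • b 2) (c 0 • b 0 + c 1 • b 1 + c 2 • b 2)
    rw [hb0, hb1, hb2, add_assoc, ← map_smul, ← map_smul, ← map_add] at hz0 ⊢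
    obtain ⟨w, hw⟩ := hs.surjective_dπ x (c 1 • v₁ + c 2 • v₂)
    rw [← hw] at hz0 ⊢
    have h1 := hs.surfMetric_mfderiv x w w
    rw [surfMetric] at h1
    rw [lorentz_add_left, lorentz_add_right, lorentz_add_right, lorentz_smul_left,
      lorentz_smul_left, lorentz_smul_right, lorentz_smul_right, hs.lorentz_surf,
      lorentz_comm (s (π x)), hs.lorentz_dsurf_surf, h1]
    have h2 : 0 ≤ H.metric x (H.shapeSub lam x w) (H.shapeSub lam x w) := real_inner_self_nonneg
    by_contra! h3
    have h4 : H.metric x (H.shapeSub lam x w) (H.shapeSub lam x w) = 0 := by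
      nlinarith [mul_self_nonneg (c 0)]
    have h5 : c 0 = 0 := by
      have : c 0 * c 0 = 0 := by nlinarith [mul_self_nonneg (c 0)]
      simpa using this
    apply hz0
    rw [h5, zero_smul, zero_add,
      hs.mfderiv_eq_zero_iff.2 ((H.mem_Δ lam).2 (H.eq_zero_of_metric_self h4)), map_zero]
  obtain ⟨A, ε, hε, hA3, hA, hAf, hAb⟩ := exists_orthogonal_basis hb hpos
  -- The subspace is not orthogonal to F, since b 3 is not. The condition is open, so one index
  -- works on a neighbourhood.
  obtain ⟨i₀, hi₀⟩ : ∃ i, lorentz (A i) (H.lc P x) ≠ 0 := by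
    by_contra! h
    apply hb3
    have h1 : b 3 ∈ Submodule.span ℝ (Set.range A) := by
      rw [hAb]
      exact Submodule.subset_span ⟨3, rfl⟩
    obtain ⟨c, hc⟩ := (Submodule.mem_span_range_iff_exists_fun ℝ).1 h1
    rw [← hc, lorentz_sum_left]
    exact Finset.sum_eq_zero fun i _ => by rw [lorentz_smul_left, h, mul_zero]
  rw [← hAb] at hbW
  have hcont : Continuous (fun x => lorentz (A i₀) (H.lc P x)) :=
    (lorentzL (n + 2) (A i₀)).continuous.comp (H.smooth_lc P).continuous
  obtain ⟨U, hU, hUo, hxU⟩ := eventually_nhds_iff.1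
    ((hs.smooth_π.continuous.continuousAt.eventually hbW).and
      (hcont.continuousAt.eventually_ne hi₀))
  have hK : ∀ x ∈ U, ∀ v, v ∈ H.Δ lam x ↔ ∃ μ : ℝ, ∀ i,
      lorentz (mvfderiv (𝓡 n) (H.lc P) x v) (A i) = μ * lorentz (H.lc P x) (A i) :=
    fun x hx v => hs.mem_Δ_iff_exists_mul hAf (hU x hx).1.1 (hU x hx).1.2 ⟨i₀, (hU x hx).2⟩
  -- The square of the fourth basis vector decides the model: cone, cylinder or rotation
  -- hypersurface for ε = 1, 0, -1.
  obtain ⟨V, hVo, hVn, hV⟩ : ∃ V : Set M, IsOpen V ∧ V.Nonempty ∧ H.ConformallySurfaceLikeOn V := by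
    rcases hε with rfl | rfl | rfl
    · refine hs.exists_surfaceLike_of_spacelike hUo hK hn ⟨x, hxU⟩
        (fun x hx => ⟨i₀, (hU x hx).2⟩) fun i j => ?_
      rw [hA]
      fin_cases i <;> rfl
    · exact hs.exists_surfaceLike_of_null hUo hK hn ⟨x, hxU⟩ hA3 hA
    · exact hs.exists_surfaceLike_of_timelike hUo hK hn ⟨x, hxU⟩
        (fun x hx => hs.lc_notMem_span hAf (hU x hx).1.1 (hU x hx).1.2 ⟨i₀, (hU x hx).2⟩) hA
  exact hcsl V hVo hVn hV

end OrientedHypersurface.Envelops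

theorem lemma5p2 {n : ℕ} (hn : 3 ≤ n)
    {M : Type*} [TopologicalSpace M] [T2Space M] [SecondCountableTopology M]
    [ChartedSpace (EuclideanSpace ℝ (Fin n)) M] [IsManifold (𝓡 n) ∞ M]
    {L : Type*} [TopologicalSpace L] [T2Space L] [SecondCountableTopology L]
    [ChartedSpace (EuclideanSpace ℝ (Fin 2)) L] [IsManifold (𝓡 2) ∞ L]
    (H : OrientedHypersurface n M) (lam : M → ℝ)
    (P : LightConeModel (n + 1)) (π : M → L) (s : L → Minkowski (n + 2))
    (hs : H.Envelops lam P π s)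
    (hcsl : ∀ U : Set M, IsOpen U → U.Nonempty → ¬ H.ConformallySurfaceLikeOn U)
    (κ : JType) :
    (∀ (J D₁ D₂ : Π x : M, H.hor lam x →ₗ[ℝ] H.hor lam x)
        (ψ : Π x : M, TangentSpace (𝓡 n) x →ₗ[ℝ] ℝ),
        H.IsOfType lam κ J → H.IsTriple lam J D₁ D₂ ψ →
        ∃ (J' D₁' D₂' : Π y : L, TangentSpace (𝓡 2) y →ₗ[ℝ] TangentSpace (𝓡 2) y)
          (ψ' : Π y : L, TangentSpace (𝓡 2) y →ₗ[ℝ] ℝ),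
          J = H.lift lam π J' ∧ D₁ = H.lift lam π D₁' ∧ D₂ = H.lift lam π D₂' ∧
          ψ = liftForm π ψ' ∧
          SurfIsOfType s κ J' ∧ SurfIsTriple s J' D₁' D₂' ψ') ∧
    (∀ J' : Π y : L, TangentSpace (𝓡 2) y →ₗ[ℝ] TangentSpace (𝓡 2) y,
        SurfIsOfType s κ J' →
        H.IsOfType lam κ (H.lift lam π J') ∧
        ∀ (D₁' D₂' : Π y : L, TangentSpace (𝓡 2) y →ₗ[ℝ] TangentSpace (𝓡 2) y)
          (ψ' : Π y : L, TangentSpace (𝓡 2) y →ₗ[ℝ] ℝ),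
          SurfIsTriple s J' D₁' D₂' ψ' →
          H.IsTriple lam (H.lift lam π J') (H.lift lam π D₁') (H.lift lam π D₂')
            (liftForm π ψ')) := by
  refine ⟨fun J D₁ D₂ ψ hJ ht => hs.exists_triple hn hJ ht
      (hs.metric_symm_of_not_surfaceLike hn hcsl hJ),
    fun J' hJ => ⟨hs.isOfType_lift hJ, fun D₁' D₂' ψ' ht => hs.isTriple_lift hJ ht⟩⟩
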